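/- Let $G$ be a group with a finite generating family $x_1,\dots,x_r$ and solvable word problem. Let $l$ be the word length and $d(g,h)=l(g^{-1}h)$ the word metric. For $S\subseteq G$ and $k\in\mathbb{N}$ let $\mathrm{VR}_kS$ be the simplicial set whose $q$-simplices are the tuples $(g_0,\dots,g_q)\in S^{q+1}$ with $d(g_i,g_j)\le k$ for all $i,j$, and write $\Delta^q_k=(\mathrm{VR}_kG)_q$. Homotopy groups of simplicial sets are those of their geometric realizations. For $k\le l$ we say that $\pi_q(\mathrm{VR}_kS)$ vanishes in $\pi_q(\mathrm{VR}_lS)$ if the inclusion induces the trivial map for all base points (for $q=0$: any two points of the first are joined by a path in the second). Let $(k_0,k_1,k_2)$ be a homotopical connecting vector of $G$: $k_0\le k_1\le k_2$, and $\pi_q(\mathrm{VR}_{k_q}G)$ vanishes in $\pi_q(\mathrm{VR}_{k_{q+1}}G)$ for $q=0,1$. Put $k=k_2$. A character is a homomorphism $\chi:G\to(\mathbb{R},+)$. Put $G_L=\{g\in G\mid\chi(g)\ge L\}$, $v(g_0,\dots,g_q)=\min_i\chi(g_i)$, and let $v$ of a finite simplicial set of tuples be the minimum of $v$ over its simplices.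 By definition $\chi\in\Sigma^2(G)$ if for $q=0,1$ and every $i$ there is $j\ge i$ such that $\pi_q(\mathrm{VR}_iG_0)$ vanishes in $\pi_q(\mathrm{VR}_jG_0)$. For simplicial sets $S,T$ let $\mathrm{Map}(S,T)$ be the set of simplicial maps to $T$ from iterated barycentric subdivisions $\mathrm{Sd}^nS$, two maps being regarded as equal if they agree after further subdivision, that is, after composition with last vertex maps $\mathrm{Sd}^{n+1}S\to\mathrm{Sd}^nS$. Algorithm 2, on input $\chi\ne0$, is the following nondeterministic procedure. Pick $t\in G$ with $\chi(t)>0$ and set $\varphi_0(g)=gt$. For $q=1,2$ and for each of the finitely many nondegenerate $\sigma=(1,g_1,\dots,g_q)\in\Delta^q_k$, search for some $\phi\in\mathrm{Map}(\Delta^q,\mathrm{VR}_k(G_{\chi(t)+v(\sigma)}))$ with $\phi|_{\partial\Delta^q}=\varphi_{q-1}\circ\sigma|_{\partial\Delta^q}$; if one is found, define $\varphi_q\circ\sigma=\phi$, and if the search is given up, return "maybe". At the end return "yes". Here $\varphi_q$ is extended to all $q$-simplices by $G$-equivariance and by compatibility with degeneracies. Then for every non-zero character $\chi$ the following are equivalent: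 (1) $\chi\in\Sigma^2(G)$; (2) there is a $G$-equivariant $\varphi\in\mathrm{Map}((\mathrm{VR}_kG)^{(2)},\mathrm{VR}_kG)$ with $v(\varphi(\sigma))-v(\sigma)>0$ for every $\sigma\in\Delta^2_k$; (3) some run of Algorithm 2 on input $\chi$ terminates with output "yes"; (4) there is $t\in G$ with $\chi(t)>0$, and for every pick of such a $t$ (and every order of the $\sigma$ with $q=1$) some run of Algorithm 2 terminates with output "yes". Hence the set of non-zero characters in $\Sigma^2(G)$ is Turing recognizable: there is a Turing machine which, when it reads an arbitrary sequence of vectors $a_0,a_1,\dots\in\mathbb{Z}^r$ with $|\chi(x_i)-2^{-j}a_{j,i}|\le2^{-j}$ for all $i,j$, where $\chi$ is a character, halts after reading finitely many of them if and only if $\chi\ne0$ and $\chi\in\Sigma^2(G)$. -/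

import Mathlib

open CategoryTheory Opposite

universe u

namespace SigmaTwo

/-! ### Finitely generated groups: words, word metric, characters -/

section Groups

variable {G : Type u} [Group G] {r : ℕ}

/-- The group element spelled by a word in the letters `x i` (`true`) and `(x i)⁻¹` (`false`). -/
def evalWord (x : Fin r → G) (w : List (Fin r × Bool)) : G :=
  (w.map fun l => if l.2 then x l.1 else (x l.1)⁻¹).prod

/-- The word problem is solvable: it is decidable which words spell the identity. -/
def SolvableWordProblem (x : Fin r → G) : Prop :=
  ComputablePred fun w : List (Fin r × Bool) => evalWord x w = 1

/-- Word length (the set of lengths is non-empty when `x` generates `G`). -/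
noncomputable def wordLength (x : Fin r → G) (g : G) : ℕ :=
  sInf {n | ∃ w : List (Fin r × Bool), w.length = n ∧ evalWord x w = g}

/-- The left-invariant word metric `d(g,h) = l(g⁻¹h)`. -/
noncomputable def wordDist (x : Fin r → G) (g h : G) : ℕ :=
  wordLength x (g⁻¹ * h)

theorem wordDist_self (x : Fin r → G) (g : G) : wordDist x g g = 0 := by
  have h : (0 : ℕ) ∈ {n | ∃ w : List (Fin r × Bool), w.length = n ∧ evalWord x w = g⁻¹ * g} :=
    ⟨[], rfl, by simp [evalWord]⟩
  exact Nat.le_zero.1 (Nat.sInf_le h)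

theorem wordDist_mul_left (x : Fin r → G) (a g h : G) :
    wordDist x (a * g) (a * h) = wordDist x g h := by
  simp [wordDist, mul_assoc]

/-- The value of a character `G → ℝ` (a homomorphism to the additive group of reals). -/
def chi (χ : G →* Multiplicative ℝ) (g : G) : ℝ := (χ g).toAdd

/-- `G_L = {g ∣ χ(g) ≥ L}`. -/
def halfSpace (χ : G →* Multiplicative ℝ) (L : ℝ) : Set G := {g | L ≤ chi χ g}

/-- The valuation of a simplex: the minimum of the `χ`-values of its vertices. -/
noncomputable def simplexVal (χ : G →* Multiplicative ℝ) {q : ℕ} (s : Fin (q + 1) → G) : ℝ :=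
  Finset.univ.inf' Finset.univ_nonempty fun i => chi χ (s i)

end Groups

/-! ### The free simplicial set on a set and Vietoris–Rips complexes -/

/-- The simplicial set `E T`: its `q`-simplices are all `(q+1)`-tuples of elements of `T`. -/
def freeSSet (T : Type u) : SSet.{u} where
  obj n := Fin (n.unop.len + 1) → T
  map f := ↾ fun s => s ∘ f.unop.toOrderHom

section Rips

variable {G : Type u} [Group G] {r : ℕ}

/-- The Vietoris–Rips complex, for the value `k`, of a subset `S` of `G` with the word metric. -/
def vietorisRips (x : Fin r → G) (S : Set G) (k : ℕ) : (freeSSet G).Subcomplex where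
  obj n := {s : Fin (n.unop.len + 1) → G |
    (∀ i, s i ∈ S) ∧ ∀ i j, wordDist x (s i) (s j) ≤ k}
  map f := fun _ hs => ⟨fun i => hs.1 (f.unop.toOrderHom i),
    fun i j => hs.2 (f.unop.toOrderHom i) (f.unop.toOrderHom j)⟩

theorem vietorisRips_mono (x : Fin r → G) {S T : Set G} (hST : S ⊆ T) {k l : ℕ} (hkl : k ≤ l) :
    vietorisRips x S k ≤ vietorisRips x T l :=
  fun _ _ hs => ⟨fun i => hST (hs.1 i), fun i j => (hs.2 i j).trans hkl⟩

/-- The Vietoris–Rips complex of the whole group, as a simplicial set. -/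
abbrev ripsG (x : Fin r → G) (k : ℕ) : SSet.{u} := (vietorisRips x Set.univ k).toSSet

/-- The action of `g : G` on the Vietoris–Rips complex by left multiplication on vertices. -/
def translate (x : Fin r → G) (k : ℕ) (g : G) : ripsG x k ⟶ ripsG x k where
  app _ := ↾ fun s => ⟨fun i => g * s.1 i, fun _ => Set.mem_univ _, fun i j =>
    (wordDist_mul_left x g (s.1 i) (s.1 j)).le.trans (s.2.2 i j)⟩

/-- The standard `q`-simplex. -/
abbrev stdS (q : ℕ) : SSet.{u} := SSet.stdSimplex.obj (SimplexCategory.mk q)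

/-- The vertex `g` of the Vietoris–Rips complex, as a map from the `0`-simplex. -/
def vertexMap (x : Fin r → G) (k : ℕ) (g : G) : stdS 0 ⟶ ripsG x k :=
  SSet.yonedaEquiv.symm ⟨fun _ => g, fun _ => Set.mem_univ _,
    fun _ _ => (wordDist_self x g).le.trans (Nat.zero_le k)⟩

end Rips

/-! ### Finiteness properties and the homotopical Sigma-invariants -/

/-- The map induced by the continuous map `f` on `π_q` is trivial, for all base points
(for `q = 0`: any two points of the source are sent to the same path component). -/
def TrivialOnPi (q : ℕ) {X Y : TopCat.{u}} (f : X ⟶ Y) : Prop :=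
  ∀ (p : X) (γ : GenLoop (Fin q) X p),
    (f.hom.comp γ.1).HomotopicRel (ContinuousMap.const _ (f.hom p)) (Cube.boundary (Fin q))

section Sigma

variable {G : Type u} [Group G] {r : ℕ}

/-- `π_q` of (the geometric realization of) the Vietoris–Rips complex of `S` for the value `k`
vanishes in `π_q` of that for the value `l`. -/
def PiVanishes (x : Fin r → G) (S : Set G) (q k l : ℕ) : Prop :=
  ∃ h : k ≤ l, TrivialOnPi q
    (SSet.toTop.map (SSet.Subcomplex.homOfLE (vietorisRips_mono x (subset_refl S) h)))

/-- The metric subspace `S` of `G` is of type `F_m`: the direct systems of homotopy groups of its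
Vietoris–Rips complexes are essentially trivial in all degrees `q < m`. -/
def IsTypeF (x : Fin r → G) (S : Set G) (m : ℕ) : Prop :=
  S.Nonempty ∧ ∀ q < m, ∀ k, ∃ l, PiVanishes x S q k l

/-- The homotopical invariant `Σ^m(G)`: the characters `χ` for which `{g ∣ χ(g) ≥ 0}` is of
type `F_m`. -/
def Sigma (x : Fin r → G) (m : ℕ) : Set (G →* Multiplicative ℝ) :=
  {χ | IsTypeF x (halfSpace χ 0) m}

/-- Homotopical connecting vectors `(k_0, …, k_m)`. -/
def IsConnectingVector (x : Fin r → G) {m : ℕ} (k : Fin (m + 1) → ℕ) : Prop :=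
  ∀ q : Fin m, PiVanishes x Set.univ q (k q.castSucc) (k q.succ)

end Sigma

/-! ### Maps defined on iterated barycentric subdivisions -/

/-- The component at `Δ[n]` of the last vertex map: a nonempty subset of `{0, …, n}` is sent to
its maximum. -/
noncomputable def lastVertexSimplex (n : SimplexCategory) :
    SimplexCategory.sd.{u}.obj n ⟶ SSet.stdSimplex.{u}.obj n where
  app d := ↾ fun F => SSet.stdSimplex.objMk
    { toFun := fun i => (F.obj i).finset.sup' (F.obj i).nonempty
        fun v : ULift.{u} (Fin (n.len + 1)) => v.down
      monotone' := fun i j hij => Finset.sup'_mono _ (F.map (homOfLE hij)).le (F.obj i).nonempty }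
  naturality := by
    intro d d' f
    rfl

theorem lastVertexSimplex_naturality {m n : SimplexCategory} (f : m ⟶ n) :
    SimplexCategory.sd.{u}.map f ≫ lastVertexSimplex n =
      lastVertexSimplex m ≫ SSet.stdSimplex.{u}.map f := by
  refine NatTrans.ext (funext fun d => ?_)
  ext F
  refine SSet.stdSimplex.objEquiv.injective (SimplexCategory.Hom.ext _ _ (OrderHom.ext _ _ ?_))
  funext i
  classical
  have key : ∀ (A : PartialOrder.NonemptyFiniteChains (ULift.{u} (Fin (m.len + 1)))),
      (A.map (SimplexCategory.toPartOrd.{u}.map f).hom).finset.sup'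
        (A.map (SimplexCategory.toPartOrd.{u}.map f).hom).nonempty
        (fun v : ULift.{u} (Fin (n.len + 1)) => v.down) =
      f.toOrderHom (A.finset.sup' A.nonempty fun v => v.down) := by
    intro A
    apply le_antisymm
    · refine Finset.sup'_le _ _ fun v hv => ?_
      obtain ⟨w, hw, rfl⟩ := (A.mem_map_iff _ v).1 hv
      exact f.toOrderHom.monotone
        (Finset.le_sup' (fun v : ULift.{u} (Fin (m.len + 1)) => v.down) hw)
    · obtain ⟨w, hw, hw'⟩ := Finset.exists_mem_eq_sup' A.nonempty
        (fun v : ULift.{u} (Fin (m.len + 1)) => v.down)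
      rw [hw']
      exact Finset.le_sup' (fun v : ULift.{u} (Fin (n.len + 1)) => v.down)
        ((A.mem_map_iff (SimplexCategory.toPartOrd.{u}.map f).hom
          (ULift.up (f.toOrderHom w.down))).2 ⟨w, hw, rfl⟩)
  exact key (F.obj i)

/-- The last vertex map from the barycentric subdivision. -/
noncomputable def lastVertex : SSet.sd.{u} ⟶ 𝟭 SSet.{u} :=
  SSet.sd.descOfIsLeftKanExtension SSet.stdSimplex.sdIso.inv (𝟭 SSet.{u})
    { app := fun n => lastVertexSimplex n
      naturality := fun _ _ f => lastVertexSimplex_naturality f }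

/-- The `n`-fold barycentric subdivision. -/
noncomputable def sdIter : ℕ → (SSet.{u} ⥤ SSet.{u})
  | 0 => 𝟭 _
  | n + 1 => SSet.sd ⋙ sdIter n

/-- `Map(S, T)`: simplicial maps to `T` from some iterated barycentric subdivision of `S`. -/
structure SubdMap (S T : SSet.{u}) where
  /-- the number of subdivisions -/
  n : ℕ
  /-- the simplicial map -/
  hom : (sdIter n).obj S ⟶ T

namespace SubdMap

variable {S S' T T' : SSet.{u}}

/-- Restriction along a simplicial map `S' ⟶ S`. -/
noncomputable def precomp (φ : SubdMap S T) (f : S' ⟶ S) : SubdMap S' T :=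
  ⟨φ.n, (sdIter φ.n).map f ≫ φ.hom⟩

/-- Composition with a simplicial map `T ⟶ T'`. -/
noncomputable def postcomp (φ : SubdMap S T) (f : T ⟶ T') : SubdMap S T' :=
  ⟨φ.n, φ.hom ≫ f⟩

/-- The same map, on one more subdivision. -/
noncomputable def refine (φ : SubdMap S T) : SubdMap S T :=
  ⟨φ.n + 1, (sdIter φ.n).map (lastVertex.app S) ≫ φ.hom⟩

/-- Two maps are identified if they agree after further subdivision. -/
def Same (φ ψ : SubdMap S T) : Prop :=
  ∃ a b : ℕ, refine^[a] φ = refine^[b] ψ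

end SubdMap

/-- A simplicial map restricts to the skeleta (simplices of dimension `< n`). -/
def skeletonMap {X Y : SSet.{u}} (f : X ⟶ Y) (n : ℕ) :
    (X.skeleton n).toSSet ⟶ (Y.skeleton n).toSSet :=
  SSet.Subcomplex.lift ((X.skeleton n).ι ≫ f) (by
    have h : X.skeleton n ≤ (Y.skeleton n).preimage f := by
      refine iSup_le fun i => iSup_le fun s => ?_
      rw [SSet.Subcomplex.ofSimplex_le_iff]
      exact SSet.mem_skeleton Y _ i.2
    rintro d _ ⟨s, rfl⟩
    exact h d s.2)

section Criterion

variable {G : Type u} [Group G] {r : ℕ}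

/-- The `2`-skeleton of the Vietoris–Rips complex of `G`. -/
abbrev ripsSkeleton2 (x : Fin r → G) (k : ℕ) : SSet.{u} := ((ripsG x k).skeleton 3).toSSet

/-- A `2`-simplex, as a map from `Δ[2]` to the `2`-skeleton. -/
def simplexMap (x : Fin r → G) (k : ℕ) (s : (ripsG x k).obj (op (.mk 2))) :
    stdS 2 ⟶ ripsSkeleton2 x k :=
  SSet.yonedaEquiv.symm ⟨s, SSet.mem_skeleton _ s⟩

/-- `φ` commutes with the left action of `G`. -/
def IsEquivariant (x : Fin r → G) (k : ℕ) (φ : SubdMap (ripsSkeleton2 x k) (ripsG x k)) : Prop :=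
  ∀ g : G, φ.precomp (skeletonMap (translate x k g) 3) = φ.postcomp (translate x k g)

/-- `v(φ(s)) > v(s)` for every `2`-simplex `s`. Here `φ(s)` is the (finite) image of
`φ` restricted to `s`, and `v(φ(s))` is the minimum of `v` over the simplices of that image. -/
def RaisesValuation (x : Fin r → G) (k : ℕ) (χ : G →* Multiplicative ℝ)
    (φ : SubdMap (ripsSkeleton2 x k) (ripsG x k)) : Prop :=
  ∀ (s : (ripsG x k).obj (op (.mk 2))) (p : ℕ) (τ : ((sdIter φ.n).obj (stdS 2)).obj (op (.mk p))),
    simplexVal χ (q := 2) s.1 <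
      simplexVal χ (q := p) ((φ.precomp (simplexMap x k s)).hom.app (op (.mk p)) τ).1

/-! ### The algorithm -/

/-- The memory of the algorithm: the values `φ_q ∘ σ` found so far, for nondegenerate simplices
`σ = (1, g_1, …, g_q)`. -/
abbrev Table (x : Fin r → G) (n : ℕ) : Type u :=
  (q : ℕ) → (Fin (q + 1) → G) → Option (SubdMap (stdS q) (ripsG x n))

open scoped Classical in
/-- Only `φ_0 : g ↦ g * t` is known; it is given by its value at `1`. -/
noncomputable def initTable (x : Fin r → G) (n : ℕ) (t : G) : Table x n
  | 0, s => if s = 1 then some ⟨0, vertexMap x n t⟩ else none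
  | _ + 1, _ => none

open scoped Classical in
/-- Define `φ_q ∘ σ := φ`. -/
noncomputable def Table.define {x : Fin r → G} {n : ℕ} (M : Table x n) {q : ℕ}
    (σ : Fin (q + 1) → G) (φ : SubdMap (stdS q) (ripsG x n)) : Table x n :=
  Function.update M q (Function.update (M q) σ (some φ))

/-- `Value M q τ ψ`: the data in the table determine `φ_q ∘ τ = ψ`, by `G`-equivariance and, on
degenerate simplices, by compatibility of `φ_q` with degeneracies. -/
inductive Value {x : Fin r → G} {n : ℕ} (M : Table x n) :
    (q : ℕ) → (Fin (q + 1) → G) → SubdMap (stdS q) (ripsG x n) → Prop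
  | translate {q : ℕ} {σ : Fin (q + 1) → G} {φ : SubdMap (stdS q) (ripsG x n)} (g : G)
      (h : M q σ = some φ) :
      Value M q (fun i => g * σ i) (φ.postcomp (SigmaTwo.translate x n g))
  | degenerate {q : ℕ} {τ : Fin (q + 1) → G} {ψ : SubdMap (stdS q) (ripsG x n)} (i : Fin (q + 1))
      (h : Value M q τ ψ) :
      Value M (q + 1) (τ ∘ i.predAbove) (ψ.precomp (SSet.stdSimplex.map (SimplexCategory.σ i)))

/-- `φ` is a possible result of the search for `σ`: it lies in
`Map(Δ^q, VR_n(G_{χ(t) + v(σ)}))`, `q = p + 1`, and its restriction to the boundary of `Δ^q` is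
`φ_{q-1} ∘ σ ∘ ∂`, that is, this holds on each face. -/
def IsSearchResult {x : Fin r → G} {n : ℕ} (χ : G →* Multiplicative ℝ) (t : G) (M : Table x n)
    {p : ℕ} (σ : Fin (p + 2) → G) (φ : SubdMap (stdS (p + 1)) (ripsG x n)) : Prop :=
  (∃ φ' : SubdMap (stdS (p + 1))
      (vietorisRips x (halfSpace χ (chi χ t + simplexVal χ (q := p + 1) σ)) n).toSSet,
    φ = φ'.postcomp
      (SSet.Subcomplex.homOfLE (vietorisRips_mono x (Set.subset_univ _) le_rfl))) ∧
  ∀ i : Fin (p + 2), ∃ ψ, Value M p (σ ∘ i.succAbove) ψ ∧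
    (φ.precomp (SSet.stdSimplex.map (SimplexCategory.δ i))).Same ψ

/-- `l` lists, without repetition, the nondegenerate `q`-simplices `(1, g_1, …, g_q)` in `Δ^q_n`
(on degenerate ones a simplicial map is determined by its values in lower dimension). -/
def Enumerates (x : Fin r → G) (n q : ℕ) (l : List (Fin (q + 1) → G)) : Prop :=
  l.Nodup ∧ ∀ σ : Fin (q + 1) → G, σ ∈ l ↔
    σ 0 = 1 ∧ σ ∈ (vietorisRips x Set.univ n).obj (op (.mk q)) ∧ σ ∈ (freeSSet G).nonDegenerate q

/-- The states of the algorithm. In `loop t p M todo` the outer loop is at `q = p + 1`, and `todo`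
lists the simplices that the inner loop has still to treat. -/
inductive AlgState (x : Fin r → G) (n : ℕ) : Type u
  | start : AlgState x n
  | loop (t : G) (p : ℕ) (M : Table x n) (todo : List (Fin (p + 2) → G)) : AlgState x n
  | yes : AlgState x n
  | maybe : AlgState x n

/-- One step of the algorithm, for the value `n` and the character `χ`. A search either comes
up with some result or is given up. -/
inductive Step (x : Fin r → G) (n : ℕ) (χ : G →* Multiplicative ℝ) :
    AlgState x n → AlgState x n → Prop
  | pick (t : G) (ht : 0 < chi χ t) (l : List (Fin 2 → G)) (hl : Enumerates x n 1 l) :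
      Step x n χ .start (.loop t 0 (initTable x n t) l)
  | found (t : G) (p : ℕ) (M : Table x n) (σ : Fin (p + 2) → G) (l : List (Fin (p + 2) → G))
      (φ : SubdMap (stdS (p + 1)) (ripsG x n)) (h : IsSearchResult χ t M σ φ) :
      Step x n χ (.loop t p M (σ :: l)) (.loop t p (M.define (q := p + 1) σ φ) l)
  | giveUp (t : G) (p : ℕ) (M : Table x n) (σ : Fin (p + 2) → G) (l : List (Fin (p + 2) → G)) :
      Step x n χ (.loop t p M (σ :: l)) .maybe
  | next (t : G) (M : Table x n) (l : List (Fin 3 → G)) (hl : Enumerates x n 2 l) :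
      Step x n χ (.loop t 0 M []) (.loop t 1 M l)
  | finish (t : G) (M : Table x n) : Step x n χ (.loop t 1 M []) .yes

/-- Some run of the algorithm ends with output "yes". -/
def AnswersYes (x : Fin r → G) (n : ℕ) (χ : G →* Multiplicative ℝ) : Prop :=
  Relation.ReflTransGen (Step x n χ) .start .yes

/-- Whichever `t` with `χ(t) > 0` is picked at the start, and in whichever order the simplices of
the first loop are treated, the run can be continued so that it ends with output "yes". -/
def AnswersYesFromEveryStart (x : Fin r → G) (n : ℕ) (χ : G →* Multiplicative ℝ) : Prop :=
  (∃ s, Step x n χ .start s) ∧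
    ∀ s, Step x n χ .start s → Relation.ReflTransGen (Step x n χ) s .yes

end Criterion

/-! ### Turing recognizability -/

section Recognizable

variable {G : Type u} [Group G] {r : ℕ}

/-- `a` is a name of `χ`: it lists dyadic approximations `a j i / 2 ^ j` to the values of `χ` on
the generators, with error at most `1 / 2 ^ j`. -/
def IsName (x : Fin r → G) (χ : G →* Multiplicative ℝ) (a : ℕ → Fin r → ℤ) : Prop :=
  ∀ j i, |2 ^ j * chi χ (x i) - a j i| ≤ 1

/-- A set of characters is Turing recognizable: some Turing machine, reading a name of a
character `χ`, halts after having read finitely many entries of it if and only if `χ` belongs to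
the set. (`P` is the set of finite lists on which the machine halts without reading further.) -/
def TuringRecognizable (x : Fin r → G) (A : Set (G →* Multiplicative ℝ)) : Prop :=
  ∃ P : List (Fin r → ℤ) → Prop, REPred P ∧
    ∀ (χ : G →* Multiplicative ℝ) (a : ℕ → Fin r → ℤ), IsName x χ a →
      (χ ∈ A ↔ ∃ N, P ((List.range N).map a))

end Recognizable

end SigmaTwo

/-! Rips complexes are flag complexes and only π_0 and π_1 are involved, so the topology can be
traded for edge paths: walks are lists of adjacent vertices, and homotopies of walks are sequences
of moves across triangles (`Ht`). `piVanishes_zero_iff` and `piVanishes_one_iff` make this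
translation; afterwards no realization occurs any more.

All conditions are compared with one finite datum, a `Certificate`. Let K be the last entry of the
connecting vector. A certificate consists of an element t, a walk m(g) from t to gt in the Rips
complex for every g of length at most K, and for every triangle (1, g, h) a homotopy from m(g) · g
m(g⁻¹h) to m(h), all at height at least δ above the simplex in question. Translation by G turns it
into an equivariant map of edge path groupoids, a ↦ at on vertices, which raises everything by δ.

A certificate with δ > 0 forces χ ∈ Σ² (`Certificate.mem_sigma`). In the whole group points can be
joined and loops of the Cayley graph contract, at some uncontrolled depth. Iterating the map lifts
these walks and homotopies back into the half space, and since the map stays at bounded distance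
from the identity, the original points and loops are recovered in a Rips complex whose parameter
does not depend on the depth.

Conversely, let χ ∈ Σ² (`exists_certificate`). Half spaces are then connected in the Cayley graph,
and loops in them contract with a loss of height bounded by a constant C. Climb from t along a ray
by at least C, cross over at that height, and descend to gt: this is m(g), and the rays absorb the
loss C. The gain is δ = χ(t), for any t.

The implications run 1 → 4 → 3 → 2 → 1. For 1 → 4, the homotopies of a certificate are arranged in
rectangular grids whose entries label the vertices of a fine subdivision of a triangle, so every
search can succeed (`Certificate.answersYes`). For 3 → 2, the table left by a successful run is
glued to an equivariant map (`Table.Sound.exists_subdMap`). For 2 → 1, the edges and triangles of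
that map trace walks and homotopies (`exists_strictCertificate`); these satisfy strict inequalities,
and as finitely many of them suffice there is a uniform gain δ > 0.

Recognizability comes from the same datum: a strict certificate can be searched for, adjacency being
confirmed by the word problem and each strict inequality by a sufficiently good dyadic approximation
(`turingRecognizable_strictCertificate`). -/

namespace SigmaTwo

/-! ### Combinatorial homotopy of walks -/

section Walks

variable {V W : Type*}

/-- A relation that is the adjacency relation of a flag complex: `A a a` says that `a` is a
vertex. -/
structure IsAdj (A : V → V → Prop) : Prop where
  symm : ∀ {a b}, A a b → A b a
  refl : ∀ {a b}, A a b → A a a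

/-- The list `l` continues the vertex `a` to a walk. -/
def Walk (A : V → V → Prop) : V → List V → Prop
  | a, [] => A a a
  | a, b :: l => A a b ∧ Walk A b l

/-- The last vertex of a walk. -/
def tgt : V → List V → V
  | a, [] => a
  | _, b :: l => tgt b l

/-- The reversed walk, from `tgt a l` to `a`. -/
def rev : V → List V → List V
  | _, [] => []
  | a, b :: l => rev b l ++ [a]

/-- Homotopy of walks relative to the endpoints, generated by triangles. -/
inductive Ht (A : V → V → Prop) : V → List V → List V → Prop
  | refl {a l} (h : Walk A a l) : Ht A a l l
  | symm {a l l'} (h : Ht A a l l') : Ht A a l' l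
  | trans {a l l' l''} (h : Ht A a l l') (h' : Ht A a l' l'') : Ht A a l l''
  | cons {a b l l'} (h : A a b) (h' : Ht A b l l') : Ht A a (b :: l) (b :: l')
  | tri {a b c l} (hab : A a b) (hbc : A b c) (hac : A a c) (h : Walk A c l) :
      Ht A a (b :: c :: l) (c :: l)
  | stay {a} (h : A a a) : Ht A a [a] []

@[simp] theorem tgt_nil (a : V) : tgt a [] = a := rfl
@[simp] theorem tgt_cons (a b : V) (l : List V) : tgt a (b :: l) = tgt b l := rfl

@[simp] theorem tgt_append (a : V) (l m : List V) : tgt a (l ++ m) = tgt (tgt a l) m := by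
  induction l generalizing a with
  | nil => rfl
  | cons b l ih => exact ih b

theorem tgt_map (f : V → W) (a : V) (l : List V) : tgt (f a) (l.map f) = f (tgt a l) := by
  induction l generalizing a with
  | nil => rfl
  | cons b l ih => exact ih b

theorem tgt_mem (a : V) (l : List V) : tgt a l ∈ a :: l := by
  induction l generalizing a with
  | nil => simp
  | cons b l ih => exact List.mem_cons_of_mem _ (ih b)

@[simp] theorem tgt_rev (a : V) (l : List V) : tgt (tgt a l) (rev a l) = a := by
  induction l generalizing a with
  | nil => rfl
  | cons b l ih => simp [rev]

theorem rev_append (a : V) (l m : List V) : rev a (l ++ m) = rev (tgt a l) m ++ rev a l := by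
  induction l generalizing a with
  | nil => simp [rev]
  | cons b l ih => simp [rev, ih]

@[simp] theorem rev_rev (a : V) (l : List V) : rev (tgt a l) (rev a l) = l := by
  induction l generalizing a with
  | nil => rfl
  | cons b l ih => simp [rev, rev_append, ih]

theorem rev_map (f : V → W) (a : V) (l : List V) : rev (f a) (l.map f) = (rev a l).map f := by
  induction l generalizing a with
  | nil => rfl
  | cons b l ih => simp [rev, ih]

variable {A B : V → V → Prop}

theorem Walk.append {a : V} {l m : List V} (h : Walk A a l) (h' : Walk A (tgt a l) m) :
    Walk A a (l ++ m) := by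
  induction l generalizing a with
  | nil => exact h'
  | cons b l ih => exact ⟨h.1, ih h.2 h'⟩

theorem Walk.start (hA : IsAdj A) {a : V} {l : List V} (h : Walk A a l) : A a a := by
  cases l with
  | nil => exact h
  | cons b l => exact hA.refl h.1

theorem Walk.end {a : V} {l : List V} (h : Walk A a l) :
    A (tgt a l) (tgt a l) := by
  induction l generalizing a with
  | nil => exact h
  | cons b l ih => exact ih h.2

theorem Walk.left (hA : IsAdj A) {a : V} {l m : List V} (h : Walk A a (l ++ m)) : Walk A a l := by
  induction l generalizing a with
  | nil => exact h.start hA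
  | cons b l ih => exact ⟨h.1, ih h.2⟩

theorem Walk.right {a : V} {l m : List V} (h : Walk A a (l ++ m)) :
    Walk A (tgt a l) m := by
  induction l generalizing a with
  | nil => exact h
  | cons b l ih => exact ih h.2

theorem Walk.rev (hA : IsAdj A) {a : V} {l : List V} (h : Walk A a l) :
    Walk A (tgt a l) (rev a l) := by
  induction l generalizing a with
  | nil => exact h
  | cons b l ih =>
    exact (ih h.2).append (by simpa [Walk] using ⟨hA.symm h.1, hA.refl h.1⟩)

theorem Walk.mem (hA : IsAdj A) {a b : V} {l : List V} (h : Walk A a l) (hb : b ∈ a :: l) :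
    A b b := by
  induction l generalizing a with
  | nil => obtain rfl := List.mem_singleton.1 hb; exact h
  | cons c l ih =>
    rcases List.mem_cons.1 hb with rfl | hb
    · exact hA.refl h.1
    · exact ih h.2 hb

theorem Walk.map {C : W → W → Prop} (f : V → W) (hf : ∀ a b, A a b → C (f a) (f b)) {a : V}
    {l : List V} (h : Walk A a l) : Walk C (f a) (l.map f) := by
  induction l generalizing a with
  | nil => exact hf _ _ h
  | cons b l ih => exact ⟨hf _ _ h.1, ih h.2⟩

theorem Walk.mono (hAB : ∀ a b, A a b → B a b) {a : V} {l : List V} (h : Walk A a l) :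
    Walk B a l := by
  simpa using h.map id hAB

namespace Ht

theorem tgt_eq {a : V} {l l' : List V} (h : Ht A a l l') : tgt a l = tgt a l' := by
  induction h with
  | refl => rfl
  | symm _ ih => exact ih.symm
  | trans _ _ ih ih' => exact ih.trans ih'
  | cons _ _ ih => exact ih
  | tri => rfl
  | stay => rfl

theorem walks {a : V} {l l' : List V} (h : Ht A a l l') :
    Walk A a l ∧ Walk A a l' := by
  induction h with
  | refl h => exact ⟨h, h⟩
  | symm _ ih => exact ih.symm
  | trans _ _ ih ih' => exact ⟨ih.1, ih'.2⟩
  | cons h _ ih => exact ⟨⟨h, ih.1⟩, ⟨h, ih.2⟩⟩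
  | tri hab hbc hac h => exact ⟨⟨hab, hbc, h⟩, hac, h⟩
  | stay h => exact ⟨⟨h, h⟩, h⟩

theorem stay' (hA : IsAdj A) {a : V} {l : List V} (h : Walk A a l) : Ht A a (a :: l) l := by
  cases l with
  | nil => exact .stay h
  | cons b l => exact .tri (hA.refl h.1) h.1 h.1 h.2

theorem append_right (hA : IsAdj A) {a : V} {l l' m : List V} (h : Ht A a l l')
    (hm : Walk A (tgt a l) m) : Ht A a (l ++ m) (l' ++ m) := by
  induction h with
  | refl h => exact .refl (h.append hm)
  | symm h ih => exact (ih (by rwa [h.tgt_eq])).symm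
  | trans h _ ih ih' => exact (ih hm).trans (ih' (by rwa [← h.tgt_eq]))
  | cons h _ ih => exact .cons h (ih hm)
  | tri hab hbc hac h => exact .tri hab hbc hac (h.append hm)
  | stay h => exact stay' hA hm

theorem append_left {a : V} {l l' m : List V} (hm : Walk A a m)
    (h : Ht A (tgt a m) l l') : Ht A a (m ++ l) (m ++ l') := by
  induction m generalizing a with
  | nil => exact h
  | cons b m ih => exact .cons hm.1 (ih hm.2 h)

theorem append (hA : IsAdj A) {a : V} {l l' m m' : List V} (h : Ht A a l l')
    (h' : Ht A (tgt a l) m m') : Ht A a (l ++ m) (l' ++ m') :=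
  (h.append_right hA h'.walks.1).trans
    (append_left h.walks.2 (by rwa [← h.tgt_eq]))

theorem append_rev (hA : IsAdj A) {a : V} {l : List V} (h : Walk A a l) :
    Ht A a (l ++ rev a l) [] := by
  induction l generalizing a with
  | nil => exact .refl h
  | cons b l ih =>
    have h1 : Ht A b (l ++ rev b l ++ [a]) ([] ++ [a]) :=
      (ih h.2).append_right hA (by simpa [Walk] using ⟨hA.symm h.1, hA.refl h.1⟩)
    have h2 : Ht A a (b :: [a]) [a] := .tri h.1 (hA.symm h.1) (hA.refl h.1) (hA.refl h.1)
    have := ((Ht.cons h.1 h1).trans h2).trans (.stay (hA.refl h.1))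
    simpa [rev] using this

theorem rev_append (hA : IsAdj A) {a : V} {l : List V} (h : Walk A a l) :
    Ht A (tgt a l) (rev a l ++ l) [] := by
  have := append_rev hA (h.rev hA)
  rwa [rev_rev] at this

/-- Compose with the reverse of `m`. The equality of targets has to be assumed, since it guarantees
that both copies of `m` start at the same vertex. -/
theorem cancel_right (hA : IsAdj A) {a : V} {l l' m : List V} (h : Ht A a (l ++ m) (l' ++ m))
    (ht : tgt a l = tgt a l') : Ht A a l l' := by
  have hw := h.walks
  have h1 := h.append_right hA (m := rev (tgt a l) m) (by
    rw [tgt_append]; exact hw.1.right.rev hA)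
  rw [List.append_assoc, List.append_assoc] at h1
  have h2 := append_left (hw.1.left hA) (append_rev hA hw.1.right)
  have h3 := append_left (hw.2.left hA) (append_rev hA hw.2.right)
  rw [List.append_nil] at h2 h3
  rw [← ht] at h3
  exact h2.symm.trans (h1.trans h3)

theorem cancel_left (hA : IsAdj A) {a : V} {l l' m : List V} (h : Ht A a (m ++ l) (m ++ l')) :
    Ht A (tgt a m) l l' := by
  have hw := h.walks
  have hm := hw.1.left hA
  have h1 := append_left (hm.rev hA) (by simpa using h)
  rw [← List.append_assoc, ← List.append_assoc] at h1
  have h2 := (rev_append hA hm).append_right hA (m := l) (by simpa using hw.1.right)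
  have h3 := (rev_append hA hm).append_right hA (m := l') (by simpa using hw.2.right)
  exact h2.symm.trans (h1.trans h3)

theorem map {C : W → W → Prop} (f : V → W) (hf : ∀ a b, A a b → C (f a) (f b)) {a : V}
    {l l' : List V} (h : Ht A a l l') : Ht C (f a) (l.map f) (l'.map f) := by
  induction h with
  | refl h => exact .refl (h.map f hf)
  | symm _ ih => exact ih.symm
  | trans _ _ ih ih' => exact ih.trans ih'
  | cons h _ ih => exact .cons (hf _ _ h) ih
  | tri hab hbc hac h => exact .tri (hf _ _ hab) (hf _ _ hbc) (hf _ _ hac) (h.map f hf)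
  | stay h => exact .stay (hf _ _ h)

theorem mono (hAB : ∀ a b, A a b → B a b) {a : V} {l l' : List V} (h : Ht A a l l') :
    Ht B a l l' := by
  simpa using h.map id hAB

/-- A walk whose vertices span a simplex is homotopic to an edge. -/
theorem cone {a : V} {l : List V} (h : ∀ b ∈ a :: l, ∀ c ∈ a :: l, A b c) :
    Ht A a l [tgt a l] := by
  induction l generalizing a with
  | nil => exact (Ht.stay (h a (by simp) a (by simp))).symm
  | cons b l ih =>
    have h1 := ih (a := b) fun c hc d hd => h c (List.mem_cons_of_mem _ hc) d
      (List.mem_cons_of_mem _ hd)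
    have hmem : tgt b l ∈ a :: b :: l := List.mem_cons_of_mem _ (tgt_mem b l)
    exact (Ht.cons (h a (by simp) b (by simp)) h1).trans
      (.tri (h a (by simp) b (by simp)) (h b (by simp) _ hmem) (h a (by simp) _ hmem)
        (h _ hmem _ hmem))

end Ht

/-- The walk obtained by replacing each edge `(a, b)` by the walk `E a b`. -/
def mapWalk (E : V → V → List W) : V → List V → List W
  | _, [] => []
  | a, b :: l => E a b ++ mapWalk E b l

theorem mapWalk_append (E : V → V → List W) (a : V) (l m : List V) :
    mapWalk E a (l ++ m) = mapWalk E a l ++ mapWalk E (tgt a l) m := by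
  induction l generalizing a with
  | nil => rfl
  | cons b l ih => simp [mapWalk, ih]

theorem Walk.mapWalk {C : W → W → Prop} {f : V → W} {E : V → V → List W}
    (hf : ∀ a, A a a → C (f a) (f a))
    (hE : ∀ a b, A a b → Walk C (f a) (E a b) ∧ tgt (f a) (E a b) = f b) {a : V}
    {l : List V} (h : Walk A a l) :
    Walk C (f a) (mapWalk E a l) ∧ tgt (f a) (SigmaTwo.mapWalk E a l) = f (tgt a l) := by
  induction l generalizing a with
  | nil => exact ⟨hf _ h, rfl⟩
  | cons b l ih =>
    obtain ⟨h1, h2⟩ := hE _ _ h.1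
    refine ⟨h1.append (by rw [h2]; exact (ih h.2).1), ?_⟩
    rw [SigmaTwo.mapWalk, tgt_append, h2]
    exact (ih h.2).2

/-- Functoriality of edge path groupoids: an assignment on edges that respects triangles respects
homotopy. -/
theorem Ht.mapWalk {C : W → W → Prop} (hC : IsAdj C) {f : V → W}
    {E : V → V → List W} (hf : ∀ a, A a a → C (f a) (f a))
    (hE : ∀ a b, A a b → Walk C (f a) (E a b) ∧ tgt (f a) (E a b) = f b)
    (hT : ∀ a b c, A a b → A b c → A a c → Ht C (f a) (E a b ++ E b c) (E a c)) {a : V}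
    {l l' : List V} (h : Ht A a l l') : Ht C (f a) (mapWalk E a l) (SigmaTwo.mapWalk E a l') := by
  induction h with
  | refl h => exact .refl (h.mapWalk hf hE).1
  | symm _ ih => exact ih.symm
  | trans _ _ ih ih' => exact ih.trans ih'
  | cons h _ ih =>
    obtain ⟨h1, h2⟩ := hE _ _ h
    exact append_left h1 (by rwa [h2])
  | tri hab hbc hac h =>
    have := (hT _ _ _ hab hbc hac).append_right hC (m := SigmaTwo.mapWalk E _ _) (by
      rw [tgt_append, (hE _ _ hab).2, (hE _ _ hbc).2]
      exact (h.mapWalk hf hE).1)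
    simpa [SigmaTwo.mapWalk] using this
  -- The degenerate triangle on `a` makes the loop `E a a` idempotent up to homotopy; cancelling one
  -- factor shows that it is null-homotopic.
  | @stay a h =>
    have h1 := hT _ _ _ h h h
    have h2 : Ht C (f a) (E a a ++ E a a) (E a a ++ []) := by simpa using h1
    have h3 := h2.cancel_left hC
    rw [(hE _ _ h).2] at h3
    simpa [SigmaTwo.mapWalk] using h3

/-- Naturality: if the squares over edges commute, so do the squares over walks. -/
theorem Ht.natural (hB : IsAdj B) {f : V → V} {E : V → V → List V}
    (hAB : ∀ a b, A a b → B a b)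
    (hf : ∀ a, A a a → B a (f a))
    (hE : ∀ a b, A a b → Walk B (f a) (E a b) ∧ tgt (f a) (E a b) = f b)
    (hN : ∀ a b, A a b → Ht B a [b, f b] (f a :: E a b)) {a : V} {l : List V}
    (h : Walk A a l) : Ht B a (l ++ [f (tgt a l)]) (f a :: SigmaTwo.mapWalk E a l) := by
  induction l generalizing a with
  | nil =>
    exact .refl ⟨hf _ h, hB.refl (hB.symm (hf _ h))⟩
  | cons b l ih =>
    have h1 := Ht.cons (hAB _ _ h.1) (ih h.2)
    refine h1.trans ?_
    have hw : Walk B (f b) (SigmaTwo.mapWalk E b l) :=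
      (h.2.mapWalk (fun a ha => hB.refl (hB.symm (hf a ha))) hE).1
    have h2 := (hN _ _ h.1).append_right hB (m := SigmaTwo.mapWalk E b l) (by simpa using hw)
    simpa [SigmaTwo.mapWalk] using h2

/-- A walk uses finitely many adjacencies, so it already lives in one stage of an increasing union.
With the analogue for homotopies, this gives every finite piece of data a lowest height or a uniform
gain. -/
theorem Walk.exists_of_directed {A : ℕ → V → V → Prop}
    (hA : ∀ m n, m ≤ n → ∀ a b, A m a b → A n a b)
    {a : V} {l : List V} (h : Walk (fun a b => ∃ n, A n a b) a l) : ∃ n, Walk (A n) a l := by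
  induction l generalizing a with
  | nil => exact h
  | cons b l ih =>
    obtain ⟨⟨m, hm⟩, h2⟩ := h
    obtain ⟨n, hn⟩ := ih h2
    exact ⟨max m n, hA _ _ (le_max_left _ _) _ _ hm, hn.mono (hA _ _ (le_max_right _ _))⟩

theorem Ht.exists_of_directed {A : ℕ → V → V → Prop}
    (hA : ∀ m n, m ≤ n → ∀ a b, A m a b → A n a b)
    {a : V} {l l' : List V} (h : Ht (fun a b => ∃ n, A n a b) a l l') :
    ∃ n, Ht (A n) a l l' := by
  induction h with
  | refl h =>
    obtain ⟨n, hn⟩ := h.exists_of_directed hA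
    exact ⟨n, .refl hn⟩
  | symm _ ih => exact ih.imp fun n h => h.symm
  | trans _ _ ih ih' =>
    obtain ⟨m, hm⟩ := ih
    obtain ⟨n, hn⟩ := ih'
    exact ⟨max m n, (hm.mono (hA _ _ (le_max_left _ _))).trans
      (hn.mono (hA _ _ (le_max_right _ _)))⟩
  | cons h _ ih =>
    obtain ⟨m, hm⟩ := h
    obtain ⟨n, hn⟩ := ih
    exact ⟨max m n, .cons (hA _ _ (le_max_left _ _) _ _ hm)
      (hn.mono (hA _ _ (le_max_right _ _)))⟩
  | tri hab hbc hac h =>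
    obtain ⟨i, hi⟩ := hab
    obtain ⟨j, hj⟩ := hbc
    obtain ⟨m, hm⟩ := hac
    obtain ⟨n, hn⟩ := h.exists_of_directed hA
    exact ⟨max (max i j) (max m n), .tri (hA _ _ (by omega) _ _ hi) (hA _ _ (by omega) _ _ hj)
      (hA _ _ (by omega) _ _ hm) (hn.mono (hA _ _ (by omega)))⟩
  | stay h => exact h.imp fun n h => .stay h

/-! ### Walks as eventually constant sequences -/

/-- The sequence of vertices of a walk, continued by its last vertex. -/
def seq : V → List V → ℕ → V
  | a, [], _ => a
  | a, _ :: _, 0 => a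
  | _, b :: l, i + 1 => seq b l i

@[simp] theorem seq_zero (a : V) (l : List V) : seq a l 0 = a := by cases l <;> rfl

theorem seq_of_le (a : V) (l : List V) {i : ℕ} (h : l.length ≤ i) : seq a l i = tgt a l := by
  induction l generalizing a i with
  | nil => rfl
  | cons b l ih =>
    obtain ⟨i, rfl⟩ : ∃ j, i = j + 1 := ⟨i - 1, by simp at h; omega⟩
    exact ih b (by simpa using h)

theorem Walk.seq {a : V} {l : List V} (h : Walk A a l) (i : ℕ) :
    A (seq a l i) (SigmaTwo.seq a l (i + 1)) := by
  induction l generalizing a i with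
  | nil => exact h
  | cons b l ih =>
    cases i with
    | zero => simpa [SigmaTwo.seq] using h.1
    | succ i => exact ih h.2 i

/-- The vertices `c 1, …, c n`. -/
def lst (c : ℕ → V) : ℕ → List V
  | 0 => []
  | n + 1 => lst c n ++ [c (n + 1)]

@[simp] theorem tgt_lst (c : ℕ → V) (n : ℕ) : tgt (c 0) (lst c n) = c n := by
  cases n <;> simp [lst]

theorem lst_succ' (c : ℕ → V) (n : ℕ) : lst c (n + 1) = c 1 :: lst (fun i => c (i + 1)) n := by
  induction n with
  | zero => rfl
  | succ n ih => rw [lst, ih, lst]; rfl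

theorem lst_seq (a : V) (l : List V) : lst (seq a l) l.length = l := by
  induction l generalizing a with
  | nil => rfl
  | cons b l ih =>
    rw [List.length_cons, lst_succ']
    congr 1
    · simp [seq]
    · exact ih b

theorem Walk.lst {c : ℕ → V} (h0 : A (c 0) (c 0)) (h : ∀ i, A (c i) (c (i + 1))) (hA : IsAdj A)
    (n : ℕ) : Walk A (c 0) (lst c n) := by
  induction n with
  | zero => exact h0
  | succ n ih =>
    exact ih.append (by rw [tgt_lst]; exact ⟨h n, hA.refl (hA.symm (h n))⟩)

/-- Two parallel walks whose squares span simplices. -/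
structure GridStep (A : V → V → Prop) (c c' : ℕ → V) : Prop where
  lower : ∀ i, A (c i) (c (i + 1))
  upper : ∀ i, A (c' i) (c' (i + 1))
  vert : ∀ i, A (c i) (c' i)
  diag : ∀ i, A (c i) (c' (i + 1))
  diag' : ∀ i, A (c (i + 1)) (c' i)

theorem GridStep.symm (hA : IsAdj A) {c c' : ℕ → V} (h : GridStep A c c') : GridStep A c' c :=
  ⟨h.upper, h.lower, fun i => hA.symm (h.vert i), fun i => hA.symm (h.diag' i),
    fun i => hA.symm (h.diag i)⟩

theorem GridStep.refl (hA : IsAdj A) {c : ℕ → V} (h : ∀ i, A (c i) (c (i + 1))) :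
    GridStep A c c :=
  ⟨h, h, fun i => hA.refl (h i), h, fun i => hA.symm (h i)⟩

/-- The ladder is crossed one square at a time; a square is a clique, hence two triangles along a
diagonal. -/
theorem GridStep.ladder (hA : IsAdj A) {c c' : ℕ → V} (h : GridStep A c c') (h0 : c 0 = c' 0)
    (n : ℕ) : Ht A (c 0) (lst c n ++ [c' n]) (lst c' n) := by
  induction n with
  | zero => simpa [lst, h0] using Ht.stay (A := A) (hA.refl (h.upper 0))
  | succ n ih =>
    have hw : Walk A (c 0) (lst c n) := Walk.lst (hA.refl (h.lower 0)) h.lower hA n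
    have e1 : A (c n) (c (n + 1)) := h.lower n
    have e2 : A (c (n + 1)) (c' (n + 1)) := h.vert _
    have e3 : A (c n) (c' (n + 1)) := h.diag n
    have e5 : A (c' n) (c' (n + 1)) := h.upper n
    have e6 : A (c' (n + 1)) (c' (n + 1)) := hA.refl (hA.symm e5)
    have h1 : Ht A (c n) [c (n + 1), c' (n + 1)] [c' n, c' (n + 1)] :=
      (Ht.tri (l := []) e1 e2 e3 e6).trans (Ht.tri (l := []) (h.vert n) e5 e3 e6).symm
    have h2 := Ht.append_left hw (by simpa using h1)
    have h3 := ih.append_right hA (m := [c' (n + 1)]) (by simpa using ⟨e5, e6⟩)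
    simpa [lst] using h2.trans (by simpa using h3)

/-- A step between walks from `a` that are constant `b` from the index `R` on. -/
structure RowStep (A : V → V → Prop) (R : ℕ) (a b : V) (c c' : ℕ → V) : Prop where
  grid : GridStep A c c'
  start : c 0 = a
  start' : c' 0 = a
  fin : ∀ i, R ≤ i → c i = b
  fin' : ∀ i, R ≤ i → c' i = b

/-- Homotopy of sequences through rows of bounded length. -/
abbrev RowHom (A : V → V → Prop) (R : ℕ) (a b : V) : (ℕ → V) → (ℕ → V) → Prop :=
  Relation.ReflTransGen (RowStep A R a b)

theorem RowHom.symm (hA : IsAdj A) {R : ℕ} {a b : V} {c c' : ℕ → V} (h : RowHom A R a b c c') :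
    RowHom A R a b c' c := by
  have : Std.Symm (RowStep A R a b) :=
    ⟨fun _ _ h => ⟨h.grid.symm hA, h.start', h.start, h.fin', h.fin⟩⟩
  exact Std.Symm.symm _ _ h

theorem RowHom.mono {R R' : ℕ} (hR : R ≤ R') {a b : V} {c c' : ℕ → V} (h : RowHom A R a b c c') :
    RowHom A R' a b c c' :=
  Relation.ReflTransGen.mono (fun _ _ (h : RowStep A R a b _ _) => (⟨h.grid, h.start, h.start',
    fun i hi => h.fin i (hR.trans hi), fun i hi => h.fin' i (hR.trans hi)⟩ :
      RowStep A R' a b _ _)) _ _ h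

/-- Repeat the vertex with index `m`. -/
def stutter (c : ℕ → V) (m i : ℕ) : V := if i ≤ m then c i else c (i - 1)

/-- Move the repeated index to the right, one place at each row, until it disappears in the constant
tail. -/
theorem RowHom.stutter (hA : IsAdj A) {c : ℕ → V} (h : ∀ i, A (c i) (c (i + 1))) {R : ℕ} {b : V}
    (hb : ∀ i, R ≤ i → c i = b) (m : ℕ) :
    RowHom A (R + 1) (c 0) b (stutter c m) c := by
  have key : ∀ n m, R ≤ m + n → RowHom A (R + 1) (c 0) b (SigmaTwo.stutter c m) c := by
    intro n
    induction n with
    | zero =>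
      intro m hm
      have : SigmaTwo.stutter c m = c := by
        funext i
        unfold SigmaTwo.stutter
        split_ifs with hi
        · rfl
        · rw [hb i (by omega), hb (i - 1) (by omega)]
      rw [this]
    | succ n ih =>
      intro m hm
      refine .head ?_ (ih (m + 1) (by omega))
      have hd : ∀ i, SigmaTwo.stutter c (m + 1) i =
          if i = m + 1 then c (m + 1) else SigmaTwo.stutter c m i := by
        intro i
        unfold SigmaTwo.stutter
        split_ifs <;> first | rfl | omega | (congr 1)
      have hr : ∀ i, A (c i) (c i) := fun i => hA.refl (h i)
      have hs : ∀ i, A (c (i + 1)) (c i) := fun i => hA.symm (h i)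
      have lem : ∀ p q : ℕ, (p = q ∨ p = q + 1 ∨ q = p + 1) → A (c p) (c q) := by
        rintro p q (rfl | rfl | rfl)
        exacts [hr _, hs _, h _]
      have e : ∀ m i, SigmaTwo.stutter c m i = c (if i ≤ m then i else i - 1) := by
        intro m i; unfold SigmaTwo.stutter; split_ifs <;> rfl
      refine ⟨⟨fun i => ?_, fun i => ?_, fun i => ?_, fun i => ?_, fun i => ?_⟩, ?_, ?_, ?_, ?_⟩
      iterate 5
        · rw [e, e]
          apply lem
          split_ifs <;> omega
      · simp [e]
      · simp [e]
      · intro i hi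
        rw [e]
        exact hb _ (by split_ifs <;> omega)
      · intro i hi
        rw [e]
        exact hb _ (by split_ifs <;> omega)
  exact key R m (by omega)

/-- Prepend a vertex to a sequence. -/
def shift (a : V) (c : ℕ → V) : ℕ → V
  | 0 => a
  | i + 1 => c i

theorem seq_cons (a b : V) (l : List V) : seq a (b :: l) = shift a (seq b l) := by
  funext i; cases i <;> rfl

theorem RowHom.shift (hA : IsAdj A) {R : ℕ} {a b e : V} (hab : A a b) {c c' : ℕ → V}
    (h : RowHom A R b e c c') : RowHom A (R + 1) a e (shift a c) (SigmaTwo.shift a c') := by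
  induction h with
  | refl => exact .refl
  | tail _ h ih =>
    refine ih.tail ⟨⟨fun i => ?_, fun i => ?_, fun i => ?_, fun i => ?_, fun i => ?_⟩, rfl, rfl,
      fun i hi => ?_, fun i hi => ?_⟩
    all_goals rcases i with _ | i
    · simpa only [SigmaTwo.shift, h.start] using hab
    · exact h.grid.lower i
    · simpa only [SigmaTwo.shift, h.start'] using hab
    · exact h.grid.upper i
    · exact hA.refl hab
    · exact h.grid.vert i
    · simpa only [SigmaTwo.shift, h.start'] using hab
    · exact h.grid.diag i
    · simpa only [SigmaTwo.shift, h.start] using hA.symm hab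
    · exact h.grid.diag' i
    · omega
    · exact h.fin i (by omega)
    · omega
    · exact h.fin' i (by omega)

/-- Moves across triangles change the length of a walk. Written as eventually constant sequences,
all intermediate walks become rows of one rectangular array; this form is needed to label a
triangle. -/
theorem Ht.rowHom (hA : IsAdj A) {a : V} {l l' : List V} (h : Ht A a l l') :
    ∃ R, RowHom A R a (tgt a l) (seq a l) (seq a l') := by
  induction h with
  | refl h => exact ⟨0, .refl⟩
  | symm h ih =>
    obtain ⟨R, hR⟩ := ih
    exact ⟨R, by rw [← h.tgt_eq]; exact hR.symm hA⟩
  | trans h _ ih ih' =>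
    obtain ⟨R, hR⟩ := ih
    obtain ⟨R', hR'⟩ := ih'
    exact ⟨max R R', (hR.mono (le_max_left _ _)).trans
      (by rw [h.tgt_eq]; exact hR'.mono (le_max_right _ _))⟩
  | cons h _ ih =>
    obtain ⟨R, hR⟩ := ih
    exact ⟨R + 1, by rw [seq_cons, seq_cons]; exact hR.shift hA h⟩
  | @tri a b c l hab hbc hac h =>
    have hac' : Walk A a (c :: l) := ⟨hac, h⟩
    -- The walk a, c, … is padded to a, c, c, …, which is a parallel row for a, b, c, …; the padding
    -- is then removed.
    have hst := RowHom.stutter hA (hac'.seq) (fun i hi => seq_of_le a (c :: l) hi) 1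
    rw [seq_zero] at hst
    refine ⟨(c :: l).length + 1, .head ?_ hst⟩
    have hcl := h.seq
    have hlen : ∀ i, l.length ≤ i → seq c l i = tgt c l := fun i hi => seq_of_le c l hi
    have e2 : ∀ i, stutter (seq a (c :: l)) 1 (i + 2) = seq c l i := by
      intro i
      simp [stutter, seq]
    have e1 : stutter (seq a (c :: l)) 1 1 = c := by simp [stutter, seq]
    have e0 : stutter (seq a (c :: l)) 1 0 = a := by simp [stutter]
    have haa := hA.refl hab
    have hbb := hA.refl hbc
    have hcc := h.start hA
    refine ⟨⟨?_, ?_, ?_, ?_, ?_⟩, by simp, e0, ?_, ?_⟩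
    · exact Walk.seq ⟨hab, hbc, h⟩
    · rintro (_ | _ | i)
      · rwa [e0, e1]
      · rw [e1, e2, seq_zero]; exact hcc
      · rw [e2, e2]; exact hcl i
    · rintro (_ | _ | i)
      · rw [e0, seq_zero]; exact haa
      · rw [e1]; simpa [seq] using hbc
      · rw [e2]; exact hA.refl (hcl i)
    · rintro (_ | _ | i)
      · rw [e1]; simpa using hac
      · rw [e2]; simpa [seq] using hbc
      · rw [e2]; exact hcl i
    · rintro (_ | _ | i)
      · rw [e0]; simpa [seq] using hA.symm hab
      · rw [e1]; simpa [seq] using hcc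
      · rw [e2]; exact hA.symm (hcl i)
    · intro i hi
      exact seq_of_le _ _ (by simpa using hi)
    · intro i hi
      obtain ⟨i, rfl⟩ : ∃ j, i = j + 2 := ⟨i - 2, by simp at hi; omega⟩
      rw [e2]
      exact hlen i (by simp at hi; omega)
  | @stay a h =>
    have : seq a [a] = seq a [] := by
      funext i
      rcases i with _ | i <;> simp [seq]
    exact ⟨0, by rw [this]⟩

end Walks

end SigmaTwo

namespace SigmaTwo

/-! ### Flag complexes and their realizations -/

section Flag

variable {V : Type u}

/-- The flag complex of an adjacency relation. -/
def flagC (A : V → V → Prop) : (freeSSet V).Subcomplex where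
  obj n := {s : Fin (n.unop.len + 1) → V | ∀ i j, A (s i) (s j)}
  map f := fun _ hs i j => hs (f.unop.toOrderHom i) (f.unop.toOrderHom j)

/-- The realization of the flag complex of an adjacency relation. -/
noncomputable abbrev flagTop (A : V → V → Prop) : TopCat.{u} :=
  SSet.toTop.obj (flagC A).toSSet

/-- The characteristic map of a simplex. -/
noncomputable def spx (A : V → V → Prop) {n : ℕ} (s : Fin (n + 1) → V)
    (hs : ∀ i j, A (s i) (s j)) : C(stdSimplex ℝ (Fin (n + 1)), flagTop A) :=
  TopCat.toSSetObjEquiv _ (op (.mk n))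
    ((sSetTopAdj.unit.app (flagC A).toSSet).app (op (.mk n)) ⟨s, hs⟩)

variable {A B : V → V → Prop}

theorem spx_comp {m n : ℕ} (f : Fin (m + 1) →o Fin (n + 1)) (s : Fin (n + 1) → V)
    (hs : ∀ i j, A (s i) (s j)) (t : stdSimplex ℝ (Fin (m + 1))) :
    spx A (s ∘ f) (fun i j => hs (f i) (f j)) t = spx A s hs (stdSimplex.map f t) := by
  have h := ConcreteCategory.congr_hom ((sSetTopAdj.unit.app (flagC A).toSSet).naturality
    (SimplexCategory.mkHom f).op) ⟨s, hs⟩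
  exact DFunLike.congr_fun (congrArg (TopCat.toSSetObjEquiv _ (op (.mk m))) h) t

theorem spx_map (hAB : flagC A ≤ flagC B) {n : ℕ} (s : Fin (n + 1) → V)
    (hs : ∀ i j, A (s i) (s j)) (hs' : ∀ i j, B (s i) (s j)) (t : stdSimplex ℝ (Fin (n + 1))) :
    SSet.toTop.map (SSet.Subcomplex.homOfLE hAB) (spx A s hs t) = spx B s hs' t := by
  have h := ConcreteCategory.congr_hom (NatTrans.congr_app
    (sSetTopAdj.unit.naturality (SSet.Subcomplex.homOfLE hAB)) (op (.mk n))) ⟨s, hs⟩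
  exact (DFunLike.congr_fun (congrArg (TopCat.toSSetObjEquiv _ (op (.mk n))) h) t).symm

theorem flagTop_hom_ext {Z : TopCat.{u}} {f g : flagTop A ⟶ Z}
    (h : ∀ (n : ℕ) (s : Fin (n + 1) → V) (hs : ∀ i j, A (s i) (s j)) t,
      f (spx A s hs t) = g (spx A s hs t)) : f = g := by
  apply (sSetTopAdj.homEquiv _ _).injective
  apply NatTrans.ext
  funext n
  ext s
  apply (TopCat.toSSetObjEquiv _ _).injective
  ext t
  exact h n.unop.len s.1 s.2 t

/-- "Lies on some simplex" and "true" are two maps to an indiscrete space, hence continuous. They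
agree on simplices, so the universal property makes them equal. -/
theorem exists_spx (p : flagTop A) : ∃ (n : ℕ) (s : Fin (n + 1) → V)
    (hs : ∀ i j, A (s i) (s j)) (t : stdSimplex ℝ (Fin (n + 1))), spx A s hs t = p := by
  let _ : TopologicalSpace (ULift.{u} Prop) := ⊤
  let f : flagTop A ⟶ TopCat.of (ULift.{u} Prop) := TopCat.ofHom
    ⟨fun p => ⟨∃ (n : ℕ) (s : Fin (n + 1) → V) (hs : ∀ i j, A (s i) (s j))
      (t : stdSimplex ℝ (Fin (n + 1))), spx A s hs t = p⟩, continuous_top⟩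
  let g : flagTop A ⟶ TopCat.of (ULift.{u} Prop) := TopCat.ofHom
    ⟨fun _ => ⟨True⟩, continuous_top⟩
  have hfg : f = g := flagTop_hom_ext fun n s hs t => by
    refine ULift.ext _ _ (eq_true ?_)
    exact ⟨n, s, hs, t, rfl⟩
  have := ConcreteCategory.congr_hom hfg p
  exact of_eq_true (congrArg ULift.down this)

/-- The universal property of the realization, with simplices in barycentric coordinates. It yields
both the coordinate functions (maps to ℝ) and homotopies (maps to a space of paths). -/
theorem exists_desc {Z : Type u} [TopologicalSpace Z]
    (F : ∀ (n : ℕ) (s : Fin (n + 1) → V), (∀ i j, A (s i) (s j)) →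
      C(stdSimplex ℝ (Fin (n + 1)), Z))
    (hF : ∀ (m n : ℕ) (f : Fin (m + 1) →o Fin (n + 1)) (s : Fin (n + 1) → V)
      (hs : ∀ i j, A (s i) (s j)) (t : stdSimplex ℝ (Fin (m + 1))),
      F m (s ∘ f) (fun i j => hs (f i) (f j)) t = F n s hs (stdSimplex.map f t)) :
    ∃ φ : C(flagTop A, Z), ∀ (n : ℕ) (s : Fin (n + 1) → V) (hs : ∀ i j, A (s i) (s j)) t,
      φ (spx A s hs t) = F n s hs t := by
  let Φ : (flagC A).toSSet ⟶ TopCat.toSSet.obj (TopCat.of Z) :=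
    { app := fun n => ↾ fun s => (TopCat.toSSetObjEquiv (TopCat.of Z) n).symm
        (F n.unop.len s.1 s.2)
      naturality := by
        intro m n f
        ext s
        apply (TopCat.toSSetObjEquiv _ _).injective
        ext t
        exact hF _ _ f.unop.toOrderHom s.1 s.2 t }
  refine ⟨((sSetTopAdj.homEquiv _ _).symm Φ).hom, fun n s hs t => ?_⟩
  have h := ConcreteCategory.congr_hom (NatTrans.congr_app
    ((sSetTopAdj.homEquiv (flagC A).toSSet (TopCat.of Z)).apply_symm_apply Φ) (op (.mk n)))
    (⟨s, hs⟩ : (flagC A).toSSet.obj (op (.mk n)))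
  exact DFunLike.congr_fun (congrArg (TopCat.toSSetObjEquiv _ (op (.mk n))) h) t

theorem map_apply {m n : ℕ} (f : Fin (m + 1) → Fin (n + 1)) (t : stdSimplex ℝ (Fin (m + 1)))
    (j : Fin (n + 1)) : stdSimplex.map f t j = ∑ i, if f i = j then t i else 0 := by
  rw [stdSimplex.map_coe, FunOnFinite.linearMap_apply_apply, Finset.sum_filter]

-- The total weight on the vertices equal to `v` does not change under simplicial operators, because
-- pushing a point forward adds up weights over fibres.
open scoped Classical in
theorem exists_weight (A : V → V → Prop) (v : V) : ∃ β : C(flagTop A, ℝ),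
    ∀ (n : ℕ) (s : Fin (n + 1) → V) (hs : ∀ i j, A (s i) (s j)) t,
      β (spx A s hs t) = ∑ i, if s i = v then t i else 0 := by
  obtain ⟨φ, hφ⟩ := exists_desc (A := A) (Z := ULift.{u} ℝ)
    (fun n s _ => ⟨fun t => ⟨∑ i, if s i = v then t i else 0⟩, by
      refine continuous_uliftUp.comp (continuous_finsetSum _ fun i _ => ?_)
      split_ifs
      · exact (continuous_apply i).comp continuous_subtype_val
      · exact continuous_const⟩) (by
    intro m n f s hs t
    refine ULift.ext _ _ ?_
    change (∑ i, if s (f i) = v then t i else 0) = ∑ j, if s j = v then stdSimplex.map f t j else 0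
    simp_rw [map_apply]
    have : ∀ j, (if s j = v then ∑ i, (if f i = j then t i else 0) else 0) =
        ∑ i, if f i = j then (if s j = v then t i else 0) else 0 := by
      intro j
      split_ifs <;> simp
    simp_rw [this]
    rw [Finset.sum_comm]
    simp)
  exact ⟨⟨fun p => (φ p).down, continuous_uliftDown.comp φ.continuous⟩, fun n s hs t =>
    congrArg ULift.down (hφ n s hs t)⟩

/-- The barycentric coordinate at a vertex. -/
noncomputable def weight (A : V → V → Prop) (v : V) : C(flagTop A, ℝ) :=
  (exists_weight A v).choose

open scoped Classical in
theorem weight_spx (v : V) {n : ℕ} (s : Fin (n + 1) → V) (hs : ∀ i j, A (s i) (s j))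
    (t : stdSimplex ℝ (Fin (n + 1))) :
    weight A v (spx A s hs t) = ∑ i, if s i = v then t i else 0 :=
  (exists_weight A v).choose_spec n s hs t

theorem exists_of_weight_pos {v : V} {n : ℕ} {s : Fin (n + 1) → V} {hs : ∀ i j, A (s i) (s j)}
    {t : stdSimplex ℝ (Fin (n + 1))} (h : 0 < weight A v (spx A s hs t)) :
    ∃ i, s i = v ∧ 0 < t i := by
  rw [weight_spx] at h
  obtain ⟨i, -, hi⟩ := Finset.exists_lt_of_sum_lt (f := fun _ => (0 : ℝ)) (by simpa using h)
  split_ifs at hi with h1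
  · exact ⟨i, h1, hi⟩
  · exact absurd hi (lt_irrefl _)

/-- Vertices whose open stars meet are adjacent. This makes open stars a cover from which walks can
be read off. -/
theorem adj_of_weight_pos {p : flagTop A} {v w : V} (hv : 0 < weight A v p)
    (hw : 0 < weight A w p) : A v w := by
  obtain ⟨n, s, hs, t, rfl⟩ := exists_spx p
  obtain ⟨i, rfl, -⟩ := exists_of_weight_pos hv
  obtain ⟨j, rfl, -⟩ := exists_of_weight_pos hw
  exact hs i j

theorem le_weight {n : ℕ} {s : Fin (n + 1) → V} {hs : ∀ i j, A (s i) (s j)}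
    {t : stdSimplex ℝ (Fin (n + 1))} (i : Fin (n + 1)) : t i ≤ weight A (s i) (spx A s hs t) := by
  classical
  rw [weight_spx]
  have := Finset.single_le_sum (f := fun j => if s j = s i then t j else 0)
    (fun j _ => by split_ifs <;> [exact t.2.1 j; exact le_rfl]) (Finset.mem_univ i)
  simpa using this

theorem exists_weight_pos (p : flagTop A) : ∃ v, 0 < weight A v p := by
  obtain ⟨n, s, hs, t, rfl⟩ := exists_spx p
  obtain ⟨i, -, hi⟩ := Finset.exists_lt_of_sum_lt (s := Finset.univ) (f := fun _ => (0 : ℝ))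
    (g := fun i => t i) (by
      have := t.2.2
      simp only [Finset.sum_const_zero]
      exact this ▸ zero_lt_one)
  exact ⟨s i, hi.trans_le (le_weight i)⟩

/-- The vertex of the realization. -/
noncomputable def vtx (A : V → V → Prop) (a : V) (ha : A a a) : flagTop A :=
  spx A (n := 0) (fun _ => a) (fun _ _ => ha) default

theorem eq_of_weight_vtx_pos {a v : V} {ha : A a a} (h : 0 < weight A v (vtx A a ha)) : v = a := by
  obtain ⟨i, hi, -⟩ := exists_of_weight_pos h
  exact hi.symm

theorem spx_vertex {n : ℕ} (s : Fin (n + 1) → V) (hs : ∀ i j, A (s i) (s j)) (i : Fin (n + 1)) :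
    spx A s hs (stdSimplex.vertex i) = vtx A (s i) (hs i i) := by
  have := spx_comp (A := A) (OrderHom.const (Fin (0 + 1)) i) s hs default
  rw [vtx]
  refine Eq.trans ?_ this.symm
  congr 1
  have h0 : (default : stdSimplex ℝ (Fin (0 + 1))) = stdSimplex.vertex 0 := by
    exact Subsingleton.elim (α := stdSimplex ℝ (Fin 1)) _ _
  rw [h0, stdSimplex.map_vertex]
  rfl

theorem vtx_map (hAB : flagC A ≤ flagC B) {a : V} (ha : A a a) (hb : B a a) :
    SSet.toTop.map (SSet.Subcomplex.homOfLE hAB) (vtx A a ha) = vtx B a hb :=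
  spx_map hAB _ _ _ _

/-- The point with parameter `τ ∈ [0, 1]` on the segment `Δ¹`. -/
noncomputable def seg (τ : ℝ) : stdSimplex ℝ (Fin 2) :=
  ⟨![1 - max 0 (min τ 1), max 0 (min τ 1)], by
    refine ⟨fun i => ?_, by simp⟩
    fin_cases i
    · simp
    · simp⟩

theorem continuous_seg : Continuous seg := by
  refine Continuous.subtype_mk (continuous_pi fun i => ?_) _
  fin_cases i
  · exact (show Continuous fun τ : ℝ => 1 - max 0 (min τ 1) by fun_prop)
  · exact (show Continuous fun τ : ℝ => max 0 (min τ 1) by fun_prop)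

theorem seg_of_nonpos {τ : ℝ} (h : τ ≤ 0) : seg τ = stdSimplex.vertex 0 := by
  refine Subtype.ext (funext fun i => ?_)
  have : max 0 (min τ 1) = 0 := max_eq_left ((min_le_left _ _).trans h)
  fin_cases i <;> simp [seg, this]

theorem seg_of_one_le {τ : ℝ} (h : 1 ≤ τ) : seg τ = stdSimplex.vertex 1 := by
  refine Subtype.ext (funext fun i => ?_)
  have : max 0 (min τ 1) = 1 := by rw [min_eq_right h]; simp
  fin_cases i <;> simp [seg, this]

theorem adj_pair (hA : IsAdj A) {a b : V} (h : A a b) (i j : Fin 2) :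
    A (![a, b] i) (![a, b] j) := by
  fin_cases i <;> fin_cases j
  exacts [hA.refl h, h, hA.symm h, hA.refl (hA.symm h)]

/-- A sequence of adjacent vertices is realized by a piecewise linear map. -/
theorem exists_polygon (hA : IsAdj A) (c : ℕ → V) (hc : ∀ i, A (c i) (c (i + 1))) (n : ℕ) :
    ∃ f : C(ℝ, flagTop A), (∀ τ, τ ≤ 0 → f τ = vtx A (c 0) (hA.refl (hc 0))) ∧
      (∀ τ : ℝ, n ≤ τ → f τ = vtx A (c n) (hA.refl (hc n))) ∧
      ∀ i < n, ∀ τ : ℝ, i ≤ τ → τ ≤ i + 1 →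
        f τ = spx A ![c i, c (i + 1)] (adj_pair hA (hc i)) (seg (τ - i)) := by
  induction n with
  | zero =>
    refine ⟨.const _ (vtx A (c 0) (hA.refl (hc 0))), fun _ _ => rfl, fun _ _ => rfl, ?_⟩
    intro i hi
    omega
  | succ n ih =>
    obtain ⟨f, h0, h1, h2⟩ := ih
    let g : ℝ → flagTop A := fun τ =>
      spx A ![c n, c (n + 1)] (adj_pair hA (hc n)) (seg (τ - n))
    have hg : Continuous g := by
      refine (spx A _ _).continuous.comp (continuous_seg.comp ?_)
      fun_prop
    have hgn : ∀ τ : ℝ, τ ≤ n → g τ = vtx A (c n) (hA.refl (hc n)) := by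
      intro τ hτ
      simp only [g]
      rw [seg_of_nonpos (by linarith), spx_vertex]
      rfl
    have hgn' : ∀ τ : ℝ, n + 1 ≤ τ → g τ = vtx A (c (n + 1)) (hA.refl (hc (n + 1))) := by
      intro τ hτ
      simp only [g]
      rw [seg_of_one_le (by linarith), spx_vertex]
      rfl
    refine ⟨⟨fun τ => if τ ≤ n then f τ else g τ, ?_⟩, fun τ hτ => ?_, fun τ hτ => ?_,
      fun i hi τ h3 h4 => ?_⟩
    · refine Continuous.if_le f.continuous hg continuous_id continuous_const ?_
      rintro τ rfl
      rw [h1 _ le_rfl, hgn _ le_rfl]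
    · have : τ ≤ n := hτ.trans (Nat.cast_nonneg n)
      simp only [ContinuousMap.coe_mk, if_pos this, h0 τ hτ]
    · push_cast at hτ
      have : ¬ τ ≤ n := by linarith
      simp only [ContinuousMap.coe_mk, if_neg this, hgn' τ hτ]
    · rcases Nat.lt_succ_iff_lt_or_eq.1 hi with hi | rfl
      · have : τ ≤ n := h4.trans (by exact_mod_cast hi)
        simp only [ContinuousMap.coe_mk, if_pos this, h2 i hi τ h3 h4]
      · simp only [ContinuousMap.coe_mk]
        split_ifs with h5
        · rw [h1 τ h3, ← hgn τ h5]
        · rfl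

end Flag

end SigmaTwo

namespace SigmaTwo

/-! ### From topological paths to walks -/

section FromTop

variable {V : Type u} {A B : V → V → Prop}

theorem isOpen_star (A : V → V → Prop) {Y : Type*} [TopologicalSpace Y] {g : Y → flagTop A}
    (hg : Continuous g) (v : V) : IsOpen {y | 0 < weight A v (g y)} :=
  isOpen_lt continuous_const ((weight A v).continuous.comp hg)

theorem univ_subset_star (A : V → V → Prop) {Y : Type*} (g : Y → flagTop A) :
    Set.univ ⊆ ⋃ v, {y | 0 < weight A v (g y)} :=
  fun y _ => Set.mem_iUnion.2 (exists_weight_pos (g y))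

/-- The endpoints of a topological path are joined by a walk. -/
theorem exists_walk_of_path (hA : IsAdj A) {a b : V} {ha : A a a} {hb : A b b}
    (γ : Path (vtx A a ha) (vtx A b hb)) : ∃ l, Walk A a l ∧ tgt a l = b := by
  -- A subdivision of the interval for which each piece lies in one open star; successive stars
  -- share a division point, so successive labels are adjacent.
  obtain ⟨t, h0, hmono, ⟨N, hN⟩, hcov⟩ := exists_monotone_Icc_subset_open_cover_unitInterval
    (isOpen_star A γ.continuous) (univ_subset_star A γ)
  choose v hv using hcov
  have hv1 : ∀ n, 0 < weight A (v n) (γ (t n)) := fun n => hv n ⟨le_rfl, hmono n.le_succ⟩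
  have hv2 : ∀ n, 0 < weight A (v n) (γ (t (n + 1))) := fun n => hv n ⟨hmono n.le_succ, le_rfl⟩
  have e0 : v 0 = a := by
    have := hv1 0
    rw [h0, γ.source] at this
    exact eq_of_weight_vtx_pos this
  have eN : v N = b := by
    have := hv1 N
    rw [hN N le_rfl, γ.target] at this
    exact eq_of_weight_vtx_pos this
  have hadj : ∀ n, A (v n) (v (n + 1)) := fun n => adj_of_weight_pos (hv2 n) (hv1 (n + 1))
  refine ⟨lst v N, ?_, ?_⟩
  · rw [← e0]
    exact Walk.lst (hA.refl (hadj 0)) hadj hA N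
  · rw [← e0, tgt_lst, eN]

/-- The labels of a subdivision of a polygon form a walk homotopic to the polygon. -/
theorem ht_labels_of_polygon (hA : IsAdj A) {c : ℕ → V} (hc : ∀ i, A (c i) (c (i + 1))) {n : ℕ}
    {g : ℝ → flagTop A} (hgn : g n = vtx A (c n) (hA.refl (hc n)))
    (hg : ∀ i < n, ∀ τ : ℝ, i ≤ τ → τ ≤ i + 1 →
        g τ = spx A ![c i, c (i + 1)] (adj_pair hA (hc i)) (seg (τ - i)))
    {T : ℕ → ℝ} (hT : Monotone T) (hT0 : T 0 = 0) (hTn : ∀ m, T m ≤ n) {M : ℕ} (hTM : T M = n)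
    {v : ℕ → V} (hv0 : v 0 = c 0)
    (hv : ∀ m, ∀ τ, T m ≤ τ → τ ≤ T (m + 1) → 0 < weight A (v m) (g τ)) :
    Ht A (c 0) (lst c n) (lst v M) := by
  have hr : ∀ i, A (c i) (c i) := fun i => hA.refl (hc i)
  have hint : ∀ i : ℕ, i ≤ n → ∀ w, 0 < weight A w (g i) → w = c i := by
    intro i hi w hw
    rcases hi.lt_or_eq with hi | rfl
    · rw [hg i hi i le_rfl (by linarith), sub_self, seg_of_nonpos le_rfl, spx_vertex] at hw
      exact eq_of_weight_vtx_pos hw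
    · rw [hgn] at hw
      exact eq_of_weight_vtx_pos hw
  -- At time τ the polygon is on the edge from `c ⌊τ⌋` to `c (⌊τ⌋ + 1)`, so a star that contains the
  -- point belongs to one of its ends.
  have hfloor : ∀ τ : ℝ, 0 ≤ τ → τ ≤ n → ∀ w, 0 < weight A w (g τ) →
      w = c ⌊τ⌋₊ ∨ w = c (⌊τ⌋₊ + 1) := by
    intro τ h0 h1 w hw
    have hle : ⌊τ⌋₊ ≤ n := Nat.floor_le_of_le h1
    rcases hle.lt_or_eq with hi | hi
    · rw [hg _ hi τ (Nat.floor_le h0) (Nat.lt_floor_add_one τ).le] at hw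
      obtain ⟨j, hj, -⟩ := exists_of_weight_pos hw
      fin_cases j
      · exact .inl hj.symm
      · exact .inr hj.symm
    · left
      have : τ = n := le_antisymm h1 (by rw [← hi]; exact Nat.floor_le h0)
      rw [hi]
      rw [this] at hw
      exact hint n le_rfl w hw
  have hT0' : ∀ m, 0 ≤ T m := fun m => hT0 ▸ hT (Nat.zero_le m)
  -- A star contains no polygon vertex other than its centre. Hence integers passed during a single
  -- piece are repetitions of one vertex and can be contracted.
  have hrep : ∀ i d w, (∀ j, i < j → j ≤ i + d + 1 → c j = w) →
      Ht A (c 0) (lst c (i + d + 1)) (lst c i ++ [w]) := by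
    intro i d w
    have hwalk : ∀ i, Walk A (c 0) (lst c i) := Walk.lst (hr 0) hc hA
    induction d with
    | zero =>
      intro h
      rw [← h (i + 1) (by omega) (by omega)]
      exact .refl (hwalk (i + 1))
    | succ d ih =>
      intro h
      have h1 := ih fun j h2 h3 => h j h2 (by omega)
      have e1 := h (i + d + 1) (by omega) (by omega)
      have e2 := h (i + (d + 1) + 1) (by omega) (by omega)
      have hww : A w w := e1 ▸ hr _
      refine Ht.trans ?_ h1
      have : Ht A (c 0) (lst c (i + d + 1) ++ [w]) (lst c (i + d + 1) ++ []) :=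
        Ht.append_left (hwalk _) (by rw [tgt_lst, e1]; exact .stay hww)
      rw [List.append_nil] at this
      rw [← e2] at this
      exact this
  have hadj : ∀ m, A (v m) (v (m + 1)) := fun m =>
    adj_of_weight_pos (hv m _ (hT m.le_succ) le_rfl) (hv (m + 1) _ le_rfl (hT (m + 1).le_succ))
  -- Induction over the pieces: follow the polygon up to the last integer time before `T m`, then
  -- step to the label. Either the integer part does not change, which costs a triangle, or `hrep`
  -- applies.
  have key : ∀ m, Ht A (c 0) (lst c ⌊T m⌋₊ ++ [v m]) (lst v m) := by
    intro m
    induction m with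
    | zero =>
      simpa [hT0, lst, hv0] using Ht.stay (hr 0)
    | succ m ih =>
      have h1 := ih.append_right hA (m := [v (m + 1)])
        (by simpa using ⟨hadj m, hA.refl (hA.symm (hadj m))⟩)
      refine Ht.trans ?_ h1
      have hle : ⌊T m⌋₊ ≤ ⌊T (m + 1)⌋₊ := Nat.floor_mono (hT m.le_succ)
      have hvm := hfloor _ (hT0' m) (hTn m) _ (hv m _ le_rfl (hT m.le_succ))
      have hvm' := hfloor _ (hT0' _) (hTn _) _ (hv (m + 1) _ le_rfl (hT (m + 1).le_succ))
      rw [List.append_assoc]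
      rcases hle.eq_or_lt with he | hlt
      · rw [← he] at hvm' ⊢
        refine Ht.symm (Ht.append_left (Walk.lst (hr 0) hc hA _) ?_)
        rw [tgt_lst]
        have lem : ∀ w, (w = c ⌊T m⌋₊ ∨ w = c (⌊T m⌋₊ + 1)) → A (c ⌊T m⌋₊) w := by
          rintro w (rfl | rfl)
          exacts [hr _, hc _]
        exact Ht.tri (l := []) (lem _ hvm) (hadj m) (lem _ hvm') (hA.refl (hA.symm (hadj m)))
      · obtain ⟨d, hd⟩ : ∃ d, ⌊T (m + 1)⌋₊ = ⌊T m⌋₊ + d + 1 := ⟨⌊T (m + 1)⌋₊ - ⌊T m⌋₊ - 1, by omega⟩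
        have h2 := hrep ⌊T m⌋₊ d (v m) fun j h3 h4 => by
          have h5 : (j : ℝ) ≤ T (m + 1) :=
            (Nat.cast_le.2 (h4.trans hd.symm.le)).trans (Nat.floor_le (hT0' _))
          exact (hint j (by exact_mod_cast h5.trans (hTn _)) _
            (hv m j (Nat.lt_of_floor_lt h3).le h5)).symm
        rw [hd]
        have h3 := h2.append_right hA (m := [v (m + 1)]) (by
          rw [h2.tgt_eq]
          simpa using ⟨hadj m, hA.refl (hA.symm (hadj m))⟩)
        simpa using h3
  have h := key M
  have hvM : v M = c n := hint n le_rfl _ (hTM ▸ hv M _ le_rfl (hT M.le_succ))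
  rw [hTM, Nat.floor_natCast, hvM] at h
  refine Ht.trans (Ht.symm ?_) h
  have : Ht A (c 0) (lst c n ++ [c n]) (lst c n ++ []) :=
    Ht.append_left (Walk.lst (hr 0) hc hA _) (by rw [tgt_lst]; exact .stay (hr n))
  rwa [List.append_nil] at this

/-- A closed walk that becomes null-homotopic in the realization is null-homotopic. -/
theorem ht_of_trivialOnPi_one (hA : IsAdj A) (hB : IsAdj B) (hAB : ∀ a b, A a b → B a b)
    (hle : flagC A ≤ flagC B)
    (h : TrivialOnPi 1 (SSet.toTop.map (SSet.Subcomplex.homOfLE hle))) {a : V} {l : List V}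
    (hl : Walk A a l) (hla : tgt a l = a) : Ht B a l [] := by
  have hc := hl.seq
  obtain ⟨f, h0, h1, h2⟩ := exists_polygon hA (seq a l) hc l.length
  have hcn : seq a l l.length = a := by rw [seq_of_le a l le_rfl, hla]
  have haA : A a a := hl.start hA
  have haB := hAB _ _ haA
  have hvA : ∀ b, (hb : A b b) → b = a → vtx A b hb = vtx A a haA := by rintro b hb rfl; rfl
  have hv : ∀ b, (hb : B b b) → b = a → vtx B b hb = vtx B a haB := by rintro b hb rfl; rfl
  let γ : GenLoop (Fin 1) (flagTop A) (vtx A a haA) :=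
    ⟨⟨fun y => f (l.length * (y 0 : ℝ)), by fun_prop⟩, by
      rintro y ⟨i, hi⟩
      obtain rfl : i = 0 := Subsingleton.elim _ _
      rcases hi with hi | hi
      · simp only [ContinuousMap.coe_mk, hi]
        rw [h0 _ (by simp)]
        exact hvA _ _ (seq_zero a l)
      · simp only [ContinuousMap.coe_mk, hi]
        rw [h1 _ (by simp)]
        exact hvA _ _ hcn⟩
  obtain ⟨H⟩ := h _ γ
  let π : flagTop A → flagTop B := SSet.toTop.map (SSet.Subcomplex.homOfLE hle)
  -- The null-homotopy as a map of the square: the loop on the bottom side, constant on the other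
  -- three.
  let K : unitInterval × unitInterval → flagTop B := fun z => H (z.2, fun _ => z.1)
  have hK : Continuous K := H.continuous.comp (by fun_prop)
  have hK0 : ∀ x, K (x, 0) = π (f (l.length * (x : ℝ))) := fun x => H.apply_zero _
  have hK1 : ∀ x, K (x, 1) = vtx B a haB := fun x => (H.apply_one _).trans (vtx_map hle haA haB)
  have hKb : ∀ x y, (x = 0 ∨ x = 1) → K (x, y) = vtx B a haB := by
    intro x y hx
    have hb : (fun _ => x : Fin 1 → unitInterval) ∈ Cube.boundary (Fin 1) := ⟨0, hx⟩
    refine (H.eq_fst y hb).trans ?_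
    have : γ.1 (fun _ => x) = vtx A a haA := γ.2 _ hb
    change π (γ.1 (fun _ => x)) = _
    rw [this]
    exact vtx_map hle haA haB
  obtain ⟨t, ht0, hmono, ⟨N, hN⟩, hcov⟩ :=
    exists_monotone_Icc_subset_open_cover_unitInterval_prod_self
      (isOpen_star B hK) (univ_subset_star B K)
  choose v hvc using hcov
  have hle' : ∀ n, t n ≤ t (n + 1) := fun n => hmono n.le_succ
  have p00 : ∀ i j, 0 < weight B (v i j) (K (t i, t j)) := fun i j =>
    hvc i j ⟨⟨le_rfl, hle' i⟩, ⟨le_rfl, hle' j⟩⟩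
  have p10 : ∀ i j, 0 < weight B (v i j) (K (t (i + 1), t j)) := fun i j =>
    hvc i j ⟨⟨hle' i, le_rfl⟩, ⟨le_rfl, hle' j⟩⟩
  have p01 : ∀ i j, 0 < weight B (v i j) (K (t i, t (j + 1))) := fun i j =>
    hvc i j ⟨⟨le_rfl, hle' i⟩, ⟨hle' j, le_rfl⟩⟩
  have p11 : ∀ i j, 0 < weight B (v i j) (K (t (i + 1), t (j + 1))) := fun i j =>
    hvc i j ⟨⟨hle' i, le_rfl⟩, ⟨hle' j, le_rfl⟩⟩
  -- Cells that touch, even only in a corner, have stars that meet there; hence consecutive rows of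
  -- labels form a grid of cliques.
  have hstep : ∀ j, GridStep B (fun i => v i j) (fun i => v i (j + 1)) := fun j =>
    ⟨fun i => adj_of_weight_pos (p10 i j) (p00 (i + 1) j),
      fun i => adj_of_weight_pos (p10 i (j + 1)) (p00 (i + 1) (j + 1)),
      fun i => adj_of_weight_pos (p01 i j) (p00 i (j + 1)),
      fun i => adj_of_weight_pos (p11 i j) (p00 (i + 1) (j + 1)),
      fun i => adj_of_weight_pos (p01 (i + 1) j) (p10 i (j + 1))⟩
  have v0 : ∀ j, v 0 j = a := fun j => by
    have := p00 0 j
    rw [hKb _ _ (.inl ht0)] at this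
    exact eq_of_weight_vtx_pos this
  have vN : ∀ j, v N j = a := fun j => by
    have := p00 N j
    rw [hKb _ _ (.inr (hN N le_rfl))] at this
    exact eq_of_weight_vtx_pos this
  have vtop : ∀ i, v i N = a := fun i => by
    have := p00 i N
    rw [hN N le_rfl, hK1] at this
    exact eq_of_weight_vtx_pos this
  have hrow : ∀ j, Ht B a (lst (fun i => v i 0) N) (lst (fun i => v i j) N) := by
    intro j
    have hwalk : ∀ j, Walk B a (lst (fun i => v i j) N) := fun j => by
      have := Walk.lst (c := fun i => v i j) (hB.refl ((hstep j).lower 0)) (hstep j).lower hB N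
      rwa [v0] at this
    induction j with
    | zero => exact .refl (hwalk 0)
    | succ j ih =>
      refine ih.trans ?_
      have h3 := (hstep j).ladder hB (by rw [v0, v0]) N
      rw [v0, vN] at h3
      refine Ht.trans ?_ h3
      have h4 : Ht B a (lst (fun i => v i j) N ++ [a]) (lst (fun i => v i j) N ++ []) := by
        refine Ht.append_left (hwalk j) ?_
        have := tgt_lst (fun i => v i j) N
        rw [v0, vN] at this
        rw [this]
        exact .stay haB
      rw [List.append_nil] at h4
      exact h4.symm
  have hend : Ht B a (lst (fun i => v i N) N) [] := by
    have hall : ∀ n, ∀ b ∈ a :: lst (fun i => v i N) n, b = a := by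
      intro n
      induction n with
      | zero => simp [lst]
      | succ n ih =>
        intro b hb
        rw [lst, ← List.cons_append, List.mem_append] at hb
        rcases hb with hb | hb
        · exact ih b hb
        · rw [List.mem_singleton.1 hb]; exact vtop _
    have h5 : Ht B a (lst (fun i => v i N) N) [tgt a (lst (fun i => v i N) N)] :=
      Ht.cone fun b hb c hc => by rw [hall N b hb, hall N c hc]; exact haB
    rw [hall N _ (tgt_mem _ _)] at h5
    exact h5.trans (.stay haB)
  have hbot : Ht B (seq a l 0) (lst (seq a l) l.length) (lst (fun i => v i 0) N) := by
    have hcB : ∀ i, B (seq a l i) (seq a l (i + 1)) := fun i => hAB _ _ (hc i)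
    refine ht_labels_of_polygon hB hcB (n := l.length) (g := fun τ => π (f τ)) (M := N)
      (T := fun m => l.length * (t m : ℝ)) ?_ ?_ ?_ ?_ ?_ ?_ ?_ ?_
    · rw [h1 _ le_rfl]
      exact vtx_map hle _ _
    · intro i hi τ h3 h4
      rw [h2 i hi τ h3 h4]
      exact spx_map hle _ _ _ _
    · intro m m' hm
      exact mul_le_mul_of_nonneg_left (hmono hm) (Nat.cast_nonneg _)
    · simp [ht0]
    · intro m
      exact mul_le_of_le_one_right (Nat.cast_nonneg _) (t m).2.2
    · simp [hN N le_rfl]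
    · rw [v0, seq_zero]
    · intro m τ h3 h4
      -- The empty walk is separate because time is divided by its length.
      rcases Nat.eq_zero_or_pos l.length with h5 | h5
      · simp only [h5, Nat.cast_zero, zero_mul] at h3 h4
        obtain rfl : τ = 0 := le_antisymm h4 h3
        have h6 := p00 m 0
        rwa [ht0, hK0, h5, Nat.cast_zero, zero_mul] at h6
      · have h5' : (0 : ℝ) < l.length := Nat.cast_pos.2 h5
        have hx1 : (t m : ℝ) ≤ τ / l.length := by rwa [le_div_iff₀ h5', mul_comm]
        have hx2 : τ / l.length ≤ (t (m + 1) : ℝ) := by rwa [div_le_iff₀ h5', mul_comm]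
        let x : unitInterval := ⟨τ / l.length, (t m).2.1.trans hx1, hx2.trans (t (m + 1)).2.2⟩
        have h6 : 0 < weight B (v m 0) (K (x, 0)) :=
          hvc m 0 ⟨⟨hx1, hx2⟩, ⟨ht0.le, by rw [← ht0]; exact hle' 0⟩⟩
        rw [hK0] at h6
        have h7 : (l.length : ℝ) * (x : ℝ) = τ := by
          change (l.length : ℝ) * (τ / l.length) = τ
          field_simp
        rwa [h7] at h6
  rw [lst_seq, seq_zero] at hbot
  exact hbot.trans ((hrow N).trans hend)

end FromTop

end SigmaTwo

namespace SigmaTwo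

/-! ### Lifts of paths and homotopies -/

section LiftedPaths

variable {X Y : Type*} [TopologicalSpace X] [TopologicalSpace Y]

/-- The path `γ` lifts along `F` to a path from `y` to `y'`. -/
def Lifts {x x' : X} (γ : Path x x') (F : C(Y, X)) (y y' : Y) : Prop :=
  ∃ δ : Path y y', ∀ τ, γ τ = F (δ τ)

theorem Lifts.trans {x x' x'' : X} {γ : Path x x'} {γ' : Path x' x''} {F : C(Y, X)} {y y' y'' : Y}
    (h : Lifts γ F y y') (h' : Lifts γ' F y' y'') : Lifts (γ.trans γ') F y y'' := by
  obtain ⟨δ, hδ⟩ := h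
  obtain ⟨δ', hδ'⟩ := h'
  refine ⟨δ.trans δ', fun τ => ?_⟩
  rw [Path.trans_apply, Path.trans_apply]
  split_ifs
  · exact hδ _
  · exact hδ' _

/-- The source of the elementary homotopies below: both paths are images of paths with common ends
in one simplex, or in the plane, where any two such paths are homotopic. -/
theorem Lifts.homotopic [SimplyConnectedSpace Y] {x x' : X} {γ γ' : Path x x'} {F : C(Y, X)}
    {y y' : Y} (h : Lifts γ F y y') (h' : Lifts γ' F y y') : γ.Homotopic γ' := by
  obtain ⟨δ, hδ⟩ := h
  obtain ⟨δ', hδ'⟩ := h'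
  have hx : x = F y := by rw [← γ.source, hδ, δ.source]
  have hx' : x' = F y' := by rw [← γ.target, hδ, δ.target]
  subst hx hx'
  have e : γ = δ.map F.continuous := Path.ext (funext hδ)
  have e' : γ' = δ'.map F.continuous := Path.ext (funext hδ')
  rw [e, e']
  exact (SimplyConnectedSpace.paths_homotopic δ δ').map F

instance instSimplyConnectedSpaceStdSimplex (n : ℕ) :
    SimplyConnectedSpace (stdSimplex ℝ (Fin (n + 1))) := by
  have : ContractibleSpace (stdSimplex ℝ (Fin (n + 1))) :=
    (convex_stdSimplex ℝ _).contractibleSpace ⟨_, (stdSimplex.vertex (S := ℝ) (0 : Fin (n + 1))).2⟩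
  infer_instance

end LiftedPaths

section ToTop

variable {V : Type u} {A B : V → V → Prop}

/-- The edge path. -/
noncomputable def edgePath (hB : IsAdj B) {a b : V} (h : B a b) :
    Path (vtx B a (hB.refl h)) (vtx B b (hB.refl (hB.symm h))) where
  toFun τ := spx B ![a, b] (adj_pair hB h) (seg τ)
  continuous_toFun := (spx B _ _).continuous.comp
    (continuous_seg.comp continuous_subtype_val)
  source' := by
    rw [seg_of_nonpos (by simp), spx_vertex]
    rfl
  target' := by
    rw [seg_of_one_le (by simp), spx_vertex]
    rfl

/-- The path from `vertex 0` to `vertex 1` in `Δ¹`. -/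
noncomputable def segPath : Path (stdSimplex.vertex (S := ℝ) (0 : Fin 2)) (stdSimplex.vertex 1) where
  toFun τ := seg τ
  continuous_toFun := continuous_seg.comp continuous_subtype_val
  source' := seg_of_nonpos (by simp)
  target' := seg_of_one_le (by simp)

theorem lifts_edgePath (hB : IsAdj B) {a b : V} (h : B a b) {n : ℕ} (s : Fin (n + 1) → V)
    (hs : ∀ i j, B (s i) (s j)) {i j : Fin (n + 1)} (hij : i ≤ j) (hi : s i = a) (hj : s j = b) :
    Lifts (edgePath hB h) (spx B s hs) (stdSimplex.vertex i) (stdSimplex.vertex j) := by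
  subst hi hj
  let f : Fin (1 + 1) →o Fin (n + 1) := ⟨![i, j], by
    intro p q hpq
    fin_cases p <;> fin_cases q
    exacts [le_rfl, hij, absurd hpq (by decide), le_rfl]⟩
  have hf : (![s i, s j] : Fin (1 + 1) → V) = s ∘ f := by
    funext p; fin_cases p <;> rfl
  refine ⟨(segPath.map (stdSimplex.continuous_map f)).cast
    (stdSimplex.map_vertex f 0).symm (stdSimplex.map_vertex f 1).symm, fun τ => ?_⟩
  have := spx_comp f s hs (seg τ)
  refine Eq.trans ?_ this
  change spx B ![s i, s j] _ (seg τ) = _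
  congr 2

theorem edgePath_trans (hB : IsAdj B) {a b c : V} (hab : B a b) (hbc : B b c) (hac : B a c) :
    ((edgePath hB hab).trans (edgePath hB hbc)).Homotopic (edgePath hB hac) := by
  have hs : ∀ i j, B (![a, b, c] i) (![a, b, c] j) := by
    intro i j
    fin_cases i <;> fin_cases j
    exacts [hB.refl hab, hab, hac, hB.symm hab, hB.refl hbc, hbc, hB.symm hac, hB.symm hbc,
      hB.refl (hB.symm hbc)]
  exact ((lifts_edgePath hB hab (n := 2) _ hs (i := 0) (j := 1) (by decide) rfl rfl).trans
    (lifts_edgePath hB hbc (n := 2) _ hs (i := 1) (j := 2) (by decide) rfl rfl)).homotopic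
    (lifts_edgePath hB hac (n := 2) _ hs (i := 0) (j := 2) (by decide) rfl rfl)

theorem edgePath_self (hB : IsAdj B) {a : V} (h : B a a) :
    (edgePath hB h).Homotopic (Path.refl _) := by
  refine (lifts_edgePath hB h (n := 0) (fun _ => a) (fun _ _ => h) (i := 0) (j := 0) le_rfl
    rfl rfl).homotopic ⟨Path.refl _, fun τ => ?_⟩
  rw [Path.refl_apply, Path.refl_apply, spx_vertex]

open Path.Homotopic (Quotient)

/-- `q` is the homotopy class of the realization of the walk `(a, l)`, which ends in `b`. -/
inductive Real (hB : IsAdj B) : (a : V) → (ha : B a a) → List V → (b : V) → (hb : B b b) →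
    Quotient (vtx B a ha) (vtx B b hb) → Prop
  | nil {a} (ha : B a a) : Real hB a ha [] a ha (.refl _)
  | cons {a b c l} (hab : B a b) {hc : B c c} {q : Quotient (vtx B b (hB.refl (hB.symm hab)))
      (vtx B c hc)} (h : Real hB b (hB.refl (hB.symm hab)) l c hc q) :
      Real hB a (hB.refl hab) (b :: l) c hc (.trans (.mk (edgePath hB hab)) q)

theorem Real.append_edge {hB : IsAdj B} {a b c : V} {ha : B a a} {hb : B b b} {l : List V}
    {q : Quotient (vtx B a ha) (vtx B b hb)} (h : Real hB a ha l b hb q) (hbc : B b c) :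
    Real hB a ha (l ++ [c]) c (hB.refl (hB.symm hbc)) (.trans q (.mk (edgePath hB hbc))) := by
  induction h with
  | nil ha =>
    have := Real.cons (hB := hB) hbc (.nil (hB.refl (hB.symm hbc)))
    rw [Quotient.trans_refl] at this
    rwa [Quotient.refl_trans]
  | cons hab h ih =>
    rw [Quotient.trans_assoc]
    exact .cons hab (ih hbc)

/-- Realization of walks is kept as a relation because the ends of a path occur in its type;
homotopic walks then have the same realizations without transport along equalities of vertices. -/
theorem Real.of_ht {hB : IsAdj B} {a : V} {l l' : List V} (h : Ht B a l l') :
    ∀ (ha : B a a) (b : V) (hb : B b b) (q : Quotient (vtx B a ha) (vtx B b hb)),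
      Real hB a ha l b hb q ↔ Real hB a ha l' b hb q := by
  induction h with
  | refl => intros; rfl
  | symm _ ih => intro ha b hb q; exact (ih ha b hb q).symm
  | trans _ _ ih ih' => intro ha b hb q; exact (ih ha b hb q).trans (ih' ha b hb q)
  | cons h _ ih =>
    intro ha c hc q
    constructor
    · rintro (_ | ⟨_, h1⟩)
      exact .cons h ((ih _ _ _ _).1 h1)
    · rintro (_ | ⟨_, h1⟩)
      exact .cons h ((ih _ _ _ _).2 h1)
  | tri hab hbc hac h =>
    intro ha e he q
    have key := Path.Homotopic.Quotient.eq.2 (edgePath_trans hB hab hbc hac)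
    rw [Quotient.mk_trans] at key
    constructor
    · rintro (_ | ⟨_, (_ | ⟨_, h1⟩)⟩)
      rw [← Quotient.trans_assoc, key]
      exact .cons hac h1
    · rintro (_ | ⟨_, h1⟩)
      rw [← key, Quotient.trans_assoc]
      exact .cons hab (.cons hbc h1)
  | stay h =>
    intro ha e he q
    have key := Path.Homotopic.Quotient.eq.2 (edgePath_self hB h)
    rw [Quotient.mk_refl] at key
    constructor
    · rintro (_ | ⟨_, _ | _⟩)
      rw [key, Quotient.trans_refl]
      exact .nil h
    · rintro (_ | _)
      have := Real.cons (hB := hB) h (.nil h)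
      rwa [key, Quotient.trans_refl] at this

/-! ### Pushing the realization towards a vertex -/

/-- The point `r v + (1 - r) t` of the cone over a simplex. -/
noncomputable def conePt {n : ℕ} (r : unitInterval) (t : stdSimplex ℝ (Fin (n + 1))) :
    stdSimplex ℝ (Fin (n + 2)) :=
  ⟨Fin.cons (r : ℝ) fun i => (1 - r) * t i, by
    refine ⟨fun i => ?_, ?_⟩
    · refine Fin.cases ?_ (fun i => ?_) i
      · exact r.2.1
      · exact mul_nonneg (sub_nonneg.2 r.2.2) (t.2.1 i)
    · rw [Fin.sum_univ_succ]
      simp only [Fin.cons_zero, Fin.cons_succ]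
      rw [← Finset.mul_sum]
      have := t.2.2
      rw [show ∑ i, t i = 1 from this]
      ring⟩

theorem continuous_conePt {n : ℕ} :
    Continuous fun z : unitInterval × stdSimplex ℝ (Fin (n + 1)) => conePt z.1 z.2 := by
  refine Continuous.subtype_mk (continuous_pi fun i => ?_) _
  refine Fin.cases ?_ (fun i => ?_) i
  · exact continuous_subtype_val.comp continuous_fst
  · have h : Continuous fun z : unitInterval × stdSimplex ℝ (Fin (n + 1)) => (z.2 : _ → ℝ) i :=
      (continuous_apply i).comp (continuous_subtype_val.comp continuous_snd)
    exact (continuous_const.sub (continuous_subtype_val.comp continuous_fst)).mul h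

theorem conePt_zero {n : ℕ} (t : stdSimplex ℝ (Fin (n + 1))) :
    conePt 0 t = stdSimplex.map Fin.succ t := by
  refine Subtype.ext (funext fun i => ?_)
  refine Eq.trans ?_ (map_apply Fin.succ t i).symm
  refine Fin.cases ?_ (fun i => ?_) i
  · simp [conePt]
  · simp [conePt]

theorem conePt_one {n : ℕ} (t : stdSimplex ℝ (Fin (n + 1))) :
    conePt 1 t = stdSimplex.vertex 0 := by
  refine Subtype.ext (funext fun i => ?_)
  refine Fin.cases ?_ (fun i => ?_) i
  · simp [conePt]
  · simp [conePt]

/-- The extension of a monotone map to cones. -/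
def consHom {m n : ℕ} (f : Fin (m + 1) →o Fin (n + 1)) : Fin (m + 1 + 1) →o Fin (n + 1 + 1) where
  toFun := Fin.cons 0 (Fin.succ ∘ f)
  monotone' := by
    intro i j hij
    induction i using Fin.cases with
    | zero => exact Fin.zero_le _
    | succ i =>
      induction j using Fin.cases with
      | zero => exact absurd hij (by simp)
      | succ j =>
        simpa using f.monotone (Fin.succ_le_succ_iff.1 hij)

@[simp] theorem consHom_zero {m n : ℕ} (f : Fin (m + 1) →o Fin (n + 1)) : consHom f 0 = 0 := rfl

@[simp] theorem consHom_succ {m n : ℕ} (f : Fin (m + 1) →o Fin (n + 1)) (i : Fin (m + 1)) :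
    consHom f i.succ = (f i).succ := rfl

@[simp] theorem conePt_apply_zero {n : ℕ} (r : unitInterval) (t : stdSimplex ℝ (Fin (n + 1))) :
    conePt r t 0 = r := rfl

@[simp] theorem conePt_apply_succ {n : ℕ} (r : unitInterval) (t : stdSimplex ℝ (Fin (n + 1)))
    (i : Fin (n + 1)) : conePt r t i.succ = (1 - r) * t i := rfl

theorem map_conePt {m n : ℕ} (f : Fin (m + 1) →o Fin (n + 1)) (r : unitInterval)
    (t : stdSimplex ℝ (Fin (m + 1))) :
    stdSimplex.map (consHom f) (conePt r t) = conePt r (stdSimplex.map f t) := by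
  refine Subtype.ext (funext fun i => ?_)
  refine (map_apply _ _ i).trans ?_
  change _ = conePt r (stdSimplex.map f t) i
  rw [Fin.sum_univ_succ]
  refine Fin.cases ?_ (fun i => ?_) i
  · simp [Fin.succ_ne_zero]
  · simp only [consHom_zero, consHom_succ, conePt_apply_succ, Fin.succ_inj, map_apply,
      Finset.mul_sum, mul_ite, mul_zero]
    simp [(Fin.succ_ne_zero i).symm]

theorem adj_cons (hB : IsAdj B) {v : V} {n : ℕ} {s : Fin (n + 1) → V}
    (hs : ∀ i j, B (s i) (s j)) (hv : ∀ i, B v (s i)) (i j : Fin (n + 2)) :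
    B ((Fin.cons v s : Fin (n + 2) → V) i) ((Fin.cons v s : Fin (n + 2) → V) j) := by
  refine Fin.cases ?_ (fun i => ?_) i <;> refine Fin.cases ?_ (fun j => ?_) j
  exacts [hB.refl (hv 0), hv j, hB.symm (hv i), hs i j]

theorem spx_conePt_zero (hB : IsAdj B) {v : V} {n : ℕ} {s : Fin (n + 1) → V}
    (hs : ∀ i j, B (s i) (s j)) (hv : ∀ i, B v (s i)) (t : stdSimplex ℝ (Fin (n + 1))) :
    spx B (Fin.cons v s) (adj_cons hB hs hv) (conePt 0 t) = spx B s hs t := by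
  rw [conePt_zero]
  exact (spx_comp (⟨Fin.succ, Fin.strictMono_succ.monotone⟩ : Fin (n + 1) →o Fin (n + 1 + 1))
    (Fin.cons v s) (adj_cons hB hs hv) t).symm

/-- The cut-off parameter `min(1, C x)`. -/
noncomputable def cutoff (C : ℕ) (x : ℝ) : unitInterval :=
  ⟨max 0 (min 1 (C * x)), le_max_left _ _, max_le zero_le_one (min_le_left _ _)⟩

theorem continuous_cutoff (C : ℕ) : Continuous (cutoff C) :=
  Continuous.subtype_mk (by fun_prop) _

/-- Inside the star of `v`, move straight towards `v` in the cone, at a speed proportional to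
`min(1, C · weight)`. The speed vanishes off the star, so the homotopy fits with the constant one on
simplices without `v`; where the weight is at least 1/C it arrives at `v`. -/
theorem exists_push (hB : IsAdj B) (v : V) (C : ℕ) :
    ∃ h : C(flagTop B, C(unitInterval, flagTop B)),
      (∀ p, h p 0 = p) ∧
      ∀ (n : ℕ) (s : Fin (n + 1) → V) (hs : ∀ i j, B (s i) (s j)) (hv : ∀ i, B v (s i))
        (_ : ∃ i, s i = v) (t : stdSimplex ℝ (Fin (n + 1))) (σ : unitInterval),
        h (spx B s hs t) σ = spx B (Fin.cons v s) (adj_cons hB hs hv)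
          (conePt (σ * cutoff C (weight B v (spx B s hs t))) t) := by
  classical
  have hadj : ∀ {n : ℕ} {s : Fin (n + 1) → V} (_ : ∀ i j, B (s i) (s j)) (_ : ∃ i, s i = v) (i),
      B v (s i) := by
    rintro n s hs ⟨j, rfl⟩ i
    exact hs j i
  let F : ∀ (n : ℕ) (s : Fin (n + 1) → V), (∀ i j, B (s i) (s j)) →
      C(stdSimplex ℝ (Fin (n + 1)), C(unitInterval, flagTop B)) := fun n s hs =>
    if hv : ∃ i, s i = v then
      ContinuousMap.curry ⟨fun z => spx B (Fin.cons v s) (adj_cons hB hs (hadj hs hv))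
        (conePt (z.2 * cutoff C (weight B v (spx B s hs z.1))) z.1), by
          refine (spx B _ _).continuous.comp (continuous_conePt.comp (Continuous.prodMk ?_ ?_))
          · refine continuous_snd.mul ((continuous_cutoff C).comp ?_)
            exact (weight B v).continuous.comp ((spx B s hs).continuous.comp continuous_fst)
          · exact continuous_fst⟩
    else ContinuousMap.curry ⟨fun z => spx B s hs z.1, by fun_prop⟩
  have hFv : ∀ (n : ℕ) (s : Fin (n + 1) → V) (hs : ∀ i j, B (s i) (s j)) (hv : ∃ i, s i = v) t σ,
      F n s hs t σ = spx B (Fin.cons v s) (adj_cons hB hs (hadj hs hv))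
        (conePt (σ * cutoff C (weight B v (spx B s hs t))) t) := by
    intro n s hs hv t σ
    simp only [F, dif_pos hv]
    rfl
  have hFn : ∀ (n : ℕ) (s : Fin (n + 1) → V) (hs : ∀ i j, B (s i) (s j)) (_ : ¬ ∃ i, s i = v) t σ,
      F n s hs t σ = spx B s hs t := by
    intro n s hs hv t σ
    simp only [F, dif_neg hv]
    rfl
  obtain ⟨h, hh⟩ := exists_desc F (by
    intro m n f s hs t
    ext σ
    by_cases hv : ∃ i, s i = v
    · rw [hFv n s hs hv]
      by_cases hv' : ∃ i, (s ∘ f) i = v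
      · rw [hFv m _ _ hv', ← map_conePt, ← spx_comp f]
        refine Eq.trans ?_ (spx_comp (consHom f) (Fin.cons v s) (adj_cons hB hs (hadj hs hv)) _)
        have e : (Fin.cons v (s ∘ f) : Fin (m + 1 + 1) → V) = Fin.cons v s ∘ consHom f := by
          funext i
          refine Fin.cases rfl (fun i => ?_) i
          simp
        congr 2
      · rw [hFn m _ _ hv']
        -- On a face that misses `v` the weight is zero, so the push does nothing there. This is the
        -- compatibility between the two cases of `F`.
        have h0 : weight B v (spx B s hs (stdSimplex.map f t)) = 0 := by
          rw [← spx_comp f, weight_spx]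
          exact Finset.sum_eq_zero fun i _ => if_neg fun h => hv' ⟨i, h⟩
        have h1 : cutoff C 0 = 0 := Subtype.ext (by simp [cutoff])
        rw [h0, h1, mul_zero, spx_conePt_zero hB hs (hadj hs hv), spx_comp]
    · have hv' : ¬ ∃ i, (s ∘ f) i = v := fun ⟨i, hi⟩ => hv ⟨f i, hi⟩
      rw [hFn n s hs hv, hFn m _ _ hv', spx_comp])
  refine ⟨h, fun p => ?_, fun n s hs hv hv' t σ => ?_⟩
  · obtain ⟨n, s, hs, t, rfl⟩ := exists_spx p
    rw [hh]
    by_cases hv : ∃ i, s i = v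
    · rw [hFv n s hs hv, zero_mul, spx_conePt_zero hB hs (hadj hs hv)]
    · rw [hFn n s hs hv]
  · rw [hh, hFv n s hs hv']

/-- The homotopy that pushes points near the vertex `v` to `v`. -/
noncomputable def push (hB : IsAdj B) (v : V) (C : ℕ) : C(flagTop B, C(unitInterval, flagTop B)) :=
  (exists_push hB v C).choose

theorem push_zero (hB : IsAdj B) (v : V) (C : ℕ) (p : flagTop B) : push hB v C p 0 = p :=
  (exists_push hB v C).choose_spec.1 p

theorem push_spx (hB : IsAdj B) {v : V} {C : ℕ} {n : ℕ} {s : Fin (n + 1) → V}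
    {hs : ∀ i j, B (s i) (s j)} (hv : ∀ i, B v (s i)) (hv' : ∃ i, s i = v)
    {t : stdSimplex ℝ (Fin (n + 1))} (h : 1 ≤ C * weight B v (spx B s hs t)) (σ : unitInterval) :
    push hB v C (spx B s hs t) σ = spx B (Fin.cons v s) (adj_cons hB hs hv) (conePt σ t) := by
  have h1 : cutoff C (weight B v (spx B s hs t)) = 1 :=
    Subtype.ext (by simp [cutoff, min_eq_left h])
  have := (exists_push hB v C).choose_spec.2 n s hs hv hv' t σ
  rwa [h1, mul_one] at this

theorem weight_pos_of_le {v : V} {C : ℕ} {p : flagTop B} (h : 1 ≤ C * weight B v p) :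
    0 < weight B v p := by
  by_contra hn
  have := mul_nonpos_of_nonneg_of_nonpos (Nat.cast_nonneg (α := ℝ) C) (not_lt.1 hn)
  linarith

theorem adj_self_of_weight_pos {v : V} {p : flagTop B} (h : 0 < weight B v p) : B v v :=
  adj_of_weight_pos h h

theorem push_one (hB : IsAdj B) {v : V} {C : ℕ} {p : flagTop B} (h : 1 ≤ C * weight B v p) :
    push hB v C p 1 = vtx B v (adj_self_of_weight_pos (weight_pos_of_le h)) := by
  obtain ⟨n, s, hs, t, rfl⟩ := exists_spx p
  obtain ⟨i, rfl, -⟩ := exists_of_weight_pos (weight_pos_of_le h)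
  rw [push_spx hB (fun j => hs i j) ⟨i, rfl⟩ h, conePt_one, spx_vertex]
  rfl

/-- The track of a point near `v` under the push to `v`. -/
noncomputable def track (hB : IsAdj B) {v : V} {C : ℕ} {p : flagTop B}
    (h : 1 ≤ C * weight B v p) :
    Path p (vtx B v (adj_self_of_weight_pos (weight_pos_of_le h))) where
  toFun := push hB v C p
  continuous_toFun := (push hB v C p).continuous
  source' := push_zero hB v C p
  target' := push_one hB h

/-- The whole picture lies in the simplex spanned by `v`, `w` and the simplex that carries `p`. -/
theorem track_trans_edgePath (hB : IsAdj B) {v w : V} {C D : ℕ} {p : flagTop B}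
    (h : 1 ≤ C * weight B v p) (h' : 1 ≤ D * weight B w p) (hvw : B v w) :
    ((track hB h).trans (edgePath hB hvw)).Homotopic (track hB h') := by
  obtain ⟨n, s, hs, t, rfl⟩ := exists_spx p
  obtain ⟨i, hi, -⟩ := exists_of_weight_pos (weight_pos_of_le h)
  obtain ⟨j, hj, -⟩ := exists_of_weight_pos (weight_pos_of_le h')
  have hv : ∀ k, B v (s k) := fun k => hi ▸ hs i k
  have hw : ∀ k, B w (s k) := fun k => hj ▸ hs j k
  have hv2 : ∀ k : Fin (n + 2), B v ((Fin.cons w s : Fin (n + 2) → V) k) := fun k =>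
    Fin.cases hvw hv k
  let S : Fin (n + 1 + 1 + 1) → V := Fin.cons v (Fin.cons w s)
  have hS : ∀ k l, B (S k) (S l) := adj_cons hB (adj_cons hB hs hw) hv2
  have lw : ∀ σ : unitInterval, (track hB h') σ = spx B S hS
      (stdSimplex.map (Fin.succ : Fin (n + 1 + 1) → Fin (n + 1 + 1 + 1)) (conePt σ t)) := by
    intro σ
    refine (push_spx hB hw ⟨j, hj⟩ h' σ).trans ?_
    exact spx_comp (⟨Fin.succ, Fin.strictMono_succ.monotone⟩ :
      Fin (n + 1 + 1) →o Fin (n + 1 + 1 + 1)) S hS _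
  let f : Fin (n + 1) →o Fin (n + 1 + 1) := ⟨Fin.succ, Fin.strictMono_succ.monotone⟩
  have lv : ∀ σ : unitInterval, (track hB h) σ = spx B S hS
      (stdSimplex.map (consHom f) (conePt σ t)) := by
    intro σ
    refine (push_spx hB hv ⟨i, hi⟩ h σ).trans ?_
    have e : (Fin.cons v s : Fin (n + 1 + 1) → V) = S ∘ consHom f := by
      funext k
      refine Fin.cases rfl (fun k => ?_) k
      simp [S, f]
    refine Eq.trans ?_ (spx_comp (consHom f) S hS _)
    congr 2
  have hc : Continuous fun σ : unitInterval => conePt σ t :=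
    continuous_conePt.comp (Continuous.prodMk continuous_id continuous_const)
  have e0 : stdSimplex.map (consHom f) (conePt 0 t) =
      stdSimplex.map (Fin.succ : Fin (n + 1 + 1) → Fin (n + 1 + 1 + 1)) (conePt 0 t) := by
    rw [map_conePt, conePt_zero, conePt_zero]
    rfl
  have L1 : Lifts (track hB h) (spx B S hS) (stdSimplex.map (consHom f) (conePt 0 t))
      (stdSimplex.vertex 0) :=
    ⟨⟨⟨fun σ => stdSimplex.map (consHom f) (conePt σ t),
      (stdSimplex.continuous_map _).comp hc⟩, rfl, by
        simp only [conePt_one, stdSimplex.map_vertex]; rfl⟩, lv⟩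
  have L2 : Lifts (track hB h') (spx B S hS) (stdSimplex.map (consHom f) (conePt 0 t))
      (stdSimplex.vertex 1) :=
    ⟨⟨⟨fun σ => stdSimplex.map (Fin.succ : Fin (n + 1 + 1) → Fin (n + 1 + 1 + 1)) (conePt σ t),
      (stdSimplex.continuous_map _).comp hc⟩, e0.symm, by
        simp only [conePt_one, stdSimplex.map_vertex]; rfl⟩, lw⟩
  exact (L1.trans (lifts_edgePath hB hvw S hS (i := 0) (j := 1) (Fin.zero_le _) rfl rfl)).homotopic
    L2

/-- Pushing each point of `γ` to `v` sweeps out a square whose top side is constant; compare the two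
ways round it. -/
theorem trans_track (hB : IsAdj B) {v : V} {C : ℕ} {p q : flagTop B} (γ : Path p q)
    (h : ∀ τ, 1 ≤ C * weight B v (γ τ)) (hp : 1 ≤ C * weight B v p) (hq : 1 ≤ C * weight B v q) :
    (γ.trans (track hB hq)).Homotopic (track hB hp) := by
  let P : ℝ → unitInterval := Set.projIcc 0 1 zero_le_one
  have hP : Continuous P := continuous_projIcc
  have hPv : ∀ τ : unitInterval, P τ = τ := fun τ => Set.projIcc_val _ τ
  have hP0 : P 0 = 0 := hPv 0
  have hP1 : P 1 = 1 := hPv 1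
  -- The square is extended to the plane by clamping both coordinates, so that the source is simply
  -- connected.
  let K : C(ℝ × ℝ, flagTop B) :=
    ⟨fun z => push hB v C (γ (P z.1)) (P z.2), by
      have : Continuous fun z : ℝ × ℝ => push hB v C (γ (P z.1)) := by fun_prop
      exact (ContinuousMap.continuous_uncurry_of_continuous ⟨_, (push hB v C).continuous⟩).comp
        ((γ.continuous.comp (hP.comp continuous_fst)).prodMk (hP.comp continuous_snd))⟩
  let d : Path ((0, 0) : ℝ × ℝ) (1, 0) := ⟨⟨fun τ => ((τ : ℝ), 0), by fun_prop⟩, by simp, by simp⟩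
  let r : Path ((1, 0) : ℝ × ℝ) (1, 1) := ⟨⟨fun τ => (1, (τ : ℝ)), by fun_prop⟩, by simp, by simp⟩
  let l : Path ((0, 0) : ℝ × ℝ) (0, 1) := ⟨⟨fun τ => (0, (τ : ℝ)), by fun_prop⟩, by simp, by simp⟩
  let w : Path ((0, 1) : ℝ × ℝ) (1, 1) := ⟨⟨fun τ => ((τ : ℝ), 1), by fun_prop⟩, by simp, by simp⟩
  have h1 : Lifts (γ.trans (track hB hq)) K (0, 0) (1, 1) :=
    Lifts.trans (y' := (1, 0)) ⟨d, fun τ => by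
      change γ τ = push hB v C (γ (P τ)) (P 0)
      rw [hP0, push_zero, hPv]⟩ ⟨r, fun τ => by
      change push hB v C q τ = push hB v C (γ (P 1)) (P τ)
      rw [hP1, hPv, γ.target]⟩
  have h2 : Lifts ((track hB hp).trans (Path.refl _)) K (0, 0) (1, 1) :=
    Lifts.trans (y' := (0, 1)) ⟨l, fun τ => by
      change push hB v C p τ = push hB v C (γ (P 0)) (P τ)
      rw [hP0, hPv, γ.source]⟩ ⟨w, fun τ => by
      change vtx B v _ = push hB v C (γ (P τ)) (P 1)
      rw [hP1, push_one hB (h _)]⟩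
  exact (h1.homotopic h2).trans ⟨Path.Homotopy.transRefl _⟩

end ToTop

end SigmaTwo

namespace SigmaTwo

/-! ### Trivial maps on homotopy groups -/

section Trivial

variable {V : Type u} {A B : V → V → Prop}


/-- A path whose pieces lie near vertices is homotopic to the walk through these vertices. -/
theorem exists_real_of_labels (hB : IsAdj B) {p q : flagTop B} (ω : Path p q)
    {t : ℕ → unitInterval} (ht0 : t 0 = 0) (hmono : Monotone t) {v : ℕ → V} {C : ℕ → ℕ}
    (h : ∀ n, ∀ τ ∈ Set.Icc (t n) (t (n + 1)), 1 ≤ C n * weight B (v n) (ω τ))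
    (hp : 1 ≤ C 0 * weight B (v 0) p) (n : ℕ) :
    ∃ (z : flagTop B) (γ : Path p z) (hz : 1 ≤ C n * weight B (v n) z)
      (c : Path.Homotopic.Quotient (vtx B (v 0) (adj_self_of_weight_pos (weight_pos_of_le hp)))
        (vtx B (v n) (adj_self_of_weight_pos (weight_pos_of_le hz)))),
      z = ω (t n) ∧ (∀ τ, γ τ = ω (Set.Icc.convexComb 0 (t n) τ)) ∧
      Real hB (v 0) (adj_self_of_weight_pos (weight_pos_of_le hp)) (lst v n) (v n)
        (adj_self_of_weight_pos (weight_pos_of_le hz)) c ∧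
      (Path.Homotopic.Quotient.mk γ).trans (.mk (track hB hz)) = .trans (.mk (track hB hp)) c := by
  induction n with
  | zero =>
    refine ⟨p, Path.refl p, hp, .refl _, by rw [ht0, ω.source], fun τ => ?_, .nil _, ?_⟩
    · simp [ht0]
    · rw [Path.Homotopic.Quotient.mk_refl, Path.Homotopic.Quotient.refl_trans, Path.Homotopic.Quotient.trans_refl]
  | succ n ih =>
    obtain ⟨z, γ, hz, c, rfl, hγ, hc, hh⟩ := ih
    have hle : t n ≤ t (n + 1) := hmono n.le_succ
    have hz1 : 1 ≤ C n * weight B (v n) (ω (t (n + 1))) := h n _ ⟨hle, le_rfl⟩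
    have hz2 : 1 ≤ C (n + 1) * weight B (v (n + 1)) (ω (t (n + 1))) :=
      h (n + 1) _ ⟨le_rfl, hmono (n + 1).le_succ⟩
    have hadj : B (v n) (v (n + 1)) :=
      adj_of_weight_pos (weight_pos_of_le hz1) (weight_pos_of_le hz2)
    have e0 : ω 0 = p := ω.source
    have hω : ∀ τ, 1 ≤ C n * weight B (v n) ((ω.subpath (t n) (t (n + 1))) τ) := by
      intro τ
      have hmem : (ω.subpath (t n) (t (n + 1))) τ ∈ Set.range (ω.subpath (t n) (t (n + 1))) :=
        ⟨τ, rfl⟩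
      rw [Path.range_subpath_of_le _ _ _ hle] at hmem
      obtain ⟨σ, hσ, hσ'⟩ := hmem
      rw [← hσ']
      exact h n σ hσ
    refine ⟨ω (t (n + 1)), (ω.subpath 0 (t (n + 1))).cast e0.symm rfl, hz2,
      .trans c (.mk (edgePath hB hadj)), rfl, fun τ => rfl, hc.append_edge hadj, ?_⟩
    have hγ' : γ = (ω.subpath 0 (t n)).cast e0.symm rfl := Path.ext (funext hγ)
    -- Split `ω` at `t n`. The new piece stays near `v n`, so by `trans_track` it can be exchanged
    -- for tracks to `v n`, and `track_trans_edgePath` changes from `v n` to the next label.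
    have k1 : Path.Homotopic.Quotient.mk ((ω.subpath 0 (t (n + 1))).cast e0.symm rfl) =
        (Path.Homotopic.Quotient.mk γ).trans (.mk (ω.subpath (t n) (t (n + 1)))) := by
      rw [hγ', ← Path.Homotopic.Quotient.mk_trans, Path.Homotopic.Quotient.eq]
      exact (Path.Homotopic.symm
        ⟨Path.Homotopy.subpathTransSubpath ω 0 (t n) (t (n + 1))⟩).pathCast e0.symm rfl
    have k2 := Path.Homotopic.Quotient.eq.2 (track_trans_edgePath hB hz1 hz2 hadj)
    have k3 := Path.Homotopic.Quotient.eq.2 (trans_track hB (ω.subpath (t n) (t (n + 1))) hω hz hz1)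
    rw [Path.Homotopic.Quotient.mk_trans] at k2 k3
    rw [k1, ← k2, Path.Homotopic.Quotient.trans_assoc, ← Path.Homotopic.Quotient.trans_assoc _ _ (Path.Homotopic.Quotient.mk (edgePath hB hadj)),
      k3, ← Path.Homotopic.Quotient.trans_assoc, hh, Path.Homotopic.Quotient.trans_assoc]

/-- Conjugation by the track of the base point turns `ω` into the class of the closed walk through
the labels, the last edge leading back to `v 0`. If this walk is null-homotopic, the track cancels.
-/
theorem homotopic_refl_of_labels (hB : IsAdj B) {p : flagTop B} (ω : Path p p)
    {t : ℕ → unitInterval} (ht0 : t 0 = 0) (hmono : Monotone t) {v : ℕ → V} {C : ℕ → ℕ}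
    (h : ∀ n, ∀ τ ∈ Set.Icc (t n) (t (n + 1)), 1 ≤ C n * weight B (v n) (ω τ))
    {N : ℕ} (hN : t N = 1) (hl : B (v N) (v 0) → Ht B (v 0) (lst v N ++ [v 0]) []) :
    ω.Homotopic (Path.refl p) := by
  have hp : 1 ≤ C 0 * weight B (v 0) p := by
    have := h 0 (t 0) ⟨le_rfl, hmono (Nat.zero_le 1)⟩
    rwa [ht0, ω.source] at this
  obtain ⟨z, γ, hz, c, hzω, hγ, hc, hh⟩ := exists_real_of_labels hB ω ht0 hmono h hp N
  rw [hN, ω.target] at hzω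
  subst hzω
  obtain rfl : γ = ω := Path.ext (funext fun τ => by rw [hγ, hN]; simp)
  have hadj : B (v N) (v 0) := adj_of_weight_pos (weight_pos_of_le hz) (weight_pos_of_le hp)
  have h1 := (Real.of_ht (hl hadj) _ _ _ _).1 (hc.append_edge hadj)
  have h2 : Path.Homotopic.Quotient.trans c (.mk (edgePath hB hadj)) = .refl _ := by
    generalize Path.Homotopic.Quotient.trans c (.mk (edgePath hB hadj)) = d at h1
    cases h1
    rfl
  have k2 := Path.Homotopic.Quotient.eq.2 (track_trans_edgePath hB hz hp hadj)
  rw [Path.Homotopic.Quotient.mk_trans] at k2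
  have k3 : (Path.Homotopic.Quotient.mk γ).trans (.mk (track hB hp)) = .mk (track hB hp) := by
    rw [← k2, ← Path.Homotopic.Quotient.trans_assoc, hh, Path.Homotopic.Quotient.trans_assoc, h2, Path.Homotopic.Quotient.trans_refl, k2]
  have k4 : ((Path.Homotopic.Quotient.mk γ).trans (.mk (track hB hp))).trans (.symm (.mk (track hB hp))) =
      (Path.Homotopic.Quotient.mk (track hB hp)).trans (.symm (.mk (track hB hp))) := by rw [k3]
  rw [Path.Homotopic.Quotient.trans_assoc, Path.Homotopic.Quotient.trans_symm, Path.Homotopic.Quotient.trans_refl, ← Path.Homotopic.Quotient.mk_refl] at k4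
  exact Path.Homotopic.Quotient.eq.1 k4

theorem weight_map (hle : flagC A ≤ flagC B) (hAB : ∀ a b, A a b → B a b) (v : V) (p : flagTop A) :
    weight B v (SSet.toTop.map (SSet.Subcomplex.homOfLE hle) p) = weight A v p := by
  classical
  obtain ⟨n, s, hs, t, rfl⟩ := exists_spx p
  rw [spx_map hle s hs (fun i j => hAB _ _ (hs i j)), weight_spx, weight_spx]

/-- A loop is homotopic to the walk through the stars that it visits. Labels are taken in the source
complex, where closed walks are controlled by `h`; the homotopies take place in the target. -/
theorem trivialOnPi_one (hA : IsAdj A) (hB : IsAdj B) (hAB : ∀ a b, A a b → B a b)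
    (hle : flagC A ≤ flagC B) (h : ∀ a l, Walk A a l → tgt a l = a → Ht B a l []) :
    TrivialOnPi 1 (SSet.toTop.map (SSet.Subcomplex.homOfLE hle)) := by
  intro p γ
  let π : flagTop A ⟶ flagTop B := SSet.toTop.map (SSet.Subcomplex.homOfLE hle)
  have hγ0 : γ.1 (fun _ => 0) = p := γ.2 _ ⟨0, .inl rfl⟩
  have hγ1 : γ.1 (fun _ => 1) = p := γ.2 _ ⟨0, .inr rfl⟩
  let ω : Path (π p) (π p) :=
    { toFun := fun τ => π (γ.1 fun _ => τ)
      continuous_toFun := π.hom.continuous.comp (γ.1.continuous.comp (by fun_prop))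
      source' := by rw [hγ0]
      target' := by rw [hγ1] }
  have hcont : Continuous fun τ : unitInterval => γ.1 fun _ => τ :=
    γ.1.continuous.comp (by fun_prop)
  -- Stars are exhausted by the sets with weight greater than 1/C, because a push reaches its vertex
  -- only there. The subdivision gives each piece its own vertex and its own `C`.
  let U : V × ℕ → Set unitInterval := fun z => {τ | 1 < (z.2 : ℝ) * weight A z.1 (γ.1 fun _ => τ)}
  obtain ⟨t, ht0, hmono, ⟨N, hN⟩, hcov⟩ := exists_monotone_Icc_subset_open_cover_unitInterval
    (c := U) (fun z => isOpen_lt continuous_const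
      (continuous_const.mul ((weight A z.1).continuous.comp hcont))) (fun τ _ => by
        obtain ⟨v, hv⟩ := exists_weight_pos (γ.1 fun _ => τ)
        obtain ⟨C, hC⟩ := exists_nat_gt (weight A v (γ.1 fun _ => τ))⁻¹
        refine Set.mem_iUnion.2 ⟨(v, C), ?_⟩
        change 1 < (C : ℝ) * _
        rwa [inv_lt_iff_one_lt_mul₀ hv] at hC)
  choose z hz using hcov
  have hpos : ∀ n, ∀ τ ∈ Set.Icc (t n) (t (n + 1)),
      1 ≤ ((z n).2 : ℝ) * weight A (z n).1 (γ.1 fun _ => τ) := fun n τ hτ => (hz n hτ).le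
  have hadj : ∀ n, A (z n).1 (z (n + 1)).1 := fun n =>
    adj_of_weight_pos (weight_pos_of_le (hpos n _ ⟨hmono n.le_succ, le_rfl⟩))
      (weight_pos_of_le (hpos (n + 1) _ ⟨le_rfl, hmono (n + 1).le_succ⟩))
  have hend : A (z N).1 (z 0).1 := by
    have h1 := weight_pos_of_le (hpos N _ ⟨le_rfl, hmono N.le_succ⟩)
    have h2 := weight_pos_of_le (hpos 0 _ ⟨le_rfl, hmono (Nat.zero_le 1)⟩)
    rw [hN N le_rfl, hγ1] at h1
    rw [ht0, hγ0] at h2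
    exact adj_of_weight_pos h1 h2
  obtain ⟨H⟩ := homotopic_refl_of_labels hB ω ht0 hmono (v := fun n => (z n).1)
    (C := fun n => (z n).2) (fun n τ hτ => by
      change 1 ≤ ((z n).2 : ℝ) * weight B (z n).1 (π (γ.1 fun _ => τ))
      rw [weight_map hle hAB]
      exact hpos n τ hτ) (hN N le_rfl) (fun _ => h _ _ (by
        refine Walk.append (Walk.lst (c := fun n => (z n).1) (hA.refl (hadj 0)) hadj hA N) ?_
        have := tgt_lst (fun n => (z n).1) N
        rw [this]
        exact ⟨hend, hA.refl (hA.symm hend)⟩) (by simp))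
  refine ⟨{ toFun := fun x => H (x.1, x.2 0)
            continuous_toFun := H.continuous.comp (by fun_prop)
            map_zero_left := fun y => ?_
            map_one_left := fun y => ?_
            prop' := fun s y hy => ?_ }⟩
  · refine (H.apply_zero _).trans ?_
    change π (γ.1 fun _ => y 0) = π (γ.1 y)
    congr 2
    funext i
    rw [Subsingleton.elim i 0]
  · exact H.apply_one _
  · obtain ⟨i, hi⟩ := hy
    obtain rfl : i = 0 := Subsingleton.elim _ _
    have e : γ.1 y = p := γ.2 y ⟨0, hi⟩
    change H (s, y 0) = π (γ.1 y)
    rw [e]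
    rcases hi with hi | hi
    · rw [hi]; exact H.source s
    · rw [hi]; exact H.target s

/-- Every point is joined to a vertex inside its simplex, and walks realize to paths. -/
theorem trivialOnPi_zero (hB : IsAdj B) (hAB : ∀ a b, A a b → B a b)
    (hle : flagC A ≤ flagC B)
    (h : ∀ a b, A a a → A b b → ∃ l, Walk B a l ∧ tgt a l = b) :
    TrivialOnPi 0 (SSet.toTop.map (SSet.Subcomplex.homOfLE hle)) := by
  intro p γ
  let π : flagTop A ⟶ flagTop B := SSet.toTop.map (SSet.Subcomplex.homOfLE hle)
  have hv : ∀ q : flagTop A, ∃ (a : V) (ha : A a a), Joined q (vtx A a ha) := by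
    intro q
    obtain ⟨n, s, hs, t, rfl⟩ := exists_spx q
    refine ⟨s 0, hs 0 0, ?_⟩
    have hj : Joined t (stdSimplex.vertex (S := ℝ) (0 : Fin (n + 1))) :=
      PathConnectedSpace.joined _ _
    rw [← spx_vertex]
    exact hj.map (spx A s hs).continuous
  have hw : ∀ (l : List V) (a b : V) (ha : B a a) (hb : B b b), Walk B a l → tgt a l = b →
      Joined (vtx B a ha) (vtx B b hb) := by
    intro l
    induction l with
    | nil => rintro a b ha hb _ rfl; exact .refl _
    | cons c l ih =>
      intro a b ha hb hwk ht
      exact Joined.trans ⟨edgePath hB hwk.1⟩ (ih c b (hB.refl (hB.symm hwk.1)) hb hwk.2 ht)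
  have hj : ∀ q q' : flagTop A, Joined (π q) (π q') := by
    intro q q'
    obtain ⟨a, ha, hqa⟩ := hv q
    obtain ⟨b, hb, hqb⟩ := hv q'
    obtain ⟨l, hl, hlt⟩ := h a b ha hb
    have h1 := hw l a b (hAB _ _ ha) (hAB _ _ hb) hl hlt
    rw [← vtx_map hle ha, ← vtx_map hle hb] at h1
    exact ((hqa.map π.hom.continuous).trans h1).trans (hqb.map π.hom.continuous).symm
  obtain ⟨δ⟩ := hj (γ.1 default) p
  refine ⟨{ toFun := fun x => δ x.1
            continuous_toFun := by fun_prop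
            map_zero_left := fun y => ?_
            map_one_left := fun y => δ.target
            prop' := fun s y hy => ?_ }⟩
  · refine δ.source.trans ?_
    change π (γ.1 default) = π (γ.1 y)
    rw [Subsingleton.elim y default]
  · obtain ⟨i, -⟩ := hy
    exact i.elim0

theorem exists_walk_of_trivialOnPi_zero (hB : IsAdj B) (hAB : ∀ a b, A a b → B a b)
    (hle : flagC A ≤ flagC B)
    (h : TrivialOnPi 0 (SSet.toTop.map (SSet.Subcomplex.homOfLE hle))) {a b : V} (ha : A a a)
    (hb : A b b) : ∃ l, Walk B a l ∧ tgt a l = b := by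
  -- A loop of dimension zero is a single point, and the boundary of the cube is empty.
  obtain ⟨H⟩ := h (vtx A b hb) ⟨.const _ (vtx A a ha), by rintro y ⟨i, -⟩; exact i.elim0⟩
  refine exists_walk_of_path hB (ha := hAB _ _ ha) (hb := hAB _ _ hb)
    { toFun := fun τ => H (τ, default)
      continuous_toFun := H.continuous.comp (by fun_prop)
      source' := (H.apply_zero _).trans (vtx_map hle ha _)
      target' := (H.apply_one _).trans (vtx_map hle hb _) }

end Trivial

/-! ### Vietoris–Rips complexes -/

section Rips

variable {G : Type u} [Group G] {r : ℕ}

/-- The adjacency relation of the Vietoris–Rips complex. -/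
def vrAdj (x : Fin r → G) (S : Set G) (k : ℕ) (a b : G) : Prop :=
  a ∈ S ∧ b ∈ S ∧ wordDist x a b ≤ k

theorem vietorisRips_eq (x : Fin r → G) (S : Set G) (k : ℕ) :
    vietorisRips x S k = flagC (vrAdj x S k) := by
  ext n s
  exact ⟨fun h i j => ⟨h.1 i, h.1 j, h.2 i j⟩, fun h => ⟨fun i => (h i i).1, fun i j => (h i j).2.2⟩⟩

theorem evalWord_append (x : Fin r → G) (w w' : List (Fin r × Bool)) :
    evalWord x (w ++ w') = evalWord x w * evalWord x w' := by
  simp [evalWord]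

/-- The formal inverse of a word. -/
def invWord (w : List (Fin r × Bool)) : List (Fin r × Bool) :=
  (w.map fun l => (l.1, !l.2)).reverse

theorem evalWord_invWord (x : Fin r → G) (w : List (Fin r × Bool)) :
    evalWord x (invWord w) = (evalWord x w)⁻¹ := by
  induction w with
  | nil => simp [evalWord, invWord]
  | cons l w ih =>
    have h1 : invWord (l :: w) = invWord w ++ [(l.1, !l.2)] := by simp [invWord]
    have h2 : l :: w = [l] ++ w := rfl
    rw [h1, evalWord_append, ih, h2, evalWord_append, mul_inv_rev]
    congr 1
    rcases l with ⟨i, _ | _⟩ <;> simp [evalWord]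

theorem length_invWord (w : List (Fin r × Bool)) : (invWord w).length = w.length := by
  simp [invWord]

theorem wordLength_inv (x : Fin r → G) (g : G) : wordLength x g⁻¹ = wordLength x g := by
  unfold wordLength
  congr 1
  ext n
  constructor
  · rintro ⟨w, hw, h⟩
    exact ⟨invWord w, by rw [length_invWord, hw], by rw [evalWord_invWord, h, inv_inv]⟩
  · rintro ⟨w, hw, h⟩
    exact ⟨invWord w, by rw [length_invWord, hw], by rw [evalWord_invWord, h]⟩

theorem wordDist_comm (x : Fin r → G) (a b : G) : wordDist x a b = wordDist x b a := by
  unfold wordDist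
  rw [← wordLength_inv]
  simp

theorem vrAdj_isAdj (x : Fin r → G) (S : Set G) (k : ℕ) : IsAdj (vrAdj x S k) :=
  ⟨fun h => ⟨h.2.1, h.1, by rw [wordDist_comm]; exact h.2.2⟩,
    fun h => ⟨h.1, h.1, by rw [wordDist_self]; exact Nat.zero_le k⟩⟩

theorem vrAdj_mono (x : Fin r → G) {S T : Set G} (hST : S ⊆ T) {k l : ℕ} (hkl : k ≤ l) (a b : G)
    (h : vrAdj x S k a b) : vrAdj x T l a b :=
  ⟨hST h.1, hST h.2.1, h.2.2.trans hkl⟩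

theorem vrAdj_self (x : Fin r → G) {S : Set G} (k : ℕ) {a : G} : vrAdj x S k a a ↔ a ∈ S :=
  ⟨fun h => h.1, fun h => ⟨h, h, by rw [wordDist_self]; exact Nat.zero_le k⟩⟩

theorem flag_aux {V : Type u} {X Y X' Y' : (freeSSet V).Subcomplex} (hX : X = X') (hY : Y = Y')
    (h : X ≤ Y) (q : ℕ) :
    TrivialOnPi q (SSet.toTop.map (SSet.Subcomplex.homOfLE h)) ↔
      TrivialOnPi q (SSet.toTop.map (SSet.Subcomplex.homOfLE (hX ▸ hY ▸ h : X' ≤ Y'))) := by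
  subst hX hY
  rfl

theorem piVanishes_zero_iff (x : Fin r → G) (S : Set G) {k l : ℕ} (hkl : k ≤ l) :
    PiVanishes x S 0 k l ↔
      ∀ a ∈ S, ∀ b ∈ S, ∃ w, Walk (vrAdj x S l) a w ∧ tgt a w = b := by
  have hm := vrAdj_mono x (subset_refl S) hkl
  constructor
  · rintro ⟨h, ht⟩ a ha b hb
    rw [flag_aux (vietorisRips_eq x S k) (vietorisRips_eq x S l)] at ht
    exact exists_walk_of_trivialOnPi_zero (vrAdj_isAdj x S l) hm _ ht ((vrAdj_self x k).2 ha)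
      ((vrAdj_self x k).2 hb)
  · intro h
    refine ⟨hkl, ?_⟩
    rw [flag_aux (vietorisRips_eq x S k) (vietorisRips_eq x S l)]
    exact trivialOnPi_zero (vrAdj_isAdj x S l) hm _
      fun a b ha hb => h a ha.1 b hb.1

/-- Together with `piVanishes_zero_iff` this removes realizations: from here on vanishing of
homotopy groups is a statement about walks in G. -/
theorem piVanishes_one_iff (x : Fin r → G) (S : Set G) {k l : ℕ} (hkl : k ≤ l) :
    PiVanishes x S 1 k l ↔
      ∀ a w, Walk (vrAdj x S k) a w → tgt a w = a → Ht (vrAdj x S l) a w [] := by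
  have hm := vrAdj_mono x (subset_refl S) hkl
  constructor
  · rintro ⟨h, ht⟩ a w hw hwa
    rw [flag_aux (vietorisRips_eq x S k) (vietorisRips_eq x S l)] at ht
    exact ht_of_trivialOnPi_one (vrAdj_isAdj x S k) (vrAdj_isAdj x S l) hm _ ht hw hwa
  · intro h
    refine ⟨hkl, ?_⟩
    rw [flag_aux (vietorisRips_eq x S k) (vietorisRips_eq x S l)]
    exact trivialOnPi_one (vrAdj_isAdj x S k) (vrAdj_isAdj x S l) hm _ h

end Rips

end SigmaTwo

namespace SigmaTwo

/-! ### The word metric and the Cayley graph -/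

section WordMetric

variable {G : Type u} [Group G] {r : ℕ} {x : Fin r → G}

theorem wordLength_le (w : List (Fin r × Bool)) : wordLength x (evalWord x w) ≤ w.length :=
  Nat.sInf_le ⟨w, rfl, rfl⟩

theorem exists_geodesic (hx : Subgroup.closure (Set.range x) = ⊤) (g : G) :
    ∃ w : List (Fin r × Bool), w.length = wordLength x g ∧ evalWord x w = g := by
  have h : ∀ g : G, ∃ w : List (Fin r × Bool), evalWord x w = g := by
    intro g
    have hg : g ∈ Subgroup.closure (Set.range x) := hx ▸ Subgroup.mem_top g
    induction hg using Subgroup.closure_induction with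
    | mem y hy =>
      obtain ⟨i, rfl⟩ := hy
      exact ⟨[(i, true)], by simp [evalWord]⟩
    | one => exact ⟨[], by simp [evalWord]⟩
    | mul a b _ _ ha hb =>
      obtain ⟨v, rfl⟩ := ha
      obtain ⟨w, rfl⟩ := hb
      exact ⟨v ++ w, evalWord_append x v w⟩
    | inv a _ ha =>
      obtain ⟨v, rfl⟩ := ha
      exact ⟨invWord v, evalWord_invWord x v⟩
  obtain ⟨w, hw⟩ := h g
  exact Nat.sInf_mem (s := {n | ∃ w : List (Fin r × Bool), w.length = n ∧ evalWord x w = g})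
    ⟨_, w, rfl, hw⟩

theorem wordLength_mul (hx : Subgroup.closure (Set.range x) = ⊤) (g h : G) :
    wordLength x (g * h) ≤ wordLength x g + wordLength x h := by
  obtain ⟨v, hv, hv'⟩ := exists_geodesic hx g
  obtain ⟨w, hw, hw'⟩ := exists_geodesic hx h
  rw [← hv, ← hw, ← List.length_append]
  conv_lhs => rw [← hv', ← hw', ← evalWord_append]
  exact wordLength_le _

theorem wordLength_one : wordLength x 1 = 0 :=
  Nat.le_zero.1 (wordLength_le (x := x) [])

theorem wordDist_triangle (hx : Subgroup.closure (Set.range x) = ⊤) (a b c : G) :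
    wordDist x a c ≤ wordDist x a b + wordDist x b c := by
  have := wordLength_mul hx (a⁻¹ * b) (b⁻¹ * c)
  rwa [show a⁻¹ * b * (b⁻¹ * c) = a⁻¹ * c by group] at this

theorem finite_ball (hx : Subgroup.closure (Set.range x) = ⊤) (n : ℕ) :
    {g : G | wordLength x g ≤ n}.Finite := by
  refine ((List.finite_length_le (Fin r × Bool) n).image (evalWord x)).subset fun g hg => ?_
  obtain ⟨w, hw, rfl⟩ := exists_geodesic hx g
  exact ⟨w, by rw [Set.mem_ofPred_eq, hw]; exact hg, rfl⟩

theorem exists_wordLength_le (s : Set G) (hs : s.Finite) :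
    ∃ n, ∀ g ∈ s, wordLength x g ≤ n := by
  obtain ⟨n, hn⟩ := (hs.image (wordLength x)).bddAbove
  exact ⟨n, fun g hg => hn ⟨g, hg, rfl⟩⟩

variable {χ : G →* Multiplicative ℝ}

@[simp] theorem chi_mul (a b : G) : chi χ (a * b) = chi χ a + chi χ b := by simp [chi]

@[simp] theorem chi_one : chi χ (1 : G) = 0 := by simp [chi]

@[simp] theorem chi_inv (a : G) : chi χ a⁻¹ = -chi χ a := by simp [chi]

@[simp] theorem chi_pow (a : G) (n : ℕ) : chi χ (a ^ n) = n * chi χ a := by simp [chi]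

/-- A bound for the slope of a character. -/
noncomputable def slope (x : Fin r → G) (χ : G →* Multiplicative ℝ) : ℝ := ∑ i, |chi χ (x i)|

theorem slope_nonneg : 0 ≤ slope x χ := Finset.sum_nonneg fun _ _ => abs_nonneg _

theorem abs_chi_evalWord_le (w : List (Fin r × Bool)) :
    |chi χ (evalWord x w)| ≤ slope x χ * w.length := by
  induction w with
  | nil => simp [evalWord]
  | cons l w ih =>
    have h2 : l :: w = [l] ++ w := rfl
    rw [h2, evalWord_append, chi_mul, List.length_append]
    refine (abs_add_le _ _).trans ?_
    have h3 : |chi χ (evalWord x [l])| ≤ slope x χ := by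
      have h4 : |chi χ (x l.1)| ≤ slope x χ :=
        Finset.single_le_sum (f := fun i => |chi χ (x i)|) (fun _ _ => abs_nonneg _)
          (Finset.mem_univ l.1)
      rcases l with ⟨i, _ | _⟩ <;> simpa [evalWord] using h4
    push_cast
    simp only [List.length_singleton, Nat.cast_one]
    linarith

/-- The vertices after `a` on the path in the Cayley graph that spells a given word. -/
def wordPath (x : Fin r → G) : G → List (Fin r × Bool) → List G
  | _, [] => []
  | a, l :: w => (a * evalWord x [l]) :: wordPath x (a * evalWord x [l]) w

theorem evalWord_cons (l : Fin r × Bool) (w : List (Fin r × Bool)) :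
    evalWord x (l :: w) = evalWord x [l] * evalWord x w :=
  evalWord_append x [l] w

theorem tgt_wordPath (a : G) (w : List (Fin r × Bool)) :
    tgt a (wordPath x a w) = a * evalWord x w := by
  induction w generalizing a with
  | nil => simp [wordPath, evalWord]
  | cons l w ih => rw [wordPath, tgt, ih, evalWord_cons l w, mul_assoc]

theorem wordPath_mul (g a : G) (w : List (Fin r × Bool)) :
    wordPath x (g * a) w = (wordPath x a w).map (g * ·) := by
  induction w generalizing a with
  | nil => rfl
  | cons l w ih => simp [wordPath, ← ih, mul_assoc]

theorem exists_prefix_of_mem_wordPath {a b : G} {w : List (Fin r × Bool)}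
    (h : b ∈ a :: wordPath x a w) : ∃ v, v <+: w ∧ b = a * evalWord x v := by
  induction w generalizing a with
  | nil => exact ⟨[], List.prefix_rfl, by simpa [wordPath, evalWord] using h⟩
  | cons l w ih =>
    rcases List.mem_cons.1 h with rfl | h
    · exact ⟨[], List.nil_prefix, by simp [evalWord]⟩
    · obtain ⟨v, hv, rfl⟩ := ih h
      exact ⟨l :: v, by simpa using hv, by rw [evalWord_cons l v, mul_assoc]⟩

theorem walk_wordPath {S : Set G} {a : G} {w : List (Fin r × Bool)}
    (h : ∀ b ∈ a :: wordPath x a w, b ∈ S) : Walk (vrAdj x S 1) a (wordPath x a w) := by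
  induction w generalizing a with
  | nil => exact (vrAdj_self x 1).2 (h a (by simp))
  | cons l w ih =>
    refine ⟨⟨h a (by simp), h _ (by simp [wordPath]), ?_⟩,
      ih fun b hb => h b (List.mem_cons_of_mem _ hb)⟩
    simpa [wordDist] using wordLength_le (x := x) [l]

/-- A chosen geodesic word. -/
noncomputable def geoWord (hx : Subgroup.closure (Set.range x) = ⊤) (g : G) :
    List (Fin r × Bool) :=
  (exists_geodesic hx g).choose

/-- A chosen geodesic path in the Cayley graph. -/
noncomputable def geo (hx : Subgroup.closure (Set.range x) = ⊤) (a b : G) : List G :=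
  wordPath x a (geoWord hx (a⁻¹ * b))

variable (hx : Subgroup.closure (Set.range x) = ⊤)

theorem length_geoWord (g : G) : (geoWord hx g).length = wordLength x g :=
  (exists_geodesic hx g).choose_spec.1

theorem evalWord_geoWord (g : G) : evalWord x (geoWord hx g) = g :=
  (exists_geodesic hx g).choose_spec.2

theorem tgt_geo (a b : G) : tgt a (geo hx a b) = b := by
  rw [geo, tgt_wordPath, evalWord_geoWord]
  simp

theorem geo_mul (g a b : G) : geo hx (g * a) (g * b) = (geo hx a b).map (g * ·) := by
  rw [geo, geo, wordPath_mul, show (g * a)⁻¹ * (g * b) = a⁻¹ * b by group]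

theorem geo_mem {a b c : G} (h : c ∈ a :: geo hx a b) :
    |chi χ c - chi χ a| ≤ slope x χ * wordDist x a b := by
  obtain ⟨v, hv, rfl⟩ := exists_prefix_of_mem_wordPath h
  have h1 := hv.length_le
  rw [length_geoWord] at h1
  rw [chi_mul, add_sub_cancel_left]
  refine (abs_chi_evalWord_le v).trans (mul_le_mul_of_nonneg_left ?_ slope_nonneg)
  exact_mod_cast h1

theorem walk_geo {S : Set G} {a b : G} (h : ∀ c ∈ a :: geo hx a b, c ∈ S) :
    Walk (vrAdj x S 1) a (geo hx a b) :=
  walk_wordPath h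

/-- A geodesic of length at most `i` deviates by at most `slope · i` in height. -/
theorem walk_geo_halfSpace {L M : ℝ} {i : ℕ} {a b : G} (hM : L + slope x χ * i ≤ M)
    (h : vrAdj x (halfSpace χ M) i a b) :
    Walk (vrAdj x (halfSpace χ L) 1) a (geo hx a b) := by
  refine walk_geo hx fun c hc => ?_
  have h1 : M ≤ chi χ a := h.1
  have h2 := (abs_le.1 (geo_mem (χ := χ) hx hc)).1
  have h3 : slope x χ * (wordDist x a b : ℝ) ≤ slope x χ * i :=
    mul_le_mul_of_nonneg_left (by exact_mod_cast h.2.2) slope_nonneg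
  change L ≤ chi χ c
  linarith

/-- A geodesic of length at most one is trivial or an edge. -/
theorem ht_geo_one {S : Set G} {k : ℕ} (hk : 1 ≤ k) {a b : G} (h : vrAdj x S 1 a b) :
    Ht (vrAdj x S k) a (geo hx a b) [b] := by
  have hab := vrAdj_mono x (subset_refl S) hk _ _ h
  have h1 : ∀ w : List (Fin r × Bool), w.length ≤ 1 → a * evalWord x w = b →
      Ht (vrAdj x S k) a (wordPath x a w) [b] := by
    rintro (_ | ⟨l, _ | ⟨l', w⟩⟩) hw hb
    · obtain rfl : a = b := by simpa [evalWord] using hb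
      exact (Ht.stay hab).symm
    · rw [show wordPath x a [l] = [b] by rw [← hb]; rfl]
      exact .refl ⟨hab, (vrAdj_self x k).2 h.2.1⟩
    · simp at hw
  refine h1 _ ?_ ?_
  · rw [length_geoWord]; exact h.2.2
  · rw [evalWord_geoWord]; simp

theorem ht_mapWalk_geo_one {S : Set G} {k : ℕ} (hk : 1 ≤ k) {a : G} {l : List G}
    (h : Walk (vrAdj x S 1) a l) : Ht (vrAdj x S k) a (mapWalk (geo hx) a l) l := by
  have hA := vrAdj_isAdj x S k
  induction l generalizing a with
  | nil => exact .refl (Walk.mono (vrAdj_mono x (subset_refl S) hk) h)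
  | cons b l ih =>
    refine Ht.append hA (m' := l) (l' := [b]) (ht_geo_one hx hk h.1) ?_
    rw [tgt_geo]
    exact ih h.2

/-- The Cayley graph is connected. -/
theorem exists_walk_univ (hx : Subgroup.closure (Set.range x) = ⊤) (a b : G) : ∃ l, Walk (vrAdj x Set.univ 1) a l ∧ tgt a l = b :=
  ⟨geo hx a b, walk_geo hx fun _ _ => Set.mem_univ _, tgt_geo hx a b⟩

/-- A finite walk has a lowest point; integer levels make the half spaces a sequence. -/
theorem Walk.exists_halfSpace (χ : G →* Multiplicative ℝ) {k : ℕ} {a : G} {l : List G}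
    (h : Walk (vrAdj x Set.univ k) a l) : ∃ n : ℕ, Walk (vrAdj x (halfSpace χ (-n)) k) a l := by
  refine Walk.exists_of_directed (A := fun n : ℕ => vrAdj x (halfSpace χ (-n)) k)
    (fun m n hmn => vrAdj_mono x (fun g hg => ?_) le_rfl) (Walk.mono (fun a b hab => ?_) h)
  · have : -(m : ℝ) ≤ chi χ g := hg
    have h2 : (m : ℝ) ≤ n := by exact_mod_cast hmn
    change -(n : ℝ) ≤ chi χ g
    linarith
  · obtain ⟨n, hn⟩ := exists_nat_ge (max (-chi χ a) (-chi χ b))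
    refine ⟨n, ?_, ?_, hab.2.2⟩
    · change -(n : ℝ) ≤ chi χ a
      linarith [le_max_left (-chi χ a) (-chi χ b)]
    · change -(n : ℝ) ≤ chi χ b
      linarith [le_max_right (-chi χ a) (-chi χ b)]

theorem Ht.exists_halfSpace (χ : G →* Multiplicative ℝ) {k : ℕ} {a : G} {l l' : List G}
    (h : Ht (vrAdj x Set.univ k) a l l') :
    ∃ n : ℕ, Ht (vrAdj x (halfSpace χ (-n)) k) a l l' := by
  refine Ht.exists_of_directed (A := fun n : ℕ => vrAdj x (halfSpace χ (-n)) k)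
    (fun m n hmn => vrAdj_mono x (fun g hg => ?_) le_rfl) (Ht.mono (fun a b hab => ?_) h)
  · have : -(m : ℝ) ≤ chi χ g := hg
    have h2 : (m : ℝ) ≤ n := by exact_mod_cast hmn
    change -(n : ℝ) ≤ chi χ g
    linarith
  · obtain ⟨n, hn⟩ := exists_nat_ge (max (-chi χ a) (-chi χ b))
    refine ⟨n, ?_, ?_, hab.2.2⟩
    · change -(n : ℝ) ≤ chi χ a
      linarith [le_max_left (-chi χ a) (-chi χ b)]
    · change -(n : ℝ) ≤ chi χ b
      linarith [le_max_right (-chi χ a) (-chi χ b)]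

theorem halfSpace_mono {L M : ℝ} (h : L ≤ M) : halfSpace χ M ⊆ halfSpace χ L :=
  fun _ hg => h.trans hg

theorem vrAdj_translate (g : G) {L M : ℝ} (h : M ≤ chi χ g + L) {k : ℕ} (a b : G)
    (hab : vrAdj x (halfSpace χ L) k a b) : vrAdj x (halfSpace χ M) k (g * a) (g * b) := by
  have h1 : L ≤ chi χ a := hab.1
  have h2 : L ≤ chi χ b := hab.2.1
  refine ⟨?_, ?_, by rw [wordDist_mul_left]; exact hab.2.2⟩
  · change M ≤ chi χ (g * a); rw [chi_mul]; linarith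
  · change M ≤ chi χ (g * b); rw [chi_mul]; linarith

/-- If loops of the Cayley graph are contractible in the Rips complex for the value `K`, then
replacing edges by geodesics respects triangles, at a bounded depth. -/
theorem exists_geo_triangle {K : ℕ}
    (hN : ∀ a l, Walk (vrAdj x Set.univ 1) a l → tgt a l = a → Ht (vrAdj x Set.univ K) a l [])
    (χ : G →* Multiplicative ℝ) (j : ℕ) :
    ∃ C : ℝ, slope x χ * j ≤ C ∧ ∀ L M : ℝ, L + C ≤ M → ∀ a b c,
      vrAdj x (halfSpace χ M) j a b → vrAdj x (halfSpace χ M) j b c →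
      vrAdj x (halfSpace χ M) j a c →
      Ht (vrAdj x (halfSpace χ L) K) a (geo hx a b ++ geo hx b c) (geo hx a c) := by
  have hU := vrAdj_isAdj x (Set.univ : Set G) K
  have hg : ∀ a b, Walk (vrAdj x Set.univ 1) a (geo hx a b) := fun a b =>
    walk_geo hx fun _ _ => Set.mem_univ _
  -- The triangle of geodesics on 1, b, c is a closed walk of the Cayley graph, so it contracts at
  -- some depth.
  have h1 : ∀ b c, ∃ n : ℕ, Ht (vrAdj x (halfSpace χ (-n)) K) 1 (geo hx 1 b ++ geo hx b c)
      (geo hx 1 c) := by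
    intro b c
    have h2 : Walk (vrAdj x Set.univ 1) 1 (geo hx 1 b ++ geo hx b c) :=
      (hg 1 b).append (by rw [tgt_geo]; exact hg b c)
    have ht : tgt 1 (geo hx 1 b ++ geo hx b c) = c := by rw [tgt_append, tgt_geo, tgt_geo]
    have h3 := (hg 1 c).rev (vrAdj_isAdj x _ 1)
    rw [tgt_geo] at h3
    have h4 := hN 1 (geo hx 1 b ++ geo hx b c ++ rev 1 (geo hx 1 c)) (h2.append (by rwa [ht]))
      (by
        have := tgt_rev 1 (geo hx 1 c)
        rw [tgt_geo] at this
        rw [tgt_append, ht, this])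
    have h5 : Ht (vrAdj x Set.univ K) 1 (geo hx 1 c ++ rev 1 (geo hx 1 c)) [] := by
      refine hN 1 _ ((hg 1 c).append (by rwa [tgt_geo])) (by rw [tgt_append, tgt_rev])
    exact ((h4.trans h5.symm).cancel_right hU (by rw [ht, tgt_geo])).exists_halfSpace χ
  choose n hn using h1
  -- Up to translation there are finitely many triangles with sides of length at most `j`, hence a
  -- common depth.
  obtain ⟨m, hm⟩ := ((((finite_ball hx j).prod (finite_ball hx j)).image fun z => n z.1 z.2)).bddAbove
  refine ⟨max (slope x χ * j) m, le_max_left _ _, fun L M hLM a b c hab hbc hac => ?_⟩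
  have h2 : n (a⁻¹ * b) (a⁻¹ * c) ≤ m := hm ⟨(a⁻¹ * b, a⁻¹ * c), ⟨hab.2.2, hac.2.2⟩, rfl⟩
  have h3 := (hn (a⁻¹ * b) (a⁻¹ * c)).map (C := vrAdj x (halfSpace χ L) K) (a * ·)
    (vrAdj_translate a (by
      have : M ≤ chi χ a := hab.1
      have h4 : (n (a⁻¹ * b) (a⁻¹ * c) : ℝ) ≤ m := by exact_mod_cast h2
      linarith [le_max_right (slope x χ * j) (m : ℝ)]))
  rw [List.map_append, ← geo_mul, ← geo_mul, ← geo_mul] at h3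
  simpa using h3

end WordMetric

end SigmaTwo

namespace SigmaTwo

/-! ### Certificates for membership in `Σ²` -/

theorem mapWalk_comp {V W X : Type*} {A : V → V → Prop} {φ : V → W} {E : V → V → List W}
    (E' : W → W → List X) (hE : ∀ a b, A a b → tgt (φ a) (E a b) = φ b) {a : V} {l : List V}
    (h : Walk A a l) :
    mapWalk (fun a b => mapWalk E' (φ a) (E a b)) a l = mapWalk E' (φ a) (mapWalk E a l) := by
  induction l generalizing a with
  | nil => rfl
  | cons b l ih => rw [mapWalk, mapWalk, mapWalk_append, hE _ _ h.1, ih h.2]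

theorem mapWalk_map {V W X Y : Type*} (f : V → X) (h : W → Y) {E : V → V → List W}
    {E' : X → X → List Y} (hE : ∀ a b, E' (f a) (f b) = (E a b).map h) (a : V) (l : List V) :
    mapWalk E' (f a) (l.map f) = (mapWalk E a l).map h := by
  induction l generalizing a with
  | nil => rfl
  | cons b l ih => simp [mapWalk, ← ih, hE]

variable {G : Type u} [Group G] {r : ℕ} {x : Fin r → G} {χ : G →* Multiplicative ℝ} {K : ℕ}

/-- Finitely many paths and homotopies which define a map `a ↦ a t` on the `2`-skeleton of the
Rips complex that raises the valuation by `δ`. -/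
structure Certificate (x : Fin r → G) (K : ℕ) (χ : G →* Multiplicative ℝ) (δ : ℝ) (t : G)
    (m : G → List G) : Prop where
  walk : ∀ g, wordLength x g ≤ K →
    Walk (vrAdj x (halfSpace χ (δ + min 0 (chi χ g))) K) t (m g)
  tgt : ∀ g, wordLength x g ≤ K → tgt t (m g) = g * t
  tri : ∀ g h, wordLength x g ≤ K → wordLength x h ≤ K → wordLength x (g⁻¹ * h) ≤ K →
    Ht (vrAdj x (halfSpace χ (δ + min 0 (min (chi χ g) (chi χ h)))) K) t
      (m g ++ (m (g⁻¹ * h)).map (g * ·)) (m h)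

namespace Certificate

variable {δ : ℝ} {t : G} {m : G → List G}

/-- The edges of the induced map on the Rips complex. -/
def edge (m : G → List G) (a b : G) : List G := (m (a⁻¹ * b)).map (a * ·)

theorem edge_mul (g a b : G) : edge m (g * a) (g * b) = (edge m a b).map (g * ·) := by
  simp [edge, mul_assoc]

/-- The edge (a, b) is the translate by `a` of the edge (1, a⁻¹b). Translation adds χ(a), which
turns δ + min(0, χ(a⁻¹b)) into δ + min(χ(a), χ(b)). -/
theorem edge_walk (h : Certificate x K χ δ t m) {L : ℝ} {a b : G}
    (hab : vrAdj x (halfSpace χ L) K a b) :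
    Walk (vrAdj x (halfSpace χ (L + δ)) K) (a * t) (edge m a b) ∧
      SigmaTwo.tgt (a * t) (edge m a b) = b * t := by
  have h1 : L ≤ chi χ a := hab.1
  have h2 : L ≤ chi χ b := hab.2.1
  refine ⟨(h.walk (a⁻¹ * b) hab.2.2).map (a * ·) (vrAdj_translate a ?_), ?_⟩
  · rw [chi_mul, chi_inv]
    rcases min_cases 0 (-chi χ a + chi χ b) with h | h <;> linarith
  · rw [edge, tgt_map (a * ·) t, h.tgt _ hab.2.2]
    group

theorem edge_tri (h : Certificate x K χ δ t m) {L : ℝ} {a b c : G}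
    (hab : vrAdj x (halfSpace χ L) K a b) (hbc : vrAdj x (halfSpace χ L) K b c)
    (hac : vrAdj x (halfSpace χ L) K a c) :
    Ht (vrAdj x (halfSpace χ (L + δ)) K) (a * t) (edge m a b ++ edge m b c) (edge m a c) := by
  have h1 : L ≤ chi χ a := hab.1
  have h2 : L ≤ chi χ b := hab.2.1
  have h3 : L ≤ chi χ c := hbc.2.1
  have h4 := (h.tri (a⁻¹ * b) (a⁻¹ * c) hab.2.2 hac.2.2 (by
    rw [show (a⁻¹ * b)⁻¹ * (a⁻¹ * c) = b⁻¹ * c by group]; exact hbc.2.2)).map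
    (C := vrAdj x (halfSpace χ (L + δ)) K) (a * ·) (vrAdj_translate a (by
      simp only [chi_mul, chi_inv]
      rcases min_cases 0 (min (-chi χ a + chi χ b) (-chi χ a + chi χ c)) with h | h <;>
      rcases min_cases (-chi χ a + chi χ b) (-chi χ a + chi χ c) with h' | h' <;> linarith))
  rw [List.map_append, List.map_map] at h4
  rw [show (a⁻¹ * b)⁻¹ * (a⁻¹ * c) = b⁻¹ * c by group,
    show ((a * ·) ∘ (a⁻¹ * b * ·) : G → G) = (b * ·) from funext fun g => by
      simp [mul_assoc]] at h4
  exact h4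

theorem mapWalk_walk (h : Certificate x K χ δ t m) {L : ℝ} {a : G} {l : List G}
    (hl : Walk (vrAdj x (halfSpace χ L) K) a l) :
    Walk (vrAdj x (halfSpace χ (L + δ)) K) (a * t) (mapWalk (edge m) a l) ∧
      SigmaTwo.tgt (a * t) (mapWalk (edge m) a l) = SigmaTwo.tgt a l * t :=
  Walk.mapWalk (f := (· * t)) (fun a ha => by
    have := (h.edge_walk ha).1.start (vrAdj_isAdj x _ K)
    exact this) (fun a b hab => h.edge_walk hab) hl

theorem mapWalk_ht (h : Certificate x K χ δ t m) {L : ℝ} {a : G} {l l' : List G}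
    (hl : Ht (vrAdj x (halfSpace χ L) K) a l l') :
    Ht (vrAdj x (halfSpace χ (L + δ)) K) (a * t) (mapWalk (edge m) a l)
      (mapWalk (edge m) a l') :=
  Ht.mapWalk (vrAdj_isAdj x _ K) (f := (· * t)) (fun a ha => by
    have := (h.edge_walk ha).1.start (vrAdj_isAdj x _ K)
    exact this) (fun a b hab => h.edge_walk hab) (fun a b c => h.edge_tri) hl

/-- Apply the height condition to the walk for g = 1, which starts at `t`. -/
theorem le_chi (h : Certificate x K χ δ t m) : δ ≤ chi χ t := by
  have := ((h.walk 1 (by simp [wordLength_one])).start (vrAdj_isAdj x _ K)).1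
  simpa [halfSpace] using this

end Certificate

/-- A bound for the size of equivariant families of paths. -/
theorem exists_size_bound (hx : Subgroup.closure (Set.range x) = ⊤) (i : ℕ) {E : G → G → List G}
    (hE : ∀ g a b, E (g * a) (g * b) = (E a b).map (g * ·)) :
    ∃ D : ℕ, ∀ a b, wordDist x a b ≤ i → ∀ c ∈ E a b, wordDist x a c ≤ D := by
  obtain ⟨D, hD⟩ := exists_wordLength_le (x := x)
    (⋃ g ∈ {g : G | wordLength x g ≤ i}, {c | c ∈ E 1 g})
    ((finite_ball hx i).biUnion fun g _ => List.finite_toSet _)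
  refine ⟨D, fun a b hab c hc => hD _ ?_⟩
  refine Set.mem_biUnion (x := a⁻¹ * b) hab ?_
  have := hE a⁻¹ a b
  rw [inv_mul_cancel] at this
  change a⁻¹ * c ∈ E 1 (a⁻¹ * b)
  rw [this]
  exact List.mem_map_of_mem hc

/-- Pushing along an equivariant family of paths is homotopic to the identity. -/
theorem ht_push (hx : Subgroup.closure (Set.range x) = ⊤) {i D l : ℕ} {t : G} {S : Set G}
    {E : G → G → List G} (hD : ∀ a b, wordDist x a b ≤ i → ∀ c ∈ E a b, wordDist x a c ≤ D)
    (hS : ∀ a ∈ S, a * t ∈ S)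
    (hE : ∀ a b, vrAdj x S i a b → (∀ c ∈ E a b, c ∈ S) ∧ tgt (a * t) (E a b) = b * t)
    (hl : 2 * (i + D + wordLength x t) ≤ l) {a b : G} (hab : vrAdj x S i a b) :
    Ht (vrAdj x S l) a [b, b * t] ((a * t) :: E a b) := by
  have hself : ∀ c, wordDist x c (c * t) = wordLength x t := fun c => by simp [wordDist]
  -- All vertices lie within i + D + l(t) of `a`, so any two are at distance at most `l`: the walk
  -- lies in one simplex and can be replaced by an edge.
  have key : ∀ w : List G, (∀ c ∈ w, c ∈ S ∧ wordDist x a c ≤ i + D + wordLength x t) →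
      Ht (vrAdj x S l) a w [tgt a w] := by
    intro w hw
    have hw' : ∀ c ∈ a :: w, c ∈ S ∧ wordDist x a c ≤ i + D + wordLength x t := by
      intro c hc
      rcases List.mem_cons.1 hc with rfl | hc
      · exact ⟨hab.1, by rw [wordDist_self]; omega⟩
      · exact hw c hc
    refine Ht.cone fun c hc d hd => ⟨(hw' c hc).1, (hw' d hd).1, ?_⟩
    have h1 := wordDist_triangle hx c a d
    rw [wordDist_comm x c a] at h1
    have h2 := (hw' c hc).2
    have h3 := (hw' d hd).2
    omega
  have h1 := key [b, b * t] (by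
    intro c hc
    have h4 := hab.2.2
    simp only [List.mem_cons, List.not_mem_nil, or_false] at hc
    rcases hc with rfl | rfl
    · exact ⟨hab.2.1, by omega⟩
    · refine ⟨hS _ hab.2.1, (wordDist_triangle hx a b _).trans ?_⟩
      rw [hself]; omega)
  have h2 := key ((a * t) :: E a b) (by
    intro c hc
    rcases List.mem_cons.1 hc with rfl | hc
    · exact ⟨hS _ hab.1, by rw [hself]; omega⟩
    · exact ⟨(hE a b hab).1 c hc, (hD a b hab.2.2 c hc).trans (by omega)⟩)
  have h3 : tgt a ((a * t) :: E a b) = b * t := (hE a b hab).2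
  rw [h3] at h2
  exact h1.trans h2.symm

namespace Certificate

variable {δ : ℝ} {t : G} {m : G → List G}

/-- Each application of the map lifts the connecting walk by δ and moves its ends to `a t` and `b
t`, which are joined to `a` and `b` by edges of length l(t). Only the number of applications depends
on the depth, not the parameter `l`. -/
theorem exists_walk (h : Certificate x K χ δ t m) (hδ : 0 ≤ δ) {l : ℕ} (hl : K ≤ l)
    (hl' : wordLength x t ≤ l) {L : ℝ} (n : ℕ) {a b : G} (ha : a ∈ halfSpace χ L)
    (hb : b ∈ halfSpace χ L) {w : List G} (hw : Walk (vrAdj x (halfSpace χ (L - n * δ)) K) a w)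
    (hwb : SigmaTwo.tgt a w = b) :
    ∃ w, Walk (vrAdj x (halfSpace χ L) l) a w ∧ SigmaTwo.tgt a w = b := by
  have ht := h.le_chi
  induction n generalizing a b w with
  | zero =>
    exact ⟨w, hw.mono (vrAdj_mono x (halfSpace_mono (by simp)) hl), hwb⟩
  | succ n ih =>
    have hs : ∀ c ∈ halfSpace χ L, c * t ∈ halfSpace χ L := fun c hc => by
      have : L ≤ chi χ c := hc
      change L ≤ chi χ (c * t)
      rw [chi_mul]; linarith
    obtain ⟨h1, h2⟩ := h.mapWalk_walk hw
    rw [hwb] at h2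
    obtain ⟨v, hv, hvb⟩ := ih (hs a ha) (hs b hb) (h1.mono (vrAdj_mono x (halfSpace_mono (by
      push_cast; linarith)) le_rfl)) h2
    have hd : ∀ c ∈ halfSpace χ L, vrAdj x (halfSpace χ L) l c (c * t) := fun c hc =>
      ⟨hc, hs c hc, by simpa [wordDist] using hl'⟩
    have hA := vrAdj_isAdj x (halfSpace χ L) l
    refine ⟨(a * t) :: (v ++ [b]), ⟨hd a ha, hv.append ?_⟩, by simp [SigmaTwo.tgt]⟩
    rw [hvb]
    exact ⟨hA.symm (hd b hb), (vrAdj_self x l).2 hb⟩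

/-- The same induction for homotopies: images of the two walks are homotopic δ higher up, and the
ladders between walks and images bring the homotopy back. The bound on `l` comes from the size of a
single application and does not involve `n`. -/
theorem ht_of_deep (hx : Subgroup.closure (Set.range x) = ⊤) (h : Certificate x K χ δ t m)
    (hδ : 0 ≤ δ) {D l : ℕ} (hD : ∀ a b, wordDist x a b ≤ K → ∀ c ∈ edge m a b, wordDist x a c ≤ D)
    (hl : 2 * (K + D + wordLength x t) ≤ l) {L : ℝ} (n : ℕ) {a : G} {w w' : List G}
    (hw : Walk (vrAdj x (halfSpace χ L) K) a w) (hw' : Walk (vrAdj x (halfSpace χ L) K) a w')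
    (hww : Ht (vrAdj x (halfSpace χ (L - n * δ)) K) a w w') :
    Ht (vrAdj x (halfSpace χ L) l) a w w' := by
  have ht := h.le_chi
  have hA := vrAdj_isAdj x (halfSpace χ L) l
  induction n generalizing a w w' with
  | zero => exact hww.mono (vrAdj_mono x (halfSpace_mono (by simp)) (by omega))
  | succ n ih =>
    have hs : ∀ c ∈ halfSpace χ L, c * t ∈ halfSpace χ L := fun c hc => by
      have : L ≤ chi χ c := hc
      change L ≤ chi χ (c * t)
      rw [chi_mul]; linarith
    have hsub : halfSpace χ (L + δ) ⊆ halfSpace χ L := halfSpace_mono (by linarith)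
    have h1 := ih ((h.mapWalk_walk hw).1.mono (vrAdj_mono x hsub le_rfl))
      ((h.mapWalk_walk hw').1.mono (vrAdj_mono x hsub le_rfl))
      ((h.mapWalk_ht hww).mono (vrAdj_mono x (halfSpace_mono (by push_cast; linarith)) le_rfl))
    have hE : ∀ a b, vrAdj x (halfSpace χ L) K a b →
        Walk (vrAdj x (halfSpace χ L) K) (a * t) (edge m a b) ∧
          SigmaTwo.tgt (a * t) (edge m a b) = b * t := fun a b hab =>
      ⟨(h.edge_walk hab).1.mono (vrAdj_mono x hsub le_rfl), (h.edge_walk hab).2⟩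
    have hnat : ∀ {v : List G}, Walk (vrAdj x (halfSpace χ L) K) a v →
        Ht (vrAdj x (halfSpace χ L) l) a (v ++ [SigmaTwo.tgt a v * t])
          ((a * t) :: mapWalk (edge m) a v) := fun {v} hv =>
      Ht.natural hA (f := (· * t)) (vrAdj_mono x subset_rfl (by omega))
        (fun c hc => ⟨hc.1, hs c hc.1, by simp [wordDist]; omega⟩)
        (fun a b hab => ⟨(hE a b hab).1.mono (vrAdj_mono x subset_rfl (by omega)), (hE a b hab).2⟩)
        (fun a b hab => ht_push hx hD hs (fun a b hab => ⟨fun c hc =>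
          ((hE a b hab).1.mem (vrAdj_isAdj x _ K) (List.mem_cons_of_mem _ hc)).1,
          (hE a b hab).2⟩) hl hab) hv
    have hat : vrAdj x (halfSpace χ L) l a (a * t) := by
      have ha := (hw.start (vrAdj_isAdj x _ K)).1
      exact ⟨ha, hs a ha, by simp [wordDist]; omega⟩
    have h2 := ((hnat hw).trans (.cons hat h1)).trans (hnat hw').symm
    rw [← hww.tgt_eq] at h2
    exact h2.cancel_right hA hww.tgt_eq

/-- Walks in the Rips complex for an arbitrary value can be pushed up and then consist of edges of
bounded length. -/
theorem exists_push (hx : Subgroup.closure (Set.range x) = ⊤) (hK : 1 ≤ K)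
    (hN : ∀ a l, Walk (vrAdj x Set.univ 1) a l → SigmaTwo.tgt a l = a →
      Ht (vrAdj x Set.univ K) a l [])
    (h : Certificate x K χ δ t m) (i n : ℕ) :
    ∃ E : G → G → List G, (∀ g a b, E (g * a) (g * b) = (E a b).map (g * ·)) ∧
      (∀ L a b, vrAdj x (halfSpace χ L) i a b →
        Walk (vrAdj x (halfSpace χ (L - slope x χ * i + n * δ)) K) (a * t ^ n) (E a b) ∧
          SigmaTwo.tgt (a * t ^ n) (E a b) = b * t ^ n) ∧
      ∀ L a w, Walk (vrAdj x (halfSpace χ L) i) a w → SigmaTwo.tgt a w = a →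
        ∃ M, Ht (vrAdj x (halfSpace χ M) K) (a * t ^ n) (mapWalk E a w) [] := by
  induction n with
  | zero =>
    have h1 : ∀ L a b, vrAdj x (halfSpace χ L) i a b →
        Walk (vrAdj x (halfSpace χ (L - slope x χ * i)) 1) a (geo hx a b) ∧
          SigmaTwo.tgt a (geo hx a b) = b := fun L a b hab =>
      ⟨walk_geo_halfSpace hx (by linarith) hab, tgt_geo hx a b⟩
    refine ⟨geo hx, geo_mul hx, fun L a b hab => ?_, fun L a w hw hwa => ?_⟩
    · simpa using ⟨(h1 L a b hab).1.mono (vrAdj_mono x subset_rfl hK), (h1 L a b hab).2⟩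
    -- Replaced by geodesics, the loop is a closed walk of the Cayley graph and contracts by `hN`.
    -- The depth `M` of the contraction depends on the loop and is not controlled.
    · have h2 := Walk.mapWalk (f := id) (C := vrAdj x Set.univ 1) (E := geo hx)
        (fun a ha => (vrAdj_self x 1).2 (Set.mem_univ _)) (fun a b hab =>
          ⟨(h1 L a b hab).1.mono (vrAdj_mono x (Set.subset_univ _) le_rfl), (h1 L a b hab).2⟩) hw
      obtain ⟨M, hM⟩ := (hN _ _ h2.1 (h2.2.trans hwa)).exists_halfSpace χ
      exact ⟨_, by simpa using hM⟩
  | succ n ih =>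
    obtain ⟨E, hE1, hE2, hE3⟩ := ih
    have e : ∀ a, a * t ^ (n + 1) = a * t ^ n * t := fun a => by rw [pow_succ, mul_assoc]
    refine ⟨fun a b => mapWalk (edge m) (a * t ^ n) (E a b), fun g a b => ?_, fun L a b hab => ?_,
      fun L a w hw hwa => ?_⟩
    · simp only [hE1, mul_assoc]
      exact mapWalk_map (g * ·) (g * ·) (edge_mul g) _ _
    · obtain ⟨h1, h2⟩ := hE2 L a b hab
      obtain ⟨h3, h4⟩ := h.mapWalk_walk h1
      rw [h2] at h4
      rw [e, e]
      refine ⟨?_, h4⟩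
      convert h3 using 3
      push_cast
      ring
    · obtain ⟨M, hM⟩ := hE3 L a w hw hwa
      refine ⟨M + δ, ?_⟩
      rw [mapWalk_comp (φ := (· * t ^ n)) (edge m) (fun a b hab => (hE2 L a b hab).2) hw, e]
      exact h.mapWalk_ht hM

/-- A certificate shows that the character belongs to `Σ²`. -/
theorem mem_sigma (hx : Subgroup.closure (Set.range x) = ⊤) (hK : 1 ≤ K)
    (hN : ∀ a l, Walk (vrAdj x Set.univ 1) a l → SigmaTwo.tgt a l = a →
      Ht (vrAdj x Set.univ K) a l [])
    (h : Certificate x K χ δ t m) (hδ : 0 < δ) : χ ∈ Sigma x 2 := by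
  have ht := h.le_chi
  have hmul : ∀ n : ℕ, ∀ c ∈ halfSpace χ 0, c * t ^ n ∈ halfSpace χ 0 := fun n c hc => by
    have h0 : 0 ≤ chi χ c := hc
    have h1 : 0 ≤ (n : ℝ) * chi χ t := mul_nonneg n.cast_nonneg (hδ.le.trans ht)
    change 0 ≤ chi χ (c * t ^ n)
    rw [chi_mul, chi_pow]
    linarith
  refine ⟨⟨1, by simp [halfSpace]⟩, fun q hq i => ?_⟩
  obtain rfl | rfl : q = 0 ∨ q = 1 := by omega
  · refine ⟨i + K + wordLength x t, (piVanishes_zero_iff x _ (by omega)).2 fun a ha b hb => ?_⟩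
    obtain ⟨w, hw, hwb⟩ := exists_walk_univ hx a b
    obtain ⟨D, hD⟩ := Walk.exists_halfSpace χ (hw.mono (vrAdj_mono x subset_rfl hK))
    -- Enough applications to lift a walk of depth `D` to level zero.
    obtain ⟨n, hn⟩ := exists_nat_ge ((D : ℝ) / δ)
    rw [div_le_iff₀ hδ] at hn
    exact h.exists_walk hδ.le (by omega) (by omega) n ha hb
      (hD.mono (vrAdj_mono x (halfSpace_mono (by linarith)) le_rfl)) hwb
  · obtain ⟨D, hD⟩ := exists_size_bound hx K (edge_mul (m := m))
    -- Replacing edges of length `i` by geodesics loses at most `slope · i`; `n` applications regain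
    -- it. This `n` depends on `i` only.
    obtain ⟨n, hn⟩ := exists_nat_ge (slope x χ * i / δ)
    rw [div_le_iff₀ hδ] at hn
    obtain ⟨E, hE1, hE2, hE3⟩ := h.exists_push hx hK hN i n
    obtain ⟨D', hD'⟩ := exists_size_bound hx i hE1
    -- The parameter is fixed before the loop is chosen: the first summand serves `ht_of_deep`, the
    -- second one the `n` applications that replace the loop by a loop in the complex for `K`.
    let l := 2 * (K + D + wordLength x t) + 2 * (i + D' + wordLength x (t ^ n))
    refine ⟨l, (piVanishes_one_iff x _ (by omega)).2 fun a w hw hwa => ?_⟩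
    have hA := vrAdj_isAdj x (halfSpace χ 0) l
    have hE : ∀ a b, vrAdj x (halfSpace χ 0) i a b →
        Walk (vrAdj x (halfSpace χ 0) K) (a * t ^ n) (E a b) ∧
          SigmaTwo.tgt (a * t ^ n) (E a b) = b * t ^ n := fun a b hab =>
      ⟨(hE2 0 a b hab).1.mono (vrAdj_mono x (halfSpace_mono (by linarith)) le_rfl),
        (hE2 0 a b hab).2⟩
    have h1 : Ht (vrAdj x (halfSpace χ 0) l) a (w ++ [SigmaTwo.tgt a w * t ^ n])
        ((a * t ^ n) :: mapWalk E a w) :=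
      Ht.natural hA (f := (· * t ^ n)) (vrAdj_mono x subset_rfl (by omega))
        (fun c hc => ⟨hc.1, hmul n c hc.1, by simp [wordDist]; omega⟩)
        (fun a b hab => ⟨(hE a b hab).1.mono (vrAdj_mono x subset_rfl (by omega)), (hE a b hab).2⟩)
        (fun a b hab => ht_push hx hD' (hmul n) (fun a b hab => ⟨fun c hc =>
          ((hE a b hab).1.mem (vrAdj_isAdj x _ K) (List.mem_cons_of_mem _ hc)).1,
          (hE a b hab).2⟩) (by omega) hab) hw
    have h2 := Walk.mapWalk (f := (· * t ^ n)) (C := vrAdj x (halfSpace χ 0) K)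
      (fun a ha => (vrAdj_self x K).2 (hmul n a ha.1)) hE hw
    have ha := (hw.start (vrAdj_isAdj x _ i)).1
    obtain ⟨M, hM⟩ := hE3 0 a w hw hwa
    -- The depth of the contraction depends on the loop, and so does `n'`, but `l` does not.
    obtain ⟨n', hn'⟩ := exists_nat_ge (-M / δ)
    rw [div_le_iff₀ hδ] at hn'
    have h3 := h.ht_of_deep hx hδ.le hD (l := l) (by omega) (L := 0) n' h2.1
      (show Walk _ _ [] from (vrAdj_self x K).2 (hmul n a ha)) (hM.mono
        (vrAdj_mono x (halfSpace_mono (by linarith)) le_rfl))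
    have hat : vrAdj x (halfSpace χ 0) l a (a * t ^ n) :=
      ⟨ha, hmul n a ha, by simp [wordDist]; omega⟩
    have h4 := h1.trans (.cons hat h3)
    rw [hwa] at h4
    exact Ht.cancel_right hA (l' := []) h4 hwa

end Certificate

end SigmaTwo

namespace SigmaTwo

/-! ### Certificates from membership in `Σ²` -/

variable {G : Type u} [Group G] {r : ℕ} {x : Fin r → G} {χ : G →* Multiplicative ℝ} {K : ℕ}

/-- A nonzero character is nonzero on some generator, and the generator or its inverse has positive
value. -/
theorem exists_generator_pos (hx : Subgroup.closure (Set.range x) = ⊤) (hχ : χ ≠ 1) :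
    ∃ s, wordLength x s ≤ 1 ∧ 0 < chi χ s := by
  by_contra! H
  refine hχ (MonoidHom.eq_of_eqOn_dense hx ?_)
  rintro _ ⟨i, rfl⟩
  have e1 : evalWord x [(i, true)] = x i := by simp [evalWord]
  have e2 : evalWord x [(i, false)] = (x i)⁻¹ := by simp [evalWord]
  have h1 := H _ (e1 ▸ wordLength_le (x := x) [(i, true)])
  have h2 := H _ (e2 ▸ wordLength_le (x := x) [(i, false)])
  rw [chi_inv] at h2
  have : chi χ (x i) = 0 := le_antisymm h1 (by linarith)
  exact this

/-- The path `a s, a s², …, a s^N`. -/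
def ray (s : G) : ℕ → G → List G
  | 0, _ => []
  | n + 1, a => (a * s) :: ray s n (a * s)

theorem tgt_ray (s : G) (n : ℕ) (a : G) : tgt a (ray s n a) = a * s ^ n := by
  induction n generalizing a with
  | zero => simp [ray]
  | succ n ih => rw [ray, tgt, ih, pow_succ', mul_assoc]

theorem ray_mul (s : G) (n : ℕ) (g a : G) : ray s n (g * a) = (ray s n a).map (g * ·) := by
  induction n generalizing a with
  | zero => rfl
  | succ n ih => simp [ray, ← ih, mul_assoc]

theorem walk_ray {s : G} (hs : wordLength x s ≤ 1) (hs' : 0 ≤ chi χ s) {L : ℝ} (n : ℕ) {a : G}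
    (ha : L ≤ chi χ a) : Walk (vrAdj x (halfSpace χ L) 1) a (ray s n a) := by
  induction n generalizing a with
  | zero => exact (vrAdj_self x 1).2 ha
  | succ n ih =>
    have h : L ≤ chi χ (a * s) := by rw [chi_mul]; linarith
    exact ⟨⟨ha, h, by simpa [wordDist] using hs⟩, ih h⟩

/-- Half spaces of a character in `Σ²` are connected in the Cayley graph. -/
theorem exists_walk_halfSpace (hx : Subgroup.closure (Set.range x) = ⊤) (hχ : χ ≠ 1)
    (h : χ ∈ Sigma x 2) (g : G) {a b : G} (ha : chi χ g ≤ chi χ a) (hb : chi χ g ≤ chi χ b) :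
    ∃ w, Walk (vrAdj x (halfSpace χ (chi χ g)) 1) a w ∧ tgt a w = b := by
  obtain ⟨s, hs, hs'⟩ := exists_generator_pos hx hχ
  obtain ⟨j, hj⟩ := h.2 0 (by omega) 0
  rw [piVanishes_zero_iff x _ hj.1] at hj
  -- Room for the height lost when edges of length at most `j` become geodesics.
  obtain ⟨N, hN⟩ := exists_nat_ge (slope x χ * j / chi χ s)
  rw [div_le_iff₀ hs'] at hN
  have hA := vrAdj_isAdj x (halfSpace χ (chi χ g)) 1
  -- Half spaces are moved to level zero by a translation, so their levels have to be values of χ;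
  -- this is why the level is given by an element `g`.
  have hpos : ∀ c, chi χ g ≤ chi χ c → (g * s ^ N)⁻¹ * (c * s ^ N) ∈ halfSpace χ 0 := by
    intro c hc
    change 0 ≤ chi χ _
    simp only [chi_mul, chi_inv, chi_pow]
    linarith
  obtain ⟨w, hw, hwb⟩ := hj _ (hpos a ha) _ (hpos b hb)
  have h1 := hw.map (C := vrAdj x (halfSpace χ (chi χ g + N * chi χ s)) j) (g * s ^ N * ·)
    (vrAdj_translate (g * s ^ N) (by simp))
  have h2 := tgt_map (g * s ^ N * ·) ((g * s ^ N)⁻¹ * (a * s ^ N)) w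
  rw [hwb] at h2
  simp only [mul_inv_cancel_left] at h1 h2
  have h3 := Walk.mapWalk (f := id) (C := vrAdj x (halfSpace χ (chi χ g)) 1) (E := geo hx)
    (fun c hc => (vrAdj_self x 1).2 (halfSpace_mono (by nlinarith [hc.1, N.cast_nonneg (α := ℝ)]) hc.1))
    (fun c d hcd => ⟨walk_geo_halfSpace hx (by linarith) hcd, tgt_geo hx c d⟩) h1
  simp only [id, h2] at h3
  refine ⟨ray s N a ++ (mapWalk (geo hx) (a * s ^ N) (w.map (g * s ^ N * ·)) ++ rev b (ray s N b)),
    (walk_ray hs hs'.le N ha).append ?_, ?_⟩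
  · rw [tgt_ray]
    refine h3.1.append ?_
    rw [h3.2, ← tgt_ray]
    exact (walk_ray hs hs'.le N hb).rev hA
  · rw [tgt_append, tgt_append, tgt_ray, h3.2, ← tgt_ray, tgt_rev]

/-- For a character in `Σ²`, loops of the Cayley graph contract without going down too far. -/
theorem exists_depth (hx : Subgroup.closure (Set.range x) = ⊤) (hK : 1 ≤ K)
    (hN : ∀ a l, Walk (vrAdj x Set.univ 1) a l → tgt a l = a → Ht (vrAdj x Set.univ K) a l [])
    (h : χ ∈ Sigma x 2) : ∃ C : ℝ, ∀ g L, L + C ≤ chi χ g → ∀ a l,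
      Walk (vrAdj x (halfSpace χ (chi χ g)) 1) a l → tgt a l = a →
      Ht (vrAdj x (halfSpace χ L) K) a l [] := by
  obtain ⟨j, hj⟩ := h.2 1 (by omega) 1
  rw [piVanishes_one_iff x _ hj.1] at hj
  obtain ⟨C, hC, hC'⟩ := exists_geo_triangle hx hN χ j
  have hC0 : 0 ≤ C := (mul_nonneg slope_nonneg j.cast_nonneg).trans hC
  refine ⟨C, fun g L hL a l hl hla => ?_⟩
  -- Translate the loop to level zero, contract it there for the parameter `j`, and translate back.
  -- Then every edge becomes a geodesic and every triangle a homotopy for `K`, at the cost of `C`.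
  have h1 := (hj (g⁻¹ * a) (l.map (g⁻¹ * ·)) (hl.map (g⁻¹ * ·) (vrAdj_translate g⁻¹ (by simp)))
    (by rw [tgt_map (g⁻¹ * ·), hla])).map (C := vrAdj x (halfSpace χ (chi χ g)) j) (g * ·)
    (vrAdj_translate g (by simp))
  simp only [mul_inv_cancel_left, List.map_map, List.map_nil] at h1
  rw [show ((g * ·) ∘ (g⁻¹ * ·) : G → G) = id from funext fun c => by simp, List.map_id] at h1
  have h2 := Ht.mapWalk (vrAdj_isAdj x (halfSpace χ L) K) (f := id) (E := geo hx)
    (fun c hc => (vrAdj_self x K).2 (halfSpace_mono (by linarith) hc.1))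
    (fun c d hcd => ⟨(walk_geo_halfSpace hx (by linarith) hcd).mono
      (vrAdj_mono x subset_rfl hK), tgt_geo hx c d⟩)
    (fun a b c hab hbc hac => hC' L (chi χ g) hL a b c hab hbc hac) h1
  exact (ht_mapWalk_geo_one hx hK (hl.mono (vrAdj_mono x (halfSpace_mono (by linarith))
    le_rfl))).symm.trans h2

/-- A character in `Σ²` has a certificate with an arbitrary translation `t`. -/
theorem exists_certificate (hx : Subgroup.closure (Set.range x) = ⊤) (hχ : χ ≠ 1) (hK : 1 ≤ K)
    (hN : ∀ a l, Walk (vrAdj x Set.univ 1) a l → tgt a l = a → Ht (vrAdj x Set.univ K) a l [])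
    (h : χ ∈ Sigma x 2) (t : G) : ∃ m, Certificate x K χ (chi χ t) t m ∧ m 1 = [] := by
  classical
  obtain ⟨s, hs, hs'⟩ := exists_generator_pos hx hχ
  obtain ⟨C, hC⟩ := exists_depth hx hK hN h
  -- The rays climb by at least `C`, the loss of height in a contraction.
  obtain ⟨N, hNC⟩ := exists_nat_ge (C / chi χ s)
  rw [div_le_iff₀ hs'] at hNC
  have hN0 : 0 ≤ (N : ℝ) * chi χ s := mul_nonneg N.cast_nonneg hs'.le
  have hu : ∀ g, ∃ w, Walk (vrAdj x (halfSpace χ (chi χ t + min 0 (chi χ g) + N * chi χ s)) 1)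
      (t * s ^ N) w ∧ tgt (t * s ^ N) w = g * t * s ^ N := by
    intro g
    rcases le_total 0 (chi χ g) with hg | hg
    · obtain ⟨w, hw⟩ := exists_walk_halfSpace hx hχ h (t * s ^ N) (a := t * s ^ N)
        (b := g * t * s ^ N) le_rfl (by simp only [chi_mul]; linarith)
      refine ⟨w, hw.1.mono (vrAdj_mono x (halfSpace_mono ?_) le_rfl), hw.2⟩
      rw [min_eq_left hg]; simp
    · obtain ⟨w, hw⟩ := exists_walk_halfSpace hx hχ h (g * t * s ^ N) (a := t * s ^ N)
        (b := g * t * s ^ N) (by simp only [chi_mul]; linarith) le_rfl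
      refine ⟨w, hw.1.mono (vrAdj_mono x (halfSpace_mono ?_) le_rfl), hw.2⟩
      rw [min_eq_right hg]
      simp only [chi_mul, chi_pow]; linarith
  choose u hu hut using hu
  -- The trivial walk at g = 1 leaves only rays in `M 1`, which cancel. A certificate with `m 1 =
  -- []` is needed later to agree with the values on degenerate edges.
  let U : G → List G := fun g => if g = 1 then [] else u g
  have hU : ∀ g, Walk (vrAdj x (halfSpace χ (chi χ t + min 0 (chi χ g) + N * chi χ s)) 1)
      (t * s ^ N) (U g) ∧ tgt (t * s ^ N) (U g) = g * t * s ^ N := by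
    intro g
    by_cases hg : g = 1
    · subst hg
      simp only [U, if_true]
      exact ⟨(vrAdj_self x 1).2 (by simp [halfSpace]), by simp [tgt]⟩
    · simp only [U, if_neg hg]
      exact ⟨hu g, hut g⟩
  let M : G → List G := fun g => ray s N t ++ (U g ++ rev (g * t) (ray s N (g * t)))
  have hMwalk : ∀ g L, L ≤ chi χ t + min 0 (chi χ g) →
      Walk (vrAdj x (halfSpace χ L) 1) t (M g) := by
    intro g L hL
    have h1 : L ≤ chi χ t := by linarith [min_le_left 0 (chi χ g)]
    have h2 : L ≤ chi χ (g * t) := by rw [chi_mul]; linarith [min_le_right 0 (chi χ g)]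
    refine (walk_ray hs hs'.le N h1).append ?_
    rw [tgt_ray]
    refine ((hU g).1.mono (vrAdj_mono x (halfSpace_mono (by linarith)) le_rfl)).append ?_
    rw [(hU g).2, ← tgt_ray]
    exact (walk_ray hs hs'.le N h2).rev (vrAdj_isAdj x _ 1)
  have hMtgt : ∀ g, tgt t (M g) = g * t := by
    intro g
    simp only [M]
    rw [tgt_append, tgt_append, tgt_ray, (hU g).2, ← tgt_ray, tgt_rev]
  have htri : ∀ g h L, L ≤ chi χ t + min 0 (min (chi χ g) (chi χ h)) →
      Ht (vrAdj x (halfSpace χ L) K) t (M g ++ (M (g⁻¹ * h)).map (g * ·)) (M h) := by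
    intro g h L hL
    have hL0 : L ≤ chi χ t + min 0 (chi χ g) :=
      hL.trans (by gcongr; exact min_le_left _ _)
    have hL1 : L ≤ chi χ t + min 0 (chi χ h) :=
      hL.trans (by gcongr; exact min_le_right _ _)
    have hA := vrAdj_isAdj x (halfSpace χ L) K
    -- The contraction lemma wants its level as the value of an element. The lowest level of the
    -- three crossings is attained at d t s^N, where d is the lowest of 1, g, h.
    obtain ⟨c, hc, hc1, hc2, hc3⟩ : ∃ c : G, L + N * chi χ s ≤ chi χ c ∧
        chi χ c ≤ chi χ t + min 0 (chi χ g) + N * chi χ s ∧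
        chi χ c ≤ chi χ t + min 0 (chi χ h) + N * chi χ s ∧
        chi χ c ≤ chi χ g + (chi χ t + min 0 (chi χ (g⁻¹ * h)) + N * chi χ s) := by
      have key : ∀ d : G, chi χ d = min 0 (min (chi χ g) (chi χ h)) →
          L + N * chi χ s ≤ chi χ (d * t * s ^ N) ∧
          chi χ (d * t * s ^ N) ≤ chi χ t + min 0 (chi χ g) + N * chi χ s ∧
          chi χ (d * t * s ^ N) ≤ chi χ t + min 0 (chi χ h) + N * chi χ s ∧
          chi χ (d * t * s ^ N) ≤
            chi χ g + (chi χ t + min 0 (chi χ (g⁻¹ * h)) + N * chi χ s) := by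
        intro d hd
        simp only [chi_mul, chi_inv, chi_pow, hd]
        have e1 : min 0 (min (chi χ g) (chi χ h)) ≤ min 0 (chi χ g) := by
          gcongr; exact min_le_left _ _
        have e2 : min 0 (min (chi χ g) (chi χ h)) ≤ min 0 (chi χ h) := by
          gcongr; exact min_le_right _ _
        refine ⟨by linarith, by linarith, by linarith, ?_⟩
        rcases min_cases 0 (-chi χ g + chi χ h) with h' | h' <;>
          linarith [min_le_right 0 (chi χ g), min_le_right 0 (chi χ h)]
      rcases min_choice 0 (min (chi χ g) (chi χ h)) with h1 | h1
      · exact ⟨_, key 1 (by rw [h1, chi_one])⟩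
      · rcases min_choice (chi χ g) (chi χ h) with h2 | h2
        · exact ⟨_, key g (by rw [h1, h2])⟩
        · exact ⟨_, key h (by rw [h1, h2])⟩
    have u1 : Walk (vrAdj x (halfSpace χ (chi χ c)) 1) (t * s ^ N) (U g) :=
      (hU g).1.mono (vrAdj_mono x (halfSpace_mono hc1) le_rfl)
    have u2 : Walk (vrAdj x (halfSpace χ (chi χ c)) 1) (t * s ^ N) (U h) :=
      (hU h).1.mono (vrAdj_mono x (halfSpace_mono hc2) le_rfl)
    have u3 : Walk (vrAdj x (halfSpace χ (chi χ c)) 1) (g * (t * s ^ N))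
        ((U (g⁻¹ * h)).map (g * ·)) := (hU (g⁻¹ * h)).1.map (g * ·) (vrAdj_translate g hc3)
    have t3 : tgt (g * (t * s ^ N)) ((U (g⁻¹ * h)).map (g * ·)) = h * t * s ^ N := by
      rw [tgt_map (g * ·), (hU (g⁻¹ * h)).2]; group
    have u4 : Walk (vrAdj x (halfSpace χ (chi χ c)) 1) (t * s ^ N)
        (U g ++ (U (g⁻¹ * h)).map (g * ·)) := u1.append (by
          rw [(hU g).2, mul_assoc g]; exact u3)
    have t4 : tgt (t * s ^ N) (U g ++ (U (g⁻¹ * h)).map (g * ·)) = h * t * s ^ N := by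
      rw [tgt_append, (hU g).2, mul_assoc g, t3]
    -- The three crossings form a closed walk above level χ(c); its contraction loses at most `C`
    -- and so stays above `L`.
    have hu : Ht (vrAdj x (halfSpace χ L) K) (t * s ^ N) (U g ++ (U (g⁻¹ * h)).map (g * ·))
        (U h) := by
      have v2 := u2.rev (vrAdj_isAdj x _ 1)
      rw [(hU h).2] at v2
      have w1 := hC c L (by linarith) _ _ (u4.append (by rw [t4]; exact v2)) (by
        have := tgt_rev (t * s ^ N) (U h)
        rw [(hU h).2] at this
        rw [tgt_append, t4, this])
      have w2 := hC c L (by linarith) _ _ (u2.append (by rw [(hU h).2]; exact v2)) (by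
        rw [tgt_append, tgt_rev])
      exact (w1.trans w2.symm).cancel_right hA (by rw [t4, (hU h).2])
    have hle : ∀ a b, vrAdj x (halfSpace χ L) 1 a b → vrAdj x (halfSpace χ L) K a b :=
      vrAdj_mono x subset_rfl hK
    have hgt : L ≤ chi χ (g * t) := by
      rw [chi_mul]; linarith [min_le_right 0 (chi χ g)]
    have hht : L ≤ chi χ (h * t) := by
      rw [chi_mul]; linarith [min_le_right 0 (chi χ h)]
    have hmap : (M (g⁻¹ * h)).map (g * ·) = ray s N (g * t) ++
        ((U (g⁻¹ * h)).map (g * ·) ++ rev (h * t) (ray s N (h * t))) := by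
      simp only [M, List.map_append]
      rw [← ray_mul, ← rev_map (g * ·), ← ray_mul,
        show g * (g⁻¹ * h * t) = h * t by group]
    have hup := (walk_ray hs hs'.le N hgt).mono hle
    have hdown := ((walk_ray hs hs'.le N hht).mono hle).rev hA
    rw [tgt_ray] at hdown
    have hsub : halfSpace χ (chi χ c) ⊆ halfSpace χ L := halfSpace_mono (by linarith)
    have z1 : Ht (vrAdj x (halfSpace χ L) K) (g * t * s ^ N) (rev (g * t) (ray s N (g * t)) ++
        ray s N (g * t)) [] := by
      have := Ht.rev_append hA hup
      rwa [tgt_ray] at this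
    have z2 : Ht (vrAdj x (halfSpace χ L) K) (g * t * s ^ N)
        (rev (g * t) (ray s N (g * t)) ++ (M (g⁻¹ * h)).map (g * ·))
        ((U (g⁻¹ * h)).map (g * ·) ++ rev (h * t) (ray s N (h * t))) := by
      rw [hmap, ← List.append_assoc]
      refine z1.append_right hA ?_
      rw [z1.tgt_eq, tgt, mul_assoc]
      exact (u3.mono (vrAdj_mono x hsub hK)).append (by rw [t3]; exact hdown)
    have z3 : Ht (vrAdj x (halfSpace χ L) K) (t * s ^ N)
        (U g ++ (rev (g * t) (ray s N (g * t)) ++ (M (g⁻¹ * h)).map (g * ·)))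
        (U h ++ rev (h * t) (ray s N (h * t))) := by
      refine Ht.trans (Ht.append_left (u1.mono (vrAdj_mono x hsub hK)) (by
        rw [(hU g).2]; exact z2)) ?_
      rw [← List.append_assoc]
      exact hu.append_right hA (by rw [t4]; exact hdown)
    have z4 := Ht.append_left (m := ray s N t) (((hMwalk h L hL1).mono hle).left hA) (by
      rw [tgt_ray]; exact z3)
    simpa only [M, List.append_assoc] using z4
  have hM1 : ∀ L ≤ chi χ t, Ht (vrAdj x (halfSpace χ L) K) t (M 1) [] := by
    intro L hL
    have : M 1 = ray s N t ++ rev t (ray s N t) := by simp [M, U]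
    rw [this]
    exact Ht.append_rev (vrAdj_isAdj x _ K) ((walk_ray hs hs'.le N hL).mono
      (vrAdj_mono x subset_rfl hK))
  -- Exchanging `M 1` for the empty walk changes nothing up to homotopy, so all conditions carry
  -- over.
  have hM : ∀ g L, L ≤ chi χ t + min 0 (chi χ g) →
      Ht (vrAdj x (halfSpace χ L) K) t (if g = 1 then [] else M g) (M g) := by
    intro g L hL
    by_cases hg : g = 1
    · subst hg
      rw [if_pos rfl]
      exact (hM1 L (hL.trans (by simp))).symm
    · rw [if_neg hg]
      exact .refl ((hMwalk g L hL).mono (vrAdj_mono x subset_rfl hK))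
  refine ⟨fun g => if g = 1 then [] else M g, ⟨fun g hg => (hM g _ le_rfl).walks.1,
    fun g hg => (hM g _ le_rfl).tgt_eq.trans (hMtgt g), fun g h hg hh hgh => ?_⟩, if_pos rfl⟩
  have hA := vrAdj_isAdj x (halfSpace χ (chi χ t + min 0 (min (chi χ g) (chi χ h)))) K
  have e1 := hM g (chi χ t + min 0 (min (chi χ g) (chi χ h)))
    (by gcongr; exact min_le_left _ _)
  have e2 := hM h (chi χ t + min 0 (min (chi χ g) (chi χ h)))
    (by gcongr; exact min_le_right _ _)
  have e3 := (hM (g⁻¹ * h) _ le_rfl).map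
    (C := vrAdj x (halfSpace χ (chi χ t + min 0 (min (chi χ g) (chi χ h)))) K) (g * ·)
    (vrAdj_translate g (by
      simp only [chi_mul, chi_inv]
      rcases min_cases 0 (-chi χ g + chi χ h) with h1 | h1 <;>
      rcases min_cases 0 (min (chi χ g) (chi χ h)) with h2 | h2 <;>
      rcases min_cases (chi χ g) (chi χ h) with h3 | h3 <;> linarith))
  refine (e1.append hA ?_).trans ((htri g h _ le_rfl).trans e2.symm)
  rw [e1.tgt_eq, hMtgt]
  exact e3

end SigmaTwo

namespace SigmaTwo

/-! ### Maps on iterated subdivisions -/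

section Subdivision

open PartialOrder

/-- Nonempty subsets of `{0, …, n}`. -/
abbrev Faces (n : ℕ) : Type := {s : Finset (Fin (n + 1)) // s.Nonempty}

/-- A nonempty subset of `{0, …, n}` as a chain. -/
def chain {n : ℕ} (s : Faces n) : NonemptyFiniteChains (ULift.{u} (Fin (n + 1))) where
  finset := s.1.map Equiv.ulift.symm.toEmbedding
  nonempty := s.2.map
  comparable a b := le_total a.1 b.1

theorem mem_chain {n : ℕ} (s : Faces n) (i : ULift.{u} (Fin (n + 1))) :
    i ∈ (chain s).finset ↔ i.down ∈ s.1 := by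
  rcases i with ⟨i⟩
  simp [chain, Equiv.ulift]

theorem chain_mono {n : ℕ} : Monotone (chain.{u} (n := n)) := by
  intro s t h i hi
  rw [mem_chain] at hi ⊢
  exact h hi

/-- The image of a face. -/
def Faces.image {m n : ℕ} (f : Fin (m + 1) →o Fin (n + 1)) : Faces m →o Faces n where
  toFun s := ⟨s.1.image f, s.2.image f⟩
  monotone' _ _ h := Finset.image_subset_image h

/-- The simplex given by a chain of faces. -/
def chainSimplex {n d : ℕ} (c : Fin (d + 1) →o Faces n) :
    (SimplexCategory.sd.{u}.obj (.mk n)).obj (op (.mk d)) :=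
  (chain_mono.comp c.monotone).functor

theorem chain_map {m n : ℕ} (g : ULift.{u} (Fin (m + 1)) →o ULift.{u} (Fin (n + 1)))
    (f : Fin (m + 1) →o Fin (n + 1)) (h : ∀ i, (g i).down = f i.down) (A : Faces m) :
    (chain.{u} A).map g = chain (Faces.image f A) := by
  apply NonemptyFiniteChains.ext
  ext v
  rw [mem_chain, NonemptyFiniteChains.mem_map_iff]
  refine Iff.trans ?_ (Finset.mem_image (s := A.1) (f := f)).symm
  constructor
  · rintro ⟨w, hw, rfl⟩
    exact ⟨w.down, (mem_chain _ _).1 hw, (h w).symm⟩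
  · rintro ⟨w, hw, hv⟩
    exact ⟨⟨w⟩, (mem_chain _ _).2 hw, ULift.ext _ _ ((h _).trans hv)⟩

theorem chainSimplex_image {m n d : ℕ} (c : Fin (d + 1) →o Faces m)
    (f : SimplexCategory.mk m ⟶ .mk n) :
    (SimplexCategory.sd.{u}.map f).app _ (chainSimplex c) =
      chainSimplex ((Faces.image f.toOrderHom).comp c) :=
  CategoryTheory.Functor.ext
    (fun i => chain_map (SimplexCategory.toPartOrd.{u}.map f).hom f.toOrderHom (fun _ => rfl) (c i))
    (fun _ _ _ => Subsingleton.elim _ _)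

/-- The simplex of the subdivision of a standard simplex given by a chain of faces. -/
noncomputable def sdSimplex {n d : ℕ} (c : Fin (d + 1) →o Faces n) :
    stdS.{u} d ⟶ SSet.sd.obj (stdS.{u} n) :=
  SSet.yonedaEquiv.symm (chainSimplex c) ≫ SSet.stdSimplex.sdIso.inv.app (.mk n)

theorem map_sdSimplex {n d e : ℕ} (c : Fin (d + 1) →o Faces n) (θ : SimplexCategory.mk e ⟶ .mk d) :
    SSet.stdSimplex.map θ ≫ sdSimplex.{u} c = sdSimplex (c.comp θ.toOrderHom) := by
  change _ ≫ _ ≫ _ = _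
  rw [← Category.assoc]
  congr 1

/-- Naturality of the identification of the subdivided standard simplex with chains of faces. -/
theorem sdSimplex_map {m n d : ℕ} (c : Fin (d + 1) →o Faces m) (f : SimplexCategory.mk m ⟶ .mk n) :
    sdSimplex.{u} c ≫ SSet.sd.map (SSet.stdSimplex.map f) =
      sdSimplex ((Faces.image f.toOrderHom).comp c) := by
  have h := SSet.stdSimplex.sdIso.{u}.inv.naturality f
  change (_ ≫ _) ≫ _ = _
  rw [Category.assoc]
  erw [← h]
  rw [← Category.assoc]
  change _ = _ ≫ _
  congr 1
  rw [← chainSimplex_image, SSet.yonedaEquiv_symm_comp]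

/-- A chain of three faces. -/
def tower {n : ℕ} (s t w : Faces n) (hst : s ≤ t) (htw : t ≤ w) : Fin 3 →o Faces n where
  toFun := ![s, t, w]
  monotone' := by
    intro i j hij
    fin_cases i <;> fin_cases j <;> first
      | exact le_rfl | exact hst | exact htw | exact absurd hij (by decide) | exact hst.trans htw

/-- A pair of comparable faces. -/
def step {n : ℕ} (s t : Faces n) (hst : s ≤ t) : Fin 2 →o Faces n where
  toFun := ![s, t]
  monotone' := by
    intro i j hij
    fin_cases i <;> fin_cases j <;> first | exact le_rfl | exact hst | exact absurd hij (by decide)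

/-- A single face. -/
def single {n : ℕ} (s : Faces n) : Fin 1 →o Faces n := OrderHom.const _ s

/-- The vertices of the standard `1`-simplex. -/
noncomputable abbrev vert (i : Fin 2) : stdS.{u} 0 ⟶ stdS.{u} 1 :=
  SSet.stdSimplex.map (SimplexCategory.δ i.rev)

/-- The faces of the standard `2`-simplex. -/
noncomputable abbrev side (i : Fin 3) : stdS.{u} 1 ⟶ stdS.{u} 2 :=
  SSet.stdSimplex.map (SimplexCategory.δ i)

noncomputable abbrev sdVert {n : ℕ} (s : Faces n) : stdS.{u} 0 ⟶ SSet.sd.obj (stdS.{u} n) :=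
  sdSimplex (single s)

noncomputable abbrev sdEdge {n : ℕ} (s t : Faces n) (h : s ≤ t) :
    stdS.{u} 1 ⟶ SSet.sd.obj (stdS.{u} n) :=
  sdSimplex (step s t h)

/-- The full face. -/
def top (n : ℕ) : Faces n := ⟨Finset.univ, Finset.univ_nonempty⟩

/-- A vertex as a face. -/
def pt {n : ℕ} (i : Fin (n + 1)) : Faces n := ⟨{i}, Finset.singleton_nonempty i⟩

theorem le_top' {n : ℕ} (s : Faces n) : s ≤ top n := Finset.subset_univ _

theorem vert_sdEdge {n : ℕ} (s t : Faces n) (h : s ≤ t) (i : Fin 2) :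
    vert.{u} i ≫ sdEdge s t h = sdVert (![s, t] i) := by
  rw [map_sdSimplex]
  congr 1
  ext j
  fin_cases i <;> fin_cases j <;> rfl

theorem side_tower {n : ℕ} (s t w : Faces n) (hst : s ≤ t) (htw : t ≤ w) :
    side.{u} 0 ≫ sdSimplex (tower s t w hst htw) = sdEdge t w htw ∧
    side.{u} 1 ≫ sdSimplex (tower s t w hst htw) = sdEdge s w (hst.trans htw) ∧
    side.{u} 2 ≫ sdSimplex (tower s t w hst htw) = sdEdge s t hst := by
  refine ⟨?_, ?_, ?_⟩ <;>
  · refine (map_sdSimplex _ _).trans (congrArg sdSimplex (OrderHom.ext _ _ (funext fun j => ?_)))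
    fin_cases j <;> rfl

theorem sdVert_map {m n : ℕ} (s : Faces m) (f : SimplexCategory.mk m ⟶ .mk n) :
    sdVert.{u} s ≫ SSet.sd.map (SSet.stdSimplex.map f) =
      sdVert (Faces.image f.toOrderHom s) :=
  (sdSimplex_map _ _).trans rfl

theorem sdEdge_map {m n : ℕ} (s t : Faces m) (h : s ≤ t) (f : SimplexCategory.mk m ⟶ .mk n) :
    sdEdge.{u} s t h ≫ SSet.sd.map (SSet.stdSimplex.map f) =
      sdEdge (Faces.image f.toOrderHom s) (Faces.image f.toOrderHom t)
        ((Faces.image f.toOrderHom).monotone h) := by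
  rw [sdSimplex_map]
  congr 1
  ext j
  fin_cases j <;> rfl

end Subdivision

section Trace

/-- Restriction of a map on an iterated subdivision. -/
noncomputable def pull {X Y T : SSet.{u}} (n : ℕ) (f : X ⟶ Y) (F : (sdIter n).obj Y ⟶ T) :
    (sdIter n).obj X ⟶ T :=
  (sdIter n).map f ≫ F

theorem pull_pull {X Y Z T : SSet.{u}} (n : ℕ) (f : X ⟶ Y) (g : Y ⟶ Z)
    (F : (sdIter n).obj Z ⟶ T) : pull n f (pull n g F) = pull n (f ≫ g) F := by
  rw [pull, pull, pull, ← Category.assoc, ← Functor.map_comp]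

variable {V W : Type u} {A : V → V → Prop} {B : W → W → Prop}

/-- The value at a point of a map from an iterated subdivision. -/
noncomputable def pointValue : (n : ℕ) →
    ((sdIter.{u} n).obj (stdS 0) ⟶ (flagC A).toSSet) → V
  | 0, F => (SSet.yonedaEquiv F).1 (0 : Fin 1)
  | n + 1, F => pointValue n (pull n (sdVert (top 0)) F)

/-- The walk traced by a map from an iterated subdivision of an edge. -/
noncomputable def trace : (n : ℕ) → ((sdIter.{u} n).obj (stdS 1) ⟶ (flagC A).toSSet) → List V
  | 0, F => [(SSet.yonedaEquiv F).1 (1 : Fin 2)]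
  -- The subdivision applied first to the edge is removed first. Edges of the subdivision run from
  -- smaller to larger faces, so the second half of the edge is traversed backwards.
  | n + 1, F => trace n (pull n (sdEdge (pt 0) (top 1) (le_top' _)) F) ++
      rev (pointValue n (pull n (sdVert (pt 1)) F))
        (trace n (pull n (sdEdge (pt 1) (top 1) (le_top' _)) F))

theorem pointValue_succ (n : ℕ) (F : (sdIter.{u} (n + 1)).obj (stdS 0) ⟶ (flagC A).toSSet) :
    pointValue (n + 1) F = pointValue n (pull n (sdVert (top 0)) F) := rfl

theorem pointValue_vert (n : ℕ) (F : (sdIter.{u} (n + 1)).obj (stdS 1) ⟶ (flagC A).toSSet)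
    (i : Fin 2) : pointValue (n + 1) (pull (n + 1) (vert i) F) =
      pointValue n (pull n (sdVert (pt i)) F) := by
  rw [pointValue_succ]
  congr 1
  refine (pull_pull n (sdVert (top 0)) (SSet.sd.map (vert i)) F).trans ?_
  rw [sdVert_map]
  congr 2
  fin_cases i <;> rfl

theorem yoneda_map {m n : ℕ} (θ : SimplexCategory.mk m ⟶ .mk n)
    (F : stdS.{u} n ⟶ (flagC A).toSSet) :
    (SSet.yonedaEquiv (SSet.stdSimplex.map θ ≫ F)).1 =
      (SSet.yonedaEquiv F).1 ∘ θ.toOrderHom := by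
  rw [← SSet.yonedaEquiv_naturality]
  rfl

theorem trace_spec (hA : IsAdj A) (n : ℕ) (F : (sdIter.{u} n).obj (stdS 1) ⟶ (flagC A).toSSet) :
    Walk A (pointValue n (pull n (vert 0) F)) (trace n F) ∧
      tgt (pointValue n (pull n (vert 0) F)) (trace n F) =
        pointValue n (pull n (vert 1) F) := by
  induction n with
  | zero =>
    have h := (SSet.yonedaEquiv F).2
    have h0 : ∀ i, pointValue 0 (pull 0 (vert i) F) = (SSet.yonedaEquiv F).1 i := by
      intro i
      refine (congrFun (yoneda_map (SimplexCategory.δ i.rev) F) (0 : Fin 1)).trans ?_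
      fin_cases i <;> rfl
    rw [h0, h0]
    exact ⟨⟨h (0 : Fin 2) (1 : Fin 2), h (1 : Fin 2) (1 : Fin 2)⟩, rfl⟩
  | succ n ih =>
    rw [pointValue_vert, pointValue_vert, trace]
    change (sdIter n).obj (SSet.sd.obj (stdS 1)) ⟶ _ at F
    have h1 := ih (pull n (sdEdge (pt 0) (top 1) (le_top' _)) F)
    have h2 := ih (pull n (sdEdge (pt 1) (top 1) (le_top' _)) F)
    simp only [pull_pull, vert_sdEdge, Matrix.cons_val_zero, Matrix.cons_val_one] at h1 h2
    have h3 := h2.1.rev hA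
    rw [h2.2] at h3
    refine ⟨h1.1.append ?_, ?_⟩
    · rw [h1.2]; exact h3
    · rw [tgt_append, h1.2]
      exact (congrArg (fun z => tgt z _) h2.2.symm).trans (tgt_rev _ _)

theorem Ht.rev (hA : IsAdj A) {a : V} {l l' : List V} (h : Ht A a l l') :
    Ht A (tgt a l) (rev a l) (SigmaTwo.rev a l') := by
  have hw := h.walks
  have h1 : Ht A (tgt a l) (SigmaTwo.rev a l ++ (l' ++ SigmaTwo.rev a l'))
      (SigmaTwo.rev a l ++ []) :=
    Ht.append_left (hw.1.rev hA) (by rw [tgt_rev]; exact Ht.append_rev hA hw.2)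
  have h2 : Ht A (tgt a l) (SigmaTwo.rev a l ++ l) (SigmaTwo.rev a l ++ l') :=
    Ht.append_left (hw.1.rev hA) (by rwa [tgt_rev])
  have h3 := (h2.symm.trans (Ht.rev_append hA hw.1)).append_right hA (m := SigmaTwo.rev a l') (by
    rw [tgt_append, tgt_rev]; exact hw.2.rev hA)
  rw [List.append_nil] at h1
  rw [List.append_assoc] at h3
  exact h1.symm.trans h3

/-- A side of a subdivided triangle runs from one corner to its midpoint `f` and on to the other
corner. -/
theorem trace_side (n : ℕ) (F : (sdIter.{u} n).obj (SSet.sd.obj (stdS 2)) ⟶ (flagC A).toSSet)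
    (k : Fin 3) {i j : Fin 3} {f : Faces 2} (hi : Faces.image (SimplexCategory.δ k).toOrderHom (pt 0) = pt i)
    (hj : Faces.image (SimplexCategory.δ k).toOrderHom (pt 1) = pt j)
    (hf : Faces.image (SimplexCategory.δ k).toOrderHom (top 1) = f) (hif : pt i ≤ f)
    (hjf : pt j ≤ f) :
    trace (n + 1) (pull (n + 1) (side k) F) = trace n (pull n (sdEdge (pt i) f hif) F) ++
      rev (pointValue n (pull n (sdVert (pt j)) F)) (trace n (pull n (sdEdge (pt j) f hjf) F)) := by
  subst hf
  have e : ∀ (X : SSet.{u}) (α : X ⟶ SSet.sd.obj (stdS 1)),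
      pull n α (pull (n + 1) (side k) F) = pull n (α ≫ SSet.sd.map (side k)) F := fun X α =>
    pull_pull n α (SSet.sd.map (side k)) F
  change trace n (pull n _ (pull (n + 1) (side k) F)) ++ rev (pointValue n (pull n _
    (pull (n + 1) (side k) F))) (trace n (pull n _ (pull (n + 1) (side k) F))) = _
  rw [e, e, e, sdEdge_map, sdEdge_map, sdVert_map]
  simp only [hi, hj]

/-- The walks traced by the sides of a triangle. -/
theorem trace_triangle (hA : IsAdj A) (n : ℕ)
    (F : (sdIter.{u} n).obj (stdS 2) ⟶ (flagC A).toSSet) :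
    Ht A (pointValue n (pull n (vert 0) (pull n (side 2) F)))
      (trace n (pull n (side 2) F) ++ trace n (pull n (side 0) F)) (trace n (pull n (side 1) F)) := by
  induction n with
  | zero =>
    have h := (SSet.yonedaEquiv F).2
    have h0 : ∀ k, trace 0 (pull 0 (side k) F) =
        [(SSet.yonedaEquiv F).1 ((SimplexCategory.δ k).toOrderHom (1 : Fin 2))] := fun k =>
      congrArg (fun z => [z]) (congrFun (yoneda_map (SimplexCategory.δ k) F) (1 : Fin 2))
    have h1 : pointValue 0 (pull 0 (vert 0) (pull 0 (side 2) F)) =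
        (SSet.yonedaEquiv F).1 (0 : Fin 3) := by
      refine (congrFun (yoneda_map (SimplexCategory.δ 1) (side 2 ≫ F)) (0 : Fin 1)).trans ?_
      exact congrFun (yoneda_map (SimplexCategory.δ 2) F) (0 : Fin 2)
    rw [h0, h0, h0, h1]
    exact Ht.tri (h (0 : Fin 3) (1 : Fin 3)) (h (1 : Fin 3) (2 : Fin 3)) (h (0 : Fin 3) (2 : Fin 3))
      (h (2 : Fin 3) (2 : Fin 3))
  | succ n ih =>
    change (sdIter n).obj (SSet.sd.obj (stdS 2)) ⟶ _ at F
    let v : Faces 2 → V := fun s => pointValue n (pull n (sdVert s) F)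
    let E : ∀ s t : Faces 2, s ≤ t → List V := fun s t h => trace n (pull n (sdEdge s t h) F)
    have hE : ∀ s t h, Walk A (v s) (E s t h) ∧ tgt (v s) (E s t h) = v t := by
      intro s t h
      have := trace_spec hA n (pull n (sdEdge s t h) F)
      simp only [pull_pull, vert_sdEdge] at this
      exact this
    -- The induction hypothesis for each small triangle, that is, for each chain of three faces.
    have htri : ∀ s t w hst htw, Ht A (v s) (E s t hst ++ E t w htw) (E s w (hst.trans htw)) := by
      intro s t w hst htw
      have := ih (pull n (sdSimplex (tower s t w hst htw)) F)
      obtain ⟨e0, e1, e2⟩ := side_tower s t w hst htw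
      rw [pull_pull n (side 2), pull_pull n (side 0), pull_pull n (side 1), e0, e1, e2, pull_pull,
        vert_sdEdge] at this
      exact this
    have hrev : ∀ s t h, Walk A (v t) (rev (v s) (E s t h)) ∧
        tgt (v t) (rev (v s) (E s t h)) = v s := by
      intro s t h
      obtain ⟨h1, h2⟩ := hE s t h
      have h3 := h1.rev hA
      rw [h2] at h3
      refine ⟨h3, ?_⟩
      rw [← h2, tgt_rev]
    -- Two small triangles, one at each half of the side, replace the midpoint by the barycenter of
    -- the triangle.
    have hface : ∀ i j f (hi : pt i ≤ f) (hj : pt j ≤ f),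
        Ht A (v (pt i)) (E (pt i) f hi ++ rev (v (pt j)) (E (pt j) f hj))
          (E (pt i) (top 2) (le_top' _) ++ rev (v (pt j)) (E (pt j) (top 2) (le_top' _))) := by
      intro i j f hi hj
      have h1 := htri (pt i) f (top 2) hi (le_top' _)
      have h2 := (htri (pt j) f (top 2) hj (le_top' _)).rev hA
      rw [tgt_append, (hE _ _ _).2, (hE _ _ _).2, SigmaTwo.rev_append, (hE _ _ _).2] at h2
      have h3 := h1.append hA (by rw [tgt_append, (hE _ _ _).2, (hE _ _ _).2]; exact h2)
      refine Ht.trans ?_ h3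
      rw [List.append_assoc, ← List.append_assoc (E f (top 2) _)]
      refine Ht.append_left (hE _ _ _).1 ?_
      rw [(hE _ _ _).2]
      have h4 := (Ht.append_rev hA (hE f (top 2) (le_top' _)).1).append_right hA
        (m := rev (v (pt j)) (E (pt j) f hj)) (by
          rw [tgt_append, tgt_rev]; exact (hrev _ _ _).1)
      exact h4.symm
    have s2 := trace_side n F 2 (i := 0) (j := 1) (f := ⟨{0, 1}, by simp⟩) (by decide) (by decide)
      (by decide) (by decide) (by decide)
    have s0 := trace_side n F 0 (i := 1) (j := 2) (f := ⟨{1, 2}, by simp⟩) (by decide) (by decide)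
      (by decide) (by decide) (by decide)
    have s1 := trace_side n F 1 (i := 0) (j := 2) (f := ⟨{0, 2}, by simp⟩) (by decide) (by decide)
      (by decide) (by decide) (by decide)
    have hs : pointValue (n + 1) (pull (n + 1) (vert 0) (pull (n + 1) (side 2) F)) = v (pt 0) := by
      rw [pointValue_vert]
      have : pull n (sdVert (pt 0)) (pull (n + 1) (side 2) F) =
          pull n (sdVert (pt 0) ≫ SSet.sd.map (side 2)) F :=
        pull_pull n (sdVert (pt 0)) (SSet.sd.map (side 2)) F
      rw [this, sdVert_map]
      rfl
    rw [s2, s0, s1, hs]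
    -- With all sides routed through the barycenter, the way from it to the middle corner and back
    -- cancels.
    refine Ht.trans ((hface 0 1 _ _ _).append hA
      (m' := E (pt 1) (top 2) (le_top' _) ++ rev (v (pt 2)) (E (pt 2) (top 2) (le_top' _))) ?_)
      (Ht.trans ?_ (hface 0 2 _ _ _).symm)
    · rw [tgt_append, (hE _ _ _).2, (hrev _ _ _).2]
      exact hface 1 2 _ _ _
    · rw [List.append_assoc, ← List.append_assoc (rev (v (pt 1)) _)]
      refine Ht.append_left (hE _ _ _).1 ?_
      rw [(hE _ _ _).2]
      have h5 := (Ht.rev_append hA (hE (pt 1) (top 2) (le_top' _)).1).append_right hA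
        (m := rev (v (pt 2)) (E (pt 2) (top 2) (le_top' _))) (by
          rw [tgt_append, tgt_rev, (hE _ _ _).2]; exact (hrev _ _ _).1)
      rw [(hE _ _ _).2] at h5
      exact h5

end Trace
end SigmaTwo

namespace SigmaTwo

/-! ### Certificates from equivariant maps -/

/-! ### Naturality of traces -/

section Trace

variable {V W : Type u} {A : V → V → Prop} {B : W → W → Prop}

theorem pull_comp {X Y T T' : SSet.{u}} (n : ℕ) (f : X ⟶ Y) (F : (sdIter n).obj Y ⟶ T)
    (g : T ⟶ T') : pull n f (F ≫ g) = pull n f F ≫ g := (Category.assoc _ _ _).symm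

theorem pointValue_comp (f : (flagC A).toSSet ⟶ (flagC B).toSSet) (h : V → W)
    (hf : ∀ d s, (f.app d s).1 = h ∘ s.1) (n : ℕ)
    (F : (sdIter.{u} n).obj (stdS 0) ⟶ (flagC A).toSSet) :
    pointValue n (F ≫ f) = h (pointValue n F) := by
  induction n with
  | zero => exact congrFun (hf _ (SSet.yonedaEquiv F)) (0 : Fin 1)
  | succ n ih => exact ih (pull n (sdVert (top 0)) F)

theorem trace_comp (f : (flagC A).toSSet ⟶ (flagC B).toSSet) (h : V → W)
    (hf : ∀ d s, (f.app d s).1 = h ∘ s.1) (n : ℕ)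
    (F : (sdIter.{u} n).obj (stdS 1) ⟶ (flagC A).toSSet) :
    trace n (F ≫ f) = (trace n F).map h := by
  induction n with
  | zero => exact congrArg (fun z => [z]) (congrFun (hf _ (SSet.yonedaEquiv F)) (1 : Fin 2))
  | succ n ih =>
    change trace n (pull n (sdEdge (pt 0) (top 1) (le_top' _)) F ≫ f) ++
      rev (pointValue n (pull n (sdVert (pt 1)) F ≫ f))
        (trace n (pull n (sdEdge (pt 1) (top 1) (le_top' _)) F ≫ f)) = _
    rw [ih, ih, pointValue_comp f h hf, rev_map, ← List.map_append]
    rfl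

end Trace

/-! ### Strict certificates and the uniform gain -/

section Strict

variable {G : Type u} [Group G] {r : ℕ} {x : Fin r → G} {χ : G →* Multiplicative ℝ} {K : ℕ}

/-- Like `Certificate`, with strict inequalities in place of a bound for the gain. -/
structure StrictCertificate (x : Fin r → G) (K : ℕ) (χ : G →* Multiplicative ℝ) (t : G)
    (m : G → List G) : Prop where
  walk : ∀ g, wordLength x g ≤ K → Walk (vrAdj x {a | min 0 (chi χ g) < chi χ a} K) t (m g)
  tgt : ∀ g, wordLength x g ≤ K → tgt t (m g) = g * t
  tri : ∀ g h, wordLength x g ≤ K → wordLength x h ≤ K → wordLength x (g⁻¹ * h) ≤ K →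
    Ht (vrAdj x {a | min 0 (min (chi χ g) (chi χ h)) < chi χ a} K) t
      (m g ++ (m (g⁻¹ * h)).map (g * ·)) (m h)

theorem vrAdj_gain_mono (L : ℝ) (m n : ℕ) (hmn : m ≤ n) (a b : G)
    (h : vrAdj x (halfSpace χ (1 / ((m : ℝ) + 1) + L)) K a b) :
    vrAdj x (halfSpace χ (1 / ((n : ℝ) + 1) + L)) K a b := by
  refine vrAdj_mono x (halfSpace_mono ?_) le_rfl _ _ h
  have : (m : ℝ) ≤ n := by exact_mod_cast hmn
  gcongr

/-- An open half space is the increasing union of the closed ones at levels L + 1/(n+1). -/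
theorem exists_gain (L : ℝ) (a b : G) (h : vrAdj x {a | L < chi χ a} K a b) :
    ∃ n : ℕ, vrAdj x (halfSpace χ (1 / ((n : ℝ) + 1) + L)) K a b := by
  have h1 : L < chi χ a := h.1
  have h2 : L < chi χ b := h.2.1
  obtain ⟨n, hn⟩ := exists_nat_one_div_lt (show 0 < min (chi χ a - L) (chi χ b - L) from
    lt_min (by linarith) (by linarith))
  have h3 := min_le_left (chi χ a - L) (chi χ b - L)
  have h4 := min_le_right (chi χ a - L) (chi χ b - L)
  exact ⟨n, show _ ≤ chi χ a by linarith, show _ ≤ chi χ b by linarith, h.2.2⟩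

/-- Each walk and each homotopy involves finitely many vertices and so has a positive gain; the ball
of radius `K` is finite, so the smallest gain serves for all. -/
theorem StrictCertificate.exists_certificate (hx : Subgroup.closure (Set.range x) = ⊤) {t : G}
    {m : G → List G} (h : StrictCertificate x K χ t m) :
    ∃ δ > 0, Certificate x K χ δ t m := by
  have h1 : ∀ g, ∃ n : ℕ, wordLength x g ≤ K →
      Walk (vrAdj x (halfSpace χ (1 / ((n : ℝ) + 1) + min 0 (chi χ g))) K) t (m g) := by
    intro g
    by_cases hg : wordLength x g ≤ K
    · obtain ⟨n, hn⟩ := Walk.exists_of_directed (vrAdj_gain_mono (x := x) (χ := χ) _)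
        (Walk.mono (exists_gain _) (h.walk g hg))
      exact ⟨n, fun _ => hn⟩
    · exact ⟨0, fun h => absurd h hg⟩
  have h2 : ∀ g k, ∃ n : ℕ, wordLength x g ≤ K → wordLength x k ≤ K →
      wordLength x (g⁻¹ * k) ≤ K →
      Ht (vrAdj x (halfSpace χ (1 / ((n : ℝ) + 1) + min 0 (min (chi χ g) (chi χ k)))) K) t
        (m g ++ (m (g⁻¹ * k)).map (g * ·)) (m k) := by
    intro g k
    by_cases hg : wordLength x g ≤ K ∧ wordLength x k ≤ K ∧ wordLength x (g⁻¹ * k) ≤ K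
    · obtain ⟨n, hn⟩ := Ht.exists_of_directed (vrAdj_gain_mono (x := x) (χ := χ) _)
        (Ht.mono (exists_gain _) (h.tri g k hg.1 hg.2.1 hg.2.2))
      exact ⟨n, fun _ _ _ => hn⟩
    · exact ⟨0, fun a b c => absurd ⟨a, b, c⟩ hg⟩
  choose n hn using h1
  choose n' hn' using h2
  obtain ⟨N, hN⟩ := ((finite_ball hx K).image n).bddAbove
  obtain ⟨N', hN'⟩ := (((finite_ball hx K).prod (finite_ball hx K)).image
    fun z => n' z.1 z.2).bddAbove
  refine ⟨1 / (((N + N' : ℕ) : ℝ) + 1), by positivity, fun g hg => ?_, h.tgt, fun g k hg hk hgk => ?_⟩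
  · exact (hn g hg).mono (vrAdj_gain_mono _ _ _ ((hN ⟨g, hg, rfl⟩).trans (by omega)))
  · exact (hn' g k hg hk hgk).mono
      (vrAdj_gain_mono _ _ _ ((hN' ⟨(g, k), ⟨hg, hk⟩, rfl⟩).trans (by omega)))

end Strict

/-! ### Walks and homotopies traced by an equivariant map -/

section Equivariant

variable {G : Type u} [Group G] {r : ℕ} {x : Fin r → G} {χ : G →* Multiplicative ℝ} {K : ℕ}

/-- A simplex of dimension at most `2`, as a map to the `2`-skeleton. -/
def skelSimplex {q : ℕ} (hq : q < 3) (s : (ripsG x K).obj (op (.mk q))) :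
    stdS q ⟶ ripsSkeleton2 x K :=
  SSet.yonedaEquiv.symm ⟨s, SSet.mem_skeleton _ s hq⟩

theorem map_skelSimplex {p q : ℕ} (hp : p < 3) (hq : q < 3) (s : (ripsG x K).obj (op (.mk q)))
    (θ : SimplexCategory.mk p ⟶ .mk q) :
    SSet.stdSimplex.map θ ≫ skelSimplex hq s = skelSimplex hp ((ripsG x K).map θ.op s) :=
  SSet.yonedaEquiv_symm_naturality_left _ _

theorem skelSimplex_translate {q : ℕ} (hq : q < 3) (s : (ripsG x K).obj (op (.mk q))) (g : G) :
    skelSimplex hq s ≫ skeletonMap (translate x K g) 3 =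
      skelSimplex hq ((translate x K g).app _ s) :=
  SSet.yonedaEquiv_symm_comp _ _

/-- The inclusion of the Rips complex in a flag complex. -/
def toFlag (x : Fin r → G) (S : Set G) (k : ℕ) :
    (vietorisRips x S k).toSSet ⟶ (flagC (vrAdj x S k)).toSSet :=
  SSet.Subcomplex.homOfLE (vietorisRips_eq x S k).le

/-- The simplices of the Rips complex given by their vertices. -/
def ripsSimplex {q : ℕ} (s : Fin (q + 1) → G) (hs : ∀ i j, wordDist x (s i) (s j) ≤ K) :
    (ripsG x K).obj (op (.mk q)) :=
  ⟨s, fun _ => Set.mem_univ _, hs⟩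

theorem simplexVal_le (χ : G →* Multiplicative ℝ) {q : ℕ} (s : Fin (q + 1) → G) (i : Fin (q + 1)) :
    simplexVal χ s ≤ chi χ (s i) :=
  Finset.inf'_le _ (Finset.mem_univ i)

/-- The image of a simplex under a map which raises the valuation. -/
theorem exists_lift (φ : SubdMap (ripsSkeleton2 x K) (ripsG x K)) (hr : RaisesValuation x K χ φ)
    (s : (ripsG x K).obj (op (.mk 2))) :
    ∃ F : (sdIter φ.n).obj (stdS 2) ⟶
        (flagC (vrAdj x {a | simplexVal χ (q := 2) s.1 < chi χ a} K)).toSSet,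
      ∃ ι : (flagC (vrAdj x {a | simplexVal χ (q := 2) s.1 < chi χ a} K)).toSSet ⟶
        (flagC (vrAdj x Set.univ K)).toSSet, (∀ d z, (ι.app d z).1 = id ∘ z.1) ∧
      F ≫ ι = pull φ.n (skelSimplex (by omega) s) (φ.hom ≫ toFlag x Set.univ K) := by
  have hle : flagC (vrAdj x {a | simplexVal χ (q := 2) s.1 < chi χ a} K) ≤
      flagC (vrAdj x Set.univ K) := fun d z hz i j =>
    vrAdj_mono x (Set.subset_univ _) le_rfl _ _ (hz i j)
  refine ⟨SSet.Subcomplex.lift (pull φ.n (skelSimplex (by omega) s) φ.hom ≫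
    (vietorisRips x Set.univ K).ι) ?_, SSet.Subcomplex.homOfLE hle, fun d z => rfl, rfl⟩
  rintro d _ ⟨τ, rfl⟩ i j
  have h := hr s d.unop.len τ
  have h' := fun i => h.trans_le (simplexVal_le χ (q := d.unop.len)
    ((φ.precomp (simplexMap x K s)).hom.app (op (.mk d.unop.len)) τ).1 i)
  exact ⟨h' i, h' j, ((φ.precomp (simplexMap x K s)).hom.app (op (.mk d.unop.len)) τ).2.2 i j⟩

theorem exists_translate (φ : SubdMap (ripsSkeleton2 x K) (ripsG x K))
    (he : IsEquivariant x K φ) {q : ℕ} (hq : q < 3) (s : (ripsG x K).obj (op (.mk q))) (g : G) :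
    ∃ τ : (flagC (vrAdj x Set.univ K)).toSSet ⟶ (flagC (vrAdj x Set.univ K)).toSSet,
      (∀ d z, (τ.app d z).1 = (g * ·) ∘ z.1) ∧
      pull φ.n (skelSimplex hq ((translate x K g).app _ s)) (φ.hom ≫ toFlag x Set.univ K) =
        pull φ.n (skelSimplex hq s) (φ.hom ≫ toFlag x Set.univ K) ≫ τ := by
  have h1 := he g
  have h2 : (sdIter φ.n).map (skeletonMap (translate x K g) 3) ≫ φ.hom =
      φ.hom ≫ translate x K g := by
    simpa [SubdMap.precomp, SubdMap.postcomp] using h1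
  refine ⟨{ app := fun d => ↾ fun z => ⟨fun i => g * z.1 i, fun i j =>
    ⟨Set.mem_univ _, Set.mem_univ _, by rw [wordDist_mul_left]; exact (z.2 i j).2.2⟩⟩ },
    fun d z => rfl, ?_⟩
  rw [← skelSimplex_translate, ← pull_pull]
  change pull _ _ ((sdIter φ.n).map _ ≫ φ.hom ≫ _) = _
  rw [reassoc_of% h2]
  rfl

/-- Take for t the value at the vertex 1 and for m(g) the trace of the edge (1, g). Equivariance
holds on the nose, so traces of translated edges are translated traces; the 2-simplices (1, g, h)
supply the homotopies. -/
theorem exists_strictCertificate (φ : SubdMap (ripsSkeleton2 x K) (ripsG x K))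
    (he : IsEquivariant x K φ) (hr : RaisesValuation x K χ φ) :
    ∃ t m, StrictCertificate x K χ t m := by
  classical
  have hA := fun S => vrAdj_isAdj x S K
  let Φ := φ.hom ≫ toFlag x Set.univ K
  have hd1 : ∀ {a b : G}, wordDist x a b ≤ K →
      ∀ i j, wordDist x (![a, b] i) (![a, b] j) ≤ K := by
    intro a b h i j
    have h' := h
    rw [wordDist_comm] at h'
    fin_cases i <;> fin_cases j <;> simp [wordDist_self, h, h']
  have hd2 : ∀ {a b c : G}, wordDist x a b ≤ K → wordDist x b c ≤ K → wordDist x a c ≤ K →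
      ∀ i j, wordDist x (![a, b, c] i) (![a, b, c] j) ≤ K := by
    intro a b c h1 h2 h3 i j
    have h1' := h1
    have h2' := h2
    have h3' := h3
    rw [wordDist_comm] at h1' h2' h3'
    fin_cases i <;> fin_cases j <;> simp [wordDist_self, h1, h2, h3, h1', h2', h3']
  let P : G → G := fun a => pointValue φ.n (pull φ.n (skelSimplex (q := 0) (by omega)
    (ripsSimplex ![a] (fun _ _ => by simp [wordDist_self]))) Φ)
  let E : ∀ a b : G, wordDist x a b ≤ K → List G := fun a b h =>
    trace φ.n (pull φ.n (skelSimplex (q := 1) (by omega) (ripsSimplex ![a, b] (hd1 h))) Φ)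
  have hP : ∀ a, P a = a * P 1 := by
    intro a
    obtain ⟨τ, hτ, h⟩ := exists_translate φ he (q := 0) (by omega)
      (ripsSimplex ![1] (fun _ _ => by simp [wordDist_self])) a
    have := pointValue_comp τ (a * ·) hτ φ.n (pull φ.n (skelSimplex (q := 0) (by omega)
      (ripsSimplex ![1] (fun _ _ => by simp [wordDist_self]))) Φ)
    rw [← h, show (translate x K a).app _ (ripsSimplex ![1] _) = ripsSimplex ![a]
      (fun _ _ => by simp [wordDist_self]) from Subtype.ext (funext fun i => by
        fin_cases i; exact mul_one a)] at this
    exact this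
  have hE : ∀ g a b (h : wordDist x a b ≤ K) (h' : wordDist x (g * a) (g * b) ≤ K),
      E (g * a) (g * b) h' = (E a b h).map (g * ·) := by
    intro g a b hab hab'
    obtain ⟨τ, hτ, h⟩ := exists_translate φ he (q := 1) (by omega) (ripsSimplex ![a, b] (hd1 hab)) g
    have := trace_comp τ (g * ·) hτ φ.n (pull φ.n (skelSimplex (q := 1) (by omega)
      (ripsSimplex ![a, b] (hd1 hab))) Φ)
    rw [← h, show (translate x K g).app _ (ripsSimplex ![a, b] (hd1 hab)) =
      ripsSimplex ![g * a, g * b] (hd1 hab') from Subtype.ext (funext fun i => by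
        fin_cases i <;> rfl)] at this
    exact this
  have key : ∀ a b c (hab : wordDist x a b ≤ K) (hbc : wordDist x b c ≤ K)
      (hac : wordDist x a c ≤ K),
      Walk (vrAdj x {z | min (chi χ a) (min (chi χ b) (chi χ c)) < chi χ z} K) (P a) (E a b hab) ∧
      tgt (P a) (E a b hab) = P b ∧
      Ht (vrAdj x {z | min (chi χ a) (min (chi χ b) (chi χ c)) < chi χ z} K) (P a)
        (E a b hab ++ E b c hbc) (E a c hac) := by
    intro a b c hab hbc hac
    obtain ⟨F, ι, hι, hF⟩ := exists_lift φ hr (ripsSimplex ![a, b, c] (hd2 hab hbc hac))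
    have hv : {z | simplexVal χ (q := 2) (ripsSimplex ![a, b, c] (hd2 hab hbc hac)).1 < chi χ z} ⊆
        {z | min (chi χ a) (min (chi χ b) (chi χ c)) < chi χ z} := by
      intro z hz
      refine lt_of_le_of_lt ?_ (show simplexVal χ (q := 2) ![a, b, c] < chi χ z from hz)
      refine Finset.le_inf' _ _ fun i _ => ?_
      fin_cases i
      · exact min_le_left _ _
      · exact (min_le_right _ _).trans (min_le_left _ _)
      · exact (min_le_right _ _).trans (min_le_right _ _)
    have e : ∀ {p : ℕ} (hp : p < 3) (θ : SimplexCategory.mk p ⟶ .mk 2),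
        pull φ.n (SSet.stdSimplex.map θ) F ≫ ι = pull φ.n (skelSimplex hp
          ((ripsG x K).map θ.op (ripsSimplex ![a, b, c] (hd2 hab hbc hac)))) Φ := by
      intro p hp θ
      rw [← pull_comp, hF, pull_pull, map_skelSimplex hp]
    have hside : ∀ (k : Fin 3) (a' b' : G) (h : wordDist x a' b' ≤ K),
        ![a, b, c] ∘ (SimplexCategory.δ k).toOrderHom = ![a', b'] →
        trace φ.n (pull φ.n (side k) F) = E a' b' h := by
      intro k a' b' h hk
      have h1 := trace_comp ι id hι φ.n (pull φ.n (side k) F)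
      rw [List.map_id, e (by omega), show (ripsG x K).map (SimplexCategory.δ k).op
        (ripsSimplex ![a, b, c] (hd2 hab hbc hac)) = ripsSimplex ![a', b'] (hd1 h) from
        Subtype.ext hk] at h1
      exact h1.symm
    have hvert : ∀ (k : Fin 3) (i : Fin 2) (a' : G),
        ![a, b, c] ∘ (SimplexCategory.δ k).toOrderHom ∘ (SimplexCategory.δ i.rev).toOrderHom =
          ![a'] →
        pointValue φ.n (pull φ.n (vert i) (pull φ.n (side k) F)) = P a' := by
      intro k i a' hk
      have h1 := pointValue_comp ι id hι φ.n (pull φ.n (vert i) (pull φ.n (side k) F))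
      have hvs : vert i ≫ side k = SSet.stdSimplex.map
          (SimplexCategory.δ i.rev ≫ SimplexCategory.δ k) := (SSet.stdSimplex.map_comp _ _).symm
      rw [pull_pull, hvs, e (by omega), show (ripsG x K).map
        (SimplexCategory.δ i.rev ≫ SimplexCategory.δ k).op
        (ripsSimplex ![a, b, c] (hd2 hab hbc hac)) = ripsSimplex ![a']
          (fun _ _ => by simp [wordDist_self]) from Subtype.ext hk] at h1
      rw [pull_pull, hvs]
      exact h1.symm
    have s2 := hside 2 a b hab (by funext i; fin_cases i <;> rfl)
    have s0 := hside 0 b c hbc (by funext i; fin_cases i <;> rfl)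
    have s1 := hside 1 a c hac (by funext i; fin_cases i <;> rfl)
    have v0 := hvert 2 0 a (by funext i; fin_cases i; rfl)
    have v1 := hvert 2 1 b (by funext i; fin_cases i; rfl)
    have h1 := trace_spec (hA _) φ.n (pull φ.n (side 2) F)
    have h2 := trace_triangle (hA _) φ.n F
    rw [v0, v1, s2] at h1
    rw [v0, s2, s0, s1] at h2
    exact ⟨h1.1.mono (vrAdj_mono x hv le_rfl), h1.2, h2.mono (vrAdj_mono x hv le_rfl)⟩
  have hone : ∀ g, wordDist x 1 g = wordLength x g := fun g => by simp [wordDist]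
  let m : G → List G := fun g =>
    if h : wordLength x g ≤ K then E 1 g ((hone g).le.trans h) else []
  have hm : ∀ g (h : wordLength x g ≤ K), m g = E 1 g ((hone g).le.trans h) := fun g h => dif_pos h
  refine ⟨P 1, m, ⟨fun g hg => ?_, fun g hg => ?_, fun g h hg hh hgh => ?_⟩⟩
  -- The hypothesis on valuations concerns 2-simplices only; the edge (1, g) is treated as a side of
  -- the degenerate triangle (1, g, g).
  · have := (key 1 g g ((hone g).le.trans hg) (by rw [wordDist_self]; exact Nat.zero_le K)
      ((hone g).le.trans hg)).1
    rw [hm g hg]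
    simpa using this
  · have := (key 1 g g ((hone g).le.trans hg) (by rw [wordDist_self]; exact Nat.zero_le K)
      ((hone g).le.trans hg)).2.1
    rw [hm g hg, this, hP]
  · have h1 := (key 1 g h ((hone g).le.trans hg) hgh ((hone h).le.trans hh)).2.2
    have h2 := hE g 1 (g⁻¹ * h) ((hone _).le.trans hgh) (by rw [wordDist_mul_left, hone]; exact hgh)
    simp only [mul_one, mul_inv_cancel_left] at h2
    rw [hm g hg, hm h hh, hm _ hgh, ← h2]
    simpa using h1

end Equivariant

end SigmaTwo

namespace SigmaTwo

/-! ### Gluing maps on iterated subdivisions -/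

section Glue

/-- The right adjoint of iterated subdivision. -/
noncomputable def exIter : ℕ → (SSet.{u} ⥤ SSet.{u})
  | 0 => 𝟭 _
  | n + 1 => exIter n ⋙ SSet.ex

/-- Iterated subdivision is left adjoint to the iterated extension functor. -/
noncomputable def sdExIter : (n : ℕ) → (sdIter.{u} n ⊣ exIter n)
  | 0 => Adjunction.id
  | n + 1 => SSet.sdExAdjunction.comp (sdExIter n)

variable {X Y T : SSet.{u}} {n : ℕ}

theorem pull_id (F : (sdIter n).obj Y ⟶ T) : pull n (𝟙 Y) F = F := by
  rw [pull, CategoryTheory.Functor.map_id, Category.id_comp]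

theorem pull_map_comp {a b c : ℕ} (f : SimplexCategory.mk a ⟶ .mk b) (g : SimplexCategory.mk b ⟶ .mk c)
    (F : (sdIter n).obj (stdS c) ⟶ T) : pull n (SSet.stdSimplex.map (f ≫ g)) F =
      pull n (SSet.stdSimplex.map f) (pull n (SSet.stdSimplex.map g) F) := by
  rw [pull_pull]
  exact congrArg (fun z => pull n z F) (SSet.stdSimplex.map_comp f g)

theorem pull_map_id {a : ℕ} (F : (sdIter n).obj (stdS a) ⟶ T) :
    pull n (SSet.stdSimplex.map (𝟙 (SimplexCategory.mk a))) F = F :=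
  (congrArg (fun z => pull n z F) (SSet.stdSimplex.map_id _)).trans (pull_id F)

theorem homEquiv_pull (f : X ⟶ Y) (F : (sdIter n).obj Y ⟶ T) :
    (sdExIter n).homEquiv X T (pull n f F) = f ≫ (sdExIter n).homEquiv Y T F :=
  (sdExIter n).homEquiv_naturality_left f F

/-- Maps on an iterated subdivision are determined by their restrictions to simplices. -/
theorem sdIter_hom_ext {F F' : (sdIter n).obj Y ⟶ T}
    (h : ∀ (d : ℕ) (y : Y.nonDegenerate d),
      pull n (SSet.yonedaEquiv.symm y.1) F = pull n (SSet.yonedaEquiv.symm y.1) F') : F = F' := by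
  apply ((sdExIter n).homEquiv Y T).injective
  refine NatTrans.ext (funext fun d => ?_)
  ext y
  obtain ⟨m, f, _, z, rfl⟩ := Y.exists_nonDegenerate (n := d.unop.len) y
  have h1 := congrArg ((sdExIter n).homEquiv _ T) (h m z)
  rw [homEquiv_pull, homEquiv_pull] at h1
  have h2 := congrArg (fun g => SSet.stdSimplex.map f ≫ g) h1
  simp only [← Category.assoc, SSet.yonedaEquiv_symm_naturality_left] at h2
  have h3 := congrArg SSet.yonedaEquiv h2
  rw [SSet.yonedaEquiv_symm_comp, SSet.yonedaEquiv_symm_comp] at h3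
  exact SSet.yonedaEquiv.symm.injective (SSet.yonedaEquiv.injective h3)

/-- Compatible maps on the subdivisions of the simplices define a map. -/
theorem exists_glue (L : ∀ d : ℕ, Y.obj (op (.mk d)) → ((sdIter n).obj (stdS d) ⟶ T))
    (hL : ∀ (c d : ℕ) (θ : SimplexCategory.mk c ⟶ .mk d) (y : Y.obj (op (.mk d))),
      L c (Y.map θ.op y) = pull n (SSet.stdSimplex.map θ) (L d y)) :
    ∃ F : (sdIter n).obj Y ⟶ T, ∀ d y, pull n (SSet.yonedaEquiv.symm y) F = L d y := by
  -- By adjunction, a map on the subdivision is a map from `Y` to the iterated extension of `T`, and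
  -- such a map is a natural family of simplices.
  let g : Y ⟶ (exIter n).obj T :=
    { app := fun d => ↾ fun y => SSet.yonedaEquiv ((sdExIter n).homEquiv _ T (L d.unop.len y))
      naturality := by
        intro d e θ
        ext y
        change SSet.yonedaEquiv ((sdExIter n).homEquiv _ T (L e.unop.len (Y.map θ y))) =
          ((exIter n).obj T).map θ (SSet.yonedaEquiv ((sdExIter n).homEquiv _ T (L d.unop.len y)))
        have h1 := SSet.yonedaEquiv_naturality (X := (exIter n).obj T) θ.unop
          ((sdExIter n).homEquiv _ T (L d.unop.len y))
        refine Eq.trans ?_ h1.symm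
        rw [← homEquiv_pull]
        exact congrArg _ (congrArg _ (hL _ _ θ.unop y)) }
  refine ⟨((sdExIter n).homEquiv Y T).symm g, fun d y => ?_⟩
  apply ((sdExIter n).homEquiv _ T).injective
  rw [homEquiv_pull, Equiv.apply_symm_apply]
  apply SSet.yonedaEquiv.injective
  rw [SSet.yonedaEquiv_comp]
  simp only [Equiv.apply_symm_apply]
  rfl

/-- Compatible maps on the subdivisions of the nondegenerate simplices define a map. -/
theorem exists_glue_nonDegenerate (L : ∀ d : ℕ, Y.nonDegenerate d → ((sdIter n).obj (stdS d) ⟶ T))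
    (hL : ∀ (d e : ℕ) (i : Fin (d + 2)) (u : Y.nonDegenerate (d + 1)) (w : Y.nonDegenerate e)
      (ρ : SimplexCategory.mk d ⟶ .mk e), Epi ρ →
      Y.map (SimplexCategory.δ i).op u.1 = Y.map ρ.op w.1 →
      pull n (SSet.stdSimplex.map (SimplexCategory.δ i)) (L (d + 1) u) =
        pull n (SSet.stdSimplex.map ρ) (L e w)) :
    ∃ F : (sdIter n).obj Y ⟶ T,
      ∀ d (u : Y.nonDegenerate d), pull n (SSet.yonedaEquiv.symm u.1) F = L d u := by
  choose dim f hf z hz using fun (d : ℕ) (y : Y.obj (op (.mk d))) => Y.exists_nonDegenerate y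
  -- The values on degenerate simplices are forced, and they are well defined because the
  -- presentation as a degeneration of a nondegenerate simplex is unique.
  let L' : ∀ d : ℕ, Y.obj (op (.mk d)) → ((sdIter n).obj (stdS d) ⟶ T) := fun d y =>
    pull n (SSet.stdSimplex.map (f d y)) (L _ (z d y))
  have hepi : ∀ (c e : ℕ) (π : SimplexCategory.mk c ⟶ .mk e) (w : Y.nonDegenerate e), Epi π →
      L' c (Y.map π.op w.1) = pull n (SSet.stdSimplex.map π) (L e w) := by
    intro c e π w hπ
    have := hf c (Y.map π.op w.1)
    have h1 := hz c (Y.map π.op w.1)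
    have h2 := Y.unique_nonDegenerate_dim _ _ _ h1 π w rfl
    have key : ∀ (m : ℕ) (g : SimplexCategory.mk c ⟶ .mk m) (v : Y.nonDegenerate m), Epi g → m = e →
        Y.map π.op w.1 = Y.map g.op v.1 →
        pull n (SSet.stdSimplex.map g) (L m v) = pull n (SSet.stdSimplex.map π) (L e w) := by
      rintro m g v hg rfl hv
      obtain rfl := Y.unique_nonDegenerate_simplex _ g v hv π w rfl
      rw [Y.unique_nonDegenerate_map _ g v hv π v rfl]
    exact key _ _ _ this h2 h1
  -- Strong induction on the dimension. An operator that is not surjective factors through a face,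
  -- and that face is a degeneration of a nondegenerate simplex of smaller dimension.
  have hall : ∀ (e c : ℕ) (θ : SimplexCategory.mk c ⟶ .mk e) (w : Y.nonDegenerate e),
      L' c (Y.map θ.op w.1) = pull n (SSet.stdSimplex.map θ) (L e w) := by
    intro e
    induction e using Nat.strong_induction_on with
    | _ e ih =>
      intro c θ w
      by_cases hθ : Epi θ
      · exact hepi c e θ w hθ
      · rw [SimplexCategory.epi_iff_surjective] at hθ
        obtain _ | e := e
        · exact absurd (fun b => ⟨0, Subsingleton.elim (α := Fin 1) _ _⟩) hθ
        · obtain ⟨i, θ', rfl⟩ := SimplexCategory.eq_comp_δ_of_not_surjective θ hθ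
          obtain ⟨m, ρ, hρ, v, hv⟩ := Y.exists_nonDegenerate (Y.map (SimplexCategory.δ i).op w.1)
          have hm : m < e + 1 := Nat.lt_succ_of_le (SimplexCategory.len_le_of_epi ρ)
          have e1 : Y.map (θ' ≫ SimplexCategory.δ i).op w.1 = Y.map (θ' ≫ ρ).op v.1 := by
            rw [op_comp, op_comp, Functor.map_comp_apply, Functor.map_comp_apply, hv]
          rw [e1, ih m hm c (θ' ≫ ρ) v, pull_map_comp, pull_map_comp, hL e m i w v ρ hρ hv]
  obtain ⟨F, hF⟩ := exists_glue L' (fun c d θ y => by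
    obtain ⟨m, g, _, v, rfl⟩ := Y.exists_nonDegenerate y
    rw [← Functor.map_comp_apply, ← op_comp, hall, hall, pull_map_comp])
  refine ⟨F, fun d u => ?_⟩
  rw [hF]
  have := hall d d (𝟙 _) u
  rw [pull_map_id] at this
  simpa using this

end Glue

end SigmaTwo

namespace SigmaTwo

/-! ### Runs of the algorithm -/

namespace SubdMap

variable {S S' T T' : SSet.{u}}

/-- Naturality of the last vertex map. -/
theorem refine_precomp (φ : SubdMap S T) (f : S' ⟶ S) :
    (φ.precomp f).refine = φ.refine.precomp f := by
  have h : SSet.sd.map f ≫ lastVertex.app S = lastVertex.app S' ≫ f := lastVertex.naturality f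
  have h2 : (sdIter φ.n).map (lastVertex.app S') ≫ (sdIter φ.n).map f ≫ φ.hom =
      (sdIter φ.n).map (SSet.sd.map f) ≫ (sdIter φ.n).map (lastVertex.app S) ≫ φ.hom := by
    rw [← Functor.map_comp_assoc, ← Functor.map_comp_assoc, h]
  exact congrArg (SubdMap.mk (φ.n + 1)) h2

theorem refine_postcomp (φ : SubdMap S T) (f : T ⟶ T') :
    (φ.postcomp f).refine = φ.refine.postcomp f :=
  congrArg (SubdMap.mk (φ.n + 1)) (Category.assoc _ _ _).symm

theorem iterate_refine_precomp (k : ℕ) (φ : SubdMap S T) (f : S' ⟶ S) :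
    refine^[k] (φ.precomp f) = (refine^[k] φ).precomp f := by
  induction k generalizing φ with
  | zero => rfl
  | succ k ih => rw [Function.iterate_succ_apply, refine_precomp, ih, Function.iterate_succ_apply]

theorem iterate_refine_postcomp (k : ℕ) (φ : SubdMap S T) (f : T ⟶ T') :
    refine^[k] (φ.postcomp f) = (refine^[k] φ).postcomp f := by
  induction k generalizing φ with
  | zero => rfl
  | succ k ih => rw [Function.iterate_succ_apply, refine_postcomp, ih, Function.iterate_succ_apply]

theorem iterate_refine_n (k : ℕ) (φ : SubdMap S T) : (refine^[k] φ).n = φ.n + k := by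
  induction k generalizing φ with
  | zero => rfl
  | succ k ih =>
    rw [Function.iterate_succ_apply, ih]
    change φ.n + 1 + k = _
    omega

/-- The map is represented by `F` on the `N`-th subdivision. -/
def AtLevel (N : ℕ) (φ : SubdMap S T) (F : (sdIter N).obj S ⟶ T) : Prop :=
  ∃ k, refine^[k] φ = ⟨N, F⟩

namespace AtLevel

variable {N : ℕ} {φ : SubdMap S T} {F F' : (sdIter N).obj S ⟶ T}

theorem precomp (h : AtLevel N φ F) (f : S' ⟶ S) : AtLevel N (φ.precomp f) (pull N f F) := by
  obtain ⟨k, hk⟩ := h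
  exact ⟨k, by rw [iterate_refine_precomp, hk]; rfl⟩

theorem postcomp (h : AtLevel N φ F) (f : T ⟶ T') : AtLevel N (φ.postcomp f) (F ≫ f) := by
  obtain ⟨k, hk⟩ := h
  exact ⟨k, by rw [iterate_refine_postcomp, hk]; rfl⟩

theorem exists_of_le (φ : SubdMap S T) (h : φ.n ≤ N) : ∃ F, AtLevel N φ F := by
  have h1 := iterate_refine_n (N - φ.n) φ
  rw [Nat.add_sub_cancel' h] at h1
  have h2 : ∀ ψ : SubdMap S T, ψ.n = N → ∃ F, ψ = ⟨N, F⟩ := by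
    rintro ⟨n, F⟩ rfl
    exact ⟨F, rfl⟩
  obtain ⟨F, hF⟩ := h2 _ h1
  exact ⟨F, _, hF⟩

theorem eq_of_mk_eq (h : (⟨N, F⟩ : SubdMap S T) = ⟨N, F'⟩) : F = F' := by
  simpa using h

/-- A coincidence after some refinements persists under further ones. Thus equality of maps becomes
equality at every sufficiently fine level. -/
theorem eq_of_same {ψ : SubdMap S T} (h : φ.Same ψ) :
    ∃ B, ∀ N, B ≤ N → ∀ F F', AtLevel N φ F → AtLevel N ψ F' → F = F' := by
  obtain ⟨a, b, hab⟩ := h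
  refine ⟨φ.n + a, fun N hN F F' ⟨k, hk⟩ ⟨k', hk'⟩ => ?_⟩
  have h1 := congrArg SubdMap.n hk
  have h2 := congrArg SubdMap.n hk'
  have h3 := congrArg SubdMap.n hab
  rw [iterate_refine_n] at h1 h2
  rw [iterate_refine_n, iterate_refine_n] at h3
  dsimp only at h1 h2
  obtain ⟨c, rfl⟩ : ∃ c, k = c + a := ⟨k - a, by omega⟩
  obtain rfl : k' = c + b := by omega
  rw [Function.iterate_add_apply, hab, ← Function.iterate_add_apply, hk'] at hk
  exact (eq_of_mk_eq hk).symm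

theorem unique (h : AtLevel N φ F) (h' : AtLevel N φ F') : F = F' := by
  obtain ⟨k, hk⟩ := h
  obtain ⟨k', hk'⟩ := h'
  have h1 := congrArg SubdMap.n hk
  have h2 := congrArg SubdMap.n hk'
  rw [iterate_refine_n] at h1 h2
  obtain rfl : k = k' := by simp at h1 h2; omega
  exact eq_of_mk_eq (hk.symm.trans hk')

theorem same {φ ψ : SubdMap S T} (h : AtLevel N φ F) (h' : AtLevel N ψ F) : φ.Same ψ := by
  obtain ⟨k, hk⟩ := h
  obtain ⟨k', hk'⟩ := h'
  exact ⟨k, k', hk.trans hk'.symm⟩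

end AtLevel

end SubdMap

section Runs

variable {G : Type u} [Group G] {r : ℕ} {x : Fin r → G} {n : ℕ} {χ : G →* Multiplicative ℝ}

/-- The nondegenerate simplices `(1, g_1, …, g_q)`. -/
def normalized (x : Fin r → G) (n q : ℕ) : Set (Fin (q + 1) → G) :=
  {σ | σ 0 = 1 ∧ σ ∈ (vietorisRips x Set.univ n).obj (op (.mk q)) ∧
    σ ∈ (freeSSet G).nonDegenerate q}

theorem normalized_finite (hx : Subgroup.closure (Set.range x) = ⊤) (n q : ℕ) :
    (normalized x n q).Finite := by
  refine (Set.Finite.pi (t := fun _ : Fin (q + 1) => {g : G | wordLength x g ≤ n})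
    fun _ => finite_ball hx n).subset fun σ hσ i _ => ?_
  have h := hσ.2.1.2 0 i
  rw [hσ.1] at h
  simpa [wordDist] using h

theorem exists_enumerates (hx : Subgroup.closure (Set.range x) = ⊤) (n q : ℕ) :
    ∃ l, Enumerates x n q l := by
  refine ⟨(normalized_finite hx n q).toFinset.toList, Finset.nodup_toList _, fun σ => ?_⟩
  rw [Finset.mem_toList, Set.Finite.mem_toFinset]
  rfl

/-- All entries of a table have been found by searches. -/
structure Table.Sound (χ : G →* Multiplicative ℝ) (t : G) (M : Table x n) : Prop where
  zero : M 0 = initTable x n t 0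
  search : ∀ p σ φ, M (p + 1) σ = some φ → σ ∈ normalized x n (p + 1) ∧ IsSearchResult χ t M σ φ

theorem Value.mono {M M' : Table x n} (h : ∀ q σ φ, M q σ = some φ → M' q σ = some φ) {q : ℕ}
    {τ : Fin (q + 1) → G} {ψ : SubdMap (stdS q) (ripsG x n)} (hv : Value M q τ ψ) :
    Value M' q τ ψ := by
  induction hv with
  | translate g hσ => exact .translate g (h _ _ _ hσ)
  | degenerate i _ ih => exact .degenerate i ih

theorem IsSearchResult.mono {M M' : Table x n} (h : ∀ q σ φ, M q σ = some φ → M' q σ = some φ)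
    {t : G} {p : ℕ} {σ : Fin (p + 2) → G} {φ : SubdMap (stdS (p + 1)) (ripsG x n)}
    (hs : IsSearchResult χ t M σ φ) : IsSearchResult χ t M' σ φ :=
  ⟨hs.1, fun i => by
    obtain ⟨ψ, h1, h2⟩ := hs.2 i
    exact ⟨ψ, h1.mono h, h2⟩⟩

theorem Table.define_self (M : Table x n) {q : ℕ} (σ : Fin (q + 1) → G)
    (φ : SubdMap (stdS q) (ripsG x n)) : M.define σ φ q σ = some φ := by
  simp [Table.define]

theorem Table.define_of_ne (M : Table x n) {q : ℕ} {σ τ : Fin (q + 1) → G}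
    (φ : SubdMap (stdS q) (ripsG x n)) (h : τ ≠ σ) : M.define σ φ q τ = M q τ := by
  simp [Table.define, h]

theorem Table.define_of_dim_ne (M : Table x n) {p q : ℕ} (σ : Fin (q + 1) → G)
    (φ : SubdMap (stdS q) (ripsG x n)) (h : p ≠ q) : M.define σ φ p = M p := by
  simp [Table.define, h]

/-- Entries are never overwritten, so the table only grows and recorded search results stay valid.
-/
theorem Table.define_extends {M : Table x n} {q : ℕ} {σ : Fin (q + 1) → G}
    (φ : SubdMap (stdS q) (ripsG x n)) (h : M q σ = none) (q' : ℕ) (τ : Fin (q' + 1) → G)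
    (ψ : SubdMap (stdS q') (ripsG x n)) (hψ : M q' τ = some ψ) : M.define σ φ q' τ = some ψ := by
  by_cases hq : q' = q
  · subst hq
    by_cases hτ : τ = σ
    · subst hτ
      rw [h] at hψ
      exact absurd hψ (by simp)
    · rw [define_of_ne _ _ hτ, hψ]
  · rw [define_of_dim_ne _ _ _ hq, hψ]

/-- What holds in every state that can be reached. -/
def Invariant (χ : G →* Multiplicative ℝ) : AlgState x n → Prop
  | .start => True
  | .maybe => True
  | .loop t p M todo => 0 < chi χ t ∧ M.Sound χ t ∧ todo.Nodup ∧
      (∀ σ ∈ todo, σ ∈ normalized x n (p + 1) ∧ M (p + 1) σ = none) ∧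
      (∀ σ ∈ normalized x n (p + 1), σ ∉ todo → M (p + 1) σ ≠ none) ∧
      (∀ q < p, ∀ σ ∈ normalized x n (q + 1), M (q + 1) σ ≠ none) ∧
      ∀ q, p < q → ∀ σ, M (q + 1) σ = none
  | .yes => ∃ (t : G) (M : Table x n), 0 < chi χ t ∧ M.Sound χ t ∧
      ∀ q < 2, ∀ σ ∈ normalized x n (q + 1), M (q + 1) σ ≠ none

theorem Step.invariant {s s' : AlgState x n} (h : Step x n χ s s') (hs : Invariant χ s) :
    Invariant χ s' := by
  cases h with
  | pick t ht l hl =>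
    refine ⟨ht, ⟨rfl, fun p σ φ h => absurd h (by simp [initTable])⟩, hl.1, fun σ hσ =>
      ⟨(hl.2 σ).1 hσ, rfl⟩, fun σ hσ hσ' => absurd ((hl.2 σ).2 hσ) hσ', fun q hq => absurd hq (by omega),
      fun q _ σ => rfl⟩
  | found t p M σ l φ h =>
    obtain ⟨h1, h2, h3, h4, h5, h6, h7⟩ := hs
    obtain ⟨hσ, hσM⟩ := h4 σ (by simp)
    have hext := Table.define_extends φ hσM
    rw [List.nodup_cons] at h3
    refine ⟨h1, ⟨?_, fun p' τ ψ hτ => ?_⟩, h3.2, fun τ hτ => ?_, fun τ hτ hτl => ?_,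
      fun q hq τ hτ => ?_, fun q hq τ => ?_⟩
    · rw [Table.define_of_dim_ne _ _ _ (by omega), h2.zero]
    · by_cases hp : p' = p
      · subst hp
        by_cases hτσ : τ = σ
        · subst hτσ
          rw [Table.define_self] at hτ
          obtain rfl := Option.some.inj hτ
          exact ⟨hσ, h.mono hext⟩
        · rw [Table.define_of_ne _ _ hτσ] at hτ
          exact ⟨(h2.search _ _ _ hτ).1, (h2.search _ _ _ hτ).2.mono hext⟩
      · rw [Table.define_of_dim_ne _ _ _ (by omega)] at hτ
        exact ⟨(h2.search _ _ _ hτ).1, (h2.search _ _ _ hτ).2.mono hext⟩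
    · have hne : τ ≠ σ := by
        rintro rfl
        exact h3.1 hτ
      rw [Table.define_of_ne _ _ hne]
      exact h4 τ (List.mem_cons_of_mem _ hτ)
    · by_cases hτσ : τ = σ
      · subst hτσ
        rw [Table.define_self]
        simp
      · rw [Table.define_of_ne _ _ hτσ]
        exact h5 τ hτ (by simp [hτσ, hτl])
    · rw [Table.define_of_dim_ne _ _ _ (by omega)]
      exact h6 q hq τ hτ
    · rw [Table.define_of_dim_ne _ _ _ (by omega)]
      exact h7 q hq τ
  | giveUp => trivial
  | next t M l hl =>
    obtain ⟨h1, h2, h3, h4, h5, h6, h7⟩ := hs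
    refine ⟨h1, h2, hl.1, fun σ hσ => ⟨(hl.2 σ).1 hσ, h7 1 (by omega) σ⟩,
      fun σ hσ hσ' => absurd ((hl.2 σ).2 hσ) hσ', fun q hq σ hσ => ?_,
      fun q hq => h7 q (by omega)⟩
    obtain rfl : q = 0 := by omega
    exact h5 σ hσ (by simp)
  | finish t M =>
    obtain ⟨h1, h2, h3, h4, h5, h6, h7⟩ := hs
    refine ⟨t, M, h1, h2, fun q hq σ hσ => ?_⟩
    obtain rfl | rfl : q = 0 ∨ q = 1 := by omega
    · exact h6 0 (by omega) σ hσ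
    · exact h5 σ hσ (by simp)

/-- A run with output "yes" leaves a complete table. -/
theorem AnswersYes.exists_table (h : AnswersYes x n χ) :
    ∃ (t : G) (M : Table x n), 0 < chi χ t ∧ M.Sound χ t ∧
      ∀ q < 2, ∀ σ ∈ normalized x n (q + 1), M (q + 1) σ ≠ none := by
  have : ∀ s, Relation.ReflTransGen (Step x n χ) .start s → Invariant χ s := by
    intro s hs
    induction hs with
    | refl => trivial
    | tail _ h ih => exact h.invariant ih
  exact this _ h

end Runs

end SigmaTwo

namespace SigmaTwo

/-! ### Equivariant maps from complete tables -/

section Extract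

variable {G : Type u} [Group G] {r : ℕ} {x : Fin r → G} {n : ℕ} {χ : G →* Multiplicative ℝ}

/-- Translations of tuples. -/
def translateFree (g : G) : freeSSet G ⟶ freeSSet G where
  app _ := ↾ fun s i => g * s i

theorem translate_mem_nonDegenerate (g : G) {d : ℕ} {s : Fin (d + 1) → G}
    (hs : s ∈ (freeSSet G).nonDegenerate d) :
    (fun i => g * s i) ∈ (freeSSet G).nonDegenerate d := by
  intro h
  refine hs ?_
  have := SSet.degenerate_app_apply h (translateFree g⁻¹)
  have e : (fun i => g⁻¹ * (g * s i)) = s := funext fun i => inv_mul_cancel_left g (s i)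
  have h1 : (fun i => g⁻¹ * (g * s i)) ∈ (freeSSet G).degenerate d := this
  rwa [e] at h1

theorem mem_nonDegenerate_skeleton_iff {d : ℕ} (y : (ripsSkeleton2 x n).obj (op (.mk d))) :
    y ∈ (ripsSkeleton2 x n).nonDegenerate d ↔ y.1.1 ∈ (freeSSet G).nonDegenerate d :=
  (SSet.Subcomplex.mem_nonDegenerate_iff _ y).trans (SSet.Subcomplex.mem_nonDegenerate_iff _ y.1)

theorem dim_lt_of_nonDegenerate {d : ℕ} (u : (ripsSkeleton2 x n).nonDegenerate d) : d < 3 :=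
  ((ripsG x n).mem_skeleton_obj_iff_of_nonDegenerate
    ⟨u.1.1, (SSet.Subcomplex.mem_nonDegenerate_iff _ u.1).1 u.2⟩ 3).1 u.1.2

/-- The translate of a simplex whose first vertex is `1`. -/
def normalize {d : ℕ} (s : Fin (d + 1) → G) : Fin (d + 1) → G := fun i => (s 0)⁻¹ * s i

theorem normalize_mem {d : ℕ} (u : (ripsSkeleton2 x n).nonDegenerate d) :
    normalize (d := d) u.1.1.1 ∈ normalized x n d :=
  ⟨inv_mul_cancel _, ⟨fun _ => Set.mem_univ _, fun i j =>
    (wordDist_mul_left x _ _ _).le.trans (u.1.1.2.2 i j)⟩,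
    translate_mem_nonDegenerate _ ((mem_nonDegenerate_skeleton_iff u.1).1 u.2)⟩

/-- The inclusion of the Rips complex of a subset. -/
def ripsIncl (x : Fin r → G) (n : ℕ) (S : Set G) : (vietorisRips x S n).toSSet ⟶ ripsG x n :=
  SSet.Subcomplex.homOfLE (vietorisRips_mono x (Set.subset_univ _) le_rfl)

theorem translate_comp (g h : G) : translate x n g ≫ translate x n h = translate x n (h * g) := by
  refine NatTrans.ext (funext fun d => ?_)
  ext s
  exact Subtype.ext (funext fun i => (mul_assoc h g (s.1 i)).symm)

/-- The map prescribed by a table on a simplex, on the `N`-th subdivision. -/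
def Piece (M : Table x n) (N d : ℕ) (s : Fin (d + 1) → G)
    (F : (sdIter N).obj (stdS d) ⟶ ripsG x n) : Prop :=
  ∃ φ F₀, M d (normalize s) = some φ ∧ SubdMap.AtLevel N φ F₀ ∧ F = F₀ ≫ translate x n (s 0)

theorem Piece.unique {M : Table x n} {N d : ℕ} {s : Fin (d + 1) → G}
    {F F' : (sdIter N).obj (stdS d) ⟶ ripsG x n} (h : Piece M N d s F) (h' : Piece M N d s F') :
    F = F' := by
  obtain ⟨φ, F₀, h1, h2, rfl⟩ := h
  obtain ⟨φ', F₀', h1', h2', rfl⟩ := h'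
  rw [h1] at h1'
  obtain rfl := Option.some.inj h1'
  rw [h2.unique h2']

theorem Piece.translate {M : Table x n} {N d : ℕ} {s : Fin (d + 1) → G}
    {F : (sdIter N).obj (stdS d) ⟶ ripsG x n} (h : Piece M N d s F) (g : G) :
    Piece M N d (fun i => g * s i) (F ≫ SigmaTwo.translate x n g) := by
  obtain ⟨φ, F₀, h1, h2, rfl⟩ := h
  refine ⟨φ, F₀, ?_, h2, by rw [Category.assoc, translate_comp]⟩
  rw [← h1]
  congr 1
  funext i
  simp [normalize, mul_assoc]

theorem Table.Sound.mem {t : G} {M : Table x n} (hM : M.Sound χ t) {q : ℕ}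
    {σ : Fin (q + 1) → G} {φ : SubdMap (stdS q) (ripsG x n)} (h : M q σ = some φ) :
    σ 0 = 1 ∧ σ ∈ (freeSSet G).nonDegenerate q := by
  obtain _ | p := q
  · rw [hM.zero] at h
    have : σ = 1 := by
      by_contra hne
      simp [initTable, hne] at h
    subst this
    refine ⟨rfl, ?_⟩
    rintro ⟨m, hm, -⟩
    exact absurd hm (by omega)
  · exact ⟨(hM.search _ _ _ h).1.1, (hM.search _ _ _ h).1.2.2⟩

/-- The values of a table are those of the map which it prescribes on nondegenerate simplices. -/
theorem Value.exists_piece {t : G} {M : Table x n} (hM : M.Sound χ t) {N D : ℕ}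
    (hN : ∀ q ≤ D, ∀ σ φ, M q σ = some φ → φ.n ≤ N) {q : ℕ} {τ : Fin (q + 1) → G}
    {ψ : SubdMap (stdS q) (ripsG x n)} (hv : Value M q τ ψ) (hq : q ≤ D) {e : ℕ}
    (w : (freeSSet G).nonDegenerate e) (ρ : SimplexCategory.mk q ⟶ .mk e) [Epi ρ]
    (h : τ = (freeSSet G).map ρ.op w.1) :
    ∃ F, Piece M N e w.1 F ∧ SubdMap.AtLevel N ψ (pull N (SSet.stdSimplex.map ρ) F) := by
  induction hv generalizing e with
  | @translate q σ φ g hσ =>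
    obtain ⟨h1, h2⟩ := hM.mem hσ
    let y : (freeSSet G).nonDegenerate q := ⟨_, translate_mem_nonDegenerate g h2⟩
    have hy : (fun i => g * σ i) = (freeSSet G).map (𝟙 (SimplexCategory.mk q)).op y.1 := rfl
    -- Uniqueness of the presentation by a nondegenerate simplex forces `w` to be the translated
    -- entry and `ρ` to be the identity.
    obtain rfl : q = e := SSet.unique_nonDegenerate_dim _ _ (𝟙 _) y hy ρ w h
    obtain rfl : y = w := SSet.unique_nonDegenerate_simplex _ _ (𝟙 _) y hy ρ w h
    obtain rfl : 𝟙 _ = ρ := SSet.unique_nonDegenerate_map _ _ (𝟙 _) y hy ρ y h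
    obtain ⟨F₀, hF₀⟩ := SubdMap.AtLevel.exists_of_le φ (hN q hq _ _ hσ)
    refine ⟨F₀ ≫ SigmaTwo.translate x n g, ⟨φ, F₀, ?_, hF₀, ?_⟩, ?_⟩
    · rw [← hσ]
      congr 1
      funext i
      change (g * σ 0)⁻¹ * (g * σ i) = σ i
      simp [h1]
    · change _ = F₀ ≫ SigmaTwo.translate x n (g * σ 0)
      rw [h1, mul_one]
    · rw [pull_map_id]
      exact hF₀.postcomp _
  | @degenerate q τ ψ i hv ih =>
    obtain ⟨m, f, hf, z, hz⟩ := (freeSSet G).exists_nonDegenerate (n := q) τ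
    have hz' : τ ∘ i.predAbove = (freeSSet G).map (SimplexCategory.σ i ≫ f).op z.1 := by
      rw [hz]
      rfl
    obtain rfl : m = e := SSet.unique_nonDegenerate_dim _ _ _ z hz' ρ w h
    obtain rfl : z = w := SSet.unique_nonDegenerate_simplex _ _ _ z hz' ρ w h
    obtain rfl : _ = ρ := SSet.unique_nonDegenerate_map _ _ _ z hz' ρ z h
    obtain ⟨F, hF, hF'⟩ := ih (by omega) z f hz
    refine ⟨F, hF, ?_⟩
    rw [pull_map_comp]
    exact hF'.precomp _

/-- A number of subdivisions on which all maps in a table are defined and agree on the faces. -/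
def Fits (M : Table x n) (N : ℕ) : Prop :=
  (∀ q ≤ 2, ∀ σ φ, M q σ = some φ → φ.n ≤ N) ∧
  ∀ p < 2, ∀ σ φ, M (p + 1) σ = some φ → ∀ i : Fin (p + 2), ∃ ψ, Value M p (σ ∘ i.succAbove) ψ ∧
    ∀ F F', SubdMap.AtLevel N (φ.precomp (SSet.stdSimplex.map (SimplexCategory.δ i))) F →
      SubdMap.AtLevel N ψ F' → F = F'

/-- Up to dimension two there are finitely many entries, with finitely many faces. Each requirement
holds for all large `N`, hence all hold for a common one. -/
theorem Table.Sound.exists_fits (hx : Subgroup.closure (Set.range x) = ⊤) {t : G} {M : Table x n}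
    (hM : M.Sound χ t) : ∃ N, Fits M N := by
  have hdom : ∀ q σ φ, M q σ = some φ → σ ∈ normalized x n q := by
    intro q σ φ h
    obtain _ | p := q
    · obtain ⟨h1, h2⟩ := hM.mem h
      refine ⟨h1, ⟨fun _ => Set.mem_univ _, fun i j => ?_⟩, h2⟩
      rw [Subsingleton.elim (α := Fin 1) i j, wordDist_self]
      exact Nat.zero_le _
    · exact (hM.search _ _ _ h).1
  have h1 : ∀ q, ∀ᶠ N in Filter.atTop, ∀ σ ∈ normalized x n q, ∀ φ, M q σ = some φ → φ.n ≤ N := by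
    intro q
    rw [Filter.eventually_all_finite (normalized_finite hx n q)]
    intro σ _
    obtain h | ⟨φ, h⟩ := (M q σ).eq_none_or_eq_some
    · exact Filter.Eventually.of_forall fun N φ hφ => absurd (h.symm.trans hφ) (by simp)
    · filter_upwards [Filter.eventually_ge_atTop φ.n] with N hN φ' hφ'
      obtain rfl := Option.some.inj (h.symm.trans hφ')
      exact hN
  have h2 : ∀ p, ∀ᶠ N in Filter.atTop, ∀ σ ∈ normalized x n (p + 1), ∀ φ, M (p + 1) σ = some φ →
      ∀ i : Fin (p + 2), ∃ ψ, Value M p (σ ∘ i.succAbove) ψ ∧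
        ∀ F F', SubdMap.AtLevel N (φ.precomp (SSet.stdSimplex.map (SimplexCategory.δ i))) F →
          SubdMap.AtLevel N ψ F' → F = F' := by
    intro p
    rw [Filter.eventually_all_finite (normalized_finite hx n (p + 1))]
    intro σ _
    obtain h | ⟨φ, h⟩ := (M (p + 1) σ).eq_none_or_eq_some
    · exact Filter.Eventually.of_forall fun N φ hφ => absurd (h.symm.trans hφ) (by simp)
    · have h3 := (hM.search _ _ _ h).2.2
      choose ψ hψ hs using h3
      choose B hB using fun i => SubdMap.AtLevel.eq_of_same (hs i)
      have h4 : ∀ᶠ N in Filter.atTop, ∀ i, B i ≤ N :=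
        Filter.eventually_all.2 fun i => Filter.eventually_ge_atTop (B i)
      filter_upwards [h4] with N hN φ' hφ' i
      obtain rfl := Option.some.inj (h.symm.trans hφ')
      exact ⟨ψ i, hψ i, fun F F' => hB i N (hN i) F F'⟩
  obtain ⟨N, ⟨a0, a1⟩, a2, b0, b1⟩ :=
    (((h1 0).and (h1 1)).and ((h1 2).and ((h2 0).and (h2 1)))).exists
  refine ⟨N, fun q hq σ φ h => ?_, fun p hp σ φ h => ?_⟩
  · obtain rfl | rfl | rfl : q = 0 ∨ q = 1 ∨ q = 2 := by omega
    · exact a0 σ (hdom _ _ _ h) φ h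
    · exact a1 σ (hdom _ _ _ h) φ h
    · exact a2 σ (hdom _ _ _ h) φ h
  · obtain rfl | rfl : p = 0 ∨ p = 1 := by omega
    · exact b0 σ (hdom _ _ _ h) φ h
    · exact b1 σ (hdom _ _ _ h) φ h

/-- In positive dimension this is part of being a search result; in dimension zero the image is the
vertex t. -/
theorem Table.Sound.exists_lower {t : G} {M : Table x n} (hM : M.Sound χ t) {q : ℕ}
    {σ : Fin (q + 1) → G} {φ : SubdMap (stdS q) (ripsG x n)} (h : M q σ = some φ) :
    ∃ φ' : SubdMap (stdS q) (vietorisRips x (halfSpace χ (chi χ t + simplexVal χ σ)) n).toSSet,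
      φ = φ'.postcomp (ripsIncl x n _) := by
  obtain _ | p := q
  · obtain ⟨h1, -⟩ := hM.mem h
    obtain rfl : σ = 1 := funext fun i => by rw [Subsingleton.elim (α := Fin 1) i 0, h1]; rfl
    rw [hM.zero] at h
    simp only [initTable, if_true] at h
    obtain rfl := Option.some.inj h
    have h2 : chi χ t + simplexVal χ (1 : Fin 1 → G) ≤ chi χ t := by
      have := simplexVal_le χ (1 : Fin 1 → G) 0
      simp only [Pi.one_apply, chi_one] at this
      linarith
    let y : (vietorisRips x (halfSpace χ (chi χ t + simplexVal χ (1 : Fin 1 → G))) n).toSSet.obj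
      (op (.mk 0)) := ⟨fun _ => t, fun _ => h2,
        fun _ _ => (wordDist_self x t).le.trans (Nat.zero_le n)⟩
    have e : vertexMap x n t = SSet.yonedaEquiv.symm y ≫ ripsIncl x n _ := by
      rw [SSet.yonedaEquiv_symm_comp]
      rfl
    exact ⟨⟨0, SSet.yonedaEquiv.symm y⟩, congrArg (SubdMap.mk 0) e⟩
  · exact (hM.search _ _ _ h).2.1

/-- Entries belong to simplices that start at 1; the translation by `s 0` shifts both sides of the
height estimate by χ(s 0). -/
theorem Piece.le_chi {t : G} {M : Table x n} (hM : M.Sound χ t) {N d : ℕ}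
    (hN : ∀ σ φ, M d σ = some φ → φ.n ≤ N) {s : Fin (d + 1) → G}
    {F : (sdIter N).obj (stdS d) ⟶ ripsG x n} (h : Piece M N d s F) {p : ℕ}
    (τ : ((sdIter N).obj (stdS d)).obj (op (.mk p))) (i : Fin (p + 1)) :
    chi χ t + simplexVal χ s ≤ chi χ ((F.app (op (.mk p)) τ).1 i) := by
  obtain ⟨φ, F₀, h1, h2, rfl⟩ := h
  obtain ⟨φ', rfl⟩ := hM.exists_lower h1
  obtain ⟨F', hF'⟩ := SubdMap.AtLevel.exists_of_le φ' (hN _ _ h1)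
  obtain rfl := h2.unique (hF'.postcomp _)
  have h3 : chi χ t + simplexVal χ (normalize s) ≤ chi χ ((F'.app (op (.mk p)) τ).1 i) :=
    (F'.app (op (.mk p)) τ).2.1 i
  change _ ≤ chi χ (s 0 * (F'.app (op (.mk p)) τ).1 i)
  rw [chi_mul]
  have h4 : simplexVal χ s ≤ chi χ (s 0) + simplexVal χ (normalize s) := by
    rw [← sub_le_iff_le_add']
    refine Finset.le_inf' _ _ fun j _ => ?_
    have := simplexVal_le χ s j
    simp only [normalize, chi_mul, chi_inv]
    linarith
  linarith

/-- A complete table gives an equivariant map which raises the valuation. -/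
theorem Table.Sound.exists_subdMap (hx : Subgroup.closure (Set.range x) = ⊤) {t : G}
    (ht : 0 < chi χ t) {M : Table x n} (hM : M.Sound χ t)
    (hfull : ∀ q < 2, ∀ σ ∈ normalized x n (q + 1), M (q + 1) σ ≠ none) :
    ∃ φ : SubdMap (ripsSkeleton2 x n) (ripsG x n),
      IsEquivariant x n φ ∧ RaisesValuation x n χ φ := by
  obtain ⟨N, hN, hface⟩ := hM.exists_fits hx
  have hex : ∀ (d : ℕ) (u : (ripsSkeleton2 x n).nonDegenerate d), ∃ F, Piece M N d u.1.1.1 F := by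
    intro d u
    have hd := dim_lt_of_nonDegenerate u
    obtain ⟨φ, hφ⟩ : ∃ φ, M d (normalize u.1.1.1) = some φ := by
      have hm := normalize_mem u
      obtain _ | p := d
      · refine ⟨⟨0, vertexMap x n t⟩, ?_⟩
        have h1 : normalize (d := 0) u.1.1.1 = 1 :=
          funext fun i => by rw [Subsingleton.elim (α := Fin 1) i 0]; exact hm.1
        have h2 := congrFun hM.zero (normalize (d := 0) u.1.1.1)
        refine h2.trans ?_
        simp [initTable, h1]
      · exact Option.ne_none_iff_exists'.1 (hfull p (by omega) _ hm)
    obtain ⟨F, hF⟩ := SubdMap.AtLevel.exists_of_le φ (hN d (by omega) _ _ hφ)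
    exact ⟨_, φ, F, hφ, hF, rfl⟩
  choose L hL using hex
  -- Along a face, the entry for the normalized simplex agrees with a value of the table. By
  -- `Value.exists_piece` this value is a degeneration of a piece, and uniqueness of pieces
  -- identifies its translate with the chosen one.
  obtain ⟨F, hF⟩ := exists_glue_nonDegenerate L (by
    intro d e i u w ρ hρ h
    have hd := dim_lt_of_nonDegenerate u
    obtain ⟨φ, F₀, h1, h2, h3⟩ := hL (d + 1) u
    obtain ⟨ψ, hψ, hψ'⟩ := hface d (by omega) _ _ h1 i
    set g := u.1.1.1 0 with hg
    have hw := translate_mem_nonDegenerate g⁻¹ ((mem_nonDegenerate_skeleton_iff w.1).1 w.2)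
    have hs : ∀ j, u.1.1.1 (i.succAbove j) = w.1.1.1 (ρ.toOrderHom j) :=
      fun j => congrFun (congrArg (fun z => z.1.1) h) j
    obtain ⟨F', hF', hF''⟩ := hψ.exists_piece hM hN (by omega) ⟨_, hw⟩ ρ
      (funext fun j => congrArg (g⁻¹ * ·) (hs j))
    have h4 := hψ' _ _ (h2.precomp _) hF''
    have h5 := hF'.translate g
    simp only [mul_inv_cancel_left] at h5
    rw [h3, h5.unique (hL e w) |>.symm, pull_comp, pull_comp, h4])
  refine ⟨⟨N, F⟩, fun g => ?_, fun s p τ => ?_⟩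
  -- The translate of a piece is a piece for the translated simplex, and pieces are unique.
  · refine congrArg (SubdMap.mk N) (sdIter_hom_ext fun d y => ?_)
    have hy : (skeletonMap (translate x n g) 3).app _ y.1 ∈ (ripsSkeleton2 x n).nonDegenerate d :=
      (mem_nonDegenerate_skeleton_iff _).2
        (translate_mem_nonDegenerate g ((mem_nonDegenerate_skeleton_iff y.1).1 y.2))
    have h1 := hF d ⟨_, hy⟩
    dsimp only at h1
    rw [← SSet.yonedaEquiv_symm_comp, ← pull_pull] at h1
    refine h1.trans (Eq.trans ?_ (pull_comp N _ F (translate x n g)).symm)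
    rw [hF]
    exact (hL d ⟨_, hy⟩).unique ((hL d y).translate g)
  · obtain ⟨m, f, hf, z, hz⟩ := (ripsSkeleton2 x n).exists_nonDegenerate
      (n := 2) ⟨s, SSet.mem_skeleton _ s⟩
    have h1 : pull N (simplexMap x n s) F = pull N (SSet.stdSimplex.map f) (L m z) := by
      rw [← hF, pull_pull, SSet.yonedaEquiv_symm_naturality_left]
      exact congrArg (fun y => pull N (SSet.yonedaEquiv.symm y) F) hz
    change simplexVal χ (q := 2) s.1 <
      simplexVal χ (q := p) ((pull N (simplexMap x n s) F).app (op (.mk p)) τ).1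
    rw [h1]
    -- A 2-simplex may be degenerate; it has the same vertices as the nondegenerate simplex it comes
    -- from.
    have h2 : simplexVal χ (q := 2) s.1 ≤ simplexVal χ (q := m) z.1.1.1 := by
      refine Finset.le_inf' _ _ fun j _ => ?_
      obtain ⟨i, rfl⟩ := SimplexCategory.epi_iff_surjective.1 hf j
      have h3 : s.1 i = z.1.1.1 (f.toOrderHom i) :=
        congrFun (congrArg (fun y => y.1.1) hz) i
      rw [← h3]
      exact simplexVal_le χ (q := 2) s.1 i
    refine (Finset.lt_inf'_iff _).2 fun i _ => ?_
    have hm := dim_lt_of_nonDegenerate z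
    have h4 := (hL m z).le_chi hM (hN m (by omega))
      (((sdIter N).map (SSet.stdSimplex.map f)).app (op (.mk p)) τ) i
    refine lt_of_lt_of_le ?_ h4
    linarith

end Extract

end SigmaTwo

namespace SigmaTwo

/-! ### Maps on subdivisions given by labels of points -/

section Mean

variable {T T' : Type u}

/-- Tuples are mapped entrywise. -/
def freeMap (h : T → T') : freeSSet T ⟶ freeSSet T' where
  app _ := ↾ fun s => h ∘ s

open scoped Classical in
/-- The set of entries of a tuple with indices in a face. -/
noncomputable def entries {d : ℕ} (y : Fin (d + 1) → T)
    (A : PartialOrder.NonemptyFiniteChains (ULift.{u} (Fin (d + 1)))) : Finset T :=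
  A.finset.image fun v => y v.down

theorem mem_entries {d : ℕ} {y : Fin (d + 1) → T}
    {A : PartialOrder.NonemptyFiniteChains (ULift.{u} (Fin (d + 1)))} {p : T} :
    p ∈ entries y A ↔ ∃ v ∈ A.finset, y v.down = p := by
  classical
  exact Finset.mem_image

/-- A simplex of the subdivided standard simplex, that is, a chain of faces, is sent to the tuple of
the values of `b` on the vertex sets of these faces. -/
noncomputable def faceTuple (b : Finset T → T) {d : ℕ} (y : Fin (d + 1) → T) :
    SimplexCategory.sd.{u}.obj (.mk d) ⟶ freeSSet T where
  app e := ↾ fun c => fun i => b (entries y (c.obj i))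
  naturality := by
    intro d d' f
    rfl

theorem sd_map_faceTuple (b : Finset T → T) {c d : ℕ} (θ : SimplexCategory.mk c ⟶ .mk d)
    (y : Fin (d + 1) → T) :
    SimplexCategory.sd.map θ ≫ faceTuple b y = faceTuple b (y ∘ θ.toOrderHom) := by
  refine NatTrans.ext (funext fun e => ?_)
  ext F
  funext i
  have key : ∀ A : PartialOrder.NonemptyFiniteChains (ULift.{u} (Fin (c + 1))),
      entries y (A.map (SimplexCategory.toPartOrd.{u}.map θ).hom) =
        entries (y ∘ θ.toOrderHom) A := by
    intro A
    ext p
    rw [mem_entries, mem_entries]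
    constructor
    · rintro ⟨v, hv, rfl⟩
      obtain ⟨w, hw, rfl⟩ := (A.mem_map_iff _ v).1 hv
      exact ⟨w, hw, rfl⟩
    · rintro ⟨w, hw, rfl⟩
      exact ⟨_, (A.mem_map_iff (SimplexCategory.toPartOrd.{u}.map θ).hom _).2 ⟨w, hw, rfl⟩, rfl⟩
  exact congrArg b (key (F.obj i))

/-- The map of tuples of faces on the subdivided standard simplex. -/
noncomputable def faceMap (b : Finset T → T) {d : ℕ} (y : Fin (d + 1) → T) :
    (sdIter 1).obj (stdS.{u} d) ⟶ freeSSet T :=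
  SSet.stdSimplex.sdIso.hom.app (.mk d) ≫ faceTuple b y

theorem pull_faceMap (b : Finset T → T) {c d : ℕ} (θ : SimplexCategory.mk c ⟶ .mk d)
    (y : Fin (d + 1) → T) :
    pull 1 (SSet.stdSimplex.map θ) (faceMap b y) = faceMap b (y ∘ θ.toOrderHom) := by
  have h := SSet.stdSimplex.sdIso.{u}.hom.naturality θ
  have h1 := congrArg (fun z => z ≫ faceTuple b y) h
  have h2 := congrArg (fun z => SSet.stdSimplex.sdIso.{u}.hom.app (.mk c) ≫ z)
    (sd_map_faceTuple b θ y)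
  dsimp only at h1 h2
  rw [Category.assoc, Category.assoc] at h1
  exact h1.trans h2

/-- The prescription depends on the vertex set of a simplex only, so it is compatible with faces and
degeneracies. -/
theorem exists_mean (b : Finset T → T) : ∃ F : (sdIter 1).obj (freeSSet T) ⟶ freeSSet T,
    ∀ d (y : (freeSSet T).obj (op (.mk d))),
      pull 1 (SSet.yonedaEquiv.symm y) F = faceMap b (d := d) y :=
  exists_glue (Y := freeSSet T) (fun d y => faceMap b (d := d) y)
    fun _ _ θ y => (pull_faceMap b θ y).symm

/-- The map from the subdivision which sends the barycenter of a simplex to the value of `b` on its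
vertex set. -/
noncomputable def meanStep (b : Finset T → T) : SSet.sd.obj (freeSSet T) ⟶ freeSSet T :=
  (exists_mean b).choose

theorem pull_meanStep (b : Finset T → T) {d : ℕ} (y : (freeSSet T).obj (op (.mk d))) :
    pull 1 (SSet.yonedaEquiv.symm y) (meanStep b) = faceMap b (d := d) y :=
  (exists_mean b).choose_spec d y

/-- The iteration of `meanStep`. -/
noncomputable def mean (b : Finset T → T) : (n : ℕ) → ((sdIter n).obj (freeSSet T) ⟶ freeSSet T)
  | 0 => 𝟙 _
  | n + 1 => pull n (meanStep b) (mean b n)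

theorem pull_succ_pull {X Y Z W : SSet.{u}} (n : ℕ) (f : X ⟶ Y) (g : SSet.sd.obj Y ⟶ Z)
    (F : (sdIter n).obj Z ⟶ W) :
    pull (n + 1) f (pull n g F) = pull n (SSet.sd.map f ≫ g) F :=
  pull_pull n (SSet.sd.map f) g F

/-- If `b` maps chains of faces of simplices of `C` to `C'`, then so does the subdivision. -/
theorem exists_mean_lift (b : Finset T → T) (C C' : (freeSSet T).Subcomplex)
    (h : ∀ d (y : Fin (d + 1) → T), y ∈ C.obj (op (.mk d)) → ∀ e c,
      (faceTuple b y).app e c ∈ C'.obj e) :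
    ∃ F : SSet.sd.obj C.toSSet ⟶ C'.toSSet, F ≫ C'.ι = SSet.sd.map C.ι ≫ meanStep b := by
  have hmem : ∀ d (y : C.toSSet.obj (op (.mk d))),
      SSet.Subcomplex.range (faceMap b (d := d) y.1) ≤ C' := by
    rintro d y e _ ⟨c, rfl⟩
    exact h d y.1 y.2 _ _
  obtain ⟨F, hF⟩ := exists_glue (n := 1) (Y := C.toSSet) (T := C'.toSSet)
    (fun d y => SSet.Subcomplex.lift (faceMap b (d := d) y.1) (hmem d y)) (fun c d θ y => by
      rw [← cancel_mono C'.ι, ← pull_comp]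
      exact (pull_faceMap b θ y.1).symm)
  refine ⟨F, sdIter_hom_ext (n := 1) fun d y => ?_⟩
  have h1 := hF d y.1
  have h2 : pull 1 (SSet.yonedaEquiv.symm y.1) F ≫ C'.ι = faceMap b (d := d) y.1.1 := by
    rw [h1]
    rfl
  refine (pull_comp 1 _ F C'.ι).trans (h2.trans ?_)
  refine Eq.trans ?_ (pull_pull 1 (SSet.yonedaEquiv.symm y.1) C.ι (meanStep b)).symm
  rw [SSet.yonedaEquiv_symm_comp]
  exact (pull_meanStep b _).symm

theorem mean_map (b : Finset T → T) (b' : Finset T' → T') (α : T → T')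
    (h : ∀ F : Finset T, F.Nonempty → open scoped Classical in b' (F.image α) = α (b F)) (n : ℕ) :
    pull n (freeMap α) (mean b' n) = mean b n ≫ freeMap α := by
  classical
  have h0 : ∀ d (y : Fin (d + 1) → T), faceTuple b' (α ∘ y) = faceTuple b y ≫ freeMap α := by
    intro d y
    refine NatTrans.ext (funext fun e => ?_)
    ext c
    funext i
    have h2 := h (entries (d := d) y (c.obj i)) ((c.obj i).nonempty.image _)
    rwa [show (entries (d := d) y (c.obj i)).image α = entries (α ∘ y) (c.obj i) from
      Finset.image_image] at h2
  have h1 : SSet.sd.map (freeMap α) ≫ meanStep b' = meanStep b ≫ freeMap α := by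
    refine sdIter_hom_ext (n := 1) fun d y => ?_
    refine (pull_pull 1 (SSet.yonedaEquiv.symm y.1) (freeMap α) (meanStep b')).trans ?_
    rw [SSet.yonedaEquiv_symm_comp]
    refine (pull_meanStep b' _).trans (Eq.trans ?_ (pull_comp 1 _ (meanStep b) (freeMap α)).symm)
    rw [pull_meanStep]
    exact congrArg (fun z => SSet.stdSimplex.sdIso.{u}.hom.app (.mk d) ≫ z) (h0 d y.1)
  induction n with
  | zero =>
    change (𝟭 SSet).map (freeMap α) ≫ 𝟙 _ = 𝟙 _ ≫ freeMap α
    rw [Category.comp_id, Category.id_comp]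
    rfl
  | succ n ih =>
    rw [mean, mean, pull_succ_pull, h1, ← pull_pull, ih]
    exact pull_comp n _ _ _

end Mean

/-! ### Iterated barycenters in a normed space -/

section Fill

variable {E : Type u} [NormedAddCommGroup E] [NormedSpace ℝ E]

/-- The barycenter. -/
noncomputable def bary (F : Finset E) : E := (F.card : ℝ)⁻¹ • ∑ p ∈ F, p

-- Injectivity keeps the number of points, so the image of the mean is the mean of the image.
open scoped Classical in
theorem bary_image {E' : Type u} [NormedAddCommGroup E'] [NormedSpace ℝ E'] (α : E →ᵃ[ℝ] E')
    (hα : Function.Injective α) (F : Finset E) (hF : F.Nonempty) :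
    bary (F.image α) = α (bary F) := by
  have hc : (F.card : ℝ) ≠ 0 := by exact_mod_cast hF.card_pos.ne'
  rw [bary, bary, Finset.card_image_of_injective _ hα, Finset.sum_image fun _ _ _ _ h => hα h,
    AffineMap.decomp α]
  simp only [Pi.add_apply, map_smul, map_sum, Finset.sum_add_distrib, Finset.sum_const, smul_add]
  rw [← Nat.cast_smul_eq_nsmul ℝ, smul_smul, inv_mul_cancel₀ hc, one_smul]

theorem bary_mem {C : Set E} (hC : Convex ℝ C) {F : Finset E} (hF : F.Nonempty)
    (h : ∀ p ∈ F, p ∈ C) : bary F ∈ C := by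
  have hc : (F.card : ℝ) ≠ 0 := by exact_mod_cast hF.card_pos.ne'
  rw [bary, Finset.smul_sum]
  exact hC.sum_mem (fun _ _ => by positivity) (by simp [hc]) h

/-- The vector from the barycenter to `a` is the mean of the differences a − p. One of the c
differences is zero, which gives the factor (c − 1)/c ≤ 2/3. -/
theorem dist_bary_le {F : Finset E} (hF : F.card ≤ 3) {D : ℝ} (hD : ∀ p ∈ F, ∀ q ∈ F, dist p q ≤ D)
    {a : E} (ha : a ∈ F) : dist a (bary F) ≤ 2 / 3 * D := by
  classical
  have hpos : 0 < F.card := Finset.card_pos.2 ⟨a, ha⟩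
  have hc : (F.card : ℝ) ≠ 0 := by exact_mod_cast hpos.ne'
  have hD0 : 0 ≤ D := dist_nonneg.trans (hD a ha a ha)
  have h1 : a - bary F = (F.card : ℝ)⁻¹ • ∑ p ∈ F.erase a, (a - p) := by
    have : ∑ p ∈ F.erase a, (a - p) = ∑ p ∈ F, (a - p) := by
      rw [← Finset.add_sum_erase F _ ha, sub_self, zero_add]
    rw [this, Finset.sum_sub_distrib, Finset.sum_const, smul_sub, ← Nat.cast_smul_eq_nsmul ℝ,
      smul_smul, inv_mul_cancel₀ hc, one_smul, bary]
  rw [dist_eq_norm, h1, norm_smul, norm_inv, Real.norm_natCast]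
  have h2 : ‖∑ p ∈ F.erase a, (a - p)‖ ≤ ((F.card : ℝ) - 1) * D := by
    refine (norm_sum_le _ _).trans ((Finset.sum_le_card_nsmul _ _ D fun p hp => ?_).trans ?_)
    · rw [← dist_eq_norm]
      exact hD a ha p (Finset.mem_of_mem_erase hp)
    · rw [nsmul_eq_mul, Finset.card_erase_of_mem ha, Nat.cast_sub hpos, Nat.cast_one]
  have h3 : (F.card : ℝ) ≤ 3 := by exact_mod_cast hF
  have h4 : (0 : ℝ) < F.card := by exact_mod_cast hpos
  rw [inv_mul_le_iff₀ h4]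
  nlinarith

theorem dist_bary_bary_le {F F' : Finset E} (hF : F.Nonempty) (hFF : F ⊆ F') (hF' : F'.card ≤ 3)
    {D : ℝ} (hD : ∀ p ∈ F', ∀ q ∈ F', dist p q ≤ D) : dist (bary F) (bary F') ≤ 2 / 3 * D :=
  bary_mem (convex_closedBall (bary F') (2 / 3 * D)) hF fun _ hp => dist_bary_le hF' hD (hFF hp)

/-- Tuples of points of `C` with at most three distinct entries, at distance at most `D`. -/
def small (C : Set E) (D : ℝ) : (freeSSet E).Subcomplex where
  obj n := {s : Fin (n.unop.len + 1) → E | (∀ i, s i ∈ C) ∧ (∀ i j, dist (s i) (s j) ≤ D) ∧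
    ∃ P : Finset E, P.card ≤ 3 ∧ ∀ i, s i ∈ P}
  map f := fun _ hs => ⟨fun _ => hs.1 _, fun _ _ => hs.2.1 _ _, by
    obtain ⟨P, hP, h⟩ := hs.2.2
    exact ⟨P, hP, fun _ => h _⟩⟩

/-- Subdivision shrinks distances by 2/3. The bound of three entries, on which this factor depends,
is preserved: see the last step. -/
theorem faceTuple_mem_small {C : Set E} (hC : Convex ℝ C) (D : ℝ) (d : ℕ) (y : Fin (d + 1) → E)
    (hy : y ∈ (small C D).obj (op (.mk d))) (e : SimplexCategoryᵒᵖ)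
    (c : (SimplexCategory.sd.{u}.obj (.mk d)).obj e) :
    (faceTuple bary y).app e c ∈ (small C (2 / 3 * D)).obj e := by
  classical
  obtain ⟨h1, h2, P, hP, h3⟩ := hy
  let F : Fin (e.unop.len + 1) → Finset E := fun i => entries y (c.obj i)
  have hF : ∀ i, (F i).Nonempty := fun i => (c.obj i).nonempty.image _
  have hmono : ∀ i j, i ≤ j → F i ⊆ F j := fun i j hij =>
    Finset.image_subset_image (c.map (homOfLE hij)).le
  have hFP : ∀ i, F i ⊆ P := by
    intro i p hp
    obtain ⟨v, -, rfl⟩ := mem_entries.1 hp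
    exact h3 _
  have hcard : ∀ i, (F i).card ≤ 3 := fun i => (Finset.card_le_card (hFP i)).trans hP
  have hdist : ∀ i, ∀ p ∈ F i, ∀ q ∈ F i, dist p q ≤ D := by
    intro i p hp q hq
    obtain ⟨v, -, rfl⟩ := mem_entries.1 hp
    obtain ⟨w, -, rfl⟩ := mem_entries.1 hq
    exact h2 _ _
  refine ⟨fun i => bary_mem hC (hF i) fun p hp => ?_, fun i j => ?_,
    (Finset.univ.image F).image bary, ?_, fun i => Finset.mem_image_of_mem _
      (Finset.mem_image_of_mem _ (Finset.mem_univ i))⟩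
  · obtain ⟨v, -, rfl⟩ := mem_entries.1 hp
    exact h1 _
  · obtain h | h := le_total i j
    · exact dist_bary_bary_le (hF i) (hmono _ _ h) (hcard j) (hdist j)
    · rw [dist_comm]
      exact dist_bary_bary_le (hF j) (hmono _ _ h) (hcard i) (hdist i)
  -- The vertex sets form a chain of nonempty sets of at most three points, so their sizes tell them
  -- apart and there are at most three of them.
  · refine Finset.card_image_le.trans ?_
    have h4 : (Finset.univ.image F).card ≤ (Finset.Icc 1 3).card := by
      refine Finset.card_le_card_of_injOn Finset.card ?_ ?_
      · intro A hA
        obtain ⟨i, -, rfl⟩ := Finset.mem_image.1 hA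
        exact Finset.mem_coe.2 (Finset.mem_Icc.2 ⟨(hF i).card_pos, hcard i⟩)
      · intro A hA B hB hAB
        obtain ⟨i, -, rfl⟩ := Finset.mem_image.1 hA
        obtain ⟨j, -, rfl⟩ := Finset.mem_image.1 hB
        obtain h | h := le_total i j
        · exact Finset.eq_of_subset_of_card_le (hmono _ _ h) hAB.ge
        · exact (Finset.eq_of_subset_of_card_le (hmono _ _ h) hAB.le).symm
    simpa using h4

theorem exists_mean_small {C : Set E} (hC : Convex ℝ C) (n : ℕ) (D : ℝ) :
    ∃ F : (sdIter n).obj (small C D).toSSet ⟶ (small C ((2 / 3) ^ n * D)).toSSet,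
      F ≫ (small C ((2 / 3) ^ n * D)).ι = pull n (small C D).ι (mean bary n) := by
  induction n generalizing D with
  | zero =>
    rw [pow_zero, one_mul]
    exact ⟨𝟙 _, (Category.id_comp _).trans (Category.comp_id _).symm⟩
  | succ n ih =>
    obtain ⟨F, hF⟩ := exists_mean_lift bary (small C D) (small C (2 / 3 * D))
      (faceTuple_mem_small hC D)
    obtain ⟨F', hF'⟩ := ih (2 / 3 * D)
    rw [pow_succ, mul_assoc]
    refine ⟨pull n F F', ?_⟩
    rw [mean, pull_succ_pull, ← hF, ← pull_pull, ← hF']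
    exact (pull_comp n F F' _).symm

variable {V : Type u} {q : ℕ}

/-- The map from the standard simplex given by a tuple. -/
def tupleMap (s : Fin (q + 1) → V) : stdS.{u} q ⟶ freeSSet V :=
  SSet.yonedaEquiv.symm (show (freeSSet V).obj (op (.mk q)) from s)

theorem map_tupleMap {p : ℕ} (θ : SimplexCategory.mk p ⟶ .mk q) (s : Fin (q + 1) → V) :
    SSet.stdSimplex.map θ ≫ tupleMap s = tupleMap (s ∘ θ.toOrderHom) :=
  SSet.yonedaEquiv_symm_naturality_left _ _

theorem tupleMap_comp {W : Type u} (s : Fin (q + 1) → V) (f : V → W) :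
    tupleMap s ≫ freeMap f = tupleMap (f ∘ s) :=
  SSet.yonedaEquiv_symm_comp _ _

theorem tupleMap_lift (C : (freeSSet V).Subcomplex) {s : Fin (q + 1) → V}
    (hs : s ∈ C.obj (op (.mk q))) :
    ∃ F : stdS q ⟶ C.toSSet, tupleMap s = F ≫ C.ι :=
  ⟨SSet.yonedaEquiv.symm (show C.toSSet.obj (op (.mk q)) from ⟨s, hs⟩),
    (SSet.yonedaEquiv_symm_comp (show C.toSSet.obj (op (.mk q)) from ⟨s, hs⟩) C.ι).symm⟩

/-- The vertices of the subdivided simplex with corners `s` are labelled by `f`. -/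
noncomputable def fill (n : ℕ) (s : Fin (q + 1) → E) (f : E → V) :
    (sdIter n).obj (stdS q) ⟶ freeSSet V :=
  pull n (tupleMap s) (mean bary n ≫ freeMap f)

theorem pull_fill (n : ℕ) {p : ℕ} (θ : SimplexCategory.mk p ⟶ .mk q) (s : Fin (q + 1) → E)
    (f : E → V) : pull n (SSet.stdSimplex.map θ) (fill n s f) = fill n (s ∘ θ.toOrderHom) f := by
  rw [fill, pull_pull, map_tupleMap, fill]

theorem fill_comp (n : ℕ) (s : Fin (q + 1) → E) (f : E → V) {W : Type u} (g : V → W) :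
    fill n s f ≫ freeMap g = fill n s (g ∘ f) :=
  (pull_comp n _ _ _).symm

/-- Injective affine maps commute with barycenters; the sides of the triangle can therefore be
compared with the segment. -/
theorem fill_affine {E' : Type u} [NormedAddCommGroup E'] [NormedSpace ℝ E'] (α : E →ᵃ[ℝ] E')
    (hα : Function.Injective α) (n : ℕ) (s : Fin (q + 1) → E) (f : E' → V) :
    fill n (α ∘ s) f = fill n s (f ∘ α) := by
  classical
  have h := mean_map (bary (E := E)) (bary (E := E')) α (fun F hF => by
    convert bary_image α hα F hF) n
  have h1 : mean bary n ≫ freeMap (f ∘ α) = pull n (freeMap α) (mean bary n ≫ freeMap f) := by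
    rw [pull_comp, h]
    rfl
  rw [fill, fill, h1, pull_pull, tupleMap_comp]

theorem mem_small {E : Type u} [NormedAddCommGroup E] (hq : q ≤ 2) {C : Set E} {s : Fin (q + 1) → E} (hs : ∀ i, s i ∈ C) :
    ∃ D, s ∈ (small C D).obj (op (.mk q)) := by
  classical
  obtain ⟨D, hD⟩ := ((Set.finite_univ : (Set.univ : Set (Fin (q + 1) × Fin (q + 1))).Finite).image
    fun z => dist (s z.1) (s z.2)).bddAbove
  refine ⟨D, hs, fun i j => hD ⟨(i, j), trivial, rfl⟩, Finset.univ.image s, ?_,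
    fun i => Finset.mem_image_of_mem _ (Finset.mem_univ _)⟩
  refine Finset.card_image_le.trans ?_
  simp
  omega

theorem exists_fill_lift (hq : q ≤ 2) {C : Set E} (hC : Convex ℝ C) {s : Fin (q + 1) → E}
    (hs : ∀ i, s i ∈ C) :
    ∃ D : ℝ, ∀ n, ∃ F : (sdIter n).obj (stdS q) ⟶ (small C ((2 / 3) ^ n * D)).toSSet,
      ∀ (V : Type u) (f : E → V), fill n s f = F ≫ (small C ((2 / 3) ^ n * D)).ι ≫ freeMap f := by
  obtain ⟨D, hD⟩ := mem_small hq hs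
  refine ⟨D, fun n => ?_⟩
  obtain ⟨F, hF⟩ := exists_mean_small hC n D
  obtain ⟨s', hs'⟩ := tupleMap_lift _ hD
  refine ⟨pull n s' F, fun V f => ?_⟩
  rw [← Category.assoc, ← pull_comp, hF, pull_pull, ← hs', fill]
  exact pull_comp n _ _ _

/-- All vertices of the subdivision lie in the convex set `C`, so labels outside it do not matter.
-/
theorem fill_congr (hq : q ≤ 2) (n : ℕ) {C : Set E} (hC : Convex ℝ C) {s : Fin (q + 1) → E}
    (hs : ∀ i, s i ∈ C) {f f' : E → V} (h : ∀ p ∈ C, f p = f' p) : fill n s f = fill n s f' := by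
  obtain ⟨D, hD⟩ := exists_fill_lift hq hC hs
  obtain ⟨F, hF⟩ := hD n
  rw [hF, hF]
  congr 1
  refine NatTrans.ext (funext fun e => ?_)
  ext y
  exact funext fun i => h _ (y.2.1 i)

end Fill

/-! ### Labellings with adjacent values at nearby points -/

section RipsFill

variable {G : Type u} [Group G] {r : ℕ} {x : Fin r → G}
variable {E : Type u} [NormedAddCommGroup E] [NormedSpace ℝ E] {q : ℕ}

/-- A labelling whose values at nearby points are adjacent defines a map on fine subdivisions. -/
theorem eventually_exists_fill (hq : q ≤ 2) {C : Set E} (hC : Convex ℝ C) {s : Fin (q + 1) → E}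
    (hs : ∀ i, s i ∈ C) {S : Set G} {K : ℕ} {f : E → G} {ε : ℝ} (hε : 0 < ε)
    (h : ∀ p ∈ C, ∀ p' ∈ C, dist p p' ≤ ε → vrAdj x S K (f p) (f p')) :
    ∀ᶠ n in Filter.atTop, ∃ F : (sdIter n).obj (stdS q) ⟶ (vietorisRips x S K).toSSet,
      F ≫ (vietorisRips x S K).ι = fill n s f := by
  obtain ⟨D, hD⟩ := exists_fill_lift hq hC hs
  have hlim : Filter.Tendsto (fun n : ℕ => (2 / 3 : ℝ) ^ n * D) Filter.atTop (nhds (0 * D)) :=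
    (tendsto_pow_atTop_nhds_zero_of_lt_one (by norm_num) (by norm_num)).mul_const D
  rw [zero_mul] at hlim
  filter_upwards [hlim.eventually_le_const hε] with n hn
  obtain ⟨F, hF⟩ := hD n
  let L : (small C ((2 / 3) ^ n * D)).toSSet ⟶ (vietorisRips x S K).toSSet :=
    SSet.Subcomplex.lift ((small C ((2 / 3) ^ n * D)).ι ≫ freeMap f) (by
      rintro d _ ⟨y, rfl⟩
      have hy : ∀ i j, vrAdj x S K (f (y.1 i)) (f (y.1 j)) := fun i j =>
        h _ (y.2.1 i) _ (y.2.1 j) ((y.2.2.1 i j).trans hn)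
      exact ⟨fun i => (hy i i).1, fun i j => (hy i j).2.2⟩)
  refine ⟨F ≫ L, ?_⟩
  rw [hF]
  rfl

end RipsFill

end SigmaTwo

namespace SigmaTwo

/-! ### Labels of the segment and the triangle -/

section Rows

variable {V : Type u} {A : V → V → Prop}

/-- Slowing down a walk. -/
theorem RowHom.reparam (hA : IsAdj A) {c : ℕ → V} (hc : ∀ i, A (c i) (c (i + 1))) {L R : ℕ} {b : V}
    (hb : ∀ i, L ≤ i → c i = b) {f : ℕ → ℕ} (f0 : f 0 = 0) (f1 : ∀ i, f i ≤ f (i + 1))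
    (f2 : ∀ i, f (i + 1) ≤ f i + 1) (fR : L ≤ f R) : RowHom A R (c 0) b (c ∘ f) c := by
  have hle : ∀ i, f i ≤ i := by
    intro i
    induction i with
    | zero => omega
    | succ i ih => have := f2 i; omega
  have hmono : ∀ i j, i ≤ j → f i ≤ f j := fun i j h => monotone_nat_of_le_succ f1 h
  have lem : ∀ p q : ℕ, p ≤ q + 1 → q ≤ p + 1 → A (c p) (c q) := by
    intro p q h1 h2
    obtain rfl | rfl | rfl : p = q ∨ p = q + 1 ∨ q = p + 1 := by omega
    exacts [hA.refl (hc _), hA.symm (hc _), hc _]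
  -- This interpolates between `f` at k = 0 and the identity below k; neighbouring values of k, and
  -- of the index, change it by at most one.
  let F : ℕ → ℕ → ℕ := fun k i => max (f i) (min i k)
  have hstep : ∀ k, RowStep A R (c 0) b (c ∘ F k) (c ∘ F (k + 1)) := by
    intro k
    refine ⟨⟨fun i => lem _ _ ?_ ?_, fun i => lem _ _ ?_ ?_, fun i => lem _ _ ?_ ?_,
      fun i => lem _ _ ?_ ?_, fun i => lem _ _ ?_ ?_⟩, ?_, ?_, ?_, ?_⟩
    iterate 10
      · have h1 := f1 i
        have h2 := f2 i
        have h3 := hle i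
        have h4 := hle (i + 1)
        simp only [F]
        omega
    · simp [F, f0]
    · simp [F, f0]
    · intro i hi
      exact hb _ (fR.trans ((hmono _ _ hi).trans (le_max_left _ _)))
    · intro i hi
      exact hb _ (fR.trans ((hmono _ _ hi).trans (le_max_left _ _)))
  have h0 : c ∘ F 0 = c ∘ f := by
    funext i
    simp [F]
  have hR : c ∘ F R = c := by
    funext i
    obtain h | h := le_total i R
    · have := hle i
      simp [F, h, this]
    · have h1 := hmono _ _ h
      have h2 := hle R
      exact (hb _ (fR.trans (h1.trans (le_max_left _ _)))).trans (hb _ (by omega)).symm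
  have key : ∀ k, RowHom A R (c 0) b (c ∘ F 0) (c ∘ F k) := by
    intro k
    induction k with
    | zero => exact .refl
    | succ k ih => exact ih.tail (hstep k)
  have := key R
  rwa [h0, hR] at this

theorem seq_append_left (a : V) (l l' : List V) {i : ℕ} (hi : i ≤ l.length) :
    seq a (l ++ l') i = seq a l i := by
  induction l generalizing a i with
  | nil =>
    obtain rfl : i = 0 := by simpa using hi
    simp
  | cons b l ih =>
    obtain _ | i := i
    · simp
    · exact ih b (by simpa using hi)

theorem seq_append_right (a : V) (l l' : List V) (i : ℕ) :
    seq a (l ++ l') (l.length + i) = seq (tgt a l) l' i := by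
  induction l generalizing a with
  | nil => simp [tgt]
  | cons b l ih =>
    rw [List.length_cons, show l.length + 1 + i = l.length + i + 1 by omega]
    exact ih b

theorem exists_steps {α : Type*} {R : α → α → Prop} {a b : α} (h : Relation.ReflTransGen R a b) :
    ∃ (J : ℕ) (H : ℕ → α), H 0 = a ∧ (∀ j, J ≤ j → H j = b) ∧ ∀ j < J, R (H j) (H (j + 1)) := by
  induction h using Relation.ReflTransGen.head_induction_on with
  | refl => exact ⟨0, fun _ => b, rfl, fun _ _ => rfl, fun j hj => absurd hj (by omega)⟩
  | @head a c hac _ ih =>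
    obtain ⟨J, H, h0, h1, h2⟩ := ih
    refine ⟨J + 1, fun j => if j = 0 then a else H (j - 1), by simp, fun j hj => ?_, fun j hj => ?_⟩
    · dsimp only
      rw [if_neg (by omega)]
      exact h1 _ (by omega)
    · obtain _ | j := j
      · simpa [h0] using hac
      · simpa using h2 j (by omega)

/-- The rows between the two long sides of a triangle and the third side, run through at half
speed; all rows have the same length. -/
structure Grid (A : V → V → Prop) (a : V) (l₁ l₂ l₃ : List V) (M J : ℕ) (H : ℕ → ℕ → V) : Prop where
  one_le : 1 ≤ M
  bottom : ∀ i ≤ M, H 0 i = seq a l₁ i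
  bottom' : ∀ i, H 0 (M + i) = seq (tgt a l₁) l₂ i
  top : ∀ i, H J i = seq a l₃ (i / 2)
  left : ∀ j, H j 0 = a
  right : ∀ j i, 2 * M - 1 ≤ i → H j i = tgt a l₃
  adj : ∀ j i j' i', j ≤ j' + 1 → j' ≤ j + 1 → i ≤ i' + 1 → i' ≤ i + 1 → A (H j i) (H j' i')

/-- The rows of `Ht.rowHom` are brought to a common length by slowing down the first and last row.
It holds for all large M, so that one M can serve all simplices. -/
theorem Ht.exists_grid (hA : IsAdj A) {a : V} {l₁ l₂ l₃ : List V} (h : Ht A a (l₁ ++ l₂) l₃) :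
    ∀ᶠ M in Filter.atTop, ∃ J H, Grid A a l₁ l₂ l₃ M J H := by
  obtain ⟨R, hR⟩ := h.rowHom hA
  have hw := h.walks
  have htgt := h.tgt_eq
  filter_upwards [Filter.eventually_ge_atTop (l₁.length + l₂.length + l₃.length + R + 1)] with M hM
  let f : ℕ → ℕ := fun i =>
    if i ≤ l₁.length then i else if i ≤ M then l₁.length else i - (M - l₁.length)
  have e1 : RowHom A (2 * M - 1) a (tgt a l₃) (seq a (l₁ ++ l₂) ∘ f) (seq a (l₁ ++ l₂)) := by
    have := RowHom.reparam hA hw.1.seq (R := 2 * M - 1)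
      (fun i hi => seq_of_le a (l₁ ++ l₂) hi) (f := f) (by simp [f])
      (fun i => by simp only [f]; split_ifs <;> omega)
      (fun i => by simp only [f]; split_ifs <;> omega)
      (by rw [List.length_append]; simp only [f]; split_ifs <;> omega)
    rwa [htgt, seq_zero] at this
  have e2 : RowHom A (2 * M - 1) a (tgt a l₃) (seq a (l₁ ++ l₂)) (seq a l₃) := by
    rw [← htgt]
    exact hR.mono (by omega)
  have e3 : RowHom A (2 * M - 1) a (tgt a l₃) (seq a l₃ ∘ (· / 2)) (seq a l₃) := by
    have := RowHom.reparam hA hw.2.seq (R := 2 * M - 1)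
      (fun i hi => seq_of_le a l₃ hi) (f := (· / 2)) (by simp)
      (fun i => by omega) (fun i => by omega) (by omega)
    rwa [seq_zero] at this
  obtain ⟨J, H, h0, h1, h2⟩ := exists_steps ((e1.trans e2).trans (e3.symm hA))
  have hlast : ∀ i, (seq a l₃ ∘ (· / 2)) (2 * M - 1 + i) = tgt a l₃ := fun i =>
    seq_of_le _ _ (by dsimp only; omega)
  have hgrid : ∀ j, GridStep A (H j) (H (j + 1)) := by
    intro j
    obtain hj | hj := lt_or_ge j J
    · exact (h2 j hj).grid
    · rw [h1 j hj, h1 (j + 1) (by omega)]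
      refine GridStep.refl hA fun i => ?_
      have hs := hw.2.seq
      simp only [Function.comp_apply]
      obtain h | h : (i + 1) / 2 = i / 2 ∨ (i + 1) / 2 = i / 2 + 1 := by omega
      · rw [h]
        exact hA.refl (hs _)
      · rw [h]
        exact hs _
  refine ⟨J, H, ⟨by omega, fun i hi => ?_, fun i => ?_, fun i => ?_, fun j => ?_, fun j i hi => ?_,
    fun j i j' i' hj hj' hi hi' => ?_⟩⟩
  · rw [h0]
    simp only [Function.comp_apply, f]
    split_ifs with h3
    · exact seq_append_left a l₁ l₂ h3
    · rw [seq_append_left a l₁ l₂ le_rfl, seq_of_le a l₁ le_rfl, seq_of_le a l₁ (by omega)]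
  · rw [h0]
    have hf : f (M + i) = l₁.length + i := by
      simp only [f]
      split_ifs <;> omega
    rw [Function.comp_apply, hf, seq_append_right]
  · rw [h1 J le_rfl]
    rfl
  · obtain hj | hj := lt_or_ge j J
    · exact (h2 j hj).start
    · rw [h1 j hj]
      simp
  · obtain hj | hj := lt_or_ge j J
    · exact (h2 j hj).fin i hi
    · rw [h1 j hj]
      obtain ⟨k, rfl⟩ := Nat.exists_eq_add_of_le hi
      exact hlast k
  · have hrow : ∀ j i i', i ≤ i' + 1 → i' ≤ i + 1 → A (H j i) (H j i') := by
      intro j i i' h3 h4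
      obtain rfl | rfl | rfl : i = i' ∨ i = i' + 1 ∨ i' = i + 1 := by omega
      exacts [hA.refl ((hgrid j).lower _), hA.symm ((hgrid j).lower _), (hgrid j).lower _]
    have hup : ∀ j i i', i ≤ i' + 1 → i' ≤ i + 1 → A (H j i) (H (j + 1) i') := by
      intro j i i' h3 h4
      obtain rfl | rfl | rfl : i = i' ∨ i = i' + 1 ∨ i' = i + 1 := by omega
      exacts [(hgrid j).vert _, (hgrid j).diag' _, (hgrid j).diag _]
    obtain rfl | rfl | rfl : j = j' ∨ j = j' + 1 ∨ j' = j + 1 := by omega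
    exacts [hrow _ _ _ hi hi', hA.symm (hup _ _ _ hi' hi), hup _ _ _ hi hi']

end Rows

/-! ### The segment and the triangle in the plane -/

section Positions

/-- The plane. -/
abbrev Plane : Type u := ULift.{u} (ℝ × ℝ)

/-- A point of the plane. -/
def point (a b : ℝ) : Plane.{u} := ⟨(a, b)⟩

/-- The corners of the segment. -/
def segCorners : Fin 2 → Plane.{u} := ![point 0 0, point 1 0]

/-- The corners of the triangle. -/
def triCorners : Fin 3 → Plane.{u} := ![point 0 0, point 1 0, point 0 1]

/-- The segment. -/
def unitSegment : Set Plane.{u} := {p | 0 ≤ p.down.1 ∧ p.down.1 ≤ 1 ∧ p.down.2 = 0}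

/-- The triangle. -/
def unitTriangle : Set Plane.{u} := {p | 0 ≤ p.down.1 ∧ 0 ≤ p.down.2 ∧ p.down.1 + p.down.2 ≤ 1}

theorem convex_seg : Convex ℝ unitSegment.{u} := by
  rintro p ⟨h1, h2, h3⟩ q ⟨h4, h5, h6⟩ a b ha hb hab
  simp only [unitSegment, Set.mem_ofPred_eq, ULift.add_down, ULift.smul_down, Prod.fst_add, Prod.snd_add,
    Prod.smul_fst, Prod.smul_snd, smul_eq_mul, h3, h6, mul_zero, add_zero, and_true]
  exact ⟨by positivity, by nlinarith⟩

theorem convex_tri : Convex ℝ unitTriangle.{u} := by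
  rintro p ⟨h1, h2, h3⟩ q ⟨h4, h5, h6⟩ a b ha hb hab
  simp only [unitTriangle, Set.mem_ofPred_eq, ULift.add_down, ULift.smul_down, Prod.fst_add, Prod.snd_add,
    Prod.smul_fst, Prod.smul_snd, smul_eq_mul]
  exact ⟨by positivity, by positivity, by nlinarith⟩

theorem segCorners_mem (i : Fin 2) : segCorners.{u} i ∈ unitSegment.{u} := by
  fin_cases i <;> simp [segCorners, unitSegment, point]

theorem triCorners_mem (i : Fin 3) : triCorners.{u} i ∈ unitTriangle.{u} := by
  fin_cases i <;> simp [triCorners, unitTriangle, point]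

/-- The parametrization of the side of the triangle opposite to the first corner. -/
def side₀ : Plane.{u} →ᵃ[ℝ] Plane.{u} :=
  LinearMap.toAffineMap
    { toFun := fun p => point (-p.down.1) (p.down.1 + p.down.2)
      map_add' := fun p q => ULift.ext _ _ (Prod.ext (by simp [point]; ring) (by simp [point]; ring))
      map_smul' := fun c p => ULift.ext _ _ (Prod.ext (by simp [point]) (by simp [point]; ring)) } +
  AffineMap.const ℝ _ (point 1 0)

theorem side₀_apply (p : Plane.{u}) : side₀ p = point (1 - p.down.1) (p.down.1 + p.down.2) :=
  ULift.ext _ _ (Prod.ext (by simp [side₀, point]; ring) (by simp [side₀, point]))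

/-- The parametrization of the side of the triangle opposite to the second corner. -/
def side₁ : Plane.{u} →ᵃ[ℝ] Plane.{u} :=
  LinearMap.toAffineMap
    { toFun := fun p => point p.down.2 p.down.1
      map_add' := fun _ _ => rfl
      map_smul' := fun _ _ => rfl }

theorem side₁_apply (p : Plane.{u}) : side₁ p = point p.down.2 p.down.1 := rfl

theorem side₀_injective : Function.Injective side₀.{u} := by
  intro p q h
  rw [side₀_apply, side₀_apply] at h
  have h1 := congrArg (fun z => z.down.1) h
  have h2 := congrArg (fun z => z.down.2) h
  simp only [point] at h1 h2
  exact ULift.ext _ _ (Prod.ext (by linarith) (by linarith))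

theorem side₁_injective : Function.Injective side₁.{u} := by
  intro p q h
  rw [side₁_apply, side₁_apply] at h
  have h1 := congrArg (fun z => z.down.1) h
  have h2 := congrArg (fun z => z.down.2) h
  exact ULift.ext _ _ (Prod.ext h2 h1)

theorem abs_sub_le_dist (p q : Plane.{u}) :
    |p.down.1 - q.down.1| ≤ dist p q ∧ |p.down.2 - q.down.2| ≤ dist p q := by
  rw [ULift.dist_eq, Prod.dist_eq, Real.dist_eq, Real.dist_eq]
  exact ⟨le_max_left _ _, le_max_right _ _⟩

variable {V : Type u} {A : V → V → Prop}

/-- The points of the segment are labelled by the entries of a sequence. -/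
noncomputable def segLabel (M : ℕ) (c : ℕ → V) (p : Plane.{u}) : V := c ⌊M * p.down.1⌋₊

/-- The points of the triangle are labelled by the entries of a grid. -/
noncomputable def triLabel (M J : ℕ) (H : ℕ → ℕ → V) (p : Plane.{u}) : V :=
  H ⌊max 0 (J * (1 - M * p.down.1))⌋₊ ⌊M * (p.down.1 + 2 * p.down.2)⌋₊

theorem floor_le_floor_add_one {a b : ℝ} (h : a ≤ b + 1) (hb : 0 ≤ b) : ⌊a⌋₊ ≤ ⌊b⌋₊ + 1 := by
  rw [← Nat.floor_add_one hb]
  exact Nat.floor_le_floor h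

theorem exists_segLabel_modulus (hA : IsAdj A) {c : ℕ → V} (hc : ∀ i, A (c i) (c (i + 1))) (M : ℕ) :
    ∃ ε > 0, ∀ p ∈ unitSegment.{u}, ∀ q ∈ unitSegment.{u}, dist p q ≤ ε → A (segLabel M c p) (segLabel M c q) := by
  refine ⟨1 / (M + 1), by positivity, fun p hp q hq hpq => ?_⟩
  have h1 := (abs_le.1 ((abs_sub_le_dist p q).1.trans hpq))
  have hM : (0 : ℝ) ≤ M := Nat.cast_nonneg M
  have h2 : (M : ℝ) * (1 / (M + 1)) ≤ 1 := by
    rw [mul_one_div, div_le_one (by positivity)]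
    linarith
  have h3 : ⌊(M : ℝ) * p.down.1⌋₊ ≤ ⌊(M : ℝ) * q.down.1⌋₊ + 1 :=
    floor_le_floor_add_one (by nlinarith) (mul_nonneg hM hq.1)
  have h4 : ⌊(M : ℝ) * q.down.1⌋₊ ≤ ⌊(M : ℝ) * p.down.1⌋₊ + 1 :=
    floor_le_floor_add_one (by nlinarith) (mul_nonneg hM hp.1)
  unfold segLabel
  generalize ⌊(M : ℝ) * p.down.1⌋₊ = i at *
  generalize ⌊(M : ℝ) * q.down.1⌋₊ = j at *
  obtain rfl | rfl | rfl : i = j ∨ i = j + 1 ∨ j = i + 1 := by omega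
  exacts [hA.refl (hc _), hA.symm (hc _), hc _]

variable {a : V} {l₁ l₂ l₃ : List V} {M J : ℕ} {H : ℕ → ℕ → V}

theorem Grid.exists_modulus (h : Grid A a l₁ l₂ l₃ M J H) :
    ∃ ε > 0, ∀ p ∈ unitTriangle.{u}, ∀ q ∈ unitTriangle.{u}, dist p q ≤ ε →
      A (triLabel M J H p) (triLabel M J H q) := by
  -- The column coordinate M(p₁ + 2p₂) has slope at most 3M, the row coordinate J(1 − M p₁) slope
  -- JM; both may change by at most one.
  refine ⟨1 / (3 * (M + 1) * (J + 1)), by positivity, ?_⟩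
  have hM : (0 : ℝ) ≤ M := Nat.cast_nonneg M
  have hJ : (0 : ℝ) ≤ J := Nat.cast_nonneg J
  have h1 : (M : ℝ) * (3 * (1 / (3 * (M + 1) * (J + 1)))) ≤ 1 := by
    rw [mul_one_div, mul_div, div_le_one (by positivity)]
    nlinarith [mul_nonneg hM hJ]
  have h2 : (J : ℝ) * (M * (1 / (3 * (M + 1) * (J + 1)))) ≤ 1 := by
    rw [mul_one_div, mul_div, div_le_one (by positivity)]
    nlinarith [mul_nonneg hM hJ]
  have key : ∀ p ∈ unitTriangle.{u}, ∀ q ∈ unitTriangle.{u}, dist p q ≤ 1 / (3 * (M + 1) * (J + 1)) →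
      ⌊max 0 ((J : ℝ) * (1 - M * p.down.1))⌋₊ ≤ ⌊max 0 ((J : ℝ) * (1 - M * q.down.1))⌋₊ + 1 ∧
      ⌊(M : ℝ) * (p.down.1 + 2 * p.down.2)⌋₊ ≤ ⌊(M : ℝ) * (q.down.1 + 2 * q.down.2)⌋₊ + 1 := by
    intro p hp q hq hpq
    have h3 := abs_le.1 ((abs_sub_le_dist p q).1.trans hpq)
    have h4 := abs_le.1 ((abs_sub_le_dist p q).2.trans hpq)
    refine ⟨floor_le_floor_add_one (max_le ?_ ?_) (le_max_left _ _),
      floor_le_floor_add_one ?_ (mul_nonneg hM (by linarith [hq.1, hq.2.1]))⟩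
    · linarith [le_max_left 0 ((J : ℝ) * (1 - M * q.down.1))]
    · have h5 : (J : ℝ) * (M * (q.down.1 - p.down.1)) ≤
          J * (M * (1 / (3 * (M + 1) * (J + 1)))) :=
        mul_le_mul_of_nonneg_left (mul_le_mul_of_nonneg_left (by linarith [h3.1]) hM) hJ
      linarith [le_max_right 0 ((J : ℝ) * (1 - M * q.down.1))]
    · have h5 : (M : ℝ) * (p.down.1 - q.down.1 + 2 * (p.down.2 - q.down.2)) ≤
          M * (3 * (1 / (3 * (M + 1) * (J + 1)))) :=
        mul_le_mul_of_nonneg_left (by linarith [h3.2, h4.2]) hM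
      linarith
  intro p hp q hq hpq
  obtain ⟨h3, h4⟩ := key p hp q hq hpq
  obtain ⟨h5, h6⟩ := key q hq p hp (by rwa [dist_comm])
  exact h.adj _ _ _ _ h3 h5 h4 h6

/-- Near the corner p₁ = 0 the rows vary, but only in column zero, which is constant; as soon as M
p₁ ≥ 1 the row is the bottom one, and its first half is `l₁`. On all three sides the labelling
depends on the walk and on M only, which makes adjacent simplices fit. -/
theorem Grid.fill_side₂ (h : Grid A a l₁ l₂ l₃ M J H) (n : ℕ) :
    pull n (SSet.stdSimplex.map (SimplexCategory.δ 2)) (fill n triCorners.{u} (triLabel M J H)) =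
      fill n segCorners.{u} (segLabel M (seq a l₁)) := by
  rw [pull_fill, show triCorners.{u} ∘ (SimplexCategory.δ (n := 1) 2).toOrderHom = segCorners from
    funext fun i => by fin_cases i <;> rfl]
  refine fill_congr (by norm_num) n convex_seg segCorners_mem fun p hp => ?_
  obtain ⟨h1, h2, h3⟩ := hp
  have hM : (1 : ℝ) ≤ M := by exact_mod_cast h.one_le
  rw [triLabel, segLabel, h3, mul_zero, add_zero]
  obtain h4 | h4 := lt_or_ge ((M : ℝ) * p.down.1) 1
  · rw [Nat.floor_eq_zero.2 h4, h.left, seq_zero]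
  · have h5 : max 0 ((J : ℝ) * (1 - M * p.down.1)) = 0 :=
      max_eq_left (mul_nonpos_of_nonneg_of_nonpos (Nat.cast_nonneg J) (by linarith))
    rw [h5, Nat.floor_zero, h.bottom]
    exact Nat.floor_le_of_le (by nlinarith)

theorem Grid.fill_side₀ (h : Grid A a l₁ l₂ l₃ M J H) (htgt : tgt (tgt a l₁) l₂ = tgt a l₃)
    (hl : l₂.length < M) (n : ℕ) :
    pull n (SSet.stdSimplex.map (SimplexCategory.δ 0)) (fill n triCorners.{u} (triLabel M J H)) =
      fill n segCorners.{u} (segLabel M (seq (tgt a l₁) l₂)) := by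
  rw [pull_fill, show triCorners.{u} ∘ (SimplexCategory.δ (n := 1) 0).toOrderHom =
    side₀ ∘ segCorners from funext fun i => by
      fin_cases i <;> simp [triCorners, segCorners, side₀_apply, point] <;> rfl,
    fill_affine side₀ side₀_injective]
  refine fill_congr (by norm_num) n convex_seg segCorners_mem fun p hp => ?_
  obtain ⟨h1, h2, h3⟩ := hp
  have hM : (1 : ℝ) ≤ M := by exact_mod_cast h.one_le
  have e : (M : ℝ) * (1 - p.down.1 + 2 * (p.down.1 + 0)) = (M : ℝ) * p.down.1 + (M : ℕ) := by ring
  rw [Function.comp_apply, triLabel, segLabel, side₀_apply, h3]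
  dsimp only [point]
  rw [e, Nat.floor_add_natCast (by positivity)]
  obtain h4 | h4 := lt_or_ge ((M : ℝ) * (1 - p.down.1)) 1
  -- Close to the third corner the column is at least 2M − 1, where all rows are constant; `l₂` has
  -- also ended, having length at most M − 1.
  · have h5 : M - 1 ≤ ⌊(M : ℝ) * p.down.1⌋₊ := by
      apply Nat.le_floor
      rw [Nat.cast_sub h.one_le, Nat.cast_one]
      linarith
    have := h.one_le
    rw [h.right _ _ (by omega), seq_of_le _ _ (by omega), htgt]
  · have h5 : max 0 ((J : ℝ) * (1 - M * (1 - p.down.1))) = 0 :=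
      max_eq_left (mul_nonpos_of_nonneg_of_nonpos (Nat.cast_nonneg J) (by linarith))
    rw [h5, Nat.floor_zero, add_comm, h.bottom']

theorem Grid.fill_side₁ (h : Grid A a l₁ l₂ l₃ M J H) (n : ℕ) :
    pull n (SSet.stdSimplex.map (SimplexCategory.δ 1)) (fill n triCorners.{u} (triLabel M J H)) =
      fill n segCorners.{u} (segLabel M (seq a l₃)) := by
  rw [pull_fill, show triCorners.{u} ∘ (SimplexCategory.δ (n := 1) 1).toOrderHom =
    side₁ ∘ segCorners from funext fun i => by
      fin_cases i <;> simp [triCorners, segCorners, side₁_apply, point] <;> rfl,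
    fill_affine side₁ side₁_injective]
  refine fill_congr (by norm_num) n convex_seg segCorners_mem fun p hp => ?_
  obtain ⟨h1, h2, h3⟩ := hp
  -- On this side p₁ = 0, so the row is the top one; the column runs at double speed and the top row
  -- at half speed.
  have e : ⌊(M : ℝ) * (0 + 2 * p.down.1)⌋₊ / 2 = ⌊(M : ℝ) * p.down.1⌋₊ := by
    rw [← Nat.floor_div_ofNat]
    congr 1
    ring
  rw [Function.comp_apply, triLabel, segLabel, side₁_apply, h3]
  dsimp only [point]
  rw [mul_zero, sub_zero, mul_one, max_eq_right (Nat.cast_nonneg J), Nat.floor_natCast, h.top, e]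

theorem fill_vertex₀ (n : ℕ) (M : ℕ) (c : ℕ → V) :
    pull n (SSet.stdSimplex.map (SimplexCategory.δ 1)) (fill n segCorners.{u} (segLabel M c)) =
      fill n (fun _ : Fin 1 => point.{u} 0 0) fun _ => c 0 := by
  rw [pull_fill, show segCorners.{u} ∘ (SimplexCategory.δ (n := 0) 1).toOrderHom =
    fun _ => point 0 0 from funext fun i => by fin_cases i; rfl]
  refine fill_congr (by norm_num) n (convex_singleton (point 0 0)) (fun _ => rfl) fun p hp => ?_
  rw [Set.mem_singleton_iff.1 hp]
  simp [segLabel, point]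

theorem fill_vertex₁ (n : ℕ) (M : ℕ) (c : ℕ → V) :
    pull n (SSet.stdSimplex.map (SimplexCategory.δ 0)) (fill n segCorners.{u} (segLabel M c)) =
      fill n (fun _ : Fin 1 => point.{u} 1 0) fun _ => c M := by
  rw [pull_fill, show segCorners.{u} ∘ (SimplexCategory.δ (n := 0) 0).toOrderHom =
    fun _ => point 1 0 from funext fun i => by fin_cases i; rfl]
  refine fill_congr (by norm_num) n (convex_singleton (point 1 0)) (fun _ => rfl) fun p hp => ?_
  rw [Set.mem_singleton_iff.1 hp]
  simp [segLabel, point]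

end Positions

end SigmaTwo

namespace SigmaTwo

/-! ### Successful runs from certificates -/

section Constant

variable {G : Type u} [Group G] {r : ℕ} {x : Fin r → G} {n : ℕ}

/-- All vertices are sent to `c`. -/
def IsConst {X : SSet.{u}} (F : X ⟶ ripsG x n) (c : G) : Prop :=
  ∀ (d : SimplexCategoryᵒᵖ) (s : X.obj d) (i : Fin (d.unop.len + 1)), (F.app d s).1 i = c

theorem IsConst.eq {X : SSet.{u}} {F F' : X ⟶ ripsG x n} {c : G} (h : IsConst F c)
    (h' : IsConst F' c) : F = F' := by
  refine NatTrans.ext (funext fun d => ?_)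
  ext s
  exact Subtype.ext (funext fun i => (h d s i).trans (h' d s i).symm)

theorem IsConst.precomp {X Y : SSet.{u}} {F : X ⟶ ripsG x n} {c : G} (h : IsConst F c)
    (f : Y ⟶ X) : IsConst (f ≫ F) c :=
  fun d s i => h d (f.app d s) i

theorem IsConst.translate {X : SSet.{u}} {F : X ⟶ ripsG x n} {c : G} (h : IsConst F c) (g : G) :
    IsConst (F ≫ SigmaTwo.translate x n g) (g * c) :=
  fun d s i => congrArg (g * ·) (h d s i)

theorem isConst_vertexMap (g : G) : IsConst (vertexMap x n g) g := fun _ _ _ => rfl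

theorem SubdMap.AtLevel.isConst {X : SSet.{u}} {φ : SubdMap X (ripsG x n)} {c : G} {N : ℕ}
    {F : (sdIter N).obj X ⟶ ripsG x n} (h : AtLevel N φ F) (hφ : IsConst φ.hom c) :
    IsConst F c := by
  obtain ⟨k, hk⟩ := h
  have : ∀ k, IsConst (refine^[k] φ).hom c := by
    intro k
    induction k with
    | zero => exact hφ
    | succ k ih =>
      rw [Function.iterate_succ_apply']
      exact ih.precomp _
  have h1 := this k
  rwa [hk] at h1

/-- Refinement keeps a map constant, and on a common subdivision there is only one constant map with
a given value. -/
theorem IsConst.same {X : SSet.{u}} {φ ψ : SubdMap X (ripsG x n)} {c : G} (hφ : IsConst φ.hom c)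
    (hψ : IsConst ψ.hom c) : φ.Same ψ := by
  obtain ⟨F, hF⟩ := SubdMap.AtLevel.exists_of_le φ (le_max_left φ.n ψ.n)
  obtain ⟨F', hF'⟩ := SubdMap.AtLevel.exists_of_le ψ (le_max_right φ.n ψ.n)
  obtain rfl := (hF.isConst hφ).eq (hF'.isConst hψ)
  exact hF.same hF'

theorem isConst_of_fill {E : Type u} [NormedAddCommGroup E] [NormedSpace ℝ E] {q N : ℕ}
    {F : (sdIter N).obj (stdS q) ⟶ ripsG x n} {s : Fin (q + 1) → E} {c : G}
    (h : F ≫ (vietorisRips x Set.univ n).ι = fill N s fun _ => c) : IsConst F c := by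
  intro d s' i
  exact congrFun (congrArg (fun z => z.app d s') h) i

end Constant

/-! ### Completing the loops of the algorithm -/

section RunExists

variable {G : Type u} [Group G] {r : ℕ} {x : Fin r → G} {n : ℕ} {χ : G →* Multiplicative ℝ}

/-- If all searches of a loop can succeed, the loop can be completed. -/
theorem exists_loop {t : G} {p : ℕ} (Q : (Fin (p + 2) → G) → SubdMap (stdS (p + 1)) (ripsG x n) → Prop)
    (l : List (Fin (p + 2) → G)) (M : Table x n)
    (h : ∀ σ ∈ l, ∃ φ, Q σ φ ∧ ∀ M' : Table x n, (∀ q, q ≠ p + 1 → M' q = M q) →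
      IsSearchResult χ t M' σ φ) :
    ∃ M' : Table x n, Relation.ReflTransGen (Step x n χ) (.loop t p M l) (.loop t p M' []) ∧
      (∀ q, q ≠ p + 1 → M' q = M q) ∧ (∀ σ ∈ l, ∃ φ, M' (p + 1) σ = some φ ∧ Q σ φ) ∧
      ∀ σ, σ ∉ l → M' (p + 1) σ = M (p + 1) σ := by
  induction l generalizing M with
  | nil => exact ⟨M, .refl, fun _ _ => rfl, by simp, fun _ _ => rfl⟩
  | cons σ l ih =>
    obtain ⟨φ, hQ, hs⟩ := h σ (by simp)
    have hdim : ∀ q, q ≠ p + 1 → M.define (q := p + 1) σ φ q = M q := fun q hq =>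
      Table.define_of_dim_ne M σ φ hq
    obtain ⟨M', h1, h2, h3, h4⟩ := ih (M.define (q := p + 1) σ φ) (fun τ hτ => by
      obtain ⟨ψ, hψ, hψ'⟩ := h τ (List.mem_cons_of_mem _ hτ)
      exact ⟨ψ, hψ, fun M' hM' => hψ' M' fun q hq => (hM' q hq).trans (hdim q hq)⟩)
    refine ⟨M', .head (.found t p M σ l φ (hs M fun _ _ => rfl)) h1,
      fun q hq => (h2 q hq).trans (hdim q hq), fun τ hτ => ?_, fun τ hτ => ?_⟩
    · by_cases hτl : τ ∈ l
      · exact h3 τ hτl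
      · obtain rfl : τ = σ := by simpa [hτl] using hτ
        exact ⟨φ, by rw [h4 τ hτl, Table.define_self], hQ⟩
    · rw [List.mem_cons, not_or] at hτ
      rw [h4 τ hτ.2, Table.define_of_ne _ _ hτ.1]

theorem seq_map {V W : Type u} (f : V → W) (a : V) (l : List V) (i : ℕ) :
    seq (f a) (l.map f) i = f (seq a l i) := by
  induction l generalizing a i with
  | nil => rfl
  | cons b l ih =>
    cases i with
    | zero => rfl
    | succ i => exact ih b i

theorem mem_nonDegenerate_of_ne {V : Type u} {σ : Fin 2 → V} (h : σ 0 ≠ σ 1) :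
    σ ∈ (freeSSet V).nonDegenerate 1 := by
  rintro ⟨m, hm, f, y, rfl⟩
  obtain rfl : m = 0 := by omega
  exact h (congrArg (show Fin 1 → V from y) (Subsingleton.elim (α := Fin 1) _ _))

/-- The entry of the table for an edge. -/
def EdgeEntry (m : G → List G) (t : G) (N M : ℕ) (σ : Fin 2 → G)
    (φ : SubdMap (stdS 1) (ripsG x n)) : Prop :=
  ∃ F : (sdIter N).obj (stdS 1) ⟶ ripsG x n, φ = ⟨N, F⟩ ∧
    F ≫ (vietorisRips x Set.univ n).ι = fill N segCorners (segLabel M (seq t (m (σ 1))))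

/-- A face of a nondegenerate triangle may be degenerate, as for (1, g, 1). Its value comes from the
vertex by a degeneracy and is constant, which agrees with the label because `m 1` is empty. -/
theorem exists_value_edge {m : G → List G} (hm : m 1 = []) {t : G} {N M : ℕ} {T : Table x n}
    (h0 : T 0 = initTable x n t 0)
    (h1 : ∀ σ ∈ normalized x n 1, ∃ φ, T 1 σ = some φ ∧ EdgeEntry m t N M σ φ) (a g : G)
    (hg : wordLength x g ≤ n) {τ : Fin 2 → G} (τ0 : τ 0 = a) (τ1 : τ 1 = a * g)
    {F : (sdIter N).obj (stdS 1) ⟶ ripsG x n}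
    (hF : F ≫ (vietorisRips x Set.univ n).ι =
      fill N segCorners ((a * ·) ∘ segLabel M (seq t (m g)))) :
    ∃ ψ, Value T 1 τ ψ ∧ (⟨N, F⟩ : SubdMap (stdS 1) (ripsG x n)).Same ψ := by
  by_cases hg1 : g = 1
  · subst hg1
    have hv : Value T 0 (fun i => a * (1 : Fin 1 → G) i) _ :=
      .translate a (σ := 1) (φ := ⟨0, vertexMap x n t⟩) (by rw [h0]; simp [initTable])
    have hv' := Value.degenerate 0 hv
    rw [show (fun i => a * (1 : Fin 1 → G) i) ∘ Fin.predAbove 0 = τ from funext fun i => by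
      fin_cases i
      · exact (mul_one a).trans τ0.symm
      · exact τ1.symm] at hv'
    refine ⟨_, hv', IsConst.same (c := a * t) (isConst_of_fill (s := segCorners) ?_) ?_⟩
    · rw [hF, hm]
      rfl
    · exact ((isConst_vertexMap t).translate a).precomp _
  · let σ : Fin 2 → G := ![1, g]
    have hσ : σ ∈ normalized x n 1 := by
      have hd : wordDist x 1 g ≤ n := by simpa [wordDist] using hg
      refine ⟨rfl, ⟨fun _ => Set.mem_univ _, fun i j => ?_⟩, mem_nonDegenerate_of_ne (Ne.symm hg1)⟩
      have hd' := hd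
      rw [wordDist_comm] at hd'
      fin_cases i <;> fin_cases j <;> simp [σ, wordDist_self, hd, hd']
    obtain ⟨_, hφ, F', rfl, hF'⟩ := h1 σ hσ
    have hv := Value.translate a hφ
    rw [show (fun i => a * σ i) = τ from funext fun i => by
      fin_cases i
      · exact (mul_one a).trans τ0.symm
      · exact τ1.symm] at hv
    refine ⟨_, hv, 0, 0, congrArg (SubdMap.mk N) ?_⟩
    rw [← cancel_mono (vietorisRips x Set.univ n).ι, hF]
    have h2 := fill_comp N segCorners (segLabel M (seq t (m g))) (a * ·)
    rw [← h2]
    exact (congrArg (fun z => z ≫ freeMap (a * ·)) hF').symm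

/-- The ends are labelled t and gt. M must be at least the length of the walk, so that the label at
the second end is its target. -/
theorem isSearchResult_edge {m : G → List G} {t : G} {N M : ℕ} {σ : Fin 2 → G} (hσ : σ 0 = 1)
    (hM : (m (σ 1)).length ≤ M) (htgt : tgt t (m (σ 1)) = σ 1 * t) {T : Table x n}
    (h0 : T 0 = initTable x n t 0)
    {F : (sdIter N).obj (stdS 1) ⟶
      (vietorisRips x (halfSpace χ (chi χ t + simplexVal χ (q := 1) σ)) n).toSSet}
    (hF : F ≫ (vietorisRips x _ n).ι = fill N segCorners (segLabel M (seq t (m (σ 1))))) :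
    IsSearchResult χ t T (p := 0) σ ⟨N, F ≫ ripsIncl x n _⟩ := by
  have hF' : (F ≫ ripsIncl x n _) ≫ (vietorisRips x Set.univ n).ι =
      fill N segCorners (segLabel M (seq t (m (σ 1)))) := hF
  refine ⟨⟨⟨N, F⟩, rfl⟩, fun i => ?_⟩
  have hval : ∀ g : G, Value T 0 (fun i => g * (1 : Fin 1 → G) i)
      (SubdMap.postcomp ⟨0, vertexMap x n t⟩ (translate x n g)) := fun g =>
    .translate g (σ := 1) (φ := ⟨0, vertexMap x n t⟩) (by rw [h0]; simp [initTable])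
  have hface : ∀ (i : Fin 2) (g : G), σ (i.succAbove 0) = g → ∀ s : Fin 1 → Plane.{u},
      pull N (SSet.stdSimplex.map (SimplexCategory.δ i))
        (fill N segCorners (segLabel M (seq t (m (σ 1))))) = fill N s (fun _ => g * t) →
      ∃ ψ, Value T 0 (σ ∘ i.succAbove) ψ ∧ (SubdMap.precomp
        (⟨N, F ≫ ripsIncl x n _⟩ : SubdMap (stdS 1) (ripsG x n))
        (SSet.stdSimplex.map (SimplexCategory.δ i))).Same ψ := by
    intro i g hg s hs
    have hv := hval g
    rw [show (fun i => g * (1 : Fin 1 → G) i) = σ ∘ i.succAbove from funext fun j => by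
      rw [Subsingleton.elim j 0, Function.comp_apply, hg, Pi.one_apply, mul_one]] at hv
    refine ⟨_, hv, IsConst.same (c := g * t) (isConst_of_fill (s := s) ?_)
      ((isConst_vertexMap t).translate g)⟩
    refine Eq.trans ?_ hs
    rw [← hF']
    exact (pull_comp N _ _ _).symm
  fin_cases i
  · refine hface 0 (σ 1) rfl (fun _ => point 1 0) ((fill_vertex₁ N M _).trans ?_)
    rw [seq_of_le _ _ hM, htgt]
  · refine hface 1 1 hσ (fun _ => point 0 0) ((fill_vertex₀ N M _).trans ?_)
    rw [seq_zero, one_mul]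

theorem isSearchResult_triangle {m : G → List G} (hm : m 1 = []) {t : G} {N M J : ℕ}
    {H : ℕ → ℕ → G} {σ : Fin 3 → G} (hσ : σ ∈ normalized x n 2) {A : G → G → Prop}
    (hgrid : Grid A t (m (σ 1)) ((m ((σ 1)⁻¹ * σ 2)).map (σ 1 * ·)) (m (σ 2)) M J H)
    (hM : (m ((σ 1)⁻¹ * σ 2)).length < M)
    (htgt : ∀ g, wordLength x g ≤ n → tgt t (m g) = g * t) {T : Table x n}
    (h0 : T 0 = initTable x n t 0)
    (h1 : ∀ σ ∈ normalized x n 1, ∃ φ, T 1 σ = some φ ∧ EdgeEntry m t N M σ φ)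
    {F : (sdIter N).obj (stdS 2) ⟶
      (vietorisRips x (halfSpace χ (chi χ t + simplexVal χ (q := 2) σ)) n).toSSet}
    (hF : F ≫ (vietorisRips x _ n).ι = fill N triCorners (triLabel M J H)) :
    IsSearchResult χ t T (p := 1) σ ⟨N, F ≫ ripsIncl x n _⟩ := by
  have hF' : (F ≫ ripsIncl x n _) ≫ (vietorisRips x Set.univ n).ι =
      fill N triCorners (triLabel M J H) := hF
  have hd : ∀ i, wordLength x (σ i) ≤ n := fun i => by
    have := hσ.2.1.2 0 i
    rw [hσ.1] at this
    simpa [wordDist] using this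
  have hd' : wordLength x ((σ 1)⁻¹ * σ 2) ≤ n := hσ.2.1.2 1 2
  refine ⟨⟨⟨N, F⟩, rfl⟩, fun i => ?_⟩
  have hface : ∀ i : Fin 3,
      (pull N (SSet.stdSimplex.map (SimplexCategory.δ i)) (F ≫ ripsIncl x n _)) ≫
        (vietorisRips x Set.univ n).ι =
      pull N (SSet.stdSimplex.map (SimplexCategory.δ i)) (fill N triCorners (triLabel M J H)) := by
    intro i
    rw [← pull_comp, hF']
  fin_cases i
  · refine exists_value_edge hm h0 h1 (σ 1) _ hd' rfl (mul_inv_cancel_left _ _).symm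
      ((hface 0).trans ((hgrid.fill_side₀ ?_ (by simpa using hM) N).trans ?_))
    · rw [htgt _ (hd 1), htgt _ (hd 2), tgt_map (σ 1 * ·), htgt _ hd', ← mul_assoc,
        mul_inv_cancel_left]
    · rw [htgt _ (hd 1)]
      congr 1
      funext p
      exact seq_map (σ 1 * ·) t _ _
  · refine exists_value_edge hm h0 h1 1 _ (hd 2) hσ.1 (one_mul _).symm
      ((hface 1).trans ((hgrid.fill_side₁ N).trans ?_))
    congr 1
    funext p
    exact (one_mul _).symm
  · refine exists_value_edge hm h0 h1 1 _ (hd 1) hσ.1 (one_mul _).symm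
      ((hface 2).trans ((hgrid.fill_side₂ N).trans ?_))
    congr 1
    funext p
    exact (one_mul _).symm

/-- A certificate for `t` lets the algorithm answer "yes" after `t` has been picked. -/
theorem Certificate.answersYes (hx : Subgroup.closure (Set.range x) = ⊤) {t : G} {m : G → List G}
    (h : Certificate x n χ (chi χ t) t m) (hm : m 1 = []) {l : List (Fin 2 → G)}
    (hl : Enumerates x n 1 l) :
    Relation.ReflTransGen (Step x n χ) (.loop t 0 (initTable x n t) l) .yes := by
  have hA := fun S => vrAdj_isAdj x S n
  have hlen : ∀ {q : ℕ} {σ : Fin (q + 1) → G}, σ ∈ normalized x n q → ∀ i,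
      wordLength x (σ i) ≤ n := fun hσ i => by
    have := hσ.2.1.2 0 i
    rw [hσ.1] at this
    simpa [wordDist] using this
  -- One M, and below one number N of subdivisions, for all simplices: the labellings of an edge by
  -- itself and as a side of triangles then coincide.
  have hM1 : ∀ᶠ M in Filter.atTop, ∀ g ∈ {g : G | wordLength x g ≤ n}, (m g).length < M := by
    rw [Filter.eventually_all_finite (finite_ball hx n)]
    exact fun g _ => Filter.eventually_gt_atTop _
  have hM2 : ∀ᶠ M in Filter.atTop, ∀ σ ∈ normalized x n 2, ∃ J H,
      Grid (vrAdj x (halfSpace χ (chi χ t + simplexVal χ (q := 2) σ)) n) t (m (σ 1))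
        ((m ((σ 1)⁻¹ * σ 2)).map (σ 1 * ·)) (m (σ 2)) M J H := by
    rw [Filter.eventually_all_finite (normalized_finite hx n 2)]
    intro σ hσ
    refine Ht.exists_grid (hA _) ((h.tri _ _ (hlen hσ 1) (hlen hσ 2) (hσ.2.1.2 1 2)).mono
      (vrAdj_mono x (halfSpace_mono ?_) le_rfl))
    have h0 := simplexVal_le χ σ 0
    rw [hσ.1, chi_one] at h0
    have := le_min h0 (le_min (simplexVal_le χ σ 1) (simplexVal_le χ σ 2))
    linarith
  obtain ⟨M, hM1, hM2⟩ := (hM1.and hM2).exists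
  have hN1 : ∀ᶠ N in Filter.atTop, ∀ σ ∈ normalized x n 1,
      ∃ F : (sdIter N).obj (stdS 1) ⟶
        (vietorisRips x (halfSpace χ (chi χ t + simplexVal χ (q := 1) σ)) n).toSSet,
      F ≫ (vietorisRips x _ n).ι = fill N segCorners (segLabel M (seq t (m (σ 1)))) := by
    rw [Filter.eventually_all_finite (normalized_finite hx n 1)]
    intro σ hσ
    have hw : Walk (vrAdj x (halfSpace χ (chi χ t + simplexVal χ (q := 1) σ)) n) t (m (σ 1)) := by
      refine (h.walk _ (hlen hσ 1)).mono (vrAdj_mono x (halfSpace_mono ?_) le_rfl)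
      have h0 := simplexVal_le χ σ 0
      rw [hσ.1, chi_one] at h0
      have := le_min h0 (simplexVal_le χ σ 1)
      linarith
    obtain ⟨ε, hε, hε'⟩ := exists_segLabel_modulus (hA _) hw.seq M
    exact eventually_exists_fill (by omega) convex_seg segCorners_mem hε hε'
  have hN2 : ∀ᶠ N in Filter.atTop, ∀ σ ∈ normalized x n 2, ∃ J H,
      Grid (vrAdj x (halfSpace χ (chi χ t + simplexVal χ (q := 2) σ)) n) t (m (σ 1))
        ((m ((σ 1)⁻¹ * σ 2)).map (σ 1 * ·)) (m (σ 2)) M J H ∧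
      ∃ F : (sdIter N).obj (stdS 2) ⟶
        (vietorisRips x (halfSpace χ (chi χ t + simplexVal χ (q := 2) σ)) n).toSSet,
      F ≫ (vietorisRips x _ n).ι = fill N triCorners (triLabel M J H) := by
    rw [Filter.eventually_all_finite (normalized_finite hx n 2)]
    intro σ hσ
    obtain ⟨J, H, hgrid⟩ := hM2 σ hσ
    obtain ⟨ε, hε, hε'⟩ := hgrid.exists_modulus
    filter_upwards [eventually_exists_fill (by omega) convex_tri triCorners_mem hε hε']
      with N hN
    exact ⟨J, H, hgrid, hN⟩
  obtain ⟨N, hN1, hN2⟩ := (hN1.and hN2).exists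
  -- The first loop records the labellings of edges; the second one needs exactly these entries for
  -- the boundaries of its triangles.
  obtain ⟨T, s1, z1, e1, -⟩ := exists_loop (χ := χ) (t := t) (p := 0) (EdgeEntry m t N M) l
    (initTable x n t) (by
      intro σ hσ
      have hσ' : σ ∈ normalized x n 1 := (hl.2 σ).1 hσ
      obtain ⟨F, hF⟩ := hN1 σ hσ'
      exact ⟨⟨N, F ≫ ripsIncl x n _⟩, ⟨_, rfl, hF⟩, fun T hT => isSearchResult_edge hσ'.1
        (hM1 _ (hlen hσ' 1)).le (h.tgt _ (hlen hσ' 1)) (hT 0 (by omega)) hF⟩)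
  obtain ⟨l', hl'⟩ := exists_enumerates hx n 2
  obtain ⟨T', s2, -⟩ := exists_loop (χ := χ) (t := t) (p := 1) (fun _ _ => True) l' T (by
      intro σ hσ
      have hσ' : σ ∈ normalized x n 2 := (hl'.2 σ).1 hσ
      obtain ⟨J, H, hgrid, F, hF⟩ := hN2 σ hσ'
      refine ⟨⟨N, F ≫ ripsIncl x n _⟩, trivial, fun T' hT' => isSearchResult_triangle hm hσ' hgrid
        (hM1 _ (hσ'.2.1.2 1 2)) h.tgt ((hT' 0 (by omega)).trans (z1 0 (by omega)))
        (fun τ hτ => ?_) hF⟩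
      rw [hT' 1 (by omega)]
      exact e1 τ ((hl.2 τ).2 hτ))
  exact ((s1.tail (.next t T l' hl')).trans s2).tail (.finish t T')

theorem answersYesFromEveryStart (hx : Subgroup.closure (Set.range x) = ⊤) (hχ : χ ≠ 1)
    (hK : 1 ≤ n)
    (hN : ∀ a l, Walk (vrAdj x Set.univ 1) a l → tgt a l = a → Ht (vrAdj x Set.univ n) a l [])
    (h : χ ∈ Sigma x 2) : AnswersYesFromEveryStart x n χ := by
  obtain ⟨l, hl⟩ := exists_enumerates hx n 1
  obtain ⟨s, -, hs⟩ := exists_generator_pos hx hχ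
  refine ⟨⟨_, .pick s hs l hl⟩, fun s hs => ?_⟩
  cases hs with
  | pick t ht l hl =>
    obtain ⟨m, hm, hm1⟩ := exists_certificate hx hχ hK hN h t
    exact hm.answersYes hx hm1 hl

theorem AnswersYes.exists_subdMap (hx : Subgroup.closure (Set.range x) = ⊤)
    (h : AnswersYes x n χ) : ∃ φ : SubdMap (ripsSkeleton2 x n) (ripsG x n),
      IsEquivariant x n φ ∧ RaisesValuation x n χ φ := by
  obtain ⟨t, M, ht, hM, hfull⟩ := h.exists_table
  exact hM.exists_subdMap hx ht hfull

end RunExists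

end SigmaTwo

namespace SigmaTwo

/-! ### Enumerability in stages -/

section Enumerable

variable {α β γ : Type*} [Primcodable α] [Primcodable β] [Primcodable γ]

/-- Enumerability in stages, by a primitive recursive relation. -/
def StageEnum (p : α → Prop) : Prop :=
  ∃ R : α → ℕ → Prop, PrimrecRel R ∧ (∀ a k k', k ≤ k' → R a k → R a k') ∧ ∀ a, p a ↔ ∃ k, R a k

namespace StageEnum

theorem of_eq {p q : α → Prop} (hp : StageEnum p) (h : ∀ a, p a ↔ q a) : StageEnum q := by
  obtain rfl : p = q := funext fun a => propext (h a)
  exact hp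

/-- Run a program for `p` with the stage as a bound for the computation. -/
theorem of_rePred {p : α → Prop} (hp : REPred p) : StageEnum p := by
  obtain ⟨c, hc⟩ := Nat.Partrec.Code.exists_code.1 hp
  refine ⟨fun a k => (Nat.Partrec.Code.evaln k c (Encodable.encode a)).isSome = true, ?_, ?_, ?_⟩
  · refine PrimrecRel.comp₂ Primrec.eq ?_ (Primrec₂.const true)
    exact Primrec.option_isSome.comp (Nat.Partrec.Code.primrec_evaln.comp
      ((Primrec.snd.pair (Primrec.const c)).pair (Primrec.encode.comp Primrec.fst)))
  · intro a k k' hk h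
    obtain ⟨y, hy⟩ := Option.isSome_iff_exists.1 h
    exact Option.isSome_iff_exists.2 ⟨y, Nat.Partrec.Code.evaln_mono hk hy⟩
  · intro a
    have h1 : (Nat.Partrec.Code.eval c (Encodable.encode a)).Dom ↔ p a := by
      rw [hc]
      simpa using ⟨fun h => h.1, fun h => ⟨h, trivial⟩⟩
    rw [← h1, Part.dom_iff_mem]
    constructor
    · rintro ⟨y, hy⟩
      obtain ⟨k, hk⟩ := Nat.Partrec.Code.evaln_complete.1 hy
      exact ⟨k, Option.isSome_iff_exists.2 ⟨y, hk⟩⟩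
    · rintro ⟨k, hk⟩
      obtain ⟨y, hy⟩ := Option.isSome_iff_exists.1 hk
      exact ⟨y, Nat.Partrec.Code.evaln_sound hy⟩

theorem rePred {p : α → Prop} (hp : StageEnum p) : REPred p := by
  classical
  obtain ⟨R, hR, -, h⟩ := hp
  have h1 : Partrec fun a => Nat.rfind fun k => Part.some (decide (R a k)) :=
    Partrec.rfind (Computable₂.partrec₂ (PrimrecRel.decide hR).to_comp)
  refine h1.dom_re.of_eq fun a => ?_
  refine Nat.rfind_dom.trans ?_
  simp [h]

theorem of_primrecPred {p : α → Prop} (hp : PrimrecPred p) : StageEnum p :=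
  ⟨fun a _ => p a, hp.comp Primrec.fst, fun _ _ _ _ h => h, fun a => by simp⟩

theorem comp {p : β → Prop} (hp : StageEnum p) {f : α → β} (hf : Primrec f) :
    StageEnum fun a => p (f a) := by
  obtain ⟨R, hR, hmono, h⟩ := hp
  exact ⟨fun a k => R (f a) k, hR.comp (hf.comp Primrec.fst) Primrec.snd, fun a => hmono (f a),
    fun a => h (f a)⟩

theorem and {p q : α → Prop} (hp : StageEnum p) (hq : StageEnum q) :
    StageEnum fun a => p a ∧ q a := by
  obtain ⟨R, hR, hmono, h⟩ := hp
  obtain ⟨R', hR', hmono', h'⟩ := hq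
  refine ⟨fun a k => R a k ∧ R' a k, PrimrecPred.and hR hR',
    fun a k k' hk h => ⟨hmono a k k' hk h.1, hmono' a k k' hk h.2⟩, fun a => ?_⟩
  refine (and_congr (h a) (h' a)).trans ?_
  constructor
  · rintro ⟨⟨k, hk⟩, k', hk'⟩
    exact ⟨max k k', hmono _ _ _ (le_max_left _ _) hk, hmono' _ _ _ (le_max_right _ _) hk'⟩
  · rintro ⟨k, h1, h2⟩
    exact ⟨⟨k, h1⟩, k, h2⟩

theorem or {p q : α → Prop} (hp : StageEnum p) (hq : StageEnum q) :
    StageEnum fun a => p a ∨ q a := by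
  obtain ⟨R, hR, hmono, h⟩ := hp
  obtain ⟨R', hR', hmono', h'⟩ := hq
  refine ⟨fun a k => R a k ∨ R' a k, PrimrecPred.or hR hR',
    fun a k k' hk h => h.imp (hmono a k k' hk) (hmono' a k k' hk), fun a => ?_⟩
  exact (or_congr (h a) (h' a)).trans exists_or.symm

theorem exists_ {p : α × β → Prop} (hp : StageEnum p) : StageEnum fun a => ∃ b, p (a, b) := by
  classical
  obtain ⟨R, hR, hmono, h⟩ := hp
  let Q : ℕ → α × ℕ → Prop := fun n z => ∃ b, Encodable.decode (α := β) n = some b ∧ R (z.1, b) z.2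
  have hQ : PrimrecRel Q := by
    have h1 : Primrec fun y : ℕ × α × ℕ =>
        Option.casesOn (motive := fun _ => Bool) (Encodable.decode (α := β) y.1) false
          fun b => decide (R (y.2.1, b) y.2.2) :=
      Primrec.option_casesOn (Primrec.decode.comp Primrec.fst) (Primrec.const false)
        (Primrec₂.mk ((PrimrecRel.decide hR).comp
          ((Primrec.fst.comp (Primrec.snd.comp Primrec.fst)).pair Primrec.snd)
            (Primrec.snd.comp (Primrec.snd.comp Primrec.fst))))
    refine PrimrecPred.of_eq (p := fun y : ℕ × α × ℕ =>
      (Option.casesOn (motive := fun _ => Bool) (Encodable.decode (α := β) y.1) false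
          fun b => decide (R (y.2.1, b) y.2.2)) = true)
      (Primrec.eq.comp h1 (Primrec.const true)) fun y => ?_
    simp only [Q]
    cases Encodable.decode (α := β) y.1 <;> simp
  -- At stage k try the witnesses with code less than k.
  refine ⟨fun a k => ∃ n ∈ List.range k, Q n (a, k), hQ.exists_mem_list.comp
    (f := fun z : α × ℕ => List.range z.2) (g := fun z : α × ℕ => z)
    (Primrec.list_range.comp Primrec.snd) Primrec.id, ?_, fun a => ?_⟩
  · rintro a k k' hk ⟨n, hn, b, hb, hR⟩
    exact ⟨n, List.mem_range.2 ((List.mem_range.1 hn).trans_le hk), b, hb, hmono _ _ _ hk hR⟩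
  · constructor
    · rintro ⟨b, hb⟩
      obtain ⟨k, hk⟩ := (h _).1 hb
      exact ⟨max k (Encodable.encode b + 1), Encodable.encode b,
        List.mem_range.2 (Nat.lt_of_succ_le (le_max_right _ _)), b, Encodable.encodek b,
        hmono _ _ _ (le_max_left _ _) hk⟩
    · rintro ⟨k, n, -, b, -, hb⟩
      exact ⟨b, (h _).2 ⟨k, hb⟩⟩

/-- Finitely many stages are bounded by a common one; here monotonicity in the stage is used. -/
theorem forall_lt {p : α × ℕ → Prop} (hp : StageEnum p) {f : α → ℕ} (hf : Primrec f) :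
    StageEnum fun a => ∀ i < f a, p (a, i) := by
  obtain ⟨R, hR, hmono, h⟩ := hp
  have h1 : PrimrecRel fun (i : ℕ) (z : α × ℕ) => R (z.1, i) z.2 :=
    hR.comp ((Primrec.fst.comp Primrec.snd).pair Primrec.fst) (Primrec.snd.comp Primrec.snd)
  refine ⟨fun a k => ∀ i ∈ List.range (f a), R (a, i) k,
    h1.forall_mem_list.comp (f := fun z : α × ℕ => List.range (f z.1)) (g := fun z : α × ℕ => z)
      (Primrec.list_range.comp (hf.comp Primrec.fst)) Primrec.id,
    fun a k k' hk h i hi => hmono _ _ _ hk (h i hi), fun a => ?_⟩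
  simp only [List.mem_range]
  constructor
  · intro ha
    choose k hk using fun i => fun hi : i < f a => (h _).1 (ha i hi)
    obtain ⟨K, hK⟩ : ∃ K, ∀ i (hi : i < f a), k i hi ≤ K := by
      refine ⟨(Finset.range (f a)).sup fun i => if hi : i < f a then k i hi else 0,
        fun i hi => ?_⟩
      have := Finset.le_sup (f := fun i => if hi : i < f a then k i hi else 0)
        (Finset.mem_range.2 hi)
      simpa [hi] using this
    exact ⟨K, fun i hi => hmono _ _ _ (hK i hi) (hk i hi)⟩
  · rintro ⟨k, hk⟩ i hi
    exact (h _).2 ⟨k, hk i hi⟩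

/-- A proposition that does not depend on the input is a built-in answer, whether or not it is
known. -/
theorem const (q : Prop) : StageEnum fun _ : α => q := by
  by_cases h : q
  · exact of_primrecPred ((Primrec.eq.comp (Primrec.const 0) (Primrec.const 0)).of_eq
      (by simp [h]))
  · exact of_primrecPred ((Primrec.eq.comp (Primrec.const 0) (Primrec.const 1)).of_eq
      (by simp [h]))

theorem forall_finite {ι : Type*} [Finite ι] {p : ι → α → Prop} (hp : ∀ i, StageEnum (p i)) :
    StageEnum fun a => ∀ i, p i a := by
  classical
  have := Fintype.ofFinite ι
  have key : ∀ s : Finset ι, StageEnum fun a => ∀ i ∈ s, p i a := by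
    intro s
    induction s using Finset.induction_on with
    | empty => exact (const True).of_eq (by simp)
    | insert i s _ ih => exact ((hp i).and ih).of_eq (by simp)
  exact (key Finset.univ).of_eq (by simp)

theorem imp (q : Prop) {p : α → Prop} (hp : StageEnum p) : StageEnum fun a => q → p a := by
  by_cases h : q
  · exact hp.of_eq (by simp [h])
  · exact (const True).of_eq (by simp [h])

theorem exists_mem (l : List β) {p : α × β → Prop} (hp : StageEnum p) :
    StageEnum fun a => ∃ b ∈ l, p (a, b) := by
  induction l with
  | nil => exact (const False).of_eq (by simp)
  | cons b l ih =>
    exact ((hp.comp (Primrec.id.pair (Primrec.const b))).or ih).of_eq (by simp)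

/-- The entry of a list at an index. -/
theorem primrecPred_getElem? {f : α → List β} {g : α → ℕ} {h : α → β} (hf : Primrec f)
    (hg : Primrec g) (hh : Primrec h) : PrimrecPred fun a => (f a)[g a]? = some (h a) :=
  Primrec.eq.comp (Primrec.list_getElem?.comp hf hg) (Primrec.option_some.comp hh)

/-- Related successive entries. -/
theorem chain {f : γ → List α} (hf : Primrec f) {g : γ → ℕ} (hg : Primrec g)
    {R : γ → α → α → Prop} (hR : StageEnum fun z : γ × α × α => R z.1 z.2.1 z.2.2) :
    StageEnum fun c => ∀ i < g c, ∃ u v, (f c)[i]? = some u ∧ (f c)[i + 1]? = some v ∧ R c u v := by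
  have p1 : Primrec fun z : ((γ × ℕ) × α) × α => z.1.1.1 :=
    Primrec.fst.comp (Primrec.fst.comp Primrec.fst)
  have p2 : Primrec fun z : ((γ × ℕ) × α) × α => z.1.1.2 :=
    Primrec.snd.comp (Primrec.fst.comp Primrec.fst)
  have p3 : Primrec fun z : ((γ × ℕ) × α) × α => z.1.2 := Primrec.snd.comp Primrec.fst
  have h1 : StageEnum fun z : ((γ × ℕ) × α) × α => (f z.1.1.1)[z.1.1.2]? = some z.1.2 :=
    of_primrecPred (primrecPred_getElem? (hf.comp p1) p2 p3)
  have h2 : StageEnum fun z : ((γ × ℕ) × α) × α => (f z.1.1.1)[z.1.1.2 + 1]? = some z.2 :=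
    of_primrecPred (primrecPred_getElem? (hf.comp p1) (Primrec.succ.comp p2) Primrec.snd)
  have h3 : StageEnum fun z : ((γ × ℕ) × α) × α => R z.1.1.1 z.1.2 z.2 :=
    hR.comp (p1.pair (p3.pair Primrec.snd))
  exact forall_lt (h1.and (h2.and h3)).exists_.exists_ hg

/-- The witness is the list of all intermediate elements. -/
theorem reflTransGen {R : γ → α → α → Prop} (hR : StageEnum fun z : γ × α × α => R z.1 z.2.1 z.2.2) :
    StageEnum fun z : γ × α × α => Relation.ReflTransGen (R z.1) z.2.1 z.2.2 := by
  have q1 : Primrec fun z : (γ × α × α) × List α × ℕ => z.1.2.1 :=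
    Primrec.fst.comp (Primrec.snd.comp Primrec.fst)
  have q2 : Primrec fun z : (γ × α × α) × List α × ℕ => z.1.2.2 :=
    Primrec.snd.comp (Primrec.snd.comp Primrec.fst)
  have q3 : Primrec fun z : (γ × α × α) × List α × ℕ => z.2.1 := Primrec.fst.comp Primrec.snd
  have q4 : Primrec fun z : (γ × α × α) × List α × ℕ => z.2.2 := Primrec.snd.comp Primrec.snd
  have h1 : StageEnum fun z : (γ × α × α) × List α × ℕ => z.2.1[0]? = some z.1.2.1 :=
    of_primrecPred (primrecPred_getElem? q3 (Primrec.const 0) q1)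
  have h2 : StageEnum fun z : (γ × α × α) × List α × ℕ => z.2.1[z.2.2]? = some z.1.2.2 :=
    of_primrecPred (primrecPred_getElem? q3 q4 q2)
  have h3 : StageEnum fun z : (γ × α × α) × List α × ℕ => ∀ i < z.2.2, ∃ u v,
      z.2.1[i]? = some u ∧ z.2.1[i + 1]? = some v ∧ R z.1.1 u v :=
    chain (R := fun z : (γ × α × α) × List α × ℕ => R z.1.1) q3 q4
      (hR.comp ((Primrec.fst.comp (Primrec.fst.comp Primrec.fst)).pair Primrec.snd))
  refine ((h1.and (h2.and h3)).exists_).of_eq fun z => ?_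
  obtain ⟨c, a, b⟩ := z
  constructor
  · rintro ⟨⟨l, n⟩, h1, h2, h3⟩
    dsimp only at h1 h2 h3 ⊢
    have key : ∀ m ≤ n, ∀ v, l[m]? = some v → Relation.ReflTransGen (R c) a v := by
      intro m
      induction m with
      | zero =>
        intro _ v hv
        obtain rfl := Option.some.inj (h1.symm.trans hv)
        exact .refl
      | succ m ih =>
        intro hm v hv
        obtain ⟨u, v', hu, hv', hR⟩ := h3 m (by omega)
        obtain rfl := Option.some.inj (hv'.symm.trans hv)
        exact (ih (by omega) u hu).tail hR
    exact key n le_rfl b h2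
  · intro h
    obtain ⟨J, H, h0, h1, h2⟩ := exists_steps h
    refine ⟨((List.range (J + 1)).map H, J), ?_, ?_, fun i hi => ⟨H i, H (i + 1), ?_, ?_, h2 i hi⟩⟩
    all_goals dsimp only at *
    · simp [h0]
    · simp [h1]
    · simp [show i < J + 1 by omega]
    · simp [hi]

theorem walk {A : γ → α → α → Prop} (hA : ∀ c, IsAdj (A c))
    (hE : StageEnum fun z : γ × α × α => A z.1 z.2.1 z.2.2) :
    StageEnum fun z : γ × α × List α => Walk (A z.1) z.2.1 z.2.2 := by
  have q1 : Primrec fun z : γ × α × List α => z.2.1 := Primrec.fst.comp Primrec.snd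
  have q2 : Primrec fun z : γ × α × List α => z.2.2 := Primrec.snd.comp Primrec.snd
  have h1 : StageEnum fun z : γ × α × List α => A z.1 z.2.1 z.2.1 :=
    hE.comp (Primrec.fst.pair (q1.pair q1))
  have h2 := chain (f := fun z : γ × α × List α => z.2.1 :: z.2.2)
    (g := fun z : γ × α × List α => z.2.2.length) (Primrec.list_cons.comp q1 q2)
    (Primrec.list_length.comp q2) (R := fun z : γ × α × List α => A z.1)
    (hE.comp ((Primrec.fst.comp Primrec.fst).pair Primrec.snd))
  refine (h1.and h2).of_eq fun z => ?_
  obtain ⟨c, a, l⟩ := z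
  dsimp only
  induction l generalizing a with
  | nil => simp [Walk]
  | cons b l ih =>
    rw [Walk, ← ih]
    constructor
    · rintro ⟨h3, h4⟩
      obtain ⟨u, v, hu, hv, huv⟩ := h4 0 (by simp)
      obtain rfl : a = u := by simpa using hu
      obtain rfl : b = v := by simpa using hv
      refine ⟨huv, (hA c).refl ((hA c).symm huv), fun i hi => ?_⟩
      simpa using h4 (i + 1) (by simpa using hi)
    · rintro ⟨h3, h4, h5⟩
      refine ⟨(hA c).refl h3, fun i hi => ?_⟩
      obtain _ | i := i
      · exact ⟨a, b, by simp, by simp, h3⟩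
      · simpa using h5 i (by simpa using hi)

end StageEnum

/-- Deletion or insertion of a vertex of a walk that is continued to `e`. -/
def DelStep {V : Type*} (A : V → V → Prop) (a e : V) (l l' : List V) : Prop :=
  Walk A a (l ++ [e]) ∧ Walk A a (l' ++ [e]) ∧ ∃ p s : List V, ∃ b : V,
    (l = p ++ b :: s ∧ l' = p ++ s) ∨ (l' = p ++ b :: s ∧ l = p ++ s)

theorem StageEnum.delStep {A : γ → α → α → Prop} (hA : ∀ c, IsAdj (A c))
    (hE : StageEnum fun z : γ × α × α => A z.1 z.2.1 z.2.2) :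
    StageEnum fun z : (γ × α × α) × List α × List α =>
      DelStep (A z.1.1) z.1.2.1 z.1.2.2 z.2.1 z.2.2 := by
  have hw := StageEnum.walk hA hE
  have p1 : Primrec fun z : (γ × α × α) × List α × List α => z.1.1 := Primrec.fst.comp Primrec.fst
  have p2 : Primrec fun z : (γ × α × α) × List α × List α => z.1.2.1 :=
    Primrec.fst.comp (Primrec.snd.comp Primrec.fst)
  have p3 : Primrec fun z : (γ × α × α) × List α × List α => z.1.2.2 :=
    Primrec.snd.comp (Primrec.snd.comp Primrec.fst)
  have p4 : Primrec fun z : (γ × α × α) × List α × List α => z.2.1 := Primrec.fst.comp Primrec.snd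
  have p5 : Primrec fun z : (γ × α × α) × List α × List α => z.2.2 := Primrec.snd.comp Primrec.snd
  have h1 : StageEnum fun z : (γ × α × α) × List α × List α =>
      Walk (A z.1.1) z.1.2.1 (z.2.1 ++ [z.1.2.2]) :=
    hw.comp (p1.pair (p2.pair (Primrec.list_concat.comp p4 p3)))
  have h2 : StageEnum fun z : (γ × α × α) × List α × List α =>
      Walk (A z.1.1) z.1.2.1 (z.2.2 ++ [z.1.2.2]) :=
    hw.comp (p1.pair (p2.pair (Primrec.list_concat.comp p5 p3)))
  have r1 : Primrec fun z : ((((γ × α × α) × List α × List α) × List α) × List α) × α =>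
      z.1.1.1.2.1 := p4.comp (Primrec.fst.comp (Primrec.fst.comp Primrec.fst))
  have r2 : Primrec fun z : ((((γ × α × α) × List α × List α) × List α) × List α) × α =>
      z.1.1.1.2.2 := p5.comp (Primrec.fst.comp (Primrec.fst.comp Primrec.fst))
  have r3 : Primrec fun z : ((((γ × α × α) × List α × List α) × List α) × List α) × α => z.1.1.2 :=
    Primrec.snd.comp (Primrec.fst.comp Primrec.fst)
  have r4 : Primrec fun z : ((((γ × α × α) × List α × List α) × List α) × List α) × α => z.1.2 :=
    Primrec.snd.comp Primrec.fst
  have r5 := Primrec.list_append.comp r3 (Primrec.list_cons.comp Primrec.snd r4)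
  have r6 := Primrec.list_append.comp r3 r4
  have h3 : StageEnum fun z : ((((γ × α × α) × List α × List α) × List α) × List α) × α =>
      (z.1.1.1.2.1 = z.1.1.2 ++ z.2 :: z.1.2 ∧ z.1.1.1.2.2 = z.1.1.2 ++ z.1.2) ∨
      (z.1.1.1.2.2 = z.1.1.2 ++ z.2 :: z.1.2 ∧ z.1.1.1.2.1 = z.1.1.2 ++ z.1.2) :=
    StageEnum.of_primrecPred (((Primrec.eq.comp r1 r5).and (Primrec.eq.comp r2 r6)).or
      ((Primrec.eq.comp r2 r5).and (Primrec.eq.comp r1 r6)))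
  exact h1.and (h2.and h3.exists_.exists_.exists_)

/-- Homotopy by deletions and insertions of vertices. -/
def DelHom {V : Type*} (A : V → V → Prop) (a e : V) (l l' : List V) : Prop :=
  Walk A a (l ++ [e]) ∧ Relation.ReflTransGen (DelStep A a e) l l'

theorem StageEnum.delHom {A : γ → α → α → Prop} (hA : ∀ c, IsAdj (A c))
    (hE : StageEnum fun z : γ × α × α => A z.1 z.2.1 z.2.2) :
    StageEnum fun z : (γ × α × α) × List α × List α =>
      DelHom (A z.1.1) z.1.2.1 z.1.2.2 z.2.1 z.2.2 := by
  have h1 := StageEnum.reflTransGen (R := fun c : γ × α × α => DelStep (A c.1) c.2.1 c.2.2)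
    (StageEnum.delStep hA hE)
  refine StageEnum.and ((StageEnum.walk hA hE).comp ((Primrec.fst.comp Primrec.fst).pair
    ((Primrec.fst.comp (Primrec.snd.comp Primrec.fst)).pair (Primrec.list_concat.comp
      (Primrec.fst.comp Primrec.snd) (Primrec.snd.comp (Primrec.snd.comp Primrec.fst)))))) h1

/-! ### Homotopy of walks by deletion of single vertices -/

section Homotopy

variable {V : Type*} {A : V → V → Prop}

theorem DelStep.symm {a e : V} {l l' : List V} (h : DelStep A a e l l') : DelStep A a e l' l := by
  obtain ⟨h1, h2, p, s, b, h3⟩ := h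
  exact ⟨h2, h1, p, s, b, h3.symm⟩

/-- In a flag complex the three adjacencies around a deleted vertex span a triangle. -/
theorem Ht.delete {a e b : V} (p s : List V) (h : Walk A a (p ++ b :: s ++ [e]))
    (h' : Walk A a (p ++ s ++ [e])) : Ht A a (p ++ b :: s ++ [e]) (p ++ s ++ [e]) := by
  induction p generalizing a with
  | nil =>
    obtain ⟨h1, h2⟩ := h
    obtain _ | ⟨c, s⟩ := s
    · exact .tri h1 h2.1 h'.1 h2.2
    · exact .tri h1 h2.1 h'.1 h2.2
  | cons c p ih => exact .cons h.1 (ih h.2 h'.2)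

theorem DelHom.ht {a e : V} {l l' : List V} (h : DelHom A a e l l') :
    Ht A a (l ++ [e]) (l' ++ [e]) := by
  obtain ⟨h1, h2⟩ := h
  induction h2 with
  | refl => exact .refl h1
  | tail _ h3 ih =>
    refine ih.trans ?_
    obtain ⟨h4, h5, p, s, b, ⟨rfl, rfl⟩ | ⟨rfl, rfl⟩⟩ := h3
    · exact Ht.delete p s h4 h5
    · exact (Ht.delete p s h5 h4).symm

/-- Repeating the target at the end makes every generating move, including `stay`, the deletion of a
vertex that is not the last one. -/
theorem Ht.delHom {a : V} {l l' : List V} (h : Ht A a l l') :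
    DelHom A a (tgt a l) l l' := by
  have hstay : ∀ {a : V} {l : List V}, Walk A a l → Walk A a (l ++ [tgt a l]) := by
    intro a l h
    exact h.append ⟨h.end, h.end⟩
  refine ⟨hstay h.walks.1, ?_⟩
  induction h with
  | refl => exact .refl
  | @symm a l l' h ih =>
    rw [← h.tgt_eq]
    have : Std.Symm (DelStep A a (tgt a l)) := ⟨fun _ _ h => h.symm⟩
    exact Std.Symm.symm (r := Relation.ReflTransGen (DelStep A a (tgt a l))) _ _ ih
  | trans h _ ih ih' =>
    rw [← h.tgt_eq] at ih'
    exact ih.trans ih'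
  | @cons a b l l' hab h ih =>
    refine Relation.ReflTransGen.lift (p := DelStep A a (tgt b l)) (b :: ·) (fun m m' hm => ?_) _ _ ih
    obtain ⟨h1, h2, p, s, c, h3⟩ := hm
    refine ⟨⟨hab, h1⟩, ⟨hab, h2⟩, b :: p, s, c, ?_⟩
    simpa using h3
  | @tri a b c l hab hbc hac h =>
    exact .single ⟨hstay (l := b :: c :: l) ⟨hab, hbc, h⟩, hstay (l := c :: l) ⟨hac, h⟩,
      [], c :: l, b, .inl ⟨rfl, rfl⟩⟩
  | @stay a h => exact .single ⟨⟨h, h, h⟩, ⟨h, h⟩, [], [], a, .inl ⟨rfl, rfl⟩⟩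

end Homotopy

end Enumerable

end SigmaTwo

namespace SigmaTwo

/-! ### Certificates in terms of words -/

theorem ht_iff_delHom {V : Type*} {A : V → V → Prop} (hA : IsAdj A) {a e : V} {l l' : List V}
    (h : tgt a l = e) (h' : tgt a l' = e) : Ht A a l l' ↔ DelHom A a e l l' :=
  ⟨fun H => h ▸ H.delHom, fun H => H.ht.cancel_right hA (h.trans h'.symm)⟩

/-- A homotopy can be lifted along a map with a section. -/
theorem Ht.of_map {V W : Type*} {A : W → W → Prop} (hA : IsAdj A) {f : V → W} {s : W → V}
    (hs : ∀ w, f (s w) = w) {a : V} {l l' : List V} (h : Ht A (f a) (l.map f) (l'.map f))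
    (ht : tgt a l = tgt a l') : Ht (fun a b => A (f a) (f b)) a l l' := by
  have hB : IsAdj fun a b => A (f a) (f b) := ⟨hA.symm, hA.refl⟩
  have hw : ∀ {a : V} {l : List V}, Walk A (f a) (l.map f) → Walk (fun a b => A (f a) (f b)) a l := by
    intro a l h
    induction l generalizing a with
    | nil => exact h
    | cons b l ih => exact ⟨h.1, ih h.2⟩
  -- Any walk is homotopic to its image under the retraction `s ∘ f`, because a vertex and its image
  -- have the same value under `f`; the homotopy downstairs is transported by `s`.
  have key : ∀ {l : List V}, Walk A (f a) (l.map f) → Ht (fun a b => A (f a) (f b)) a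
      (l ++ [s (f (tgt a l))]) (s (f a) :: (l.map f).map s) := by
    intro l h
    have h1 := Ht.natural hB (f := fun v => s (f v)) (E := fun _ b => [s (f b)])
      (fun _ _ h => h) (fun a h => by simpa [hs] using h)
      (fun a b h => ⟨⟨by simpa [hs] using h, show A _ _ by simpa [hs] using hB.refl (hB.symm h)⟩, rfl⟩)
      (fun a b h => by
        have e1 := hB.refl h
        have e2 := hB.refl (hB.symm h)
        have e3 : Walk (fun a b => A (f a) (f b)) (s (f b)) [] := show A _ _ by simpa [hs] using e2
        exact (Ht.tri (A := fun a b => A (f a) (f b)) h (by simpa [hs] using e2) (by simpa [hs] using h) e3).trans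
          (Ht.tri (A := fun a b => A (f a) (f b)) (by simpa [hs] using e1) (by simpa [hs] using h) (by simpa [hs] using h) e3).symm)
      (hw h)
    have h2 : ∀ (a : V) (l : List V),
        SigmaTwo.mapWalk (fun _ b => [s (f b)]) a l = (l.map f).map s := by
      intro a l
      induction l generalizing a with
      | nil => rfl
      | cons b l ih => simpa [SigmaTwo.mapWalk] using ih b
    rwa [h2] at h1
  have h1 : Ht (fun a b => A (f a) (f b)) (s (f a)) ((l.map f).map s) ((l'.map f).map s) :=
    h.map s fun a b h => by simpa [hs] using h
  have h2 : A (f a) (f (s (f a))) := by simpa [hs] using h.walks.1.start hA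
  have h3 := (key h.walks.1).trans ((Ht.cons (A := fun a b => A (f a) (f b)) h2 h1).trans (key h.walks.2).symm)
  rw [ht] at h3
  exact h3.cancel_right hB ht

/-! ### Parts of integers are primitive recursive -/

section Integers

open Encodable

theorem primrec_toNat : Primrec Int.toNat := by
  have h : Primrec fun z : ℤ => if encode z % 2 = 0 then encode z / 2 else 0 :=
    Primrec.ite (Primrec.eq.comp (Primrec.nat_mod.comp Primrec.encode (Primrec.const 2))
      (Primrec.const 0)) (Primrec.nat_div.comp Primrec.encode (Primrec.const 2)) (Primrec.const 0)
  refine h.of_eq fun z => ?_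
  have h1 : ∀ n : ℕ, encode (Int.ofNat n) = 2 * n := fun n => rfl
  have h2 : ∀ n : ℕ, encode (Int.negSucc n) = 2 * n + 1 := fun n => rfl
  obtain n | n := z
  · rw [h1]; simp
  · rw [h2]; simp [Nat.add_mod]

theorem primrec_toNat_neg : Primrec fun z : ℤ => (-z).toNat := by
  have h : Primrec fun z : ℤ => if encode z % 2 = 0 then 0 else encode z / 2 + 1 :=
    Primrec.ite (Primrec.eq.comp (Primrec.nat_mod.comp Primrec.encode (Primrec.const 2))
      (Primrec.const 0)) (Primrec.const 0)
      (Primrec.succ.comp (Primrec.nat_div.comp Primrec.encode (Primrec.const 2)))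
  refine h.of_eq fun z => ?_
  have h1 : ∀ n : ℕ, encode (Int.ofNat n) = 2 * n := fun n => rfl
  have h2 : ∀ n : ℕ, encode (Int.negSucc n) = 2 * n + 1 := fun n => rfl
  obtain n | n := z
  · rw [h1]; simp
  · rw [h2, if_neg (by omega)]
    simp only [Int.neg_negSucc]
    omega

end Integers

/-! ### Signs of the values of words from approximations -/

section Scores

variable {r : ℕ}

/-- The sum of the positive (`true`) or negative (`false`) parts of the values of the letters. -/
def partSum (c : Bool) (b : Fin r → ℤ) (w : List (Fin r × Bool)) : ℕ :=
  w.foldr (fun l n => (bif c == l.2 then (b l.1).toNat else (-b l.1).toNat) + n) 0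

/-- The approximate values `b` show that a word has positive value. -/
def IsPositive (b : Fin r → ℤ) (w : List (Fin r × Bool)) : Prop :=
  partSum false b w + w.length < partSum true b w

theorem primrec_partSum (c : Bool) :
    Primrec fun z : (Fin r → ℤ) × List (Fin r × Bool) => partSum c z.1 z.2 := by
  have h1 : Primrec fun y : ((Fin r → ℤ) × List (Fin r × Bool)) × (Fin r × Bool) × ℕ =>
      y.1.1 y.2.1.1 :=
    Primrec.fin_app.comp (Primrec.fst.comp Primrec.fst)
      (Primrec.fst.comp (Primrec.fst.comp Primrec.snd))
  have h2 : Primrec fun y : ((Fin r → ℤ) × List (Fin r × Bool)) × (Fin r × Bool) × ℕ =>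
      c == y.2.1.2 :=
    Primrec.beq.comp (Primrec.const c) (Primrec.snd.comp (Primrec.fst.comp Primrec.snd))
  have h3 := Primrec.nat_add.comp
    (Primrec.cond h2 (primrec_toNat.comp h1) (primrec_toNat_neg.comp h1))
    (Primrec.snd.comp Primrec.snd)
  exact Primrec.list_foldr Primrec.snd (Primrec.const 0) h3.to₂

theorem primrecRel_isPositive : PrimrecRel (IsPositive (r := r)) := by
  exact Primrec.nat_lt.comp (Primrec.nat_add.comp (primrec_partSum false)
    (Primrec.list_length.comp Primrec.snd)) (primrec_partSum true)

theorem partSum_cons (c : Bool) (b : Fin r → ℤ) (l : Fin r × Bool) (w : List (Fin r × Bool)) :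
    partSum c b (l :: w) =
      (bif c == l.2 then (b l.1).toNat else (-b l.1).toNat) + partSum c b w := rfl

/-- Each letter contributes an error of at most one. -/
theorem abs_partSum_sub_le {G : Type u} [Group G] {x : Fin r → G} {χ : G →* Multiplicative ℝ}
    {b : Fin r → ℤ} {c : ℝ} (h : ∀ i, |c * chi χ (x i) - b i| ≤ 1) (w : List (Fin r × Bool)) :
    |c * chi χ (evalWord x w) - ((partSum true b w : ℝ) - partSum false b w)| ≤ w.length := by
  induction w with
  | nil => simp [partSum, evalWord]
  | cons l w ih =>
    obtain ⟨i, e⟩ := l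
    have h1 : ((b i).toNat : ℝ) - ((-b i).toNat : ℝ) = b i := by
      have : ((b i).toNat : ℤ) - ((-b i).toNat : ℤ) = b i := by omega
      exact_mod_cast this
    have h2 := abs_le.1 (h i)
    have h3 := abs_le.1 ih
    have h4 : evalWord x ((i, e) :: w) = (if e then x i else (x i)⁻¹) * evalWord x w := by
      simp [evalWord]
    rw [h4, chi_mul, partSum_cons, partSum_cons, mul_add, List.length_cons]
    cases e <;> simp only [Bool.false_eq_true, if_true, if_false, chi_inv, beq_self_eq_true,
      cond_true, Bool.true_beq, Bool.false_beq, Bool.not_true, cond_false, mul_neg] <;>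
      rw [abs_le] <;> constructor <;> push_cast <;> linarith

/-- Some entry of the list shows that a word has positive value. -/
def SeenPositive (L : List (Fin r → ℤ)) (w : List (Fin r × Bool)) : Prop := ∃ b ∈ L, IsPositive b w

variable {G : Type u} [Group G] {x : Fin r → G} {χ : G →* Multiplicative ℝ} {a : ℕ → Fin r → ℤ}

theorem SeenPositive.pos (ha : IsName x χ a) {N : ℕ} {w : List (Fin r × Bool)}
    (h : SeenPositive ((List.range N).map a) w) : 0 < chi χ (evalWord x w) := by
  obtain ⟨b, hb, h⟩ := h
  obtain ⟨j, -, rfl⟩ := List.mem_map.1 hb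
  have h1 := abs_le.1 (abs_partSum_sub_le (ha j) w)
  have h2 : (partSum false (a j) w : ℝ) + w.length < partSum true (a j) w := by exact_mod_cast h
  exact pos_of_mul_pos_right (show 0 < 2 ^ j * chi χ (evalWord x w) by linarith) (by positivity)

theorem exists_seenPositive (ha : IsName x χ a) {w : List (Fin r × Bool)}
    (h : 0 < chi χ (evalWord x w)) : ∃ N, SeenPositive ((List.range N).map a) w := by
  -- Twice the length: once for the error of the approximation, once for the margin demanded by
  -- `IsPositive`.
  obtain ⟨j, hj⟩ := pow_unbounded_of_one_lt (2 * w.length / chi χ (evalWord x w)) one_lt_two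
  rw [div_lt_iff₀ h] at hj
  refine ⟨j + 1, a j, List.mem_map.2 ⟨j, by simp, rfl⟩, ?_⟩
  have h1 := abs_le.1 (abs_partSum_sub_le (ha j) w)
  have h2 : (partSum false (a j) w : ℝ) + w.length < partSum true (a j) w := by linarith
  exact_mod_cast h2

theorem SeenPositive.mono {M N : ℕ} (h : M ≤ N) {w : List (Fin r × Bool)}
    (hw : SeenPositive ((List.range M).map a) w) : SeenPositive ((List.range N).map a) w := by
  obtain ⟨b, hb, hw⟩ := hw
  obtain ⟨j, hj, rfl⟩ := List.mem_map.1 hb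
  exact ⟨a j, List.mem_map.2 ⟨j, by simp at hj ⊢; omega, rfl⟩, hw⟩

theorem stageEnum_seenPositive (Z : List (List (Fin r × Bool))) :
    StageEnum fun z : List (Fin r → ℤ) × List (Fin r × Bool) =>
      ∃ y ∈ Z, SeenPositive z.1 (y ++ z.2) := by
  have h1 : PrimrecRel (SeenPositive (r := r)) := primrecRel_isPositive.exists_mem_list
  exact StageEnum.exists_mem Z (p := fun z : (List (Fin r → ℤ) × List (Fin r × Bool)) ×
      List (Fin r × Bool) => SeenPositive z.1.1 (z.2 ++ z.1.2))
    (StageEnum.of_primrecPred (h1.comp (Primrec.fst.comp Primrec.fst)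
      (Primrec.list_append.comp Primrec.snd (Primrec.snd.comp Primrec.fst))))

end Scores

section Recognition

variable {G : Type u} [Group G] {r : ℕ} {x : Fin r → G} {K : ℕ}

/-- Guess a word of length at most K for the quotient, together with a word inverse to the second
one, and let the word problem confirm both equations. -/
theorem stageEnum_wordDist_le (hx : Subgroup.closure (Set.range x) = ⊤)
    (hwp : SolvableWordProblem x) (K : ℕ) :
    StageEnum fun z : List (Fin r × Bool) × List (Fin r × Bool) =>
      wordDist x (evalWord x z.1) (evalWord x z.2) ≤ K := by
  have h1 : StageEnum fun w : List (Fin r × Bool) => evalWord x w = 1 :=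
    StageEnum.of_rePred hwp.to_re
  have h2 : StageEnum fun z : ((List (Fin r × Bool) × List (Fin r × Bool)) × List (Fin r × Bool)) ×
      List (Fin r × Bool) => z.1.2.length ≤ K :=
    StageEnum.of_primrecPred (Primrec.nat_le.comp
      (Primrec.list_length.comp (Primrec.snd.comp Primrec.fst)) (Primrec.const K))
  have h3 : StageEnum fun z : ((List (Fin r × Bool) × List (Fin r × Bool)) × List (Fin r × Bool)) ×
      List (Fin r × Bool) => evalWord x (z.1.1.1 ++ (z.1.2 ++ z.2)) = 1 :=
    h1.comp (Primrec.list_append.comp (Primrec.fst.comp (Primrec.fst.comp Primrec.fst))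
      (Primrec.list_append.comp (Primrec.snd.comp Primrec.fst) Primrec.snd))
  have h4 : StageEnum fun z : ((List (Fin r × Bool) × List (Fin r × Bool)) × List (Fin r × Bool)) ×
      List (Fin r × Bool) => evalWord x (z.1.1.2 ++ z.2) = 1 :=
    h1.comp (Primrec.list_append.comp (Primrec.snd.comp (Primrec.fst.comp Primrec.fst)) Primrec.snd)
  refine (h2.and (h3.and h4)).exists_.exists_.of_eq fun z => ?_
  obtain ⟨a, b⟩ := z
  simp only [evalWord_append]
  constructor
  · rintro ⟨w, v, hw, h5, h6⟩
    have : (evalWord x a)⁻¹ * evalWord x b = evalWord x w := by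
      rw [eq_inv_of_mul_eq_one_left h6, inv_mul_eq_iff_eq_mul, eq_comm, ← mul_eq_one_iff_eq_inv,
        mul_assoc]
      exact h5
    rw [wordDist, this]
    exact (wordLength_le w).trans hw
  · intro h
    obtain ⟨w, hw, hw'⟩ := exists_geodesic hx ((evalWord x a)⁻¹ * evalWord x b)
    exact ⟨w, invWord b, hw.trans_le h, by rw [hw', evalWord_invWord]; group,
      by rw [evalWord_invWord, mul_inv_cancel]⟩

/-- Adjacency of words that spell nearby elements, for which one of the translates by the words in
`Z` is seen to have positive value. -/
def WordAdj (x : Fin r → G) (K : ℕ) (Z : List (List (Fin r × Bool))) (L : List (Fin r → ℤ))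
    (a b : List (Fin r × Bool)) : Prop :=
  (∃ y ∈ Z, SeenPositive L (y ++ a)) ∧ (∃ y ∈ Z, SeenPositive L (y ++ b)) ∧
    wordDist x (evalWord x a) (evalWord x b) ≤ K

theorem wordAdj_isAdj (x : Fin r → G) (K : ℕ) (Z : List (List (Fin r × Bool)))
    (L : List (Fin r → ℤ)) : IsAdj (WordAdj x K Z L) :=
  ⟨fun h => ⟨h.2.1, h.1, by rw [wordDist_comm]; exact h.2.2⟩,
    fun h => ⟨h.1, h.1, by rw [wordDist_self]; exact Nat.zero_le K⟩⟩

theorem stageEnum_wordAdj (hx : Subgroup.closure (Set.range x) = ⊤) (hwp : SolvableWordProblem x)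
    (Z : List (List (Fin r × Bool))) :
    StageEnum fun z : List (Fin r → ℤ) × List (Fin r × Bool) × List (Fin r × Bool) =>
      WordAdj x K Z z.1 z.2.1 z.2.2 :=
  ((stageEnum_seenPositive Z).comp (Primrec.fst.pair (Primrec.fst.comp Primrec.snd))).and
    (((stageEnum_seenPositive Z).comp (Primrec.fst.pair (Primrec.snd.comp Primrec.snd))).and
      ((stageEnum_wordDist_le hx hwp K).comp Primrec.snd))

/-- A certificate, in terms of words, for the approximate values `L`. -/
def WordCertificate (x : Fin r → G) (K : ℕ) {p : ℕ} (w : Fin p → List (Fin r × Bool))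
    (L : List (Fin r → ℤ)) (t : List (Fin r × Bool)) (m : Fin p → List (List (Fin r × Bool))) :
    Prop :=
  ∀ i j u, evalWord x (w i) * evalWord x (w u) = evalWord x (w j) →
    Ht (WordAdj x K [[], invWord (w i), invWord (w j)] L) t
      ((m i ++ [w i ++ t]) ++ ((m u ++ [w u ++ t]).map (w i ++ ·)) ++ [w j ++ t])
      (m j ++ [w j ++ t])

/-- The relations among the words `w i` do not depend on the input, so they are built into the
machine; what remains is a finite conjunction of enumerable homotopies. -/
theorem stageEnum_wordCertificate (hx : Subgroup.closure (Set.range x) = ⊤)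
    (hwp : SolvableWordProblem x) {p : ℕ} (w : Fin p → List (Fin r × Bool)) :
    StageEnum fun L => ∃ z : List (Fin r × Bool) × (Fin p → List (List (Fin r × Bool))),
      WordCertificate x K w L z.1 z.2 := by
  refine StageEnum.exists_ (p := fun z : List (Fin r → ℤ) × List (Fin r × Bool) ×
    (Fin p → List (List (Fin r × Bool))) => WordCertificate x K w z.1 z.2.1 z.2.2) ?_
  have pL : Primrec fun z : List (Fin r → ℤ) × List (Fin r × Bool) ×
    (Fin p → List (List (Fin r × Bool))) => z.1 := Primrec.fst
  have pt : Primrec fun z : List (Fin r → ℤ) × List (Fin r × Bool) ×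
    (Fin p → List (List (Fin r × Bool))) => z.2.1 := Primrec.fst.comp Primrec.snd
  have pm : ∀ i, Primrec fun z : List (Fin r → ℤ) × List (Fin r × Bool) ×
      (Fin p → List (List (Fin r × Bool))) => z.2.2 i := fun i =>
    Primrec.fin_app.comp (Primrec.snd.comp Primrec.snd) (Primrec.const i)
  have pe : ∀ i, Primrec fun z : List (Fin r → ℤ) × List (Fin r × Bool) ×
      (Fin p → List (List (Fin r × Bool))) => w i ++ z.2.1 := fun i =>
    Primrec.list_append.comp (Primrec.const (w i)) pt
  have pM : ∀ i, Primrec fun z : List (Fin r → ℤ) × List (Fin r × Bool) ×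
      (Fin p → List (List (Fin r × Bool))) => z.2.2 i ++ [w i ++ z.2.1] := fun i =>
    Primrec.list_concat.comp (pm i) (pe i)
  refine StageEnum.forall_finite fun i => StageEnum.forall_finite fun j =>
    StageEnum.forall_finite fun u => StageEnum.imp _ ?_
  have h1 := StageEnum.delHom (fun L => wordAdj_isAdj x K [[], invWord (w i), invWord (w j)] L)
    (stageEnum_wordAdj hx hwp _)
  refine (h1.comp ((pL.pair (pt.pair (pe j))).pair ((Primrec.list_concat.comp
    (Primrec.list_append.comp (pM i) (Primrec.list_map (pM u) (Primrec.list_append.comp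
      (Primrec.const (w i)) Primrec.snd).to₂)) (pe j)).pair (pM j)))).of_eq fun z => ?_
  exact (ht_iff_delHom (wordAdj_isAdj x K _ _) (by simp) (by simp)).symm

end Recognition

end SigmaTwo

namespace SigmaTwo

/-! ### Recognition of `Σ²` -/

section Recognition

variable {G : Type u} [Group G] {r : ℕ} {x : Fin r → G} {K : ℕ} {χ : G →* Multiplicative ℝ}

theorem Ht.append_tgt {V : Type*} {A : V → V → Prop} {a e : V} {l : List V} (h : Walk A a l)
    (he : tgt a l = e) : Ht A a (l ++ [e]) l := by
  subst he
  simpa using Ht.append_left h (Ht.stay h.end)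

/-- Spell out the words. A value above min(0, χ(g), χ(h)) means that a, g⁻¹a or h⁻¹a has positive
value; this is what the three translating words express. -/
theorem WordCertificate.exists_strictCertificate {p : ℕ} {w : Fin p → List (Fin r × Bool)}
    (hw : ∀ g, wordLength x g ≤ K → ∃ i, evalWord x (w i) = g) {L : List (Fin r → ℤ)}
    (hL : ∀ v, SeenPositive L v → 0 < chi χ (evalWord x v)) {t : List (Fin r × Bool)}
    {m : Fin p → List (List (Fin r × Bool))} (h : WordCertificate x K w L t m) :
    ∃ t m, StrictCertificate x K χ t m := by
  classical
  have h1 : wordLength x (1 : G) ≤ K := wordLength_one.trans_le K.zero_le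
  have hp : Nonempty (Fin p) := ⟨(hw 1 h1).choose⟩
  choose! i hi using hw
  have key : ∀ i j u, evalWord x (w i) * evalWord x (w u) = evalWord x (w j) →
      Ht (vrAdj x {a | min 0 (min (chi χ (evalWord x (w i))) (chi χ (evalWord x (w j)))) < chi χ a} K)
        (evalWord x t)
        (((m i ++ [w i ++ t]).map (evalWord x)) ++
          ((m u ++ [w u ++ t]).map (evalWord x)).map (evalWord x (w i) * ·) ++ [evalWord x (w j ++ t)])
        ((m j).map (evalWord x) ++ [evalWord x (w j ++ t)]) := by
    intro i j u hu
    have hmem : ∀ a, (∃ y ∈ [[], invWord (w i), invWord (w j)], SeenPositive L (y ++ a)) →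
        min 0 (min (chi χ (evalWord x (w i))) (chi χ (evalWord x (w j)))) < chi χ (evalWord x a) := by
      rintro a ⟨y, hy, ha⟩
      have := hL _ ha
      rw [evalWord_append, chi_mul] at this
      simp only [List.mem_cons, List.not_mem_nil, or_false] at hy
      simp only [min_lt_iff]
      rcases hy with rfl | rfl | rfl
      · exact .inl (by simpa [evalWord] using this)
      · exact .inr (.inl (by simp only [evalWord_invWord, chi_inv] at this; linarith))
      · exact .inr (.inr (by simp only [evalWord_invWord, chi_inv] at this; linarith))
    have := (h i j u hu).map (C := vrAdj x
      {a | min 0 (min (chi χ (evalWord x (w i))) (chi χ (evalWord x (w j)))) < chi χ a} K)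
      (evalWord x) fun a b hab => ⟨hmem a hab.1, hmem b hab.2.1, hab.2.2⟩
    simpa [evalWord_append, Function.comp_def] using this
  refine ⟨evalWord x t, fun g => (m (i g) ++ [w (i g) ++ t]).map (evalWord x),
    fun g hg => ?_, fun g hg => by simp [evalWord_append, hi g hg], fun g h hg hh hgh => ?_⟩
  -- The walk condition is read off from the degenerate triangle given by g · 1 = g.
  · have := (key (i g) (i g) (i 1) (by rw [hi 1 h1, mul_one])).walks.2
    rw [hi g hg, min_self] at this
    simpa using this
  · have e : tgt (evalWord x t) ((m (i g) ++ [w (i g) ++ t]).map (evalWord x) ++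
        ((m (i (g⁻¹ * h)) ++ [w (i (g⁻¹ * h)) ++ t]).map (evalWord x)).map (g * ·)) =
        evalWord x (w (i h) ++ t) := by
      simp [evalWord_append, hi _ hgh, hi h hh, mul_assoc]
    have h2 := key (i g) (i h) (i (g⁻¹ * h)) (by rw [hi g hg, hi h hh, hi _ hgh]; group)
    rw [hi g hg, hi h hh] at h2
    have h3 := Ht.append_tgt (h2.walks.1.left (vrAdj_isAdj x _ K)) e
    simpa using h3.symm.trans h2

/-- Homotopies lift from G to words, since words that spell the same element are adjacent. Their
finitely many strict inequalities are seen by finitely many approximations. The targets `w i ++ t`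
are appended because walks of words must end in equal words, not just in equal elements. -/
theorem StrictCertificate.exists_wordCertificate (hx : Subgroup.closure (Set.range x) = ⊤) {p : ℕ}
    {w : Fin p → List (Fin r × Bool)} (hw : ∀ i, wordLength x (evalWord x (w i)) ≤ K)
    {a : ℕ → Fin r → ℤ} (ha : IsName x χ a) {t : G} {m : G → List G}
    (h : StrictCertificate x K χ t m) :
    ∃ N t m, WordCertificate x K w ((List.range N).map a) t m := by
  choose s hs using fun g => exists_geodesic hx g
  replace hs := fun g => (hs g).2
  have hs' : ∀ l : List G, (l.map s).map (evalWord x) = l := fun l => by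
    simp [Function.comp_def, hs]
  let M : Fin p → List (List (Fin r × Bool)) := fun i => (m (evalWord x (w i))).map s
  have hM : ∀ i, (M i ++ [w i ++ s t]).map (evalWord x) =
      m (evalWord x (w i)) ++ [evalWord x (w i) * t] := fun i => by
    simp only [List.map_append, M, hs', List.map_cons, List.map_nil, evalWord_append, hs]
  have h1 : ∀ i j u, ∃ N, evalWord x (w i) * evalWord x (w u) = evalWord x (w j) →
      Ht (WordAdj x K [[], invWord (w i), invWord (w j)] ((List.range N).map a)) (s t)
        ((M i ++ [w i ++ s t]) ++ ((M u ++ [w u ++ s t]).map (w i ++ ·)) ++ [w j ++ s t])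
        (M j ++ [w j ++ s t]) := by
    intro i j u
    by_cases hu : evalWord x (w i) * evalWord x (w u) = evalWord x (w j)
    swap
    · exact ⟨0, fun h => absurd h hu⟩
    obtain ⟨S, hS⟩ : ∃ S, S = {b | min 0 (min (chi χ (evalWord x (w i)))
      (chi χ (evalWord x (w j)))) < chi χ b} := ⟨_, rfl⟩
    have hA := vrAdj_isAdj x S K
    have hu' : (evalWord x (w i))⁻¹ * evalWord x (w j) = evalWord x (w u) := by
      rw [← hu, inv_mul_cancel_left]
    have ht := fun i => h.tgt _ (hw i)
    have h2 := h.tri _ _ (hw i) (hw j) (by rw [hu']; exact hw u)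
    rw [hu', ← hS] at h2
    have he := h2.walks.2.end
    rw [ht] at he
    have h3 : Walk (vrAdj x S K) (SigmaTwo.tgt t (m (evalWord x (w i))))
        ((m (evalWord x (w u))).map (evalWord x (w i) * ·)) := h2.walks.1.right
    have h4 : Ht (vrAdj x S K) t
        ((m (evalWord x (w i)) ++ [evalWord x (w i) * t]) ++
          (m (evalWord x (w u)) ++ [evalWord x (w u) * t]).map (evalWord x (w i) * ·) ++
            [evalWord x (w j) * t])
        (m (evalWord x (w j)) ++ [evalWord x (w j) * t]) := by
      have e1 : SigmaTwo.tgt (evalWord x (w i) * t)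
          ((m (evalWord x (w u))).map (evalWord x (w i) * ·)) = evalWord x (w j) * t := by
        rw [tgt_map, ht, ← hu, mul_assoc]
      have h5 := (Ht.append_tgt (h2.walks.1.left hA) (ht i)).append hA
        (Ht.append_tgt (e := evalWord x (w j) * t) (by simpa [ht] using h3)
          (by simpa [ht] using e1))
      have h6 := h5.append_right hA (m := [evalWord x (w j) * t])
        (by rw [h5.tgt_eq, h2.tgt_eq, ht]; exact ⟨he, he⟩)
      refine Ht.trans ?_ (h6.trans ?_)
      · simpa [← hu, mul_assoc] using Ht.refl h6.walks.1
      · exact h2.append_right hA (by rw [h2.tgt_eq, ht]; exact ⟨he, he⟩)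
    have h5 := Ht.of_map hA (f := evalWord x) (s := s) hs (a := s t)
      (l := (M i ++ [w i ++ s t]) ++ ((M u ++ [w u ++ s t]).map (w i ++ ·)) ++ [w j ++ s t])
      (l' := M j ++ [w j ++ s t]) (by
        have e : ((M u ++ [w u ++ s t]).map (w i ++ ·)).map (evalWord x) =
            (m (evalWord x (w u)) ++ [evalWord x (w u) * t]).map (evalWord x (w i) * ·) := by
          rw [← hM, List.map_map, List.map_map]
          exact List.map_congr_left fun b _ => evalWord_append x _ _
        rw [List.map_append, List.map_append, hM, hM, e, hs]
        simpa [evalWord_append, hs] using h4) (by simp)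
    have hmem : ∀ b, evalWord x b ∈ S → ∃ N, ∃ y ∈ [[], invWord (w i), invWord (w j)],
        SeenPositive ((List.range N).map a) (y ++ b) := by
      intro b hb
      rw [hS] at hb
      change (_ : ℝ) < _ at hb
      rcases min_lt_iff.1 hb with hb | hb
      · obtain ⟨N, hN⟩ := exists_seenPositive ha hb
        exact ⟨N, [], by simp, hN⟩
      rcases min_lt_iff.1 hb with hb | hb
      · obtain ⟨N, hN⟩ := exists_seenPositive ha (w := invWord (w i) ++ b) (by
          rw [evalWord_append, chi_mul, evalWord_invWord, chi_inv]; linarith)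
        exact ⟨N, _, by simp, hN⟩
      · obtain ⟨N, hN⟩ := exists_seenPositive ha (w := invWord (w j) ++ b) (by
          rw [evalWord_append, chi_mul, evalWord_invWord, chi_inv]; linarith)
        exact ⟨N, invWord (w j), by simp, hN⟩
    have hmono : ∀ k n, k ≤ n → ∀ b,
        (∃ y ∈ [[], invWord (w i), invWord (w j)], SeenPositive ((List.range k).map a) (y ++ b)) →
        ∃ y ∈ [[], invWord (w i), invWord (w j)], SeenPositive ((List.range n).map a) (y ++ b) :=
      fun k n hkn b ⟨y, hy, hb⟩ => ⟨y, hy, hb.mono hkn⟩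
    have h6 := h5.mono (B := fun b c => ∃ N, WordAdj x K [[], invWord (w i), invWord (w j)]
      ((List.range N).map a) b c) fun b c hbc => by
        obtain ⟨k, hk⟩ := hmem b hbc.1
        obtain ⟨n, hn⟩ := hmem c hbc.2.1
        exact ⟨max k n, hmono _ _ (le_max_left _ _) _ hk, hmono _ _ (le_max_right _ _) _ hn, hbc.2.2⟩
    obtain ⟨N, hN⟩ := h6.exists_of_directed (A := fun N => WordAdj x K
      [[], invWord (w i), invWord (w j)] ((List.range N).map a))
      fun k n hkn b c hbc => ⟨hmono _ _ hkn _ hbc.1, hmono _ _ hkn _ hbc.2.1, hbc.2.2⟩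
    exact ⟨N, fun _ => hN⟩
  choose N hN using h1
  obtain ⟨n, hn⟩ := (Set.finite_range fun z : Fin p × Fin p × Fin p => N z.1 z.2.1 z.2.2).bddAbove
  refine ⟨n, s t, M, fun i j u hu => (hN i j u hu).mono ?_⟩
  rintro b c ⟨⟨y, hy, hb⟩, ⟨z, hz, hc⟩, hbc⟩
  have : N i j u ≤ n := hn ⟨(i, j, u), rfl⟩
  exact ⟨⟨y, hy, hb.mono this⟩, ⟨z, hz, hc.mono this⟩, hbc⟩

theorem turingRecognizable_strictCertificate (hx : Subgroup.closure (Set.range x) = ⊤)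
    (hwp : SolvableWordProblem x) (K : ℕ) :
    TuringRecognizable x {χ | ∃ t m, StrictCertificate x K χ t m} := by
  choose s hs using fun g => exists_geodesic hx g
  have := (finite_ball hx K).to_subtype
  obtain ⟨p, ⟨e⟩⟩ := Finite.exists_equiv_fin {g : G | wordLength x g ≤ K}
  let w : Fin p → List (Fin r × Bool) := fun i => s (e.symm i)
  have hw : ∀ i, evalWord x (w i) = e.symm i := fun i => (hs _).2
  refine ⟨_, (stageEnum_wordCertificate (K := K) hx hwp w).rePred, fun χ a ha => ⟨?_, ?_⟩⟩
  · rintro ⟨t, m, h⟩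
    obtain ⟨N, t', m', h'⟩ := h.exists_wordCertificate hx (w := w)
      (fun i => by rw [hw]; exact (e.symm i).2) ha
    exact ⟨N, (t', m'), h'⟩
  · rintro ⟨N, ⟨t, m⟩, h⟩
    exact h.exists_strictCertificate (fun g hg => ⟨e ⟨g, hg⟩, by simp [hw]⟩) fun v hv => hv.pos ha

end Recognition

/-! ### Strict certificates characterize the nonzero characters in `Σ²` -/

section Main

variable {G : Type u} [Group G] {r : ℕ} {x : Fin r → G} {K : ℕ} {χ : G →* Multiplicative ℝ}

theorem StrictCertificate.ne_one {t : G} {m : G → List G} (h : StrictCertificate x K χ t m) :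
    χ ≠ 1 := by
  rintro rfl
  have := (h.walk 1 (wordLength_one.trans_le K.zero_le)).start (vrAdj_isAdj x _ K)
  simpa [chi] using this.1

/-- The criterion for membership in `Σ²`, in terms of strict certificates. -/
theorem exists_strictCertificate_iff (hx : Subgroup.closure (Set.range x) = ⊤)
    (H : χ ≠ 1 → 1 ≤ K ∧
      ∀ a l, Walk (vrAdj x Set.univ 1) a l → tgt a l = a → Ht (vrAdj x Set.univ K) a l []) :
    (χ ≠ 1 ∧ χ ∈ Sigma x 2) ↔ ∃ t m, StrictCertificate x K χ t m := by
  constructor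
  · rintro ⟨hχ, h⟩
    obtain ⟨s, -, hs⟩ := exists_generator_pos hx hχ
    obtain ⟨m, hm, -⟩ := exists_certificate hx hχ (H hχ).1 (H hχ).2 h s
    have hsub : ∀ L : ℝ, halfSpace χ (chi χ s + L) ⊆ {a | L < chi χ a} := fun L a ha => by
      change (_ : ℝ) ≤ _ at ha
      change (_ : ℝ) < _
      linarith
    exact ⟨s, m, fun g hg => (hm.walk g hg).mono (vrAdj_mono x (hsub _) le_rfl), hm.tgt,
      fun g h hg hh hgh => (hm.tri g h hg hh hgh).mono (vrAdj_mono x (hsub _) le_rfl)⟩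
  · rintro ⟨t, m, h⟩
    obtain ⟨δ, hδ, hc⟩ := h.exists_certificate hx
    have hχ := h.ne_one
    exact ⟨hχ, hc.mem_sigma hx (H hχ).1 (H hχ).2 hδ⟩

theorem one_le_of_piVanishes_zero (hx : Subgroup.closure (Set.range x) = ⊤) (hχ : χ ≠ 1) {k l : ℕ}
    (h : PiVanishes x Set.univ 0 k l) : 1 ≤ l := by
  by_contra hl
  obtain rfl : l = 0 := by omega
  -- For the parameter zero adjacent vertices are equal, so walks do not move, while a nonzero
  -- character needs two elements.
  have hfix : ∀ {a : G} {w : List G}, Walk (vrAdj x Set.univ 0) a w → tgt a w = a := by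
    intro a w hw
    induction w generalizing a with
    | nil => rfl
    | cons b w ih =>
      have h1 : wordDist x a b = 0 := Nat.le_zero.1 hw.1.2.2
      obtain ⟨v, hv, hv'⟩ := exists_geodesic hx (a⁻¹ * b)
      rw [show wordLength x (a⁻¹ * b) = 0 from h1, List.length_eq_zero_iff] at hv
      rw [hv, eq_comm, inv_mul_eq_iff_eq_mul] at hv'
      have h2 : b = a := by simpa [evalWord] using hv'
      rw [tgt_cons, ih hw.2, h2]
  obtain ⟨s, -, hs⟩ := exists_generator_pos hx hχ
  obtain ⟨w, hw, hw'⟩ := (piVanishes_zero_iff x Set.univ h.1).1 h 1 trivial s trivial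
  rw [hfix hw] at hw'
  rw [← hw', chi_one] at hs
  exact lt_irrefl _ hs

end Main

end SigmaTwo

theorem theoremF {G : Type u} [Group G] {r : ℕ} (x : Fin r → G)
    (hx : Subgroup.closure (Set.range x) = ⊤)
    (hwp : SigmaTwo.SolvableWordProblem x)
    (k : Fin 3 → ℕ) (hk : SigmaTwo.IsConnectingVector (m := 2) x k) :
    (∀ χ : G →* Multiplicative ℝ, χ ≠ 1 →
      List.TFAE
        [χ ∈ SigmaTwo.Sigma x 2,
         ∃ φ : SigmaTwo.SubdMap (SigmaTwo.ripsSkeleton2 x (k 2)) (SigmaTwo.ripsG x (k 2)),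
           SigmaTwo.IsEquivariant x (k 2) φ ∧ SigmaTwo.RaisesValuation x (k 2) χ φ,
         SigmaTwo.AnswersYes x (max (k 0) (max (k 1) (k 2))) χ,
         SigmaTwo.AnswersYesFromEveryStart x (max (k 0) (max (k 1) (k 2))) χ]) ∧
    SigmaTwo.TuringRecognizable x {χ | χ ≠ 1 ∧ χ ∈ SigmaTwo.Sigma x 2} := by
  obtain ⟨h01, h0⟩ := hk 0
  obtain ⟨h12, h1⟩ := hk 1
  replace h01 : k 0 ≤ k 1 := h01
  replace h12 : k 1 ≤ k 2 := h12
  have hmax : max (k 0) (max (k 1) (k 2)) = k 2 := by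
    rw [max_eq_right h12, max_eq_right (h01.trans h12)]
  -- A nonzero character makes G nontrivial, so vanishing of π_0 forces k 1 ≥ 1. Loops of the Cayley
  -- graph are then loops for k 1 and contract for k 2.
  have hsim : ∀ χ : G →* Multiplicative ℝ, χ ≠ 1 → 1 ≤ k 2 ∧ ∀ a l,
      SigmaTwo.Walk (SigmaTwo.vrAdj x Set.univ 1) a l → SigmaTwo.tgt a l = a →
        SigmaTwo.Ht (SigmaTwo.vrAdj x Set.univ (k 2)) a l [] := by
    intro χ hχ
    have h : 1 ≤ k 1 := SigmaTwo.one_le_of_piVanishes_zero hx hχ (hk 0)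
    refine ⟨h.trans h12, fun a l hl hla => ?_⟩
    exact (SigmaTwo.piVanishes_one_iff x Set.univ h12).1 (hk 1) a l
      (hl.mono (SigmaTwo.vrAdj_mono x (subset_refl _) h)) hla
  rw [hmax]
  refine ⟨fun χ hχ => ?_, ?_⟩
  · obtain ⟨hK, hN⟩ := hsim χ hχ
    tfae_have 1 → 4 := SigmaTwo.answersYesFromEveryStart hx hχ hK hN
    tfae_have 4 → 3 := fun ⟨⟨s, hs⟩, h⟩ => (h s hs).head hs
    tfae_have 3 → 2 := fun h => h.exists_subdMap hx
    tfae_have 2 → 1 := fun ⟨φ, he, hr⟩ =>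
      ((SigmaTwo.exists_strictCertificate_iff hx (hsim χ)).2
        (SigmaTwo.exists_strictCertificate φ he hr)).2
    tfae_finish
  · have h : {χ : G →* Multiplicative ℝ | χ ≠ 1 ∧ χ ∈ SigmaTwo.Sigma x 2} =
        {χ | ∃ t m, SigmaTwo.StrictCertificate x (k 2) χ t m} :=
      Set.ext fun χ => SigmaTwo.exists_strictCertificate_iff hx (hsim χ)
    rw [h]
    exact SigmaTwo.turingRecognizable_strictCertificate hx hwp (k 2)
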